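/- Let $n\ge 2$. Write $\mathrm{PGL}_n=\operatorname{Spec} S_0$ over $\mathbb Z$, where $S_0$ is the degree $0$ part of $\mathbb Z[x_{ij}][\det^{-1}]$, let $\mathcal O(1)$ be the line bundle on $\mathrm{PGL}_n$ given by the degree $1$ part, and let $\overline g=(x_{ij}):\mathcal O^n\to\mathcal O^n\otimes\mathcal O(1)$ be the universal isomorphism. For a commutative ring $R$ and $g\in \mathrm{PGL}_n(R)$ put $L=g^*\mathcal O(1)$ and view $g$ as a morphism $R^n\to R^n\otimes L$. Let $\mathcal S(R^n,g)$ be the graded $R$-linear category with two objects $X,Y$ and, for $V=R^n$, $$\operatorname{Hom}(X,Y)=\operatorname{Hom}^0(X,Y)=V,\quad \operatorname{Hom}(Y,X)=\operatorname{Hom}^1(Y,X)=V^\vee,\quad \operatorname{Hom}^0(X,X)=R\,\mathrm{id}_X,\quad \operatorname{Hom}^0(Y,Y)=R\,\mathrm{id}_Y,\quad \operatorname{Hom}^1(X,X)=L,\quad \operatorname{Hom}^1(Y,Y)=R,$$ all other graded pieces being $0$, with compositions $v^*\circ v=\langle v^*,g(v)\rangle$ and $v\circ v^*=\langle v^*,v\rangle$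 for $v\in V$, $v^*\in V^\vee$ (and, by degree reasons, no other nontrivial compositions except with identities). A minimal $A_\infty$-structure on $\mathcal S(R^n,g)$ is a strictly unital $R$-linear $A_\infty$-structure $(m_k)_{k\ge 1}$ with $m_1=0$ and $m_2$ the given composition. A minimal $A'_4$-structure is a collection $(m_2,m_3,m_4)$ as above satisfying the $A_\infty$-identities with at most $5$ arguments. Gauge equivalence means the existence of a strictly unital $A_\infty$-morphism $(f_k)_{k\ge1}$ with $f_1=\mathrm{id}$ (for $A'_4$-structures only the identities with at most $4$ arguments are imposed). Let $\mathcal M_\infty(\mathcal S_n)$ (resp. $\mathcal M_4(\mathcal S_n)$) be the functor on affine schemes over $\mathrm{PGL}_n$ sending $(R,g)$ to the set of gauge equivalence classes of minimal $A_\infty$-structures (resp. minimal $A'_4$-structures) on $\mathcal S(R^n,g)$, with extension of scalars as functoriality. Let $U\subset\mathrm{PGL}_2$ be the open complement of the closed point $\operatorname{Spec}(\mathbb Z/2)\hookrightarrow\mathrm{PGL}_2$ given by the unit over $\mathbb Z/2$, and let $\mathcal M_\infty(\mathcal S_{2,U})$ and $\mathcal M_4(\mathcal S_{2,U})$ be the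 sheafifications, with respect to the Zariski topology of the base $U$, of the analogous functors on affine schemes over $U$. Theorem. (1) For $n\ge 3$ the functors $\mathcal M_\infty(\mathcal S_n)$ and $\mathcal M_4(\mathcal S_n)$ are representable by affine schemes of finite type over $\mathrm{PGL}_n$, and the projection $\mathcal M_\infty(\mathcal S_n)\to\mathcal M_4(\mathcal S_n)$, $(m_k)\mapsto(m_2,m_3,m_4)$, is a closed embedding. (2) The functors $\mathcal M_\infty(\mathcal S_{2,U})$ and $\mathcal M_4(\mathcal S_{2,U})$ are representable by schemes that are affine and of finite type over $U$, and the projection $\mathcal M_\infty(\mathcal S_{2,U})\to\mathcal M_4(\mathcal S_{2,U})$ is a closed embedding. (3) For $n\ge3$ the functor $\mathcal M_\infty(\mathrm{sph},n)$ on commutative rings, sending $R$ to the set of pairs consisting of $g\in\mathrm{PGL}_n(R)$ and a gauge equivalence class of minimal $A_\infty$-structures on $\mathcal S(R^n,g)$, is representable by an affine scheme of finite type over $\mathbb Z$. The same holds for the subfunctor $\mathcal M_\infty(\mathrm{sph},2)[\mathrm{tr}^{-1}]$ of $\mathcal M_\infty(\mathrm{sph},2)$ given by the condition that $\operatorname{tr}(g)$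 is a generator of $L$. -/

import Mathlib

open CategoryTheory AlgebraicGeometry Opposite
open scoped TensorProduct

universe u

namespace SphPair

noncomputable section

/-! ## The category `S(Rⁿ, g)` -/

/-- The two objects `X`, `Y`. -/
inductive Obj : Type
  | X
  | Y

/-- The total space of morphisms of `S(Rⁿ, g)`, where `g` has coefficients in the `R`-module `L`.
An element is `((a, b), (l, c), v, w)` with
`a ∈ Hom⁰(X,X) = R`, `b ∈ Hom⁰(Y,Y) = R`, `l ∈ Hom¹(X,X) = L`, `c ∈ Hom¹(Y,Y) = R`,
`v ∈ Hom⁰(X,Y) = V = Rⁿ`, and `w ∈ Hom¹(Y,X) = V^∨`, written in the dual basis. -/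
abbrev Mor (n : ℕ) (R L : Type u) : Type u :=
  (R × R) × (L × R) × (Fin n → R) × (Fin n → R)

section Cat

variable {n : ℕ} {R L : Type u} [CommRing R] [AddCommGroup L] [Module R L]

/-- The summand `Hom^d(a, b)` of the total space of morphisms: a component of `x ∈ Hom^d(a, b)` is
zero unless its source, target and degree are `a`, `b`, `d`. -/
def hom (a b : Obj) (d : ℤ) : Submodule R (Mor n R L) where
  carrier := {x |
    (¬(a = .X ∧ b = .X ∧ d = 0) → x.1.1 = 0) ∧
    (¬(a = .Y ∧ b = .Y ∧ d = 0) → x.1.2 = 0) ∧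
    (¬(a = .X ∧ b = .X ∧ d = 1) → x.2.1.1 = 0) ∧
    (¬(a = .Y ∧ b = .Y ∧ d = 1) → x.2.1.2 = 0) ∧
    (¬(a = .X ∧ b = .Y ∧ d = 0) → x.2.2.1 = 0) ∧
    (¬(a = .Y ∧ b = .X ∧ d = 1) → x.2.2.2 = 0)}
  add_mem' := by
    rintro x y ⟨h1, h2, h3, h4, h5, h6⟩ ⟨k1, k2, k3, k4, k5, k6⟩
    exact ⟨fun h => by simp [h1 h, k1 h], fun h => by simp [h2 h, k2 h],
      fun h => by simp [h3 h, k3 h], fun h => by simp [h4 h, k4 h],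
      fun h => by simp [h5 h, k5 h], fun h => by simp [h6 h, k6 h]⟩
  zero_mem' := by simp
  smul_mem' := by
    rintro c x ⟨h1, h2, h3, h4, h5, h6⟩
    exact ⟨fun h => by simp [h1 h], fun h => by simp [h2 h],
      fun h => by simp [h3 h], fun h => by simp [h4 h],
      fun h => by simp [h5 h], fun h => by simp [h6 h]⟩

/-- Composition `x 0 ∘ x 1` in `S(Rⁿ, g)`: besides the identities, `v* ∘ v = ⟨v*, g v⟩ ∈ L` and
`v ∘ v* = ⟨v*, v⟩ ∈ R`. -/
def compo (g : Matrix (Fin n) (Fin n) L) :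
    MultilinearMap R (fun _ : Fin 2 => Mor n R L) (Mor n R L) :=
  MultilinearMap.mk'
    (fun x =>
      (((x 0).1.1 * (x 1).1.1, (x 0).1.2 * (x 1).1.2),
       ((x 0).1.1 • (x 1).2.1.1 + (x 1).1.1 • (x 0).2.1.1
          + ∑ i, ∑ j, ((x 0).2.2.2 i * (x 1).2.2.1 j) • g i j,
        (x 0).1.2 * (x 1).2.1.2 + (x 1).1.2 * (x 0).2.1.2
          + ∑ i, (x 0).2.2.1 i * (x 1).2.2.2 i),
       (x 0).1.2 • (x 1).2.2.1 + (x 1).1.1 • (x 0).2.2.1,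
       (x 0).1.1 • (x 1).2.2.2 + (x 1).1.2 • (x 0).2.2.2))
    (by
      intro m i x y
      fin_cases i
      all_goals
        simp only [Fin.zero_eta, Fin.mk_one, Function.update_self, ne_eq, one_ne_zero, zero_ne_one,
          not_false_eq_true, Function.update_of_ne, Prod.fst_add, Prod.snd_add, Pi.add_apply,
          add_mul, mul_add, add_smul, smul_add, Finset.sum_add_distrib, Prod.mk_add_mk,
          Prod.mk.injEq, true_and]
        refine ⟨⟨?_, ?_⟩, ?_, ?_⟩ <;> abel)
    (by
      intro m i c x
      fin_cases i
      all_goals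
        simp only [Fin.zero_eta, Fin.mk_one, Function.update_self, ne_eq, one_ne_zero, zero_ne_one,
          not_false_eq_true, Function.update_of_ne, Prod.smul_fst, Prod.smul_snd, Pi.smul_apply,
          smul_eq_mul, smul_add, Prod.smul_mk, Finset.smul_sum, smul_smul, Finset.mul_sum, mul_add,
          Prod.mk.injEq]
        refine ⟨⟨by ring, by ring⟩, ⟨?_, ?_⟩, ?_, ?_⟩ <;>
        simp only [mul_assoc, mul_comm])

/-- `x ↦ (-1)^(s · deg x) x`, the Koszul sign for moving an operation of degree `s` past `x`. -/
def koszul (s : ℕ) : Mor n R L →ₗ[R] Mor n R L where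
  toFun x := (x.1, (-1 : R) ^ s • x.2.1, x.2.2.1, (-1 : R) ^ s • x.2.2.2)
  map_add' x y := by simp
  map_smul' c x := by simp [smul_smul, mul_comm]

/-! ## Minimal `A_∞`-structures -/

/-- `k`-ary operations on the total space of morphisms. -/
abbrev Op (n : ℕ) (R L : Type u) [CommRing R] [AddCommGroup L] [Module R L] (k : ℕ) : Type u :=
  MultilinearMap R (fun _ : Fin k => Mor n R L) (Mor n R L)

/-- `f` is a family of maps
`Hom(c₁, c₀) ⊗ Hom(c₂, c₁) ⊗ ⋯ ⊗ Hom(c_k, c_{k-1}) → Hom(c_k, c₀)` of degree `t`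
(extended by zero to sequences of morphisms that are not composable). -/
structure IsCochain {k : ℕ} (t : ℤ) (f : Op n R L k) : Prop where
  mem : ∀ (c : Fin (k + 1) → Obj) (d : Fin k → ℤ) (x : Fin k → Mor n R L),
    (∀ i, x i ∈ hom (R := R) (c i.succ) (c i.castSucc) (d i)) →
      f x ∈ hom (R := R) (c (Fin.last k)) (c 0) (∑ i, d i + t)
  zero : ∀ (a b : Fin k → Obj) (d : Fin k → ℤ) (x : Fin k → Mor n R L),
    (∀ i, x i ∈ hom (R := R) (a i) (b i) (d i)) →
      (∃ i j : Fin k, (i : ℕ) + 1 = j ∧ a i ≠ b j) → f x = 0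

/-- `f` vanishes if one of its arguments is (a multiple of) an identity morphism;
recall `Hom⁰(v, v) = R · id_v`. -/
def IsReduced {k : ℕ} (f : Op n R L k) : Prop :=
  ∀ (x : Fin k → Mor n R L) (i : Fin k) (v : Obj), x i ∈ hom (R := R) v v 0 → f x = 0

/-- The sequence `a₀, …, a_{r-1}, y, a_{r+s}, a_{r+s+1}, …`, with the Koszul sign for moving
an operation of degree `s` (modulo 2) past `a₀, …, a_{r-1}`. -/
def insertAt (r s : ℕ) (y : Mor n R L) (a : ℕ → Mor n R L) (i : ℕ) : Mor n R L :=
  if i < r then koszul (R := R) s (a i) else if i = r then y else a (i + s - 1)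

/-- `∑_{r+s+t=k} (-1)^{r+st} f_{r+1+t}(1^{⊗r} ⊗ m_s ⊗ 1^{⊗t})` applied to `a₀ ⊗ ⋯ ⊗ a_{k-1}`. -/
def insertSum (f m : ∀ k, Op n R L k) (k : ℕ) (a : ℕ → Mor n R L) : Mor n R L :=
  ∑ p ∈ Finset.HasAntidiagonal.antidiagonal k, ∑ q ∈ Finset.HasAntidiagonal.antidiagonal p.2,
    (-1 : R) ^ (p.1 + q.1 * q.2) •
      f (p.1 + 1 + q.2) (fun i => insertAt (R := R) p.1 q.1 (m q.1 fun j => a (p.1 + j)) a i)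

/-- `∑ (-1)^e m_r(f_{i₁} ⊗ ⋯ ⊗ f_{i_r})` applied to `a₀ ⊗ ⋯ ⊗ a_{k-1}`, where the sum is over
`i₁ + ⋯ + i_r = k` and `e = (r-1)(i₁-1) + (r-2)(i₂-1) + ⋯ + (i_{r-1}-1)`. The Koszul sign comes from
moving each `f_{i_j}`, of degree `1 - i_j`, past the arguments of `f_{i_1}, …, f_{i_{j-1}}`. -/
def composeSum (m f : ∀ k, Op n R L k) (k : ℕ) (a : ℕ → Mor n R L) : Mor n R L :=
  ∑ c : Composition k,
    (-1 : R) ^ (∑ l : Fin c.length, (c.length - 1 - l) * (c.blocksFun l - 1)) •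
      m c.length (fun l => f (c.blocksFun l) (fun j =>
        koszul (R := R) (∑ l' ∈ Finset.Ioi l, (c.blocksFun l' - 1)) (a (c.embedding l j))))

/-- For `N = ∞`: minimal strictly unital `A_∞`-structures on `S(Rⁿ, g)`.
For finite `N ≥ 2`: minimal strictly unital `A'_N`-structures `(m₂, …, m_N)`, i.e. the `A_∞`-identities
with at most `N + 1` arguments are imposed (the last one being `[m₂, m_N] + [m₃, m_{N-1}] + ⋯ = 0`);
`m k` is set to zero for `k > N`. -/
@[ext]
structure MinAInf (N : ℕ∞) (g : Matrix (Fin n) (Fin n) L) where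
  m : ∀ k, Op n R L k
  cochain : ∀ k : ℕ, IsCochain (2 - (k : ℤ)) (m k)
  reduced : ∀ k, 3 ≤ k → IsReduced (m k)
  m_one : m 1 = 0
  m_two : m 2 = compo g
  m_top : ∀ k : ℕ, N < k → m k = 0
  stasheff : ∀ k : ℕ, (k : ℕ∞) ≤ N + 1 → ∀ a : ℕ → Mor n R L, insertSum m m k a = 0

/-- Two minimal structures are gauge equivalent if there is a strictly unital `A_∞`-morphism
`f = (id, f₂, f₃, …)` between them; for `A'_N`-structures the identities with at most `N` arguments
are imposed. -/
def GaugeEquiv {N : ℕ∞} {g : Matrix (Fin n) (Fin n) L} (m m' : MinAInf (R := R) N g) : Prop :=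
  ∃ f : ∀ k, Op n R L k,
    (∀ k : ℕ, IsCochain (1 - (k : ℤ)) (f k)) ∧ (∀ k, 2 ≤ k → IsReduced (f k)) ∧ (∀ x, f 1 x = x 0) ∧
    ∀ k : ℕ, (k : ℕ∞) ≤ N → ∀ a : ℕ → Mor n R L, insertSum f m.m k a = composeSum m'.m f k a

variable (R) in
/-- Gauge equivalence classes of minimal structures on `S(Rⁿ, g)`. -/
def Classes (N : ℕ∞) (g : Matrix (Fin n) (Fin n) L) : Type u :=
  Quot (GaugeEquiv (R := R) (N := N) (g := g))

end Cat

/-! ## Base change -/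

section BaseChange

variable {R R' : Type u} [CommRing R] [CommRing R'] {ρ : R →+* R'}

/-- The `ρ`-linear map `φ : M → M'` is universal, i.e. exhibits `M'` as `R' ⊗_R M`. -/
def IsUniv {M M' : Type u} [AddCommGroup M] [Module R M] [AddCommGroup M'] [Module R' M']
    (φ : M →ₛₗ[ρ] M') : Prop :=
  ∀ (Q : Type u) [AddCommGroup Q] [Module R' Q] (f : M →ₛₗ[ρ] Q),
    ∃! f' : M' →ₗ[R'] Q, ∀ x, f' (φ x) = f x

theorem isUniv_ring : IsUniv (M := R) (M' := R') (ρ := ρ) ρ.toSemilinearMap := by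
  intro Q _ _ f
  refine ⟨LinearMap.toSpanSingleton R' Q (f 1), fun x => ?_, fun h hh => ?_⟩
  · have := f.map_smulₛₗ x 1
    simpa using this.symm
  · ext
    have := hh 1
    simpa using this

theorem IsUniv.prod {M M' P P' : Type u} [AddCommGroup M] [Module R M] [AddCommGroup M']
    [Module R' M'] [AddCommGroup P] [Module R P] [AddCommGroup P'] [Module R' P']
    {φ : M →ₛₗ[ρ] M'} {χ : P →ₛₗ[ρ] P'} (hφ : IsUniv φ) (hχ : IsUniv χ)
    (θ : M × P →ₛₗ[ρ] M' × P') (hθ : ∀ x, θ x = (φ x.1, χ x.2)) : IsUniv θ := by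
  intro Q _ _ f
  let f₁ : M →ₛₗ[ρ] Q :=
    { toFun := fun x => f (x, 0)
      map_add' := fun x y => by rw [← f.map_add]; simp
      map_smul' := fun c x => by rw [← f.map_smulₛₗ]; simp }
  let f₂ : P →ₛₗ[ρ] Q :=
    { toFun := fun x => f (0, x)
      map_add' := fun x y => by rw [← f.map_add]; simp
      map_smul' := fun c x => by rw [← f.map_smulₛₗ]; simp }
  obtain ⟨g₁, hg₁, u₁⟩ := hφ Q f₁
  obtain ⟨g₂, hg₂, u₂⟩ := hχ Q f₂
  refine ⟨g₁.coprod g₂, fun x => ?_, fun h hh => ?_⟩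
  · rw [hθ]
    simp only [LinearMap.coprod_apply, hg₁, hg₂]
    change f (x.1, 0) + f (0, x.2) = f x
    rw [← f.map_add]; simp
  · have e₁ := u₁ (h.comp (LinearMap.inl R' M' P')) (fun x => by
      have := hh (x, 0); rw [hθ] at this; simpa [f₁] using this)
    have e₂ := u₂ (h.comp (LinearMap.inr R' M' P')) (fun x => by
      have := hh (0, x); rw [hθ] at this; simpa [f₂] using this)
    rw [← e₁, ← e₂]
    ext <;> simp

theorem isUniv_pi {n : ℕ} (θ : (Fin n → R) →ₛₗ[ρ] (Fin n → R'))
    (hθ : ∀ x i, θ x i = ρ (x i)) : IsUniv θ := by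
  have hs : ∀ i, θ (Pi.single i 1) = Pi.single i 1 := fun i => by
    ext j
    rw [hθ]
    by_cases h : j = i
    · subst h; simp
    · simp [h]
  intro Q _ _ f
  refine ⟨Fintype.linearCombination R' (fun i => f (Pi.single i 1)), fun x => ?_, fun h hh => ?_⟩
  · conv_rhs => rw [pi_eq_sum_univ' x]
    simp [Fintype.linearCombination_apply, hθ, map_sum]
  · refine LinearMap.pi_ext' fun i => LinearMap.ext_ring ?_
    have := hh (Pi.single i 1)
    rw [hs] at this
    simpa using this

theorem IsUniv.multi_ext {M M' Q : Type u} [AddCommGroup M] [Module R M] [AddCommGroup M']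
    [Module R' M'] [AddCommGroup Q] [Module R' Q] {φ : M →ₛₗ[ρ] M'} (hφ : IsUniv φ) {k : ℕ}
    {F G : MultilinearMap R' (fun _ : Fin k => M') Q}
    (h : ∀ x : Fin k → M, F (fun i => φ (x i)) = G (fun i => φ (x i))) : F = G := by
  induction k with
  | zero =>
    ext x
    have := h (fun i => i.elim0)
    convert this
  | succ k ih =>
    have key : ∀ x, F.curryLeft (φ x) = G.curryLeft (φ x) := by
      intro x
      apply ih
      intro y
      have := h (Fin.cons x y)
      have e : (fun i : Fin (k + 1) => φ ((Fin.cons x y : Fin (k + 1) → M) i)) =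
          Fin.cons (φ x) (fun i => φ (y i)) := by
        ext i
        refine Fin.cases ?_ (fun i => ?_) i <;> simp
      rw [e] at this
      simpa using this
    let f : M →ₛₗ[ρ] MultilinearMap R' (fun _ : Fin k => M') Q := (F.curryLeft).comp φ
    obtain ⟨f', -, uf⟩ := hφ _ f
    have h1 := uf F.curryLeft (fun x => rfl)
    have h2 := uf G.curryLeft (fun x => (key x).symm)
    have : F.curryLeft = G.curryLeft := h1.trans h2.symm
    rw [← F.uncurry_curryLeft, this, G.uncurry_curryLeft]

theorem IsUniv.multi_exists {M M' Q : Type u} [AddCommGroup M] [Module R M] [AddCommGroup M']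
    [Module R' M'] [AddCommGroup Q] [Module R' Q] {φ : M →ₛₗ[ρ] M'} (hφ : IsUniv φ) {k : ℕ}
    (F : (Fin k → M) → Q)
    (hadd : ∀ x i a b, F (Function.update x i (a + b)) =
      F (Function.update x i a) + F (Function.update x i b))
    (hsmul : ∀ x i (c : R) a, F (Function.update x i (c • a)) = ρ c • F (Function.update x i a)) :
    ∃ F' : MultilinearMap R' (fun _ : Fin k => M') Q, ∀ x, F' (fun i => φ (x i)) = F x := by
  induction k with
  | zero =>
    refine ⟨MultilinearMap.constOfIsEmpty R' _ (F (fun i => i.elim0)), fun x => ?_⟩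
    exact congrArg F (Subsingleton.elim _ _)
  | succ k ih =>
    have hG : ∀ x : M, ∃ G : MultilinearMap R' (fun _ : Fin k => M') Q,
        ∀ y, G (fun i => φ (y i)) = F (Fin.cons x y) := by
      intro x
      apply ih (fun y => F (Fin.cons x y))
      · intro y i a b
        simp only [Fin.cons_update, hadd]
      · intro y i c a
        simp only [Fin.cons_update, hsmul]
    choose G hG using hG
    let Gl : M →ₛₗ[ρ] MultilinearMap R' (fun _ : Fin k => M') Q :=
      { toFun := G
        map_add' := fun a b => hφ.multi_ext fun y => by
          simp only [add_apply, hG]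
          have := hadd (Fin.cons a y) 0 a b
          simpa only [Fin.update_cons_zero] using this
        map_smul' := fun c a => hφ.multi_ext fun y => by
          simp only [smul_apply, hG]
          have := hsmul (Fin.cons a y) 0 c a
          simpa only [Fin.update_cons_zero] using this }
    obtain ⟨G', hG', -⟩ := hφ _ Gl
    refine ⟨G'.uncurryLeft, fun x => ?_⟩
    rw [LinearMap.uncurryLeft_apply, hG']
    change G (x 0) (fun i => φ (x i.succ)) = F x
    rw [hG]
    congr 1
    exact Fin.cons_self_tail x

variable {n : ℕ} {L L' : Type u} [AddCommGroup L] [Module R L] [AddCommGroup L'] [Module R' L']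

/-- The map on morphisms induced by a ring map `ρ : R → R'` and a `ρ`-linear map `L → L'`. -/
def morMap (n : ℕ) (φ : L →ₛₗ[ρ] L') : Mor n R L →ₛₗ[ρ] Mor n R' L' where
  toFun x := ((ρ x.1.1, ρ x.1.2), (φ x.2.1.1, ρ x.2.1.2), fun i => ρ (x.2.2.1 i),
    fun i => ρ (x.2.2.2 i))
  map_add' x y := by ext <;> simp
  map_smul' c x := by ext <;> simp

theorem isUniv_morMap {φ : L →ₛₗ[ρ] L'} (hφ : IsUniv φ) : IsUniv (morMap n φ) := by
  let p : (Fin n → R) →ₛₗ[ρ] (Fin n → R') :=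
    { toFun := fun x i => ρ (x i)
      map_add' := fun x y => by ext; simp
      map_smul' := fun c x => by ext; simp }
  have hp : IsUniv p := isUniv_pi p fun _ _ => rfl
  let a : R × R →ₛₗ[ρ] R' × R' :=
    { toFun := fun x => (ρ x.1, ρ x.2)
      map_add' := fun x y => by ext <;> simp
      map_smul' := fun c x => by ext <;> simp }
  let b : L × R →ₛₗ[ρ] L' × R' :=
    { toFun := fun x => (φ x.1, ρ x.2)
      map_add' := fun x y => by ext <;> simp
      map_smul' := fun c x => by ext <;> simp }
  let q : (Fin n → R) × (Fin n → R) →ₛₗ[ρ] (Fin n → R') × (Fin n → R') :=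
    { toFun := fun x => (p x.1, p x.2)
      map_add' := fun x y => by simp
      map_smul' := fun c x => by simp }
  let r : (L × R) × (Fin n → R) × (Fin n → R) →ₛₗ[ρ] (L' × R') × (Fin n → R') × (Fin n → R') :=
    { toFun := fun x => (b x.1, q x.2)
      map_add' := fun x y => by simp
      map_smul' := fun c x => by simp }
  have ha : IsUniv a := isUniv_ring.prod isUniv_ring a fun _ => rfl
  have hb : IsUniv b := hφ.prod isUniv_ring b fun _ => rfl
  have hq : IsUniv q := hp.prod hp q fun _ => rfl
  have hr : IsUniv r := hb.prod hq r fun _ => rfl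
  exact ha.prod hr _ fun _ => rfl

open Classical in
/-- The projection onto `hom a b d`. -/
def homProj (a b : Obj) (d : ℤ) : Mor n R L →ₗ[R] Mor n R L where
  toFun x :=
    ((if a = .X ∧ b = .X ∧ d = 0 then x.1.1 else 0, if a = .Y ∧ b = .Y ∧ d = 0 then x.1.2 else 0),
     (if a = .X ∧ b = .X ∧ d = 1 then x.2.1.1 else 0,
      if a = .Y ∧ b = .Y ∧ d = 1 then x.2.1.2 else 0),
     if a = .X ∧ b = .Y ∧ d = 0 then x.2.2.1 else 0,
     if a = .Y ∧ b = .X ∧ d = 1 then x.2.2.2 else 0)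
  map_add' x y := by
    simp only [Prod.fst_add, Prod.snd_add, Prod.mk_add_mk, Prod.mk.injEq]
    refine ⟨⟨?_, ?_⟩, ⟨?_, ?_⟩, ?_, ?_⟩ <;> split_ifs <;> simp
  map_smul' c x := by
    simp only [Prod.smul_fst, Prod.smul_snd, Prod.smul_mk, Prod.mk.injEq, RingHom.id_apply]
    refine ⟨⟨?_, ?_⟩, ⟨?_, ?_⟩, ?_, ?_⟩ <;> split_ifs <;> simp

theorem mem_hom_iff {a b : Obj} {d : ℤ} {x : Mor n R L} :
    x ∈ hom (R := R) a b d ↔ homProj (R := R) a b d x = x := by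
  obtain ⟨⟨x1, x2⟩, ⟨x3, x4⟩, x5, x6⟩ := x
  change (_ ∧ _) ↔ _
  simp only [homProj, LinearMap.coe_mk, AddHom.coe_mk, Prod.mk.injEq]
  have key : ∀ {T : Type u} [Zero T] (p : Prop) (y : T) [Decidable p],
      (¬p → y = 0) ↔ (if p then y else 0) = y := by
    intro T _ p y _
    by_cases hp : p <;> simp [hp, eq_comm]
  rw [← key, ← key, ← key, ← key, ← key, ← key, and_assoc, and_assoc]

theorem homProj_mem (a b : Obj) (d : ℤ) (x : Mor n R L) :
    homProj (R := R) a b d x ∈ hom (R := R) a b d := by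
  rw [mem_hom_iff]
  simp only [homProj, LinearMap.coe_mk, AddHom.coe_mk, Prod.mk.injEq]
  refine ⟨⟨?_, ?_⟩, ⟨?_, ?_⟩, ?_, ?_⟩ <;> split_ifs <;> rfl

theorem homProj_morMap (φ : L →ₛₗ[ρ] L') (a b : Obj) (d : ℤ) (x : Mor n R L) :
    homProj (R := R') a b d (morMap n φ x) = morMap n φ (homProj (R := R) a b d x) := by
  simp only [homProj, morMap, LinearMap.coe_mk, AddHom.coe_mk, Prod.mk.injEq]
  refine ⟨⟨?_, ?_⟩, ⟨?_, ?_⟩, ?_, ?_⟩ <;> split_ifs <;> simp <;> rfl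

theorem koszul_morMap (φ : L →ₛₗ[ρ] L') (s : ℕ) (x : Mor n R L) :
    koszul (R := R') s (morMap n φ x) = morMap n φ (koszul (R := R) s x) := by
  ext <;> simp [koszul, morMap]

/-- `f'` is obtained from `f` by extension of scalars. -/
def Extends (φ : L →ₛₗ[ρ] L') {k : ℕ} (f : Op n R L k) (f' : Op n R' L' k) : Prop :=
  ∀ x, f' (fun i => morMap n φ (x i)) = morMap n φ (f x)

theorem exists_extends {φ : L →ₛₗ[ρ] L'} (hφ : IsUniv φ) {k : ℕ} (f : Op n R L k) :
    ∃ f' : Op n R' L' k, Extends φ f f' :=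
  (isUniv_morMap hφ).multi_exists (fun x => morMap n φ (f x))
    (fun x i a b => by simp) (fun x i c a => by simp)

theorem Extends.unique {φ : L →ₛₗ[ρ] L'} (hφ : IsUniv φ) {k : ℕ} {f : Op n R L k}
    {f' f'' : Op n R' L' k} (h' : Extends φ f f') (h'' : Extends φ f f'') : f' = f'' :=
  (isUniv_morMap hφ).multi_ext fun x => (h' x).trans (h'' x).symm

theorem Extends.isCochain {φ : L →ₛₗ[ρ] L'} (hφ : IsUniv φ) {k : ℕ} {f : Op n R L k}
    {f' : Op n R' L' k} (h : Extends φ f f') {t : ℤ} (hf : IsCochain t f) : IsCochain t f' where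
  mem c d x hx := by
    have key : f'.compLinearMap (fun i => homProj (R := R') (c i.succ) (c i.castSucc) (d i)) =
        (homProj (R := R') (c (Fin.last k)) (c 0) (∑ i, d i + t)).compMultilinearMap
          (f'.compLinearMap (fun i => homProj (R := R') (c i.succ) (c i.castSucc) (d i))) := by
      refine (isUniv_morMap hφ).multi_ext fun y => ?_
      simp only [MultilinearMap.compLinearMap_apply, LinearMap.compMultilinearMap_apply,
        homProj_morMap]
      rw [h (fun i => homProj (R := R) (c i.succ) (c i.castSucc) (d i) (y i)), homProj_morMap]
      congr 1
      exact (mem_hom_iff.1 (hf.mem c d _ fun i => homProj_mem _ _ _ _)).symm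
    have := congrArg (fun F => F x) key
    simp only [MultilinearMap.compLinearMap_apply, LinearMap.compMultilinearMap_apply,
      fun i => mem_hom_iff.1 (hx i)] at this
    exact mem_hom_iff.2 this.symm
  zero a b d x hx hab := by
    have key : f'.compLinearMap (fun i => homProj (R := R') (a i) (b i) (d i)) = 0 := by
      refine (isUniv_morMap hφ).multi_ext fun y => ?_
      simp only [MultilinearMap.compLinearMap_apply, homProj_morMap, zero_apply]
      rw [h (fun i => homProj (R := R) (a i) (b i) (d i) (y i)),
        hf.zero a b d _ (fun i => homProj_mem _ _ _ _) hab, map_zero]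
    have := congrArg (fun F => F x) key
    simpa only [MultilinearMap.compLinearMap_apply, zero_apply,
      fun i => mem_hom_iff.1 (hx i)] using this

theorem Extends.isReduced {φ : L →ₛₗ[ρ] L'} (hφ : IsUniv φ) {k : ℕ} {f : Op n R L k}
    {f' : Op n R' L' k} (h : Extends φ f f') (hf : IsReduced f) : IsReduced f' := by
  intro x i v hx
  let π (S : Type u) (P : Type u) [CommRing S] [AddCommGroup P] [Module S P] (j : Fin k) :
      Mor n S P →ₗ[S] Mor n S P := if j = i then homProj (R := S) v v 0 else LinearMap.id
  have hπ : ∀ j y, π R' L' j (morMap n φ y) = morMap n φ (π R L j y) := by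
    intro j y
    by_cases hj : j = i
    · simp [π, hj, homProj_morMap]
    · simp [π, hj]
  have key : f'.compLinearMap (π R' L') = 0 := by
    refine (isUniv_morMap hφ).multi_ext fun y => ?_
    simp only [MultilinearMap.compLinearMap_apply, hπ, zero_apply]
    rw [h (fun j => π R L j (y j)), hf _ i v, map_zero]
    simp [π, homProj_mem]
  have := congrArg (fun F => F x) key
  simp only [MultilinearMap.compLinearMap_apply, zero_apply] at this
  rw [← this]
  congr 1
  ext1 j
  by_cases hj : j = i
  · subst hj; simp [π, mem_hom_iff.1 hx]
  · simp [π, hj]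

theorem extends_compo (φ : L →ₛₗ[ρ] L') (g : Matrix (Fin n) (Fin n) L) :
    Extends φ (compo (R := R) g) (compo (R := R') (g.map φ)) := by
  intro x
  simp only [compo, MultilinearMap.mk', MultilinearMap.coe_mk, morMap, LinearMap.coe_mk,
    AddHom.coe_mk, Prod.mk.injEq]
  refine ⟨⟨?_, ?_⟩, ⟨?_, ?_⟩, ?_, ?_⟩
  · simp
  · simp
  · simp [map_sum]
  · simp [map_sum]
  · ext; simp
  · ext; simp

end BaseChange

section Multi

variable {n : ℕ} {R L : Type u} [CommRing R] [AddCommGroup L] [Module R L]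

/-- `G` is a multilinear function of the first `k` terms of a sequence. -/
def IsMulti (k : ℕ) (G : (ℕ → Mor n R L) → Mor n R L) : Prop :=
  ∃ F : Op n R L k, ∀ a : ℕ → Mor n R L, G a = F (fun i => a i)

theorem IsMulti.sum {k : ℕ} {ι : Type*} {s : Finset ι} {G : ι → (ℕ → Mor n R L) → Mor n R L}
    (h : ∀ i ∈ s, IsMulti (R := R) k (G i)) : IsMulti (R := R) k (fun a => ∑ i ∈ s, G i a) := by
  classical
  have h' : ∀ i, ∃ F : Op n R L k, i ∈ s → ∀ a : ℕ → Mor n R L, G i a = F (fun i => a i) := by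
    intro i
    by_cases hi : i ∈ s
    · obtain ⟨F, hF⟩ := h i hi
      exact ⟨F, fun _ => hF⟩
    · exact ⟨0, fun h => absurd h hi⟩
  choose F hF using h'
  refine ⟨∑ i ∈ s, F i, fun a => ?_⟩
  rw [sum_apply]
  exact Finset.sum_congr rfl fun i hi => hF i hi a

theorem IsMulti.smul {k : ℕ} {G : (ℕ → Mor n R L) → Mor n R L} (h : IsMulti (R := R) k G) (c : R) :
    IsMulti (R := R) k (fun a => c • G a) := by
  obtain ⟨F, hF⟩ := h
  exact ⟨c • F, fun a => by simp only [hF a, smul_apply]⟩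

/-- Extension of a finite sequence by zero. -/
def extSeq {k : ℕ} (x : Fin k → Mor n R L) (i : ℕ) : Mor n R L := if h : i < k then x ⟨i, h⟩ else 0

theorem extSeq_update {n : ℕ} {R L : Type u} [CommRing R] [AddCommGroup L] {k : ℕ} (x : Fin k → Mor n R L) (i : Fin k) (y : Mor n R L) :
    extSeq (Function.update x i y) = Function.update (extSeq x) i y := by
  ext1 j
  by_cases hj : j < k
  · by_cases hij : j = i
    · subst hij; simp [extSeq]
    · have : (⟨j, hj⟩ : Fin k) ≠ i := fun h => hij (by rw [← h])
      simp [extSeq, hj, hij, this]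
  · have : j ≠ i := by omega
    simp [extSeq, hj, this]

theorem IsMulti.of_update {k : ℕ} {G : (ℕ → Mor n R L) → Mor n R L}
    (hdep : ∀ a b : ℕ → Mor n R L, (∀ i < k, a i = b i) → G a = G b)
    (hlin : ∀ i < k, ∀ a : ℕ → Mor n R L, ∃ ℓ : Mor n R L →ₗ[R] Mor n R L,
      ∀ y, G (Function.update a i y) = ℓ y) : IsMulti (R := R) k G := by
  refine ⟨MultilinearMap.mk' (fun x => G (extSeq x)) (fun x i y z => ?_) (fun x i c y => ?_),
    fun a => ?_⟩
  · obtain ⟨ℓ, hℓ⟩ := hlin i i.2 (extSeq x)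
    simp only [extSeq_update, hℓ, map_add]
  · obtain ⟨ℓ, hℓ⟩ := hlin i i.2 (extSeq x)
    simp only [extSeq_update, hℓ, map_smul]
  · apply hdep
    intro i hi
    simp [extSeq, hi]

theorem update_fin {T : Type u} {k : ℕ} (b : ℕ → T) (i : ℕ) (hi : i < k) (y : T) :
    (fun l : Fin k => Function.update b i y l) = Function.update (fun l : Fin k => b l) ⟨i, hi⟩ y := by
  ext1 l
  by_cases h : (l : ℕ) = i
  · have : l = ⟨i, hi⟩ := Fin.ext h
    subst this; simp
  · have : l ≠ ⟨i, hi⟩ := fun h' => h (by rw [h'])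
    simp [h, this]

theorem isMulti_insert {r s t : ℕ} (f : Op n R L (r + 1 + t)) (m : Op n R L s) :
    IsMulti (R := R) (r + (s + t))
      (fun a => f (fun i => insertAt (R := R) r s (m fun j => a (r + j)) a i)) := by
  apply IsMulti.of_update
  · intro a b hab
    have e : (fun j : Fin s => a (r + j)) = fun j : Fin s => b (r + j) := by
      ext1 j; exact hab _ (by omega)
    simp only [e]
    congr 1
    ext1 i
    unfold insertAt
    split_ifs with h1 h2
    · rw [hab _ (by omega)]
    · rfl
    · rw [hab _ (by omega)]
  · intro i hi a
    by_cases h1 : i < r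
    · refine ⟨(f.toLinearMap (fun i => insertAt (R := R) r s (m fun j => a (r + j)) a i)
        ⟨i, by omega⟩).comp (koszul (R := R) s), fun y => ?_⟩
      simp only [LinearMap.comp_apply, MultilinearMap.toLinearMap_apply]
      rw [← update_fin]
      congr 1
      ext1 l
      have e : (fun j : Fin s => Function.update a i y (r + j)) = fun j : Fin s => a (r + j) := by
        ext1 j; rw [Function.update_of_ne (by omega)]
      rw [e]
      by_cases hl : (l : ℕ) = i
      · simp [insertAt, hl, h1]
      · rw [Function.update_of_ne hl]
        unfold insertAt
        split_ifs with h3 h4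
        · rw [Function.update_of_ne hl]
        · rfl
        · rw [Function.update_of_ne (by omega)]
    · by_cases h2 : i < r + s
      · refine ⟨(f.toLinearMap (fun i => insertAt (R := R) r s (m fun j => a (r + j)) a i)
          ⟨r, by omega⟩).comp (m.toLinearMap (fun j => a (r + j)) ⟨i - r, by omega⟩), fun y => ?_⟩
        simp only [LinearMap.comp_apply, MultilinearMap.toLinearMap_apply]
        rw [← update_fin, ← update_fin (fun j => a (r + j))]
        congr 1
        ext1 l
        have e : (fun j : Fin s => Function.update a i y (r + j)) =
            fun j : Fin s => Function.update (fun j => a (r + j)) (i - r) y j := by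
          ext1 j
          by_cases hj : (j : ℕ) = i - r
          · have : r + (j : ℕ) = i := by omega
            rw [this, hj]; simp
          · rw [Function.update_of_ne (by omega), Function.update_of_ne hj]
        rw [e]
        by_cases hl : (l : ℕ) = r
        · simp [insertAt, hl]
        · rw [Function.update_of_ne hl]
          unfold insertAt
          split_ifs with h3
          · rw [Function.update_of_ne (by omega)]
          · rw [Function.update_of_ne (by omega)]
      · refine ⟨f.toLinearMap (fun i => insertAt (R := R) r s (m fun j => a (r + j)) a i)
          ⟨i + 1 - s, by omega⟩, fun y => ?_⟩
        simp only [MultilinearMap.toLinearMap_apply]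
        rw [← update_fin]
        congr 1
        ext1 l
        have e : (fun j : Fin s => Function.update a i y (r + j)) = fun j : Fin s => a (r + j) := by
          ext1 j; rw [Function.update_of_ne (by omega)]
        rw [e]
        by_cases hl : (l : ℕ) = i + 1 - s
        · have h3 : ¬ (i + 1 - s < r) := by omega
          have h4 : ¬ (i + 1 - s = r) := by omega
          have h5 : i + 1 - s + s - 1 = i := by omega
          simp [insertAt, hl, h3, h4, h5]
        · rw [Function.update_of_ne hl]
          unfold insertAt
          split_ifs with h3 h4
          · rw [Function.update_of_ne (by omega)]
          · rfl
          · rw [Function.update_of_ne (by omega)]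

theorem isMulti_insertSum (f m : ∀ k, Op n R L k) (k : ℕ) :
    IsMulti (R := R) k (insertSum (R := R) f m k) := by
  refine IsMulti.sum fun p hp => IsMulti.sum fun q hq => IsMulti.smul ?_ _
  rw [Finset.HasAntidiagonal.mem_antidiagonal] at hp hq
  rw [← hp, ← hq]
  exact isMulti_insert _ _

theorem isMulti_composeSum (m f : ∀ k, Op n R L k) (k : ℕ) :
    IsMulti (R := R) k (composeSum (R := R) m f k) := by
  refine IsMulti.sum fun c _ => IsMulti.smul ?_ _
  refine ⟨((m c.length).compMultilinearMap (fun l => (f (c.blocksFun l)).compLinearMap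
    (fun _ => koszul (R := R) (∑ l' ∈ Finset.Ioi l, (c.blocksFun l' - 1))))).domDomCongr
      c.blocksFinEquiv, fun a => ?_⟩
  rfl

end Multi

section Push

variable {R R' : Type u} [CommRing R] [CommRing R'] {ρ : R →+* R'}
variable {n : ℕ} {L L' : Type u} [AddCommGroup L] [Module R L] [AddCommGroup L'] [Module R' L']

theorem IsMulti.ext {φ : L →ₛₗ[ρ] L'} (hφ : IsUniv φ) {k : ℕ}
    {G H : (ℕ → Mor n R' L') → Mor n R' L'} (hG : IsMulti (R := R') k G)
    (hH : IsMulti (R := R') k H)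
    (h : ∀ a : ℕ → Mor n R L, G (fun i => morMap n φ (a i)) = H (fun i => morMap n φ (a i)))
    (a : ℕ → Mor n R' L') : G a = H a := by
  obtain ⟨F, hF⟩ := hG
  obtain ⟨K, hK⟩ := hH
  rw [hF, hK]
  congr 1
  refine (isUniv_morMap (n := n) hφ).multi_ext fun x => ?_
  have := h (extSeq x)
  rw [hF, hK] at this
  simpa [extSeq] using this

theorem insertSum_morMap {φ : L →ₛₗ[ρ] L'} {f m : ∀ k, Op n R L k} {f' m' : ∀ k, Op n R' L' k}
    (hf : ∀ k, Extends φ (f k) (f' k)) (hm : ∀ k, Extends φ (m k) (m' k)) (k : ℕ)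
    (a : ℕ → Mor n R L) :
    insertSum (R := R') f' m' k (fun i => morMap n φ (a i)) =
      morMap n φ (insertSum (R := R) f m k a) := by
  simp only [insertSum, map_sum, LinearMap.map_smulₛₗ, map_pow, map_neg, map_one]
  refine Finset.sum_congr rfl fun p _ => Finset.sum_congr rfl fun q _ => ?_
  congr 1
  rw [← hf]
  congr 1
  ext1 i
  rw [hm q.1 (fun j => a (p.1 + j))]
  unfold insertAt
  split_ifs
  · rw [koszul_morMap]
  · rfl
  · rfl

theorem composeSum_morMap {φ : L →ₛₗ[ρ] L'} {f m : ∀ k, Op n R L k} {f' m' : ∀ k, Op n R' L' k}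
    (hf : ∀ k, Extends φ (f k) (f' k)) (hm : ∀ k, Extends φ (m k) (m' k)) (k : ℕ)
    (a : ℕ → Mor n R L) :
    composeSum (R := R') m' f' k (fun i => morMap n φ (a i)) =
      morMap n φ (composeSum (R := R) m f k a) := by
  simp only [composeSum, map_sum, LinearMap.map_smulₛₗ, map_pow, map_neg, map_one]
  refine Finset.sum_congr rfl fun c _ => ?_
  congr 1
  rw [← hm]
  congr 1
  ext1 l
  rw [← hf]
  congr 1
  ext1 j
  rw [koszul_morMap]

/-- Extension of scalars of a minimal structure along a universal `ρ`-linear map `L → L'`. -/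
def MinAInf.push {φ : L →ₛₗ[ρ] L'} (hφ : IsUniv φ) {N : ℕ∞} {g : Matrix (Fin n) (Fin n) L}
    {g' : Matrix (Fin n) (Fin n) L'} (hg : g' = g.map φ) (m : MinAInf (R := R) N g) :
    MinAInf (R := R') N g' where
  m k := (exists_extends hφ (m.m k)).choose
  cochain k := (exists_extends hφ (m.m k)).choose_spec.isCochain hφ (m.cochain k)
  reduced k hk := (exists_extends hφ (m.m k)).choose_spec.isReduced hφ (m.reduced k hk)
  m_one := (exists_extends hφ (m.m 1)).choose_spec.unique hφ (by intro x; simp [m.m_one])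
  m_two := (exists_extends hφ (m.m 2)).choose_spec.unique hφ (by
    rw [hg, m.m_two]; exact extends_compo φ g)
  m_top k hk := (exists_extends hφ (m.m k)).choose_spec.unique hφ (by
    intro x; simp [m.m_top k hk])
  stasheff k hk := by
    refine IsMulti.ext (H := fun _ => 0) hφ (isMulti_insertSum _ _ k) ⟨0, fun _ => rfl⟩ fun a => ?_
    rw [insertSum_morMap (fun k => (exists_extends hφ (m.m k)).choose_spec)
      (fun k => (exists_extends hφ (m.m k)).choose_spec), m.stasheff k hk, map_zero]

theorem MinAInf.push_extends {φ : L →ₛₗ[ρ] L'} (hφ : IsUniv φ) {N : ℕ∞}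
    {g : Matrix (Fin n) (Fin n) L} {g' : Matrix (Fin n) (Fin n) L'} (hg : g' = g.map φ)
    (m : MinAInf (R := R) N g) (k : ℕ) : Extends φ (m.m k) ((m.push hφ hg).m k) :=
  (exists_extends hφ (m.m k)).choose_spec

theorem GaugeEquiv.push {φ : L →ₛₗ[ρ] L'} (hφ : IsUniv φ) {N : ℕ∞}
    {g : Matrix (Fin n) (Fin n) L} {g' : Matrix (Fin n) (Fin n) L'} (hg : g' = g.map φ)
    {m₁ m₂ : MinAInf (R := R) N g} (h : GaugeEquiv m₁ m₂) :
    GaugeEquiv (m₁.push hφ hg) (m₂.push hφ hg) := by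
  obtain ⟨f, h1, h2, h3, h4⟩ := h
  choose f' hf' using fun k => exists_extends hφ (f k)
  refine ⟨f', fun k => (hf' k).isCochain hφ (h1 k), fun k hk => (hf' k).isReduced hφ (h2 k hk),
    ?_, ?_⟩
  · have : f' 1 = MultilinearMap.ofSubsingleton R' _ _ 0 LinearMap.id :=
      (hf' 1).unique hφ (fun x => by simp [h3])
    intro x
    simp [this]
  · intro k hk
    refine IsMulti.ext hφ (isMulti_insertSum _ _ k) (isMulti_composeSum _ _ k) fun a => ?_
    rw [insertSum_morMap hf' (m₁.push_extends hφ hg), composeSum_morMap hf' (m₂.push_extends hφ hg),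
      h4 k hk]

/-- Extension of scalars on gauge equivalence classes. -/
def Classes.push {φ : L →ₛₗ[ρ] L'} (hφ : IsUniv φ) {N : ℕ∞}
    {g : Matrix (Fin n) (Fin n) L} {g' : Matrix (Fin n) (Fin n) L'} (hg : g' = g.map φ) :
    Classes R N g → Classes R' N g' :=
  Quot.map (MinAInf.push hφ hg) fun _ _ => GaugeEquiv.push hφ hg

end Push

section Trunc

variable {n : ℕ} {R L : Type u} [CommRing R] [AddCommGroup L] [Module R L]

theorem MinAInf.m_zero {N : ℕ∞} {g : Matrix (Fin n) (Fin n) L} (m : MinAInf (R := R) N g) :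
    m.m 0 = 0 := by
  ext1 x
  have := (m.cochain 0).mem (fun _ => .X) (fun i => i.elim0) x (fun i => i.elim0)
  obtain ⟨h1, h2, h3, h4, h5, h6⟩ := this
  refine Prod.ext (Prod.ext (h1 ?_) (h2 ?_))
    (Prod.ext (Prod.ext (h3 ?_) (h4 ?_)) (Prod.ext (h5 ?_) (h6 ?_))) <;> simp

/-- The projection `(m₂, m₃, …) ↦ (m₂, …, m_N)`. -/
def MinAInf.trunc {g : Matrix (Fin n) (Fin n) L} (N : ℕ) (hN : 2 ≤ N)
    (m : MinAInf (R := R) ⊤ g) : MinAInf (R := R) (N : ℕ∞) g where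
  m k := if k ≤ N then m.m k else 0
  cochain k := by
    split_ifs
    · exact m.cochain k
    · exact ⟨fun _ _ _ _ => Submodule.zero_mem _, fun _ _ _ _ _ _ => rfl⟩
  reduced k hk := by
    split_ifs
    · exact m.reduced k hk
    · exact fun _ _ _ _ => rfl
  m_one := by rw [if_pos (by omega)]; exact m.m_one
  m_two := by rw [if_pos hN]; exact m.m_two
  m_top k hk := by
    have : N < k := by exact_mod_cast hk
    rw [if_neg (by omega)]
  stasheff k hk a := by
    have hk' : k ≤ N + 1 := by exact_mod_cast hk
    rw [← m.stasheff k (by simp) a]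
    unfold insertSum
    refine Finset.sum_congr rfl fun p hp => Finset.sum_congr rfl fun q hq => ?_
    rw [Finset.HasAntidiagonal.mem_antidiagonal] at hp hq
    congr 1
    by_cases hs : q.1 ≤ 1
    · have h0 : m.m q.1 = 0 := by
        have : q.1 = 0 ∨ q.1 = 1 := by omega
        rcases this with h | h
        · rw [h]; exact m.m_zero
        · rw [h]; exact m.m_one
      have h0' : (if q.1 ≤ N then m.m q.1 else 0) = 0 := by rw [h0]; simp
      have hlt : p.1 < p.1 + 1 + q.2 := by omega
      rw [MultilinearMap.map_coord_zero _ ⟨p.1, hlt⟩, MultilinearMap.map_coord_zero _ ⟨p.1, hlt⟩]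
      · simp [insertAt, h0]
      · simp [insertAt, h0']
    · by_cases hu : p.1 + 1 + q.2 = 1
      · have h1 : ∀ u, u = 1 → m.m u = 0 := by rintro u rfl; exact m.m_one
        simp [h1 _ hu]
      · simp only [if_pos (show p.1 + 1 + q.2 ≤ N by omega), if_pos (show q.1 ≤ N by omega)]

theorem GaugeEquiv.trunc {g : Matrix (Fin n) (Fin n) L} (N : ℕ) (hN : 2 ≤ N)
    {m₁ m₂ : MinAInf (R := R) ⊤ g} (h : GaugeEquiv m₁ m₂) :
    GaugeEquiv (m₁.trunc N hN) (m₂.trunc N hN) := by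
  obtain ⟨f, h1, h2, h3, h4⟩ := h
  refine ⟨f, h1, h2, h3, fun k hk a => ?_⟩
  have hk' : k ≤ N := by exact_mod_cast hk
  have e1 : insertSum f (m₁.trunc N hN).m k a = insertSum f m₁.m k a := by
    unfold insertSum
    refine Finset.sum_congr rfl fun p hp => Finset.sum_congr rfl fun q hq => ?_
    rw [Finset.HasAntidiagonal.mem_antidiagonal] at hp hq
    have : (m₁.trunc N hN).m q.1 = m₁.m q.1 := if_pos (by omega)
    rw [this]
  have e2 : composeSum (m₂.trunc N hN).m f k a = composeSum m₂.m f k a := by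
    unfold composeSum
    refine Finset.sum_congr rfl fun c _ => ?_
    have : (m₂.trunc N hN).m c.length = m₂.m c.length := if_pos (c.length_le.trans hk')
    rw [this]
  rw [e1, e2, h4 k (by simp) a]

/-- The projection to gauge equivalence classes of `A'_N`-structures. -/
def Classes.trunc {g : Matrix (Fin n) (Fin n) L} (N : ℕ) (hN : 2 ≤ N) :
    Classes R ⊤ g → Classes R (N : ℕ∞) g :=
  Quot.map (MinAInf.trunc N hN) fun _ _ => GaugeEquiv.trunc N hN

theorem Classes.trunc_push {R' L' : Type u} [CommRing R'] [AddCommGroup L'] [Module R' L']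
    {ρ : R →+* R'} {φ : L →ₛₗ[ρ] L'} (hφ : IsUniv φ) {g : Matrix (Fin n) (Fin n) L}
    {g' : Matrix (Fin n) (Fin n) L'} (hg : g' = g.map φ) (N : ℕ) (hN : 2 ≤ N) (x : Classes R ⊤ g) :
    (x.push hφ hg).trunc N hN = (x.trunc N hN).push hφ hg := by
  induction x using Quot.ind with
  | mk m =>
    refine congrArg (Quot.mk _) (MinAInf.ext (funext fun k => ?_))
    refine Extends.unique hφ (f := (m.trunc N hN).m k) ?_ ((m.trunc N hN).push_extends hφ hg k)
    simp only [MinAInf.trunc]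
    split_ifs
    · exact m.push_extends hφ hg k
    · intro x; simp

end Trunc

/-! ## The scheme `PGL_n` and the line bundle `O(1)` -/

section PGL

/-- The polynomial ring `ℤ[x_{ij}]`. -/
abbrev MatRing (n : ℕ) : Type u := MvPolynomial (Fin n × Fin n) (ULift.{u} ℤ)

/-- The determinant of the generic matrix. -/
def genDet (n : ℕ) : MatRing.{u} n := (Matrix.mvPolynomialX (Fin n) (Fin n) (ULift.{u} ℤ)).det

/-- The coordinate ring `ℤ[x_{ij}][det⁻¹]` of `GL_n`. -/
abbrev GLRing (n : ℕ) : Type u := Localization.Away (genDet.{u} n)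

theorem genDet_isHomogeneous (n : ℕ) : (genDet.{u} n).IsHomogeneous n := by
  rw [genDet, Matrix.det_apply]
  refine MvPolynomial.IsHomogeneous.sum _ _ _ fun σ _ => ?_
  have h : (∏ i, Matrix.mvPolynomialX (Fin n) (Fin n) (ULift.{u} ℤ) (σ i) i).IsHomogeneous n := by
    have := MvPolynomial.IsHomogeneous.prod Finset.univ
      (fun i => Matrix.mvPolynomialX (Fin n) (Fin n) (ULift.{u} ℤ) (σ i) i) (fun _ => 1)
      (fun i _ => MvPolynomial.isHomogeneous_X _ _)
    simpa using this
  rcases Int.units_eq_one_or (Equiv.Perm.sign σ) with hs | hs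
  · rw [hs, one_smul]; exact h
  · rw [hs, Units.neg_smul, one_smul]; exact h.neg

/-- The part of weight `d` of `ℤ[x_{ij}][det⁻¹]` for the action of the central `𝔾_m`: elements
`p / det^k` where `p` is homogeneous of degree `n k + d`. -/
def glPart (n d : ℕ) : AddSubgroup (GLRing.{u} n) where
  carrier := {b | ∃ (k : ℕ) (p : MatRing.{u} n), p.IsHomogeneous (n * k + d) ∧
    algebraMap _ (GLRing n) (genDet n) ^ k * b = algebraMap _ (GLRing n) p}
  zero_mem' := ⟨0, 0, MvPolynomial.isHomogeneous_zero _ _ _, by simp⟩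
  add_mem' := by
    rintro b c ⟨k, p, hp, hb⟩ ⟨l, q, hq, hc⟩
    refine ⟨k + l, genDet n ^ l * p + genDet n ^ k * q, ?_, ?_⟩
    · refine MvPolynomial.IsHomogeneous.add ?_ ?_
      · have := ((genDet_isHomogeneous n).pow l).mul hp
        rwa [show n * l + (n * k + d) = n * (k + l) + d by ring] at this
      · have := ((genDet_isHomogeneous n).pow k).mul hq
        rwa [show n * k + (n * l + d) = n * (k + l) + d by ring] at this
    · simp only [map_add, map_mul, map_pow, ← hb, ← hc]
      ring
  neg_mem' := by
    rintro b ⟨k, p, hp, hb⟩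
    exact ⟨k, -p, hp.neg, by rw [mul_neg, hb, map_neg]⟩

theorem glPart_mul {n d e : ℕ} {b c : GLRing.{u} n} (hb : b ∈ glPart n d) (hc : c ∈ glPart n e) :
    b * c ∈ glPart n (d + e) := by
  obtain ⟨k, p, hp, hb⟩ := hb
  obtain ⟨l, q, hq, hc⟩ := hc
  refine ⟨k + l, p * q, ?_, ?_⟩
  · have := hp.mul hq
    rwa [show n * k + d + (n * l + e) = n * (k + l) + (d + e) by ring] at this
  · rw [map_mul, ← hb, ← hc]
    ring

/-- The part of weight `0`, a subring. -/
def pglSubring (n : ℕ) : Subring (GLRing.{u} n) where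
  __ := glPart n 0
  mul_mem' hb hc := glPart_mul hb hc
  one_mem' := ⟨0, 1, by simpa using MvPolynomial.isHomogeneous_one _ _, by simp⟩

/-- The part of weight `1`, a module over the part of weight `0`. -/
def o1Submodule (n : ℕ) : Submodule (pglSubring.{u} n) (GLRing.{u} n) where
  __ := glPart n 1
  smul_mem' c b hb := by
    have := glPart_mul c.2 hb
    rwa [zero_add] at this

/-- The coordinate ring of `PGL_n = GL_n / 𝔾_m`: the part of weight `0` of `ℤ[x_{ij}][det⁻¹]`. -/
def PGLRing (n : ℕ) : Type u := pglSubring.{u} n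

instance (n : ℕ) : CommRing (PGLRing.{u} n) := inferInstanceAs (CommRing (pglSubring.{u} n))

/-- The module of sections of the line bundle `O(1)` on `PGL_n`: the part of weight `1`. -/
def O1 (n : ℕ) : Type u := o1Submodule.{u} n

instance (n : ℕ) : AddCommGroup (O1.{u} n) := inferInstanceAs (AddCommGroup (o1Submodule.{u} n))

instance (n : ℕ) : Module (PGLRing.{u} n) (O1.{u} n) :=
  inferInstanceAs (Module (pglSubring.{u} n) (o1Submodule.{u} n))

/-- The matrix coefficients `x_{ij}`, as sections of `O(1)`; they form the universal morphism
`O^n → O^n ⊗ O(1)` over `PGL_n`. -/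
def univMat (n : ℕ) : Matrix (Fin n) (Fin n) (O1.{u} n) := fun i j =>
  (⟨algebraMap (MatRing n) (GLRing n) (MvPolynomial.X (i, j)),
    0, MvPolynomial.X (i, j), by simpa using MvPolynomial.isHomogeneous_X _ _, by simp⟩ :
    o1Submodule.{u} n)

/-- The extension of scalars `R ⊗_A P` along `ψ : A → R`. -/
def Pull {A R : Type u} [CommRing A] [CommRing R] (ψ : A →+* R)
    (P : Type u) [AddCommGroup P] [Module A P] : Type u :=
  letI := ψ.toAlgebra
  R ⊗[A] P

variable {A R P : Type u} [CommRing A] [CommRing R] [AddCommGroup P] [Module A P]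

instance (ψ : A →+* R) : AddCommGroup (Pull ψ P) := by
  letI := ψ.toAlgebra
  unfold Pull
  infer_instance

instance (ψ : A →+* R) : Module R (Pull ψ P) :=
  letI := ψ.toAlgebra
  TensorProduct.leftModule

/-- `y ↦ 1 ⊗ y`. -/
def Pull.of (ψ : A →+* R) (y : P) : Pull ψ P :=
  letI := ψ.toAlgebra
  (1 : R) ⊗ₜ[A] y

/-- The universal property of extension of scalars. -/
theorem Pull.exists_lift (ψ : A →+* R) {Q : Type u} [AddCommGroup Q] [Module R Q]
    (f : P → Q) (hadd : ∀ x y, f (x + y) = f x + f y)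
    (hsmul : ∀ (c : A) x, f (c • x) = ψ c • f x) :
    ∃! F : Pull ψ P →ₗ[R] Q, ∀ y, F (Pull.of ψ y) = f y := by
  let _ := ψ.toAlgebra
  let _ : Module A Q := Module.compHom Q ψ
  have : IsScalarTower A R Q :=
    ⟨fun c r q => by
      change (ψ c * r) • q = ψ c • (r • q)
      rw [mul_smul]⟩
  have hb := TensorProduct.isBaseChange A P R
  let f' : P →ₗ[A] Q :=
    { toFun := f, map_add' := hadd, map_smul' := hsmul }
  refine ⟨hb.lift f', fun y => hb.lift_eq f' y, fun G hG => ?_⟩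
  exact hb.algHom_ext G (hb.lift f') fun y => (hG y).trans (hb.lift_eq f' y).symm

theorem Pull.of_add (ψ : A →+* R) (x y : P) :
    Pull.of ψ (x + y) = Pull.of ψ x + Pull.of ψ y :=
  let _ := ψ.toAlgebra
  TensorProduct.tmul_add _ _ _

theorem Pull.of_smul (ψ : A →+* R) (c : A) (x : P) :
    Pull.of ψ (c • x) = ψ c • Pull.of ψ x := by
  let _ := ψ.toAlgebra
  change (1 : R) ⊗ₜ[A] (c • x) = (ψ c • (1 : R)) ⊗ₜ[A] x
  rw [← TensorProduct.smul_tmul, Algebra.smul_def, smul_eq_mul]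
  rfl

variable {R' : Type u} [CommRing R'] {ψ : A →+* R} {ψ' : A →+* R'}

/-- The map `R ⊗_A P → R' ⊗_A P` for `ψ' = ρ ∘ ψ`. -/
theorem Pull.exists_map (ρ : R →+* R') (h : ρ.comp ψ = ψ') :
    ∃ F : Pull ψ P →ₛₗ[ρ] Pull ψ' P, ∀ y, F (Pull.of ψ y) = Pull.of ψ' y := by
  let _ : Module R (Pull ψ' P) := Module.compHom _ ρ
  obtain ⟨F, hF, -⟩ := Pull.exists_lift (P := P) ψ (Q := Pull ψ' P) (Pull.of ψ') (Pull.of_add ψ')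
    (fun c x => by rw [Pull.of_smul]; subst h; rfl)
  exact ⟨{ toFun := F, map_add' := F.map_add, map_smul' := F.map_smul }, hF⟩

/-- The map `R ⊗_A P → R' ⊗_A P` for `ψ' = ρ ∘ ψ`. -/
def Pull.map (ρ : R →+* R') (h : ρ.comp ψ = ψ') : Pull ψ P →ₛₗ[ρ] Pull ψ' P :=
  (Pull.exists_map (P := P) ρ h).choose

theorem Pull.map_of (ρ : R →+* R') (h : ρ.comp ψ = ψ') (y : P) :
    Pull.map ρ h (Pull.of ψ y) = Pull.of ψ' y :=
  (Pull.exists_map (P := P) ρ h).choose_spec y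

theorem Pull.semilinear_ext {ρ : R →+* R'} {Q : Type u} [AddCommGroup Q] [Module R' Q]
    {F G : Pull ψ P →ₛₗ[ρ] Q} (h : ∀ y, F (Pull.of ψ y) = G (Pull.of ψ y)) : F = G := by
  let _ : Module R Q := Module.compHom _ ρ
  obtain ⟨K, -, hK⟩ := Pull.exists_lift (P := P) ψ (Q := Q) (fun y => F (Pull.of ψ y))
    (fun x y => by rw [Pull.of_add, map_add])
    (fun c x => by rw [Pull.of_smul, LinearMap.map_smulₛₗ]; rfl)
  have h1 := hK { toFun := F, map_add' := F.map_add, map_smul' := F.map_smulₛₗ } fun _ => rfl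
  have h2 := hK { toFun := G, map_add' := G.map_add, map_smul' := G.map_smulₛₗ } fun y => (h y).symm
  ext x
  exact LinearMap.congr_fun (h1.trans h2.symm) x

theorem Pull.isUniv_map (ρ : R →+* R') (h : ρ.comp ψ = ψ') : IsUniv (Pull.map (P := P) ρ h) := by
  intro Q _ _ f
  obtain ⟨F, hF, hu⟩ := Pull.exists_lift (P := P) ψ' (Q := Q) (fun y => f (Pull.of ψ y))
    (fun x y => by rw [Pull.of_add, map_add])
    (fun c x => by rw [Pull.of_smul, LinearMap.map_smulₛₗ]; subst h; rfl)
  refine ⟨F, fun x => ?_, fun G hG => hu G fun y => ?_⟩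
  · have : F.comp (Pull.map ρ h) = f := Pull.semilinear_ext fun y => by
      rw [LinearMap.comp_apply, Pull.map_of, hF]
    exact LinearMap.congr_fun this x
  · rw [← hG, Pull.map_of]

end PGL

section Functors

variable {n : ℕ} {R R' : Type u} [CommRing R] [CommRing R'] {ψ : PGLRing.{u} n →+* R}
  {ψ' : PGLRing.{u} n →+* R'}

/-- The line bundle `ψ^* O(1)` for an `R`-point `ψ` of `PGL_n`. -/
abbrev Lb (ψ : PGLRing.{u} n →+* R) : Type u := Pull ψ (O1.{u} n)

/-- The morphism `g : R^n → R^n ⊗ L`, `L = ψ^* O(1)`, given by the `R`-point `ψ` of `PGL_n`. -/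
def matOf (ψ : PGLRing.{u} n →+* R) : Matrix (Fin n) (Fin n) (Lb ψ) :=
  (univMat n).map (Pull.of ψ)

theorem matOf_map (ρ : R →+* R') (h : ρ.comp ψ = ψ') : matOf ψ' = (matOf ψ).map (Pull.map ρ h) := by
  ext i j
  simp only [matOf, Matrix.map_apply, Pull.map_of]

/-! ## The moduli functors -/

/-- Gauge equivalence classes of minimal `A_∞`-structures (for `N = ∞`), or of minimal
`A'_N`-structures, on `S(R^n, g)`, where `g` is the `R`-point `ψ` of `PGL_n`. -/
abbrev Moduli (N : ℕ∞) (ψ : PGLRing.{u} n →+* R) : Type u := Classes R N (matOf ψ)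

/-- Functoriality in `(R, g)`. -/
def Moduli.map {N : ℕ∞} (ρ : R →+* R') (h : ρ.comp ψ = ψ') : Moduli N ψ → Moduli N ψ' :=
  Classes.push (Pull.isUniv_map ρ h) (matOf_map ρ h)

theorem Moduli.map_id {N : ℕ∞} (x : Moduli N ψ) (h : (RingHom.id R).comp ψ = ψ) :
    Moduli.map (RingHom.id R) h x = x := by
  induction x using Quot.ind with
  | mk m =>
    refine congrArg (Quot.mk _) (MinAInf.ext (funext fun k => ?_))
    refine Extends.unique (Pull.isUniv_map (P := O1.{u} n) (RingHom.id R) h) (f := m.m k)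
      (m.push_extends _ _ k) ?_
    have e : Pull.map (P := O1.{u} n) (RingHom.id R) h = LinearMap.id := Pull.semilinear_ext fun y => by
      rw [Pull.map_of]; rfl
    intro x
    rw [e]
    rfl

theorem Moduli.map_comp {N : ℕ∞} {R'' : Type u} [CommRing R''] {ψ'' : PGLRing.{u} n →+* R''}
    (ρ : R →+* R') (h : ρ.comp ψ = ψ') (σ : R' →+* R'') (h' : σ.comp ψ' = ψ'')
    (h'' : (σ.comp ρ).comp ψ = ψ'') (x : Moduli N ψ) :
    Moduli.map (σ.comp ρ) h'' x = Moduli.map σ h' (Moduli.map ρ h x) := by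
  induction x using Quot.ind with
  | mk m =>
    refine congrArg (Quot.mk _) (MinAInf.ext (funext fun k => ?_))
    refine Extends.unique (Pull.isUniv_map (P := O1.{u} n) (σ.comp ρ) h'') (f := m.m k)
      (m.push_extends _ _ k) ?_
    have e : ∀ z : Lb ψ, Pull.map (σ.comp ρ) h'' z = Pull.map σ h' (Pull.map ρ h z) := by
      have : RingHomCompTriple ρ σ (σ.comp ρ) := ⟨rfl⟩
      intro z
      have : Pull.map (P := O1.{u} n) (σ.comp ρ) h'' = (Pull.map σ h').comp (Pull.map ρ h) :=
        Pull.semilinear_ext fun y => by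
          rw [LinearMap.comp_apply, Pull.map_of, Pull.map_of, Pull.map_of]
      exact LinearMap.congr_fun this z
    have e' : ∀ z : Mor n R (Lb ψ), morMap n (Pull.map (σ.comp ρ) h'') z =
        morMap n (Pull.map σ h') (morMap n (Pull.map ρ h) z) := by
      intro z
      simp only [morMap, LinearMap.coe_mk, AddHom.coe_mk, e, RingHom.comp_apply]
    intro x
    simp only [e']
    rw [(MinAInf.push_extends _ _ _ k) (fun i => morMap n (Pull.map ρ h) (x i)),
      m.push_extends _ _ k]

/-- The functor `(R, g) ↦` gauge equivalence classes of minimal `A_∞`-structures (for `N = ∞`) or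
minimal `A'_N`-structures on `S(R^n, g)`, on affine schemes over `PGL_n`. -/
def modFunctor (N : ℕ∞) (n : ℕ) : CommAlgCat.{u} (PGLRing.{u} n) ⥤ Type u where
  obj B := Moduli N (algebraMap (PGLRing.{u} n) B)
  map f := ↾(Moduli.map f.hom.toRingHom f.hom.comp_algebraMap)
  map_id B := by
    ext x
    exact Moduli.map_id x _
  map_comp f h := by
    ext x
    exact Moduli.map_comp f.hom.toRingHom _ h.hom.toRingHom _ _ x

/-- The projection from `A_∞`-structures to `A'_N`-structures. -/
def modTrunc (N : ℕ) (hN : 2 ≤ N) (n : ℕ) : modFunctor.{u} ⊤ n ⟶ modFunctor.{u} N n where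
  app B := ↾(Classes.trunc N hN)
  naturality B C f := by
    ext x
    exact Classes.trunc_push _ _ N hN x

/-! ### Absolute versions -/

/-- The functor `M_∞(sph, n)`: a point over `R` consists of `g ∈ PGL_n(R)` and a gauge equivalence
class of minimal `A_∞`-structures on `S(R^n, g)`. -/
def sphFunctor (n : ℕ) : CommRingCat.{u} ⥤ Type u where
  obj R := Σ ψ : PGLRing.{u} n →+* R, Moduli ⊤ ψ
  map ρ := ↾(fun x => ⟨ρ.hom.comp x.1, Moduli.map ρ.hom rfl x.2⟩)
  map_id R := by
    refine ConcreteCategory.hom_ext _ _ fun x => ?_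
    exact congrArg (fun y => (⟨x.1, y⟩ : Σ ψ : PGLRing.{u} n →+* R, Moduli ⊤ ψ)) (Moduli.map_id x.2 rfl)
  map_comp ρ σ := by
    refine ConcreteCategory.hom_ext _ _ fun x => ?_
    exact congrArg (fun y => (⟨(σ.hom.comp ρ.hom).comp x.1, y⟩ : Σ ψ : PGLRing.{u} n →+* _, Moduli ⊤ ψ))
      (Moduli.map_comp ρ.hom rfl σ.hom rfl rfl x.2)

/-- The trace of the matrix `g`, as an element of `ψ^* O(1)`, is a generator. -/
def TrInvertible (ψ : PGLRing.{u} n →+* R) : Prop :=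
  Submodule.span R {(matOf ψ).trace} = ⊤

theorem TrInvertible.map (h : TrInvertible ψ) (ρ : R →+* R') (hρ : ρ.comp ψ = ψ') :
    TrInvertible ψ' := by
  have ht : Pull.map ρ hρ (matOf ψ).trace = (matOf ψ').trace := by
    simp only [Matrix.trace, map_sum, Matrix.diag_apply, matOf, Matrix.map_apply, Pull.map_of]
  have hm : ∀ x, Pull.map ρ hρ x ∈ Submodule.span R' {(matOf ψ').trace} := by
    intro x
    have hx : x ∈ Submodule.span R {(matOf ψ).trace} := h ▸ Submodule.mem_top
    obtain ⟨c, rfl⟩ := Submodule.mem_span_singleton.1 hx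
    rw [LinearMap.map_smulₛₗ, ht]
    exact Submodule.smul_mem _ _ (Submodule.mem_span_singleton_self _)
  let q := (Submodule.span R' {(matOf ψ').trace}).mkQ
  obtain ⟨F, -, hF⟩ := Pull.isUniv_map ρ hρ _ (q.comp (Pull.map ρ hρ))
  have hq : q = 0 := (hF q fun x => rfl).trans (hF 0 fun x => by
    have := (Submodule.Quotient.mk_eq_zero _).2 (hm x)
    exact this.symm).symm
  have := Submodule.ker_mkQ (Submodule.span R' {(matOf ψ').trace})
  rw [TrInvertible, ← this]
  exact LinearMap.ker_eq_top.2 hq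

/-- The subfunctor `M_∞(sph, n)[tr⁻¹]` of `M_∞(sph, n)`, where `tr(g)` is invertible. -/
def sphTrFunctor (n : ℕ) : CommRingCat.{u} ⥤ Type u where
  obj R := {x : (sphFunctor.{u} n).obj R // TrInvertible x.1}
  map ρ := ↾(fun x => ⟨(sphFunctor.{u} n).map ρ x.1, x.2.map ρ.hom rfl⟩)
  map_id R := by
    refine ConcreteCategory.hom_ext _ _ fun x => ?_
    exact Subtype.ext (ConcreteCategory.congr_hom ((sphFunctor.{u} n).map_id R) x.1)
  map_comp ρ σ := by
    refine ConcreteCategory.hom_ext _ _ fun x => ?_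
    exact Subtype.ext (ConcreteCategory.congr_hom ((sphFunctor.{u} n).map_comp ρ σ) x.1)

end Functors

/-! ### The open subscheme `U` of `PGL_2` -/

section OpenU

/-- The unit point of `GL_n` over `ℤ/2`, as a homomorphism `ℤ[x_{ij}][det⁻¹] → ℤ/2`. -/
def glUnitMod2 (n : ℕ) : GLRing.{u} n →+* ZMod 2 :=
  IsLocalization.Away.lift (genDet.{u} n)
    (g := MvPolynomial.eval₂Hom ((Int.castRingHom (ZMod 2)).comp
      (ULift.ringEquiv : ULift.{u} ℤ ≃+* ℤ).toRingHom)
      (fun p : Fin n × Fin n => (1 : Matrix (Fin n) (Fin n) (ZMod 2)) p.1 p.2))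
    (by
      rw [genDet, RingHom.map_det]
      have : (MvPolynomial.eval₂Hom ((Int.castRingHom (ZMod 2)).comp
          (ULift.ringEquiv : ULift.{u} ℤ ≃+* ℤ).toRingHom)
          (fun p : Fin n × Fin n => (1 : Matrix (Fin n) (Fin n) (ZMod 2)) p.1 p.2)).mapMatrix
          (Matrix.mvPolynomialX (Fin n) (Fin n) (ULift.{u} ℤ)) = 1 := by
        ext i j
        simp [Matrix.mvPolynomialX]
      rw [this, Matrix.det_one]
      exact isUnit_one)

/-- The unit point of `PGL_n` over `ℤ/2`. -/
def pglUnitMod2 (n : ℕ) : PGLRing.{u} n →+* ZMod 2 :=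
  (glUnitMod2.{u} n).comp (pglSubring.{u} n).subtype

/-- The scheme `PGL_n` over `ℤ`. -/
abbrev PGL (n : ℕ) : Scheme.{u} := Spec (.of (PGLRing.{u} n))

/-- The complement in `PGL_2` of the closed subscheme `Spec(ℤ/2)` embedded by the unit point. -/
def PGL2U : (PGL.{u} 2).Opens :=
  ⟨(PrimeSpectrum.zeroLocus (RingHom.ker (pglUnitMod2.{u} 2) : Set (PGLRing.{u} 2)))ᶜ,
    (PrimeSpectrum.isClosed_zeroLocus _).isOpen_compl⟩

/-- The category of affine schemes over `U`. -/
abbrev AffU : Type (u + 1) := CostructuredArrow Scheme.Spec.{u} (PGL2U.{u} : Scheme.{u})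

/-- The ring homomorphism `O(PGL_2) → R` given by a morphism `Spec R → U`. -/
def AffU.point (T : AffU.{u}) : PGLRing.{u} 2 →+* T.left.unop :=
  (Spec.preimage (T.hom ≫ PGL2U.{u}.ι)).hom

theorem AffU.point_comp {T T' : AffU.{u}} (f : T ⟶ T') :
    f.left.unop.hom.comp T'.point = T.point := by
  have h : Spec.preimage (T'.hom ≫ PGL2U.{u}.ι) ≫ f.left.unop = Spec.preimage (T.hom ≫ PGL2U.{u}.ι) := by
    apply Spec.map_injective
    have := CostructuredArrow.w f
    rw [Spec.map_comp, Spec.map_preimage, Spec.map_preimage, ← this, Category.assoc]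
    rfl
  exact congrArg CommRingCat.Hom.hom h

/-- The presheaf of gauge equivalence classes of minimal `A_∞`-structures (for `N = ∞`) or minimal
`A'_N`-structures on affine schemes over `U`. -/
def modPresheafU (N : ℕ∞) : AffU.{u}ᵒᵖ ⥤ Type u where
  obj T := Moduli N T.unop.point
  map f := ↾(Moduli.map f.unop.left.unop.hom (AffU.point_comp f.unop))
  map_id T := by
    ext x
    exact Moduli.map_id x _
  map_comp f g := by
    ext x
    exact Moduli.map_comp f.unop.left.unop.hom (AffU.point_comp f.unop)
      g.unop.left.unop.hom (AffU.point_comp g.unop) _ x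

/-- The projection from `A_∞`-structures to `A'_N`-structures. -/
def modTruncU (N : ℕ) (hN : 2 ≤ N) : modPresheafU.{u} ⊤ ⟶ modPresheafU.{u} N where
  app T := ↾(Classes.trunc N hN)
  naturality T T' f := by
    ext x
    exact Classes.trunc_push _ _ N hN x

/-- For a family `W` of open subsets of `U`, the sieve of those `T' → T` for which `T' → U`
factors through some `W i`. -/
def baseSieve {ι : Type u} (W : ι → (PGL2U.{u} : Scheme.{u}).Opens) (T : AffU.{u}) : Sieve T where
  arrows T' _ := ∃ i, Set.range T'.hom ⊆ (W i : Set (PGL2U.{u} : Scheme.{u}))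
  downward_closed := by
    rintro T₁ T₂ f ⟨i, hi⟩ g
    refine ⟨i, ?_⟩
    rw [← CostructuredArrow.w g]
    rintro _ ⟨x, rfl⟩
    exact hi ⟨_, (Scheme.Hom.comp_apply _ _ _).symm⟩

/-- The Zariski topology of the base `U`, on affine schemes over `U`: it is generated by
the pull-backs of the open coverings of `U`. -/
def baseTopology : GrothendieckTopology AffU.{u} :=
  sInf {J | ∀ (ι : Type u) (W : ι → (PGL2U.{u} : Scheme.{u}).Opens), (⨆ i, W i) = ⊤ →
    ∀ T : AffU.{u}, baseSieve W T ∈ J T}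

/-- The functor `M_∞(S_{2,U})` (for `N = ∞`) or `M_N(S_{2,U})`: the sheafification of the presheaf of
gauge equivalence classes. -/
def modSheafU (N : ℕ∞) : AffU.{u}ᵒᵖ ⥤ Type (u + 1) :=
  sheafify baseTopology.{u} (modPresheafU.{u} N ⋙ uliftFunctor.{u + 1})

/-- The projection `M_∞(S_{2,U}) → M_N(S_{2,U})`. -/
def modSheafTruncU (N : ℕ) (hN : 2 ≤ N) : modSheafU.{u} ⊤ ⟶ modSheafU.{u} N :=
  sheafifyMap baseTopology.{u} (Functor.whiskerRight (modTruncU.{u} N hN) uliftFunctor.{u + 1})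

/-- The functor of points `T ↦ Hom_U(T, Z)` of a `U`-scheme `Z`, on affine schemes over `U`. -/
def pointsU : Over (PGL2U.{u} : Scheme.{u}) ⥤ (AffU.{u}ᵒᵖ ⥤ Type (u + 1)) :=
  yoneda ⋙ (Functor.whiskeringLeft _ _ _).obj (CostructuredArrow.toOver Scheme.Spec.{u} PGL2U.{u}).op ⋙
    (Functor.whiskeringRight _ _ _).obj uliftFunctor.{u + 1}

end OpenU

end

end SphPair

open SphPair

set_option autoImplicit false

namespace SphPair

open LinearMap (mulLeft mulRight comp_assoc comp_add mulLeft_apply mulRight_apply add_comp comp_sub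
  comp_id zero_comp sub_comp id_comp)
open TensorProduct (map_tmul smul_tmul map_add_left tmul_sub sub_tmul neg_tmul)
open Finset (sum_congr sum_smul smul_sum sum_insert sum_sub_distrib sum_singleton sum_add_distrib
  mem_univ)
open List (ofFn length_cons length_append length_eq_zero_iff map_cons length_nil)
open Function (update update_of_ne update_self)
open Category (assoc)
open Submodule (smul_mem mem_bot subset_span)
open Pi (single single_apply)

noncomputable section

/-- Square matrices. -/
notation "Mat" n:max L:max => Matrix (Fin n) (Fin n) L

/-- Tensor products of linear maps. -/
notation "tpMap" => TensorProduct.map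

/-- Identity linear maps. -/
notation "idL" => LinearMap.id

/-- Quotient maps of rings. -/
notation "qmk" => Ideal.Quotient.mk

section Apply

variable {R M N P : Type*} [Semiring R] [AddCommGroup M] [AddCommGroup N] [AddCommGroup P]
  [Module R M] [Module R N] [Module R P] (f g : M →ₗ[R] N)

lemma comp_apply (h : N →ₗ[R] P) (x : M) : (h ∘ₗ f) x = h (f x) := rfl

lemma zero_apply (x : M) : (0 : M →ₗ[R] N) x = 0 := rfl

lemma add_apply (x : M) : (f + g) x = f x + g x := rfl

lemma sub_apply (x : M) : (f - g) x = f x - g x := rfl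

variable {f g} in
lemma lcongr (h : f = g) (x : M) : f x = g x := h ▸ rfl

end Apply

lemma sub_eq_sub_of_eq_add {M : Type*} [AddCommGroup M] {a b c x y : M} (ha : a = c + x)
    (hb : b = c + y) : a - b = x - y := by rw [ha, hb, add_sub_add_left_eq_sub]

/-! ## The tensor coalgebra -/

section TensorCoalgebra

open TensorAlgebra (ι)

variable {R W N : Type*} [CommRing R] [AddCommGroup W] [Module R W] [AddCommGroup N] [Module R N]

local notation "𝕋" => TensorAlgebra R W
local notation "𝔼" => TensorAlgebra R W →ₗ[R] TensorAlgebra R W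
local notation "ℭ" => TensorAlgebra R W →ₗ[R] W

/-- The product of a list of letters in the tensor algebra. -/
def wd (l : List W) : 𝕋 := (l.map (ι R)).prod

@[simp] theorem wd_nil : wd (R := R) ([] : List W) = 1 := rfl

@[simp] theorem wd_cons (a : W) (l : List W) : wd (R := R) (a :: l) = ι R a * wd l := by simp [wd]

lemma wd_append (l l' : List W) : wd (R := R) (l ++ l') = wd l * wd l' := by simp [wd]

/-- Structural recursion on the tensor algebra, from the left. -/
lemma exists_leftRec (n₀ : N) (s : W →ₗ[R] 𝕋 × N →ₗ[R] N) :
    ∃ φ : 𝕋 →ₗ[R] N, φ 1 = n₀ ∧ ∀ a t, φ (ι R a * t) = s a (t, φ t) := by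
  let st : W →ₗ[R] Module.End R (𝕋 × N) :=
    { toFun := fun a => ((mulLeft R (ι R a)).comp (LinearMap.fst R 𝕋 N)).prod (s a)
      map_add' := fun a b => by
        refine LinearMap.ext fun x => Prod.ext ?_ ?_ <;> simp [add_mul]
      map_smul' := fun c a => by
        refine LinearMap.ext fun x => Prod.ext ?_ ?_ <;> simp }
  let ev : 𝕋 →ₗ[R] 𝕋 × N :=
    (LinearMap.applyₗ ((1 : 𝕋), n₀)).comp (TensorAlgebra.lift R st).toLinearMap
  have hev : ∀ a t, ev (ι R a * t) = st a (ev t) := by intro a t; simp [ev]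
  have h1 : ∀ t, (ev t).1 = t := by
    intro t
    have key : ∀ t u : 𝕋, ((TensorAlgebra.lift R st t) (u, (TensorAlgebra.lift R st u ((1 : 𝕋), n₀)).2)).1
        = t * u := by
      intro t
      induction t using TensorAlgebra.induction with
      | algebraMap r => intro u; simp [Algebra.algebraMap_eq_smul_one]
      | ι a => intro u; simp [st]
      | add a b ha hb => intro u; simp [ha, hb, add_mul]
      | mul a b ha hb =>
        intro u; have h2 : ∀ (a : 𝕋) (x y : 𝕋 × N), x.1 = y.1 → ((TensorAlgebra.lift R st a) x).1 =
            ((TensorAlgebra.lift R st a) y).1 := by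
          intro a
          induction a using TensorAlgebra.induction with
          | algebraMap r => intro x y h; simp [Algebra.algebraMap_eq_smul_one, h]
          | ι a => intro x y h; simp [st, h]
          | add a b ha hb => intro x y h; simp [ha x y h, hb x y h]
          | mul a b ha hb => intro x y h; simp [ha _ _ (hb x y h)]
        rw [map_mul, Module.End.mul_apply, mul_assoc, ← ha (b * u)]; exact h2 a _ _ (hb u)
    have := key t 1; simpa [ev] using this
  refine ⟨(LinearMap.snd R 𝕋 N).comp ev, by simp [ev], fun a t => ?_⟩; rw [comp_apply, hev]
  change s a (ev t) = s a (t, (ev t).2); congr 1; exact Prod.ext (h1 t) rfl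

/-- Induction on the tensor algebra, from the left. -/
lemma leftInduction {C : 𝕋 → Prop} (one : C 1) (cons : ∀ a t, C t → C (ι R a * t))
    (add : ∀ s t, C s → C t → C (s + t)) (smul : ∀ (r : R) t, C t → C (r • t)) (t : 𝕋) : C t := by
  have key : ∀ t u : 𝕋, C u → C (t * u) := by
    intro t
    induction t using TensorAlgebra.induction with
    | algebraMap r =>
      intro u hu; rw [Algebra.algebraMap_eq_smul_one, smul_mul_assoc, one_mul]; exact smul _ _ hu
    | ι a => exact fun u hu => cons a u hu
    | add a b ha hb => intro u hu; rw [add_mul]; exact add _ _ (ha u hu) (hb u hu)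
    | mul a b ha hb => intro u hu; rw [mul_assoc]; exact ha _ (hb u hu)
  simpa using key t 1 one

lemma span_wd : Submodule.span R (Set.range (wd : List W → 𝕋)) = ⊤ := by
  refine Submodule.eq_top_iff'.2 fun t => ?_
  induction t using leftInduction with
  | one => exact subset_span ⟨[], rfl⟩
  | cons a t ht =>
    refine Submodule.span_induction (p := fun t _ => ι R a * t ∈ _) ?_ (by simp) ?_ ?_ ht
    · rintro _ ⟨l, rfl⟩; exact subset_span ⟨a :: l, by simp⟩
    · intro x y _ _ hx hy; rw [mul_add]; exact Submodule.add_mem _ hx hy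
    · intro r x _ hx; rw [mul_smul_comm]; exact smul_mem _ _ hx
  | add s t hs ht => exact Submodule.add_mem _ hs ht
  | smul r t ht => exact smul_mem _ _ ht

lemma ext_wd {φ ψ : 𝕋 →ₗ[R] N} (h : ∀ l : List W, φ (wd l) = ψ (wd l)) : φ = ψ :=
  LinearMap.ext_on_range span_wd h

lemma ext_cons {φ ψ : 𝕋 →ₗ[R] N}
    (h1 : φ 1 = ψ 1) (h : ∀ a t, φ t = ψ t → φ (ι R a * t) = ψ (ι R a * t)) : φ = ψ := by
  ext t
  induction t using leftInduction with
  | one => exact h1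
  | cons a t ht => exact h a t ht
  | add s t hs ht => simp [hs, ht]
  | smul r t ht => simp [ht]

/-- Left multiplication by a letter. -/
abbrev lm (a : W) : 𝔼 := mulLeft R (ι R a)

/-- The counit. -/
abbrev eps : 𝕋 →ₗ[R] R := (TensorAlgebra.algebraMapInv : 𝕋 →ₐ[R] R).toLinearMap

lemma eps_one : eps (1 : 𝕋) = 1 := by simp

lemma eps_cons (a : W) (t : 𝕋) : eps (ι R a * t) = 0 := by simp [TensorAlgebra.algebraMapInv]

/-- The deconcatenation coproduct. -/
lemma exists_dec : ∃ φ : 𝕋 →ₗ[R] 𝕋 ⊗[R] 𝕋, φ 1 = 1 ⊗ₜ 1 ∧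
    ∀ a t, φ (ι R a * t) = 1 ⊗ₜ (ι R a * t) + ι R a • φ t := by
  obtain ⟨φ, h1, h2⟩ := exists_leftRec (R := R) (W := W) (N := 𝕋 ⊗[R] 𝕋) (1 ⊗ₜ 1)
    { toFun := fun a =>
        { toFun := fun x => 1 ⊗ₜ (ι R a * x.1) + ι R a • x.2
          map_add' := fun x y => by
            simp only [Prod.fst_add, Prod.snd_add, mul_add, TensorProduct.tmul_add, smul_add]; abel
          map_smul' := fun c x => by
            simp only [Prod.smul_fst, Prod.smul_snd, mul_smul_comm, TensorProduct.tmul_smul,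
              RingHom.id_apply, smul_add, smul_comm c] }
      map_add' := fun a b => by
        refine LinearMap.ext fun x => ?_
        simp only [map_add, add_mul, TensorProduct.tmul_add, add_smul, LinearMap.coe_mk,
          AddHom.coe_mk, add_apply]; abel
      map_smul' := fun c a => by
        refine LinearMap.ext fun x => ?_
        simp only [map_smul, smul_mul_assoc, TensorProduct.tmul_smul, LinearMap.coe_mk,
          AddHom.coe_mk, LinearMap.smul_apply, RingHom.id_apply, smul_add, smul_assoc] }
  exact ⟨φ, h1, h2⟩

/-- The deconcatenation coproduct. -/
def dec : 𝕋 →ₗ[R] 𝕋 ⊗[R] 𝕋 := exists_dec.choose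

lemma dec_one : dec (1 : 𝕋) = 1 ⊗ₜ 1 := exists_dec.choose_spec.1

lemma dec_cons (a : W) (t : 𝕋) : dec (ι R a * t) = 1 ⊗ₜ (ι R a * t) + ι R a • dec t :=
  exists_dec.choose_spec.2 a t

/-- The projection to the letters. -/
lemma exists_pr : ∃ φ : ℭ, φ 1 = 0 ∧ ∀ a t, φ (ι R a * t) = eps t • a := by
  obtain ⟨φ, h1, h2⟩ := exists_leftRec (R := R) (W := W) (N := W) 0
    { toFun := fun a => (LinearMap.toSpanSingleton R W a).comp (eps.comp (LinearMap.fst R 𝕋 W))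
      map_add' := fun a b => by refine LinearMap.ext fun x => ?_; simp
      map_smul' := fun c a => by
        refine LinearMap.ext fun x => ?_
        simp only [comp_apply, LinearMap.toSpanSingleton_apply, LinearMap.smul_apply,
          RingHom.id_apply]; exact smul_comm _ _ _ }
  exact ⟨φ, h1, h2⟩

/-- The projection to the letters. -/
def pr : ℭ := exists_pr.choose

lemma pr_one : pr (1 : 𝕋) = 0 := exists_pr.choose_spec.1

lemma pr_cons (a : W) (t : 𝕋) : pr (ι R a * t) = eps t • a := exists_pr.choose_spec.2 a t

@[simp] theorem pr_ι (a : W) : pr (ι R a) = a := by have := pr_cons (R := R) a 1; simpa using this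

section Conv

variable [Module (TensorAlgebra R W) N] [IsScalarTower R (TensorAlgebra R W) N]

/-- The convolution product `t ↦ ∑ p(t₁) • X(t₂)`. -/
def conv (p : 𝔼) (X : 𝕋 →ₗ[R] N) : 𝕋 →ₗ[R] N :=
  (TensorProduct.lift (LinearMap.mk₂ R (fun s t => p s • X t) (fun a b c => by simp [add_smul])
    (fun r a b => by simp) (fun a b c => by simp) (fun r a b => by
      rw [map_smul, ← algebraMap_smul 𝕋 r (X b), ← algebraMap_smul 𝕋 r (p a • X b), smul_smul,
        smul_smul, Algebra.commutes]))).comp dec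

lemma conv_one (p : 𝔼) (X : 𝕋 →ₗ[R] N) : conv p X 1 = p 1 • X 1 := by simp [conv, dec_one]

lemma conv_cons (p : 𝔼) (X : 𝕋 →ₗ[R] N) (a : W) (t : 𝕋) :
    conv p X (ι R a * t) = p 1 • X (ι R a * t) + conv (p.comp (lm a)) X t := by
  simp only [conv, comp_apply, dec_cons, map_add, TensorProduct.lift.tmul, LinearMap.mk₂_apply]
  congr 1
  induction dec t with
  | zero => simp
  | add x y hx hy => simp [hx, hy]
  | tmul x y => simp [TensorProduct.smul_tmul']

lemma conv_add_left (p q : 𝔼) (X : 𝕋 →ₗ[R] N) :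
    conv (p + q) X = conv p X + conv q X := by
  ext t; simp only [conv, comp_apply, add_apply]
  induction dec t with
  | zero => simp
  | add x y hx hy => simp only [map_add, hx, hy]; abel
  | tmul x y => simp [add_smul]

lemma conv_add_right (p : 𝔼) (X Y : 𝕋 →ₗ[R] N) :
    conv p (X + Y) = conv p X + conv p Y := by
  ext t; simp only [conv, comp_apply, add_apply]
  induction dec t with
  | zero => simp
  | add x y hx hy => simp only [map_add, hx, hy]; abel
  | tmul x y => simp

lemma conv_smul_left (r : 𝕋) (p : 𝔼) (X : 𝕋 →ₗ[R] N) (t : 𝕋) :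
    conv ((mulLeft R r).comp p) X t = r • conv p X t := by
  simp only [conv, comp_apply]
  induction dec t with
  | zero => simp
  | add x y hx hy => simp only [map_add, hx, hy, smul_add]
  | tmul x y => simp [mul_smul]

@[simp] theorem conv_zero_left (X : 𝕋 →ₗ[R] N) : conv 0 X = 0 := by
  ext t; simp only [conv, comp_apply, zero_apply]
  induction dec t with
  | zero => simp
  | add x y hx hy => simp only [map_add, hx, hy, add_zero]
  | tmul x y => simp

@[simp] theorem conv_zero_right (p : 𝔼) : conv p (0 : 𝕋 →ₗ[R] N) = 0 := by
  ext t; simp only [conv, comp_apply, zero_apply]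
  induction dec t with
  | zero => simp
  | add x y hx hy => simp only [map_add, hx, hy, add_zero]
  | tmul x y => simp

lemma conv_neg_left (p : 𝔼) (X : 𝕋 →ₗ[R] N) : conv (-p) X = -conv p X := by
  rw [eq_neg_iff_add_eq_zero, ← conv_add_left]; simp

lemma conv_neg_right (p : 𝔼) (X : 𝕋 →ₗ[R] N) : conv p (-X) = -conv p X := by
  rw [eq_neg_iff_add_eq_zero, ← conv_add_right]; simp

lemma conv_sub_left (p q : 𝔼) (X : 𝕋 →ₗ[R] N) :
    conv (p - q) X = conv p X - conv q X := by
  rw [sub_eq_add_neg, conv_add_left, conv_neg_left, sub_eq_add_neg]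

lemma conv_sub_right (p : 𝔼) (X Y : 𝕋 →ₗ[R] N) :
    conv p (X - Y) = conv p X - conv p Y := by
  rw [sub_eq_add_neg, conv_add_right, conv_neg_right, sub_eq_add_neg]

/-- The unit for convolution. -/
abbrev eta : 𝔼 := (Algebra.linearMap R 𝕋).comp eps

lemma eta_one : (eta : 𝔼) 1 = 1 := by simp

lemma eta_comp_lm (a : W) : (eta : 𝔼).comp (lm a) = 0 := by
  ext t; simp only [comp_apply, mulLeft_apply, eps_cons, map_zero, zero_apply]

lemma conv_eta_left (X : 𝕋 →ₗ[R] N) : conv eta X = X := by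
  refine ext_cons ?_ fun a t _ => ?_
  · rw [conv_one, eta_one, one_smul]
  · rw [conv_cons, eta_one, one_smul, eta_comp_lm, conv_zero_left, zero_apply, add_zero]

lemma conv_assoc (p q : 𝔼) (X : 𝕋 →ₗ[R] N) :
    conv p (conv q X) = conv (conv p q) X := by
  ext t
  induction t using leftInduction generalizing p with
  | one => simp [conv_one, mul_smul]
  | cons a t ht =>
    have e : (conv p q).comp (lm a) = (mulLeft R (p 1)).comp (q.comp (lm a)) +
        conv (p.comp (lm a)) q := by ext t; simp [conv_cons]
    rw [conv_cons, conv_cons, conv_cons, e, conv_add_left, add_apply, conv_smul_left, ht,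
      conv_one, smul_add, smul_eq_mul, mul_smul, add_assoc]
  | add s t hs ht => simp [hs, ht]
  | smul r t ht => simp [ht]

end Conv

lemma conv_map_dec (p A B : 𝔼) :
    conv p ((tpMap A B).comp dec) = (tpMap (conv p A) B).comp dec := by
  ext t
  induction t using leftInduction generalizing p with
  | one => simp [conv_one, dec_one, TensorProduct.smul_tmul']
  | cons a t ht =>
    have e : (conv p A).comp (lm a) = (mulLeft R (p 1)).comp (A.comp (lm a)) +
        conv (p.comp (lm a)) A := by ext t; simp [conv_cons]
    have e2 : ∀ (C : 𝔼) (s : 𝕋 ⊗[R] 𝕋), tpMap C B (ι R a • s) = tpMap (C.comp (lm a)) B s := by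
      intro C s
      induction s with
      | zero => simp
      | add x y hx hy => simp [hx, hy]
      | tmul x y => simp [TensorProduct.smul_tmul']
    have e3 : ∀ (C : 𝔼) (s : 𝕋 ⊗[R] 𝕋), tpMap
        ((mulLeft R (p 1)).comp C) B s = p 1 • tpMap C B s := by
      intro C s
      induction s with
      | zero => simp
      | add x y hx hy => simp [hx, hy]
      | tmul x y => simp [TensorProduct.smul_tmul']
    rw [conv_cons, ht]; simp only [comp_apply, dec_cons, map_add, e2, e, map_add_left,
      add_apply, e3, smul_add, map_tmul, conv_one, TensorProduct.smul_tmul', smul_eq_mul]; abel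
  | add s t hs ht => simp only [map_add, hs, ht]
  | smul r t ht => simp only [map_smul, ht]

/-- Convolution from the left by a cochain with values in letters. -/
abbrev convL [Module 𝕋 N] [IsScalarTower R 𝕋 N]
    (p : ℭ) (X : 𝕋 →ₗ[R] N) : 𝕋 →ₗ[R] N := conv ((ι R).comp p) X

lemma id_eq : (idL : 𝔼) = eta + convL pr idL := by
  refine ext_cons ?_ fun a t _ => ?_
  · simp [conv_one, pr_one]
  · have e : ((ι R).comp pr).comp (lm a) = (mulLeft R (ι R a)).comp eta := by
      ext t; simp only [comp_apply, mulLeft_apply, pr_cons, map_smul,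
        Algebra.linearMap_apply, Algebra.algebraMap_eq_smul_one, mul_one]
    rw [add_apply, conv_cons, e, conv_smul_left, conv_eta_left]
    simp only [comp_apply, pr_one, map_zero, zero_mul, eps_cons, zero_add,
      LinearMap.id_apply, smul_eq_mul]

lemma eq_eta_add_conv_pr (t : 𝕋) : t = algebraMap R 𝕋 (eps t) +
    TensorProduct.lift ((LinearMap.mul R 𝕋).comp ((ι R).comp pr)) (dec t) := by
  have := lcongr (id_eq (R := R) (W := W)) t
  simp only [LinearMap.id_apply, add_apply, comp_apply, Algebra.linearMap_apply] at this
  refine this.trans (congrArg _ ?_); simp only [conv, comp_apply]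
  induction dec t with
  | zero => simp
  | add x y hx hy => simp only [map_add, hx, hy]
  | tmul x y => simp

section Words

variable [Module (TensorAlgebra R W) N] [IsScalarTower R (TensorAlgebra R W) N]

lemma conv_wd_mem (S : AddSubmonoid N) (p : 𝔼) (X : 𝕋 →ₗ[R] N) (l : List W)
    (h : ∀ u v, u ++ v = l → p (wd u) • X (wd v) ∈ S) : conv p X (wd l) ∈ S := by
  induction l generalizing p with
  | nil => rw [wd_nil, conv_one]; exact h [] [] rfl
  | cons a l ih =>
    rw [wd_cons, conv_cons]; refine S.add_mem ?_ (ih _ fun u v huv => ?_)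
    · have := h [] (a :: l) rfl; simpa using this
    · have := h (a :: u) v (by simp [huv]); simpa using this

lemma conv_wd_eq_zero {p : 𝔼} {X : 𝕋 →ₗ[R] N} {l : List W}
    (h : ∀ u v, u ++ v = l → p (wd u) • X (wd v) = 0) : conv p X (wd l) = 0 := conv_wd_mem ⊥ p X l h

lemma conv_wd_congr {p p' : 𝔼} {X X' : 𝕋 →ₗ[R] N} {l : List W}
    (h : ∀ u v, u ++ v = l → p (wd u) • X (wd v) = p' (wd u) • X' (wd v)) :
    conv p X (wd l) = conv p' X' (wd l) := by
  induction l generalizing p p' with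
  | nil => rw [wd_nil, conv_one, conv_one]; exact h [] [] rfl
  | cons a l ih =>
    rw [wd_cons, conv_cons, conv_cons]; refine congrArg₂ _ ?_ (ih fun u v huv => ?_)
    · have := h [] (a :: l) rfl; simpa using this
    · have := h (a :: u) v (by simp [huv]); simpa using this

lemma eq_zero_of_eq_convL {p : ℭ} (hp : p 1 = 0) {X : 𝕋 →ₗ[R] N} (h : X = convL p X) : X = 0 := by
  refine ext_wd fun l => ?_
  induction hk : l.length using Nat.strong_induction_on generalizing l with
  | _ k ih =>
    rw [h]; refine conv_wd_eq_zero fun u v huv => ?_; rcases u with _ | ⟨a, u⟩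
    · simp [hp]
    · have : v.length < k := by rw [← hk, ← huv]; simp
      rw [ih _ this v rfl]; simp

end Words

section Fixpoint

lemma exists_assemble (φ : ℕ → 𝕋 →ₗ[R] N) :
    ∃ ψ : 𝕋 →ₗ[R] N, ∀ l : List W, ψ (wd l) = φ l.length (wd l) := by
  let gr : 𝕋 →ₐ[R] Polynomial 𝕋 := TensorAlgebra.lift R
    ((Polynomial.monomial (R := 𝕋) 1).restrictScalars R ∘ₗ ι R)
  have hgr : ∀ l : List W, gr (wd l) = Polynomial.monomial l.length (wd l) := by
    intro l
    induction l with
    | nil => simp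
    | cons a l ih =>
      rw [wd_cons, map_mul, ih]; simp [gr, Polynomial.monomial_mul_monomial, add_comm]
  refine ⟨(Polynomial.lsum φ).comp gr.toLinearMap, fun l => ?_⟩
  rw [comp_apply, AlgHom.toLinearMap_apply, hgr]
  exact Polynomial.sum_monomial_index _ _ (map_zero _)

/-- A map on cochains which increases the length where two cochains agree has a fixed point. -/
lemma exists_fixpoint (c : List W → Set N) (φ₀ : 𝕋 →ₗ[R] N) (h₀ : ∀ l, φ₀ (wd l) ∈ c l)
    (Φ : (𝕋 →ₗ[R] N) → 𝕋 →ₗ[R] N)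
    (hc : ∀ φ : 𝕋 →ₗ[R] N, (∀ l, φ (wd l) ∈ c l) → ∀ l, Φ φ (wd l) ∈ c l)
    (hΦ : ∀ φ φ' : 𝕋 →ₗ[R] N, (∀ l, φ (wd l) ∈ c l) → (∀ l, φ' (wd l) ∈ c l) → ∀ l : List W,
      (∀ l' : List W, l'.length < l.length → φ (wd l') = φ' (wd l')) → Φ φ (wd l) = Φ φ' (wd l)) :
    ∃ φ, (∀ l, φ (wd l) ∈ c l) ∧ Φ φ = φ := by
  have hs : ∀ k, Φ^[k + 1] φ₀ = Φ (Φ^[k] φ₀) := fun k => Function.iterate_succ_apply' Φ k φ₀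
  have hC : ∀ k l, Φ^[k] φ₀ (wd l) ∈ c l := by
    intro k
    induction k with
    | zero => exact h₀
    | succ k ih => rw [hs]; exact hc _ ih
  obtain ⟨ψ, hψ⟩ := exists_assemble (fun k => Φ^[k + 1] φ₀)
  have hψC : ∀ l, ψ (wd l) ∈ c l := fun l => by rw [hψ]; exact hC _ l
  have h1 : ∀ k (l : List W), l.length < k → Φ^[k + 1] φ₀ (wd l) = Φ^[k] φ₀ (wd l) := by
    intro k
    induction k with
    | zero => intro l hl; omega
    | succ k ih =>
      intro l hl; rw [hs (k + 1)]
      conv_rhs => rw [hs k]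
      exact hΦ _ _ (hC _) (hC _) l fun l' hl' => ih l' (by omega)
  have h2 : ∀ j (l : List W), l.length < j → Φ^[j] φ₀ (wd l) = ψ (wd l) := by
    intro j
    induction j with
    | zero => intro l hl; omega
    | succ j ih =>
      intro l hl; rcases Nat.lt_succ_iff_lt_or_eq.1 hl with h | h
      · rw [h1 j l h, ih l h]
      · rw [hψ, h]
  refine ⟨ψ, hψC, ext_wd fun l => ?_⟩; rw [hψ, hs]
  exact hΦ _ _ hψC (hC _) l fun l' hl' => (h2 l.length l' hl').symm

end Fixpoint

section DecConv

lemma eps_convL (p : ℭ) (X : 𝔼) : eps.comp (convL p X) = 0 := by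
  ext t; simp only [conv, comp_apply, zero_apply]
  induction dec t with
  | zero => simp
  | add x y hx hy => simp only [map_add, hx, hy, add_zero]
  | tmul x y => rw [TensorProduct.lift.tmul, LinearMap.mk₂_apply, smul_eq_mul]; exact eps_cons _ _

lemma dec_convL (p : ℭ) (X : 𝔼) :
    dec.comp (convL p X) = (TensorProduct.mk R 𝕋 𝕋 1).comp (convL p X) + convL p (dec.comp X) := by
  ext t; simp only [conv, comp_apply, add_apply]
  induction dec t with
  | zero => simp
  | add x y hx hy => simp only [map_add, hx, hy]; abel
  | tmul x y =>
    simp only [TensorProduct.lift.tmul, LinearMap.mk₂_apply, smul_eq_mul, dec_cons,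
      TensorProduct.mk_apply]

lemma map_eta_dec (B : 𝔼) : (tpMap eta B).comp dec = (TensorProduct.mk R 𝕋 𝕋 1).comp B := by
  refine ext_cons ?_ fun a t _ => ?_
  · simp [dec_one]
  · have e2 : ∀ s : 𝕋 ⊗[R] 𝕋, tpMap eta B (ι R a • s) = 0 := by
      intro s
      induction s with
      | zero => simp
      | add x y hx hy => simp [hx, hy]
      | tmul x y =>
        rw [TensorProduct.smul_tmul', map_tmul, smul_eq_mul, comp_apply,
          eps_cons, map_zero, TensorProduct.zero_tmul]
    rw [comp_apply, dec_cons, map_add, e2, add_zero, map_tmul, eta_one]; rfl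

lemma pr_convL_of_eps {X : 𝔼} (hX : eps.comp X = eps) (p : ℭ) : pr.comp (convL p X) = p := by
  ext t; have hX' : ∀ t, eps (X t) = eps t := fun t => lcongr hX t
  induction t using leftInduction generalizing p with
  | one => rw [comp_apply, conv_one, smul_eq_mul, comp_apply, pr_cons, hX', eps_one, one_smul]
  | cons a t ht =>
    rw [comp_apply, conv_cons, map_add, smul_eq_mul, comp_apply, pr_cons, hX',
      eps_cons, zero_smul, zero_add]; exact ht (p.comp (lm a))
  | add s t hs ht => simp only [map_add, hs, ht]
  | smul r t ht => simp only [map_smul, ht]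

lemma pr_convL_of_eps_eq_zero {X : 𝔼} (hX : eps.comp X = 0) (p : ℭ) : pr.comp (convL p X) = 0 := by
  ext t; have hX' : ∀ t, eps (X t) = 0 := fun t => lcongr hX t
  induction t using leftInduction generalizing p with
  | one => rw [comp_apply, conv_one, smul_eq_mul, comp_apply, pr_cons, hX', zero_smul, zero_apply]
  | cons a t ht =>
    rw [comp_apply, conv_cons, map_add, smul_eq_mul, comp_apply, pr_cons, hX', zero_smul, zero_add]
    exact ht (p.comp (lm a))
  | add s t hs ht => simp only [map_add, hs, ht]
  | smul r t ht => simp only [map_smul, ht]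

end DecConv

section Coalg

/-- Coalgebra endomorphisms of the tensor coalgebra preserving `1`. -/
structure IsCoalg (P : 𝔼) : Prop where
  map_one : P 1 = 1
  eps_comp : eps.comp P = eps
  dec_comp : dec.comp P = (tpMap P P).comp dec

lemma IsCoalg.eq_conv {P : 𝔼} (h : IsCoalg P) : P = eta + convL (pr.comp P) P := by
  ext t; have h1 : dec (P t) = tpMap P P (dec t) := lcongr h.dec_comp t
  have h2 : eps (P t) = eps t := lcongr h.eps_comp t; rw [eq_eta_add_conv_pr (P t), h1, h2]
  simp only [add_apply, conv, comp_apply, Algebra.linearMap_apply]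
  congr 1
  induction dec t with
  | zero => simp
  | add x y hx hy => simp only [map_add, hx, hy]
  | tmul x y => simp

lemma IsCoalg.pr_comp_one {P : 𝔼} (h : IsCoalg P) : (pr.comp P) 1 = 0 := by
  rw [comp_apply, h.map_one, SphPair.pr_one]

lemma isCoalg_id : IsCoalg (idL : 𝔼) := ⟨rfl, rfl, by simp⟩

lemma IsCoalg.comp {P Q : 𝔼} (hP : IsCoalg P) (hQ : IsCoalg Q) : IsCoalg (P.comp Q) where
  map_one := by simp [hP.map_one, hQ.map_one]
  eps_comp := by rw [← comp_assoc, hP.eps_comp, hQ.eps_comp]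
  dec_comp := by
    rw [← comp_assoc, hP.dec_comp, comp_assoc, hQ.dec_comp, ← comp_assoc, ← TensorProduct.map_comp]

/-- Two coalgebra maps agree on the words of length at most `k` if their letter components do. -/
lemma IsCoalg.eq_on {P Q : 𝔼} (hP : IsCoalg P) (hQ : IsCoalg Q) {k : ℕ}
    (h : ∀ l : List W, l.length ≤ k → pr (P (wd l)) = pr (Q (wd l))) (l : List W)
    (hl : l.length ≤ k) : P (wd l) = Q (wd l) := by
  induction hj : l.length using Nat.strong_induction_on generalizing l with
  | _ j ih =>
    rw [hP.eq_conv, hQ.eq_conv, add_apply, add_apply]; congr 1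
    refine conv_wd_congr fun u v huv => ?_
    have hlen : u.length + v.length = l.length := by rw [← huv, length_append]
    rcases u with _ | ⟨a, u⟩
    · simp [hP.map_one, hQ.map_one, SphPair.pr_one]
    · have : v.length < j := by rw [← hj, ← hlen]; simp
      rw [ih _ this v (by omega) rfl, comp_apply, comp_apply,
        comp_apply, comp_apply, h _ (by omega)]

lemma IsCoalg.ext {P Q : 𝔼} (hP : IsCoalg P) (hQ : IsCoalg Q) (h : pr.comp P = pr.comp Q) : P = Q :=
  ext_wd fun l => hP.eq_on hQ (k := l.length) (fun l' _ => lcongr h (wd l')) l le_rfl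

lemma exists_hat (F : ℭ) (hF : F 1 = 0) : ∃ P : 𝔼, IsCoalg P ∧ pr.comp P = F := by
  obtain ⟨P, -, hP⟩ := exists_fixpoint (fun _ => Set.univ) 0 (fun _ => trivial)
    (fun P : 𝕋 →ₗ[R] 𝕋 => eta + convL F P) (fun _ _ _ => trivial) (by
    intro φ φ' _ _ l h; rw [add_apply, add_apply]; congr 1; refine conv_wd_congr fun u v huv => ?_
    rcases u with _ | ⟨a, u⟩
    · simp [hF]
    · rw [h v (by rw [← huv]; simp)])
  have he : eps.comp P = eps := by rw [← hP, comp_add, eps_convL, add_zero]; ext t; simp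
  have h1 : P 1 = 1 := by rw [← hP]; simp [conv_one, hF]
  have hpr : pr.comp P = F := by
    rw [← hP, comp_add, pr_convL_of_eps he]; ext t; simp [Algebra.algebraMap_eq_smul_one, pr_one]
  refine ⟨P, ⟨h1, he, ?_⟩, hpr⟩; rw [← sub_eq_zero]; apply eq_zero_of_eq_convL hF
  have e1 : dec.comp P = (TensorProduct.mk R 𝕋 𝕋 1).comp P + convL F (dec.comp P) := by
    conv_lhs => rw [← hP, comp_add, dec_convL]
    conv_rhs => rw [← hP, comp_add]
    rw [hP, ← add_assoc]; congr 2; ext t; simp [Algebra.algebraMap_eq_smul_one, dec_one]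
  have e2 : (tpMap P P).comp dec = (TensorProduct.mk R 𝕋 𝕋 1).comp P +
      convL F ((tpMap P P).comp dec) := by
    conv_lhs => rw [← hP]; rw [map_add_left]; rw [hP]
    rw [add_comp, map_eta_dec]; exact congrArg _ (conv_map_dec ((ι R).comp F) P P).symm
  exact (sub_eq_sub_of_eq_add e1 e2).trans (conv_sub_right _ _ _).symm

end Coalg

/-! ## Coderivations and coalgebra maps -/

variable (R W) in
/-- The span of the words of length at most `k`. -/
def Tle (k : ℕ) : Submodule R (𝕋) := Submodule.span R (wd '' {l : List W | l.length ≤ k})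

lemma wd_Tle {k : ℕ} {l : List W} (h : l.length ≤ k) : wd l ∈ Tle R W k := subset_span ⟨l, h, rfl⟩

lemma Tle_mono {j k : ℕ} (h : j ≤ k) : Tle R W j ≤ Tle R W k :=
  Submodule.span_mono (Set.image_mono fun _ hl => le_trans hl h)

lemma one_mem_Tle (k : ℕ) : (1 : 𝕋) ∈ Tle R W k := wd_Tle (l := []) (Nat.zero_le k)

lemma ι_mem_Tle (a : W) : ι R a ∈ Tle R W 1 := by
  have := wd_Tle (R := R) (l := [a]) (k := 1) le_rfl; simpa using this

lemma exists_mem_Tle (t : 𝕋) : ∃ k, t ∈ Tle R W k := by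
  have ht : t ∈ Submodule.span R (Set.range (wd : List W → 𝕋)) := by rw [span_wd]; trivial
  induction ht using Submodule.span_induction with
  | mem x hx => obtain ⟨l, rfl⟩ := hx; exact ⟨l.length, wd_Tle le_rfl⟩
  | zero => exact ⟨0, zero_mem _⟩
  | add x y _ _ hx hy =>
    obtain ⟨j, hj⟩ := hx; obtain ⟨k, hk⟩ := hy
    exact ⟨max j k, Submodule.add_mem _ (Tle_mono (le_max_left _ _) hj)
      (Tle_mono (le_max_right _ _) hk)⟩
  | smul r x _ hx => obtain ⟨k, hk⟩ := hx; exact ⟨k, smul_mem _ _ hk⟩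

lemma mul_mem_Tle {i j k : ℕ} {s t : 𝕋} (hs : s ∈ Tle R W i) (ht : t ∈ Tle R W j)
    (h : i + j ≤ k) : s * t ∈ Tle R W k := by
  have : s * t ∈ Tle R W i * Tle R W j := Submodule.mul_mem_mul hs ht
  rw [Tle, Tle, Submodule.span_mul_span] at this; refine Submodule.span_le.2 ?_ this
  rintro _ ⟨_, ⟨l, hl, rfl⟩, _, ⟨l', hl', rfl⟩, rfl⟩; simp only [Set.mem_ofPred_eq] at hl hl'
  have := wd_Tle (R := R) (l := l ++ l') (k := k) (by rw [length_append]; omega)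
  rwa [wd_append] at this

lemma mem_of_Tle {φ : 𝕋 →ₗ[R] N} {k : ℕ}
    {S : Submodule R N} (h : ∀ l : List W, l.length ≤ k → φ (wd l) ∈ S) {t : 𝕋}
    (ht : t ∈ Tle R W k) : φ t ∈ S := by
  refine (Submodule.span_le (p := S.comap φ)).2 ?_ ht; rintro _ ⟨l, hl, rfl⟩; exact h l hl

lemma eq_of_Tle {φ ψ : 𝕋 →ₗ[R] N} {k : ℕ}
    (h : ∀ l : List W, l.length ≤ k → φ (wd l) = ψ (wd l)) {t : 𝕋}
    (ht : t ∈ Tle R W k) : φ t = ψ t := by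
  have := mem_of_Tle (φ := φ - ψ) (S := ⊥) (fun l hl => by simp [h l hl]) ht
  simpa [sub_eq_zero] using this

lemma IsCoalg.mem_Tle {P : 𝔼} (hP : IsCoalg P) {k : ℕ} {t : 𝕋} (ht : t ∈ Tle R W k) :
    P t ∈ Tle R W k := by
  refine mem_of_Tle (S := Tle R W k) (fun l hl => ?_) ht; refine Tle_mono hl ?_; clear hl ht
  induction hj : l.length using Nat.strong_induction_on generalizing l with
  | _ j ih =>
    rw [hP.eq_conv, add_apply]; refine Submodule.add_mem _ ?_ ?_
    · simp only [comp_apply, Algebra.linearMap_apply, Algebra.algebraMap_eq_smul_one]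
      exact smul_mem _ _ (one_mem_Tle _)
    · refine conv_wd_mem (Tle R W j).toAddSubmonoid _ _ _ fun u v huv => ?_
      have hlen : u.length + v.length = j := by rw [← hj, ← huv, length_append]
      rcases u with _ | ⟨a, u⟩
      · simp [hP.map_one, pr_one]
      · simp only [length_cons] at hlen
        exact mul_mem_Tle (ι_mem_Tle _) (ih v.length (by omega) v rfl) (by omega)

/-- The coderivation along `P` and `Q` with letter component `H`. -/
def coder (P : 𝔼) (H : ℭ) (Q : 𝔼) : 𝔼 := conv P (convL H Q)

lemma coder_add (P : 𝔼) (H H' : ℭ) (Q : 𝔼) : coder P (H + H') Q = coder P H Q + coder P H' Q := by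
  simp only [coder, convL, comp_add, conv_add_left, conv_add_right]

lemma coder_wd_mem (S : AddSubmonoid 𝕋) {P : 𝔼} {H : ℭ} {Q : 𝔼}
    {l : List W} (h : ∀ u v x, u ++ (v ++ x) = l → P (wd u) * (ι R (H (wd v)) * Q (wd x)) ∈ S) :
    coder P H Q (wd l) ∈ S := by
  refine conv_wd_mem S _ _ _ fun u y huy => ?_
  refine conv_wd_mem (S.comap (mulLeft R (P (wd u))).toAddMonoidHom) _ _ _ fun v x hvx => ?_
  exact h u v x (by rw [hvx, huy])

lemma coder_wd_congr {P P' : 𝔼} {H H' : ℭ} {Q Q' : 𝔼}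
    {l : List W} (h : ∀ u v x, u ++ (v ++ x) = l → P (wd u) * (ι R (H (wd v)) * Q (wd x)) =
      P' (wd u) * (ι R (H' (wd v)) * Q' (wd x))) : coder P H Q (wd l) = coder P' H' Q' (wd l) := by
  refine conv_wd_congr fun u y huy => ?_
  have e : ∀ (P : 𝔼) (H : ℭ) (Q : 𝔼), P (wd u) • convL H Q (wd y) =
      conv ((mulLeft R (P (wd u))).comp ((ι R).comp H)) Q (wd y) := by
    intro P H Q; rw [conv_smul_left]
  rw [e, e]; refine conv_wd_congr fun v x hvx => ?_; have := h u v x (by rw [hvx, huy])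
  simpa only [comp_apply, mulLeft_apply, smul_eq_mul, mul_assoc] using this

lemma coder_mem_Tle {P Q : 𝔼} (hP : IsCoalg P) (hQ : IsCoalg Q) {H : ℭ} {s : ℕ}
    (hH : ∀ l : List W, l.length ≤ s → H (wd l) = 0) {j k : ℕ} (hjk : j ≤ k + s) {t : 𝕋}
    (ht : t ∈ Tle R W j) : coder P H Q t ∈ Tle R W k := by
  refine mem_of_Tle (S := Tle R W k) (fun l hl => ?_) ht
  refine coder_wd_mem (Tle R W k).toAddSubmonoid fun u v x huvx => ?_
  have hlen : u.length + (v.length + x.length) = l.length := by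
    rw [← huvx, length_append, length_append]
  by_cases hv : v.length ≤ s
  · simp [hH v hv]
  · exact mul_mem_Tle (hP.mem_Tle (wd_Tle le_rfl))
      (mul_mem_Tle (ι_mem_Tle _) (hQ.mem_Tle (wd_Tle le_rfl)) le_rfl) (by omega)

section

variable {P Q : TensorAlgebra R W →ₗ[R] TensorAlgebra R W} (hP : IsCoalg P) (hQ : IsCoalg Q)
  (H : TensorAlgebra R W →ₗ[R] W)
include hP

lemma IsCoalg.coder_eq : coder P H Q = convL H Q + convL (pr.comp P) (coder P H Q) := by
  conv_lhs => rw [coder, hP.eq_conv, conv_add_left, conv_eta_left]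
  congr 1; exact (conv_assoc _ _ _).symm

lemma IsCoalg.eps_coder : eps.comp (coder P H Q) = 0 := by
  rw [hP.coder_eq, comp_add, eps_convL, eps_convL, add_zero]

include hQ

lemma IsCoalg.pr_coder : pr.comp (coder P H Q) = H := by
  rw [hP.coder_eq, comp_add, pr_convL_of_eps hQ.eps_comp,
    pr_convL_of_eps_eq_zero (hP.eps_coder H), add_zero]

lemma IsCoalg.dec_coder : dec.comp (coder P H Q) =
    (tpMap P (coder P H Q) + tpMap (coder P H Q) Q).comp dec := by
  set K := coder P H Q with hK; have hKe := hP.coder_eq (Q := Q) H; rw [← hK] at hKe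
  rw [← sub_eq_zero]; apply eq_zero_of_eq_convL hP.pr_comp_one
  have e1 : dec.comp K = (TensorProduct.mk R 𝕋 𝕋 1).comp K +
      (tpMap (convL H Q) Q).comp dec + convL (pr.comp P) (dec.comp K) := by
    conv_lhs => rw [hKe, comp_add, dec_convL, dec_convL, hQ.dec_comp]
    have h1 : convL H ((tpMap Q Q).comp dec) = (tpMap (convL H Q) Q).comp dec := conv_map_dec _ _ _
    rw [h1]
    conv_rhs => rw [hKe, comp_add, ← hKe]
    abel
  have e2 : (tpMap P K + tpMap K Q).comp dec =
      (TensorProduct.mk R 𝕋 𝕋 1).comp K + (tpMap (convL H Q) Q).comp dec +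
      convL (pr.comp P) ((tpMap P K + tpMap K Q).comp dec) := by
    have h1 : (tpMap P K).comp dec = (TensorProduct.mk R 𝕋 𝕋 1).comp K +
        convL (pr.comp P) ((tpMap P K).comp dec) := by
      conv_lhs => rw [hP.eq_conv, map_add_left, add_comp, map_eta_dec]
      exact congrArg _ (conv_map_dec _ _ _).symm
    have h2 : (tpMap K Q).comp dec = (tpMap (convL H Q) Q).comp dec +
        convL (pr.comp P) ((tpMap K Q).comp dec) := by
      conv_lhs => rw [hKe, map_add_left, add_comp]
      exact congrArg _ (conv_map_dec _ _ _).symm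
    have h3 : convL (pr.comp P) ((tpMap P K + tpMap K Q).comp dec) =
        convL (pr.comp P) ((tpMap P K).comp dec) + convL (pr.comp P) ((tpMap K Q).comp dec) := by
      rw [add_comp]; exact conv_add_right _ _ _
    rw [h3]
    conv_lhs => rw [add_comp, h1, h2]
    abel
  exact (sub_eq_sub_of_eq_add e1 e2).trans (conv_sub_right _ _ _).symm

end

/-- Coderivations along `P` and `Q`. -/
structure IsCoder (P Q X : 𝔼) : Prop where
  eps_comp : eps.comp X = 0
  dec_comp : dec.comp X = (tpMap P X + tpMap X Q).comp dec

lemma IsCoalg.isCoder {P Q : 𝔼} (hP : IsCoalg P) (hQ : IsCoalg Q) (H : ℭ) :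
    IsCoder P Q (coder P H Q) := ⟨hP.eps_coder H, hP.dec_coder hQ H⟩

lemma eq_conv_of_dec {X P' X' : 𝔼} {Y : 𝕋 →ₗ[R] 𝕋 ⊗[R] 𝕋} (he : eps.comp X = 0) {t : 𝕋}
    (hd : dec (X t) = tpMap P' X' (dec t) + Y t) : X t = convL (pr.comp P') X' t +
      TensorProduct.lift ((LinearMap.mul R 𝕋).comp ((ι R).comp pr)) (Y t) := by
  have h2 : eps (X t) = 0 := lcongr he t
  rw [eq_eta_add_conv_pr (X t), hd, h2, map_zero, zero_add, map_add]; congr 1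
  simp only [conv, comp_apply]
  induction dec t with
  | zero => simp
  | add x y hx hy => simp only [map_add, hx, hy]
  | tmul x y => simp

lemma lift_map_dec (A B : 𝔼) (t : 𝕋) :
    TensorProduct.lift ((LinearMap.mul R 𝕋).comp ((ι R).comp pr)) (tpMap A B (dec t)) =
      convL (pr.comp A) B t := by
  simp only [conv, comp_apply]
  induction dec t with
  | zero => simp
  | add x y hx hy => simp only [map_add, hx, hy]
  | tmul x y => simp

lemma IsCoder.eq_conv {P Q X : 𝔼} (h : IsCoder P Q X) :
    X = convL (pr.comp P) X + convL (pr.comp X) Q := by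
  ext t; rw [eq_conv_of_dec (P' := P) (X' := X) (Y := (tpMap X Q).comp dec) h.eps_comp
    (lcongr h.dec_comp t), add_apply]; congr 1; exact lift_map_dec _ _ _

lemma IsCoder.eq_zero {P Q X : 𝔼} (h : IsCoder P Q X) (hP : IsCoalg P) {k : ℕ}
    (hX : ∀ l : List W, l.length ≤ k → pr (X (wd l)) = 0) {t : 𝕋} (ht : t ∈ Tle R W k) :
    X t = 0 := by
  refine eq_of_Tle (φ := X) (ψ := 0) (fun l hl => ?_) ht
  induction hj : l.length using Nat.strong_induction_on generalizing l with
  | _ j ih =>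
    rw [h.eq_conv, add_apply, zero_apply]
    have hlen : ∀ u v : List W, u ++ v = l → u.length + v.length = j := fun u v huv => by
      rw [← hj, ← huv, length_append]
    rw [conv_wd_eq_zero, conv_wd_eq_zero, add_zero]
    · intro u v huv; have := hlen u v huv
      rw [comp_apply, comp_apply, hX u (by omega), map_zero, zero_smul]
    · intro u v huv; have := hlen u v huv; rcases u with _ | ⟨a, u⟩
      · simp [hP.map_one, pr_one]
      · simp only [length_cons] at this; rw [ih v.length (by omega) v (by omega) rfl]; simp

lemma IsCoder.sub {P Q X Y : 𝔼} (hX : IsCoder P Q X) (hY : IsCoder P Q Y) :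
    IsCoder P Q (X - Y) where
  eps_comp := by rw [comp_sub, hX.eps_comp, hY.eps_comp, sub_zero]
  dec_comp := by
    rw [comp_sub, hX.dec_comp, hY.dec_comp, ← sub_comp]; congr 1
    refine TensorProduct.ext' fun x y => ?_
    simp only [sub_apply, add_apply, map_tmul, tmul_sub, sub_tmul]; abel

lemma IsCoder.eq_coder {P Q X : 𝔼} (h : IsCoder P Q X) (hP : IsCoalg P)
    (hQ : IsCoalg Q) : X = coder P (pr.comp X) Q := by
  rw [← sub_eq_zero]; refine LinearMap.ext fun t => ?_; obtain ⟨k, hk⟩ := exists_mem_Tle t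
  refine (h.sub (hP.isCoder hQ _)).eq_zero hP (fun l _ => ?_) hk
  rw [sub_apply, map_sub, sub_eq_zero]; exact (lcongr (hP.pr_coder hQ (pr.comp X)) (wd l)).symm

lemma IsCoalg.sub {P Q : 𝔼} (hP : IsCoalg P) (hQ : IsCoalg Q) : IsCoder P Q (P - Q) where
  eps_comp := by rw [comp_sub, hP.eps_comp, hQ.eps_comp, sub_self]
  dec_comp := by
    rw [comp_sub, hP.dec_comp, hQ.dec_comp, ← sub_comp]; congr 1
    refine TensorProduct.ext' fun x y => ?_
    simp only [sub_apply, add_apply, map_tmul, tmul_sub, sub_tmul]; abel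

open Classical in
/-- The coalgebra map with letter component `F`. -/
def hat (F : ℭ) : 𝔼 := if h : F 1 = 0 then (exists_hat F h).choose else 0

lemma isCoalg_hat {F : ℭ} (hF : F 1 = 0) : IsCoalg (hat F) := by
  rw [hat, dif_pos hF]; exact (exists_hat F hF).choose_spec.1

lemma pr_comp_hat {F : ℭ} (hF : F 1 = 0) : pr.comp (hat F) = F := by
  rw [hat, dif_pos hF]; exact (exists_hat F hF).choose_spec.2

lemma pr_hat {F : ℭ} (hF : F 1 = 0) (t : 𝕋) : pr (hat F t) = F t := lcongr (pr_comp_hat hF) t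

lemma hat_pr : hat (pr : ℭ) = idL :=
  (isCoalg_hat pr_one).ext isCoalg_id (by rw [pr_comp_hat pr_one, comp_id])

lemma IsCoalg.eq_hat {P : 𝔼} (hP : IsCoalg P) : P = hat (pr.comp P) :=
  hP.ext (isCoalg_hat hP.pr_comp_one) (pr_comp_hat hP.pr_comp_one).symm

lemma hat_wd_congr {F F' : ℭ} (hF : F 1 = 0) (hF' : F' 1 = 0) {k : ℕ}
    (h : ∀ l : List W, l.length ≤ k → F (wd l) = F' (wd l)) {l : List W} (hl : l.length ≤ k) :
    hat F (wd l) = hat F' (wd l) := (isCoalg_hat hF).eq_on (isCoalg_hat hF')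
    (fun l hl => by rw [pr_hat hF, pr_hat hF', h l hl]) l hl

lemma IsCoalg.map_ι {P : 𝔼} (hP : IsCoalg P) (a : W) : P (ι R a) = ι R (pr (P (ι R a))) := by
  have h : P (ι R a * 1) = ι R (pr (P (ι R a * 1))) := by
    conv_lhs => rw [hP.eq_conv, add_apply, conv_cons, conv_one]
    rw [comp_apply, eps_cons, map_zero, zero_add, comp_apply, hP.pr_comp_one,
      map_zero, zero_smul, zero_add, hP.map_one, smul_eq_mul, mul_one]; rfl
  rwa [mul_one] at h

lemma hat_sub_id_mem {P : 𝔼} (hP : IsCoalg P) (h1 : ∀ a, pr (P (ι R a)) = a) {k : ℕ}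
    {t : 𝕋} (ht : t ∈ Tle R W (k + 1)) : P t - t ∈ Tle R W k := by
  have h := (hP.sub isCoalg_id).eq_coder hP isCoalg_id
  have : P t - t = coder P (pr.comp (P - idL)) idL t := by rw [← h]; rfl
  rw [this]; refine coder_mem_Tle hP isCoalg_id (s := 1) (fun l hl => ?_) le_rfl ht
  rcases l with _ | ⟨a, _ | ⟨b, l⟩⟩
  · simp [hP.map_one]
  · simp [h1]
  · simp at hl

/-- Coalgebra maps which are the identity on letters are invertible. -/
lemma IsCoalg.exists_inv {P : 𝔼} (hP : IsCoalg P) (h1 : ∀ a, pr (P (ι R a)) = a)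
    (c : List W → Set W) (hc : ∀ l, pr (wd (R := R) l) ∈ c l)
    (hc' : ∀ φ : ℭ, (∀ l, φ (wd l) ∈ c l) → ∀ l, (pr - φ.comp (P - idL) : ℭ) (wd l) ∈ c l) :
    ∃ Q : 𝔼, IsCoalg Q ∧ (∀ a, pr (Q (ι R a)) = a) ∧ Q.comp P = idL ∧
      P.comp Q = idL ∧ ∀ l, pr (Q (wd l)) ∈ c l := by
  have left : ∀ P : 𝔼, IsCoalg P → (∀ a, pr (P (ι R a)) = a) → ∀ c : List W → Set W,
      (∀ l, pr (wd (R := R) l) ∈ c l) → (∀ φ : ℭ, (∀ l, φ (wd l) ∈ c l) →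
        ∀ l, (pr - φ.comp (P - idL) : ℭ) (wd l) ∈ c l) →
      ∃ Q : 𝔼, IsCoalg Q ∧ (∀ a, pr (Q (ι R a)) = a) ∧ Q.comp P = idL ∧
        ∀ l, pr (Q (wd l)) ∈ c l := by
    intro P hP h1 c hc hc'
    obtain ⟨G, hGc, hG⟩ := exists_fixpoint c pr hc (fun φ => pr - φ.comp (P - idL)) hc' (by
      intro φ φ' _ _ l h; simp only [sub_apply, comp_apply, LinearMap.id_apply]; congr 1
      rcases hl : l.length with _ | k
      · rw [length_eq_zero_iff.1 hl]; simp [hP.map_one]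
      · refine eq_of_Tle (k := k) (fun l' hl' => h l' (by omega))
          (hat_sub_id_mem hP h1 (wd_Tle hl.le)))
    have hGP : G.comp P = pr := by
      have : G = pr - (G.comp P - G) := by
        conv_lhs => rw [← hG]
        rw [comp_sub, comp_id]
      have h2 := sub_eq_iff_eq_add.1 this.symm; have h3 : G + (G.comp P - G) = G.comp P := by abel
      rw [← h3]; exact h2.symm
    have hG1 : G 1 = 0 := by have := lcongr hGP 1; simpa [hP.map_one, pr_one] using this
    refine ⟨hat G, isCoalg_hat hG1, fun a => ?_, ?_, fun l => ?_⟩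
    · have := lcongr hGP (ι R a); rw [comp_apply, hP.map_ι, h1, pr_ι] at this; rw [pr_hat hG1, this]
    · refine ((isCoalg_hat hG1).comp hP).ext isCoalg_id ?_
      rw [← comp_assoc, pr_comp_hat hG1, hGP, comp_id]
    · rw [pr_hat hG1]; exact hGc l
  obtain ⟨Q, hQ, hQ1, hQP, hQc⟩ := left P hP h1 c hc hc'
  obtain ⟨Q', hQ', -, hQQ, -⟩ := left Q hQ hQ1 (fun _ => Set.univ) (fun _ => trivial)
    (fun _ _ _ => trivial); refine ⟨Q, hQ, hQ1, hQP, ?_, hQc⟩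
  have : Q' = P := by rw [← comp_id Q', ← hQP, ← comp_assoc, hQQ, id_comp]
  rw [← this, hQQ]

/-! ## Signs, units and homotopies in the tensor coalgebra -/

lemma conv_mul [Module 𝕋 N] [IsScalarTower R 𝕋 N] (p : 𝔼) (X : 𝕋 →ₗ[R] N) (s t : 𝕋) :
    conv p X (s * t) = conv p (X.comp (mulRight R t)) s +
      conv (p.comp (mulLeft R s)) X t - p s • X t := by
  induction s using leftInduction generalizing p with
  | one =>
    have : p.comp (mulLeft R 1) = p := by ext; simp
    rw [conv_one, this]; simp
  | cons a s ih =>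
    have : p.comp (mulLeft R (ι R a * s)) = (p.comp (lm a)).comp (mulLeft R s) := by ext; simp
    rw [mul_assoc, conv_cons, ih, conv_cons, this]
    simp only [comp_apply, mulRight_apply, mulLeft_apply, mul_assoc]; abel
  | add s s' h h' =>
    have : p.comp (mulLeft R (s + s')) =
        p.comp (mulLeft R s) + p.comp (mulLeft R s') := by ext; simp [add_mul]
    simp only [add_mul, map_add, h, h', this, conv_add_left, add_apply, add_smul]; abel
  | smul r s h =>
    have : p.comp (mulLeft R (r • s)) =
        (mulLeft R (algebraMap R 𝕋 r)).comp (p.comp (mulLeft R s)) := by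
      ext x; simp only [comp_apply, mulLeft_apply, smul_mul_assoc, map_smul, ← Algebra.smul_def]
    rw [smul_mul_assoc, map_smul, map_smul, map_smul, h, this, conv_smul_left, algebraMap_smul,
      smul_assoc, smul_sub, smul_add]

lemma conv_unit [Module 𝕋 N] [IsScalarTower R 𝕋 N] (p : 𝔼) (X : 𝕋 →ₗ[R] N) (e : W) (s t : 𝕋) :
    conv p X (s * (ι R e * t)) = conv p (X.comp (mulRight R (ι R e * t))) s +
      conv (p.comp (mulLeft R (s * ι R e))) X t := by
  have : p.comp (mulLeft R (s * ι R e)) = (p.comp (mulLeft R s)).comp (lm e) := by ext; simp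
  rw [conv_mul, conv_cons, this]; simp only [comp_apply, mulLeft_apply, mul_one]; abel

lemma conv_mulRight (p X : 𝔼) (y t : 𝕋) :
    conv p ((mulRight R y).comp X) t = conv p X t * y := by
  simp only [conv, comp_apply]
  induction dec t with
  | zero => simp
  | add a b ha hb => simp only [map_add, ha, hb, add_mul]
  | tmul a b => simp [mul_assoc]

/-- The algebra endomorphism induced by `τ`. -/
def th (τ : W →ₗ[R] W) : 𝔼 := (TensorAlgebra.lift R ((ι R).comp τ)).toLinearMap

lemma th_one (τ : W →ₗ[R] W) : th τ (1 : 𝕋) = 1 := map_one (TensorAlgebra.lift R _)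

lemma th_mul (τ : W →ₗ[R] W) (s t : 𝕋) : th τ (s * t) = th τ s * th τ t :=
  map_mul (TensorAlgebra.lift R _) s t

lemma th_ι (τ : W →ₗ[R] W) (a : W) : th τ (ι R a) = ι R (τ a) := by simp [th]

lemma th_wd (τ : W →ₗ[R] W) (l : List W) : th τ (wd l) = wd (l.map τ) := by
  induction l with
  | nil => exact th_one τ
  | cons a l ih => simp [th_mul, th_ι, ih]

lemma isCoalg_th (τ : W →ₗ[R] W) : IsCoalg (th τ) where
  map_one := th_one τ
  eps_comp := ext_cons (by simp [th_one]) fun a t _ => by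
    rw [comp_apply, th_mul, th_ι, eps_cons, eps_cons]
  dec_comp := ext_cons (by simp [th_one, dec_one]) fun a t h => by
    have e : ∀ s : 𝕋 ⊗[R] 𝕋, tpMap (th τ) (th τ) (ι R a • s) =
        ι R (τ a) • tpMap (th τ) (th τ) s := by
      intro s
      induction s with
      | zero => simp
      | add x y hx hy => simp [hx, hy]
      | tmul x y => simp [TensorProduct.smul_tmul', th_mul, th_ι]
    simp only [comp_apply] at h
    simp only [comp_apply, th_mul, th_ι, dec_cons, map_add, h, e, map_tmul, th_one]

lemma pr_th (τ : W →ₗ[R] W) (t : 𝕋) : pr (th τ t) = τ (pr t) := by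
  have h : pr.comp (th τ) = τ.comp pr := ext_cons (by simp [th_one, pr_one]) fun a t _ => by
      have := lcongr (isCoalg_th (R := R) τ).eps_comp t; rw [comp_apply] at this
      rw [comp_apply, th_mul, th_ι, pr_cons, this, comp_apply, pr_cons, map_smul]
  exact lcongr h t

lemma th_th {τ : W →ₗ[R] W} (hτ : ∀ a, τ (τ a) = a) (t : 𝕋) : th τ (th τ t) = t := by
  have h : (th τ).comp (th τ) = idL := ext_cons (by simp [th_one]) fun a t h => by
      simp only [comp_apply, LinearMap.id_apply] at h
      simp only [comp_apply, LinearMap.id_apply, th_mul, th_ι, hτ, h]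
  exact lcongr h t

section DecComp

variable {X Y A B C D P : TensorAlgebra R W →ₗ[R] TensorAlgebra R W}

lemma dec_coder_comp_coder (hY : dec.comp Y = (tpMap A Y + tpMap Y B).comp dec)
    (hX : dec.comp X = (tpMap C X + tpMap X D).comp dec) :
    dec.comp (Y.comp X) = (tpMap (A.comp C) (Y.comp X) +
      tpMap (A.comp X) (Y.comp D) + tpMap (Y.comp C) (B.comp X) +
      tpMap (Y.comp X) (B.comp D)).comp dec := by
  rw [← comp_assoc, hY, comp_assoc, hX, ← comp_assoc]; congr 1
  simp only [add_comp, comp_add, ← TensorProduct.map_comp]; abel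

lemma dec_coalg_comp_coder (hP : IsCoalg P) (hX : dec.comp X = (tpMap C X + tpMap X D).comp dec) :
    dec.comp (P.comp X) = (tpMap (P.comp C) (P.comp X) + tpMap (P.comp X) (P.comp D)).comp dec := by
  rw [← comp_assoc, hP.dec_comp, comp_assoc, hX, ← comp_assoc]; congr 1
  simp only [comp_add, ← TensorProduct.map_comp]

lemma dec_coder_comp_coalg (hP : IsCoalg P) (hX : dec.comp X = (tpMap C X + tpMap X D).comp dec) :
    dec.comp (X.comp P) = (tpMap (C.comp P) (X.comp P) + tpMap (X.comp P) (D.comp P)).comp dec := by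
  rw [← comp_assoc, hX, comp_assoc, hP.dec_comp, ← comp_assoc]; congr 1
  simp only [add_comp, ← TensorProduct.map_comp]

lemma IsCoder.comp_coalg (hX : IsCoder C D X) (hP : IsCoalg P) :
    IsCoder (C.comp P) (D.comp P) (X.comp P) where
  eps_comp := by rw [← comp_assoc, hX.eps_comp, zero_comp]
  dec_comp := dec_coder_comp_coalg hP hX.dec_comp

lemma IsCoalg.comp_coder (hP : IsCoalg P) (hX : IsCoder C D X) :
    IsCoder (P.comp C) (P.comp D) (P.comp X) where
  eps_comp := by rw [← comp_assoc, hP.eps_comp, hX.eps_comp]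
  dec_comp := dec_coalg_comp_coder hP hX.dec_comp

lemma IsCoder.add (hX : IsCoder A B X) (hY : IsCoder A B Y) : IsCoder A B (X + Y) where
  eps_comp := by rw [comp_add, hX.eps_comp, hY.eps_comp, add_zero]
  dec_comp := by
    rw [comp_add, hX.dec_comp, hY.dec_comp, ← add_comp, map_add_left, TensorProduct.map_add_right]
    congr 1; abel

lemma IsCoder.eq_zero' (h : IsCoder A B X) (hA : IsCoalg A) (hX : pr.comp X = 0) : X = 0 := by
  refine LinearMap.ext fun t => ?_; obtain ⟨k, hk⟩ := exists_mem_Tle t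
  exact h.eq_zero hA (fun l _ => lcongr hX (wd l)) hk

end DecComp

variable {τ : W →ₗ[R] W}

/-- The coderivation of the bar construction with letter component `B`. -/
def bh (τ : W →ₗ[R] W) (B : ℭ) : 𝔼 := coder (th τ) B idL

lemma isCoder_bh (τ : W →ₗ[R] W) (B : ℭ) : IsCoder (th τ) idL (bh τ B) :=
  (isCoalg_th τ).isCoder isCoalg_id B

lemma pr_bh (B : ℭ) (t : 𝕋) : pr (bh τ B t) = B t := lcongr ((isCoalg_th τ).pr_coder isCoalg_id B) t

lemma eps_bh (B : ℭ) (t : 𝕋) : eps (bh τ B t) = 0 := lcongr (isCoder_bh τ B).eps_comp t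

lemma coder_one {P Q : 𝔼} (hP : P 1 = 1) (hQ : Q 1 = 1) (H : ℭ) : coder P H Q 1 = ι R (H 1) := by
  rw [coder, conv_one, conv_one, hP, hQ, one_smul]; simp

lemma bh_cons (B : ℭ) (a : W) (t : 𝕋) :
    bh τ B (ι R a * t) = convL B idL (ι R a * t) + ι R (τ a) * bh τ B t := by
  rw [bh, coder, conv_cons, th_one, one_smul]; congr 1
  have : (th τ).comp (lm a) = (mulLeft R (ι R (τ a))).comp (th τ) := by ext t; simp [th_mul, th_ι]
  rw [this, conv_smul_left, smul_eq_mul]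

/-- Cochains anticommuting with the sign. -/
def IsOdd (τ : W →ₗ[R] W) (B : ℭ) : Prop := ∀ t, τ (B t) = -B (th τ t)

/-- Cochains commuting with the sign. -/
def IsEven (τ : W →ₗ[R] W) (F : ℭ) : Prop := ∀ t, τ (F t) = F (th τ t)

lemma IsEven.hat {F : ℭ} (hF : IsEven τ F) (h1 : F 1 = 0) (t : 𝕋) :
    th τ (hat F t) = hat F (th τ t) := by
  have : (th τ).comp (SphPair.hat F) = (SphPair.hat F).comp (th τ) :=
    ((isCoalg_th τ).comp (isCoalg_hat h1)).ext ((isCoalg_hat h1).comp (isCoalg_th τ)) (by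
      ext t; simp only [comp_apply, pr_th, pr_hat h1]; exact hF t)
  exact lcongr this t

section Odd

variable (hτ : ∀ a, τ (τ a) = a)
include hτ

lemma th_comp_th : (th τ).comp (th τ) = (idL : 𝔼) := LinearMap.ext fun t => th_th hτ t

lemma IsOdd.coder {H F F' : ℭ} (hH : IsOdd τ H) (hF : IsEven τ F) (hF' : IsEven τ F')
    (h1 : F 1 = 0) (h1' : F' 1 = 0) (t : 𝕋) : th τ (coder ((th τ).comp (hat F')) H (hat F) t) =
      -SphPair.coder ((th τ).comp (hat F')) H (hat F) (th τ t) := by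
  have c1 := (isCoalg_th τ).comp (isCoalg_hat h1'); have hK := c1.isCoder (isCoalg_hat h1) H
  set K := SphPair.coder ((th τ).comp (SphPair.hat F')) H (SphPair.hat F) with hKdef
  have e1 : (th τ).comp ((th τ).comp (SphPair.hat F')) = SphPair.hat F' := by
    rw [← comp_assoc, th_comp_th hτ, id_comp]
  have e2 : ((th τ).comp (SphPair.hat F')).comp (th τ) = SphPair.hat F' := by
    rw [comp_assoc]
    conv_rhs => rw [← e1]
    congr 1; ext t; simp only [comp_apply]; exact (hF'.hat h1' t).symm
  have e3 : (SphPair.hat F).comp (th τ) = (th τ).comp (SphPair.hat F) :=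
    LinearMap.ext fun t => (hF.hat h1 t).symm; have h := (isCoalg_th τ).comp_coder hK
  have h' := hK.comp_coalg (isCoalg_th τ); rw [e1] at h; rw [e2, e3] at h'
  have h0 := (h.add h').eq_zero' (isCoalg_hat h1') (by
    ext t; have hp := lcongr (c1.pr_coder (isCoalg_hat h1) H); simp only [comp_apply] at hp
    simp only [comp_apply, add_apply, map_add, pr_th, zero_apply]
    rw [hKdef, hp, hp, hH, neg_add_cancel])
  exact eq_neg_of_add_eq_zero_left (lcongr h0 t)

lemma IsOdd.bh {B : ℭ} (hB : IsOdd τ B) (t : 𝕋) : th τ (bh τ B t) = -SphPair.bh τ B (th τ t) := by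
  have he : IsEven τ (pr : ℭ) := fun t => (pr_th τ t).symm
  have := IsOdd.coder hτ hB he he pr_one pr_one t; rwa [hat_pr, comp_id] at this

omit hτ in
lemma hat_comp_bh {F B B' : ℭ} (hF : IsEven τ F) (h1 : F 1 = 0) {k : ℕ}
    (h : ∀ t ∈ Tle R W k, F (bh τ B t) = B' (hat F t)) {t : 𝕋} (ht : t ∈ Tle R W k) :
    hat F (bh τ B t) = bh τ B' (hat F t) := by
  have a := (isCoalg_hat h1).comp_coder (isCoder_bh τ B)
  have b := (isCoder_bh τ B').comp_coalg (isCoalg_hat h1)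
  have e : (th τ).comp (hat F) = (hat F).comp (th τ) := LinearMap.ext fun t => hF.hat h1 t
  rw [e] at b
  have := (a.sub b).eq_zero ((isCoalg_hat h1).comp (isCoalg_th τ)) (k := k) (fun l hl => by
    simp only [sub_apply, comp_apply, map_sub, pr_hat h1, pr_bh]; rw [h _ (wd_Tle hl), sub_self]) ht
  exact sub_eq_zero.1 this

lemma bh_bh {B : ℭ} (hB : IsOdd τ B) {k : ℕ} (h : ∀ t ∈ Tle R W k, B (bh τ B t) = 0)
    {t : 𝕋} (ht : t ∈ Tle R W k) : bh τ B (bh τ B t) = 0 := by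
  set b := bh τ B with hb; have hc : IsCoder (idL : 𝔼) idL (b.comp b) := by
    refine ⟨?_, ?_⟩
    · rw [← comp_assoc, (isCoder_bh τ B).eps_comp, zero_comp]
    · rw [dec_coder_comp_coder (isCoder_bh τ B).dec_comp (isCoder_bh τ B).dec_comp]; congr 1
      rw [th_comp_th hτ]; refine TensorProduct.ext' fun x y => ?_; have := hB.bh hτ x
      simp only [add_apply, map_tmul, comp_apply, LinearMap.id_apply, ← hb] at this ⊢
      rw [this, neg_tmul]; abel
  exact hc.eq_zero isCoalg_id (k := k) (fun l hl => by
    rw [comp_apply, hb, pr_bh, ← hb, h _ (wd_Tle hl)]) ht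

/-- The deformation of a morphism of bar constructions by a homotopy is again a morphism. -/
lemma homotopy_comm {F F' H B B' : ℭ} (h1 : F 1 = 0) (h1' : F' 1 = 0) (hH1 : H 1 = 0)
    (hF : IsEven τ F) (hF' : IsEven τ F') (hH : IsOdd τ H) (hB : IsOdd τ B) (hB' : IsOdd τ B')
    (hB1 : B 1 = 0) {k : ℕ}
    (hBB : ∀ t ∈ Tle R W k, B (bh τ B t) = 0) (hBB' : ∀ t ∈ Tle R W k, B' (bh τ B' t) = 0)
    (hFB : ∀ t ∈ Tle R W k, F (bh τ B t) = B' (hat F t))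
    (he : F' = F + B'.comp (coder ((th τ).comp (hat F')) H (hat F)) + H.comp (bh τ B)) {t : 𝕋}
    (ht : t ∈ Tle R W k) : F' (bh τ B t) = B' (hat F' t) := by
  set P := hat F with hP; set P' := hat F' with hP'; set b := bh τ B with hb
  set b' := bh τ B' with hb'; set K := coder ((th τ).comp P') H P with hK
  have cP : IsCoalg P := isCoalg_hat h1; have cP' : IsCoalg P' := isCoalg_hat h1'
  have ctP' : IsCoalg ((th τ).comp P') := (isCoalg_th τ).comp cP'
  have kK : IsCoder ((th τ).comp P') P K := ctP'.isCoder cP H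
  set X : 𝔼 := P' - P - b'.comp K - K.comp b with hX
  have oK : ∀ t, th τ (K t) = -K (th τ t) := IsOdd.coder hτ hH hF hF' h1 h1'
  have oK' : ∀ t, K (th τ t) = -th τ (K t) := fun t => by rw [oK, neg_neg]
  have ob' : ∀ t, b' (th τ t) = -th τ (b' t) := fun t => by rw [hb', hB'.bh hτ, neg_neg]
  have eP' : ∀ t, P' (th τ t) = th τ (P' t) := fun t => (hF'.hat h1' t).symm
  have prX : pr.comp X = 0 := by
    ext t; have hp : ∀ t, pr (K t) = H t := lcongr (ctP'.pr_coder cP H)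
    simp only [hX, comp_apply, sub_apply, map_sub, zero_apply]
    rw [hP', hP, pr_hat h1', pr_hat h1, hb', pr_bh, hp]
    conv_lhs => rw [he]
    simp only [add_apply, comp_apply]; abel
  set D : 𝔼 := P'.comp b - b'.comp P' with hD; have epsX : eps.comp X = 0 := by
    simp only [hX, comp_sub, cP.eps_comp, cP'.eps_comp, ← comp_assoc,
      hb', (isCoder_bh τ B').eps_comp, kK.eps_comp, zero_comp, sub_self]
  have decX : dec.comp X = (tpMap P' X + tpMap X P - tpMap ((th τ).comp D) K -
      tpMap ((th τ).comp K) (b'.comp P - P.comp b)).comp dec := by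
    have d1 := dec_coder_comp_coder (isCoder_bh τ B').dec_comp kK.dec_comp
    have d2 := dec_coder_comp_coder kK.dec_comp (isCoder_bh τ B).dec_comp; rw [← hb'] at d1
    rw [← hb] at d2
    have : dec.comp X = dec.comp P' - dec.comp P - dec.comp (b'.comp K) - dec.comp (K.comp b) := by
      simp only [hX, comp_sub]
    rw [this, d1, d2, cP.dec_comp, cP'.dec_comp, ← sub_comp, ← sub_comp, ← sub_comp]; congr 1
    refine TensorProduct.ext' fun x y => ?_; simp only [hX, hD, add_apply, sub_apply, map_tmul,
      comp_apply, LinearMap.id_apply, tmul_sub, sub_tmul,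
      map_sub, th_th hτ, eP', oK', ob', neg_tmul]; abel
  have K1 : K 1 = 0 := by rw [hK, coder_one ctP'.map_one cP.map_one, hH1, map_zero]
  have zPb : ∀ t ∈ Tle R W k, b' (P t) - P (b t) = 0 := fun t ht => by
    rw [sub_eq_zero]; exact (hat_comp_bh hF h1 hFB ht).symm
  have bz : ∀ t ∈ Tle R W k, b (b t) = 0 := fun t ht => bh_bh hτ hB hBB ht
  have bz' : ∀ t ∈ Tle R W k, b' (b' t) = 0 := fun t ht => bh_bh hτ hB' hBB' ht
  have Kmem : ∀ j, ∀ t ∈ Tle R W j, K t ∈ Tle R W j := fun j t ht =>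
    coder_mem_Tle ctP' cP (s := 0) (fun l hl => by
      rw [length_eq_zero_iff.1 (Nat.le_zero.1 hl)]; exact hH1) (by omega) ht
  have bmem : ∀ j, ∀ t ∈ Tle R W j, b t ∈ Tle R W j := fun j t ht =>
    coder_mem_Tle (isCoalg_th τ) isCoalg_id (s := 0) (fun l hl => by
      rw [length_eq_zero_iff.1 (Nat.le_zero.1 hl)]; exact hB1) (by omega) ht
  have key : ∀ j ≤ k, (∀ t ∈ Tle R W j, X t = 0) ∧ (∀ t ∈ Tle R W j, D t = 0) := by
    intro j
    induction j using Nat.strong_induction_on with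
    | _ j ih =>
      intro hjk; have hXj : ∀ t ∈ Tle R W j, X t = 0 := by
        intro t ht; refine eq_of_Tle (φ := X) (ψ := 0) (fun l hl => ?_) ht
        have hlen : ∀ u v : List W, u ++ v = l → u.length + v.length = l.length := fun u v huv => by
          rw [← huv, length_append]
        rw [eq_conv_of_dec (P' := P') (X' := X) (Y := (tpMap X P - tpMap ((th τ).comp D) K -
          tpMap ((th τ).comp K) (b'.comp P - P.comp b)).comp dec) epsX (by
            have := lcongr decX (wd l); simp only [comp_apply, sub_apply, add_apply] at this ⊢
            rw [this]; abel)]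
        simp only [comp_apply, sub_apply, map_sub, lift_map_dec, zero_apply]
        rw [conv_wd_eq_zero, conv_wd_eq_zero, conv_wd_eq_zero, conv_wd_eq_zero]
        · simp
        · intro u v huv; have := hlen u v huv
          have e : (b'.comp P - P.comp b) (wd v) = 0 := zPb _ (wd_Tle (by omega)); rw [e, smul_zero]
        · intro u v huv; have h2 := hlen u v huv; rcases v with _ | ⟨a, v⟩
          · rw [wd_nil, K1, smul_zero]
          · simp only [length_cons] at h2
            have e := (ih u.length (by omega) (by omega)).2 _ (wd_Tle le_rfl)
            simp only [comp_apply, e, map_zero, zero_smul]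
        · intro u v _; have e : pr (X (wd u)) = 0 := lcongr prX (wd u)
          simp only [comp_apply, e, map_zero, zero_smul]
        · intro u v huv; have h2 := hlen u v huv; rcases u with _ | ⟨a, u⟩
          · simp [cP'.map_one, pr_one]
          · simp only [length_cons] at h2
            rw [(ih v.length (by omega) (by omega)).1 _ (wd_Tle le_rfl), smul_zero]
      refine ⟨hXj, fun t ht => ?_⟩
      have e : ∀ t ∈ Tle R W j, P' t = P t + b' (K t) + K (b t) := fun t ht => by
        have := hXj t ht; simp only [hX, sub_apply, comp_apply] at this
        rw [sub_sub, sub_sub, sub_eq_zero] at this; rw [this]; abel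
      have e' : b' (P t) = P (b t) := sub_eq_zero.1 (zPb t (Tle_mono hjk ht))
      simp only [hD, sub_apply, comp_apply]
      rw [e _ (bmem _ _ ht), e _ ht, bz _ (Tle_mono hjk ht), map_add, map_add, e',
        bz' _ (Tle_mono hjk (Kmem _ _ ht)), map_zero]; abel
  have := congrArg pr ((key k le_rfl).2 t ht)
  simp only [hD, sub_apply, comp_apply, map_sub, map_zero, sub_eq_zero] at this
  rwa [hP', pr_hat h1', hb', pr_bh, ← hP'] at this

end Odd

section Unit

variable {e : W}

/-- The cochain `F` preserves the unit `e` strictly. -/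
def RedF (e : W) (F : ℭ) : Prop := ∀ s t : 𝕋, F (s * (ι R e * t)) = eps s • eps t • e

/-- The unit `e` is a strict unit for the operations `B`. -/
def RedB (τ : W →ₗ[R] W) (e : W) (B : ℭ) : Prop :=
  ∀ s t : 𝕋, B (s * (ι R e * t)) = eps s • pr t - eps t • τ (pr s)

/-- The cochain `H` vanishes on words containing the unit `e`. -/
def RedH (e : W) (H : ℭ) : Prop := ∀ s t : 𝕋, H (s * (ι R e * t)) = 0

lemma smul_eq_conv_eta (X : 𝔼) (r : R) (c t : 𝕋) :
    conv ((mulLeft R c).comp (r • eta)) X t = r • (c * X t) := by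
  rw [conv_smul_left]; have : r • (eta : 𝔼) = (mulLeft R (algebraMap R 𝕋 r)).comp eta := by
    ext t; simp [Algebra.smul_def]
  rw [this, conv_smul_left, conv_eta_left, smul_eq_mul, smul_eq_mul, ← Algebra.smul_def,
    mul_smul_comm]

lemma RedF.comp_mulLeft {F : ℭ} (h : RedF e F) (s : 𝕋) :
    ((ι R).comp F).comp (mulLeft R (s * ι R e)) = (mulLeft R (ι R e)).comp (eps s • eta) := by
  ext t; simp only [comp_apply, mulLeft_apply, mul_assoc, LinearMap.smul_apply]; rw [h]
  simp [Algebra.algebraMap_eq_smul_one]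

lemma RedF.hat {F : ℭ} (h : RedF e F) (h1 : F 1 = 0) (s t : 𝕋) :
    hat F (s * (ι R e * t)) = SphPair.hat F s * (ι R e * SphPair.hat F t) := by
  have hP := isCoalg_hat h1; set P := SphPair.hat F with hPdef; have eP : P = eta + convL F P := by
    conv_lhs => rw [hP.eq_conv]
    rw [hPdef, pr_comp_hat h1]
  have hA : P.comp (mulRight R (ι R e * t)) = (mulRight R (ι R e * P t)).comp eta +
        convL F (P.comp (mulRight R (ι R e * t))) := by
    ext s; rw [comp_apply, mulRight_apply]
    conv_lhs => rw [eP, add_apply, conv_unit, h.comp_mulLeft, smul_eq_conv_eta]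
    have : (eta : 𝔼) (s * (ι R e * t)) = 0 := by simp [TensorAlgebra.algebraMapInv]
    rw [this, zero_add, add_apply, add_comm]; congr 1
  have hC : (mulRight R (ι R e * P t)).comp P = (mulRight R (ι R e * P t)).comp eta +
        convL F ((mulRight R (ι R e * P t)).comp P) := by
    ext s; rw [add_apply, conv_mulRight, comp_apply, mulRight_apply]; have q := lcongr eP s; rw [q]
    simp only [comp_apply, add_apply, mulRight_apply, add_mul]
  have := eq_zero_of_eq_convL h1 ((sub_eq_sub_of_eq_add hA hC).trans (conv_sub_right _ _ _).symm)
  exact lcongr (sub_eq_zero.1 this) s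

lemma RedB.bh {B : ℭ} (h : RedB τ e B) (hB1 : B 1 = 0) (he : τ e = -e) (s t : 𝕋) :
    bh τ B (s * (ι R e * t)) = SphPair.bh τ B s * (ι R e * t) -
      th τ s * (ι R e * SphPair.bh τ B t) + eps s • t - eps t • th τ s := by
  have hβ : ∀ s, convL B idL (s * (ι R e * t)) =
      convL B idL s * (ι R e * t) + eps s • (t - eps t • 1) - ι R (τ (pr s)) * t := by
    intro s; have e1 : ((ι R).comp B).comp (mulLeft R (s * ι R e)) =
        (mulLeft R (algebraMap R 𝕋 (eps s))).comp ((ι R).comp pr) -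
        (mulLeft R (ι R (τ (pr s)))).comp eta := by
      ext t; simp only [comp_apply, mulLeft_apply, mul_assoc, sub_apply]; rw [h]
      simp only [map_sub, map_smul, Algebra.linearMap_apply]
      rw [← Algebra.smul_def, ← Algebra.commutes, ← Algebra.smul_def]
    have e2 : convL pr idL t = t - eps t • 1 := by
      have := lcongr (id_eq (R := R) (W := W)) t
      simp only [LinearMap.id_apply, add_apply, comp_apply,
        Algebra.linearMap_apply, Algebra.algebraMap_eq_smul_one] at this
      rw [eq_sub_iff_add_eq, add_comm]; exact this.symm
    rw [conv_unit, e1, conv_sub_left, sub_apply, conv_smul_left, conv_smul_left, conv_eta_left]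
    have e3 := conv_mulRight ((ι R).comp B) idL (ι R e * t) s; rw [comp_id] at e3; rw [id_comp, e3]
    change _ + (algebraMap R 𝕋 (eps s) • convL pr idL t - _) = _
    rw [e2, algebraMap_smul, LinearMap.id_apply, smul_eq_mul, add_sub_assoc]
  induction s using leftInduction with
  | one =>
    rw [one_mul, bh_cons, he]; have := hβ 1; rw [one_mul] at this; rw [this, conv_one]
    have b1 : SphPair.bh τ B (1 : 𝕋) = 0 := by
      rw [SphPair.bh, coder_one (th_one τ) rfl, hB1, map_zero]
    simp only [comp_apply, hB1, map_zero, zero_smul, zero_mul, eps_one, one_smul,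
      pr_one, th_one, b1, map_neg, neg_mul, one_mul]; abel
  | cons a s ih =>
    rw [mul_assoc, bh_cons, ← mul_assoc, hβ, bh_cons, ih, pr_cons, eps_cons, th_mul, th_ι]
    simp only [zero_smul, map_smul, smul_mul_assoc, mul_add, mul_sub, add_mul, mul_smul_comm,
      mul_assoc]; abel
  | add s s' h h' => simp only [add_mul, map_add, h, h', add_smul, smul_add]; abel
  | smul r s h =>
    simp only [smul_mul_assoc, map_smul, h, smul_sub, smul_add, smul_eq_mul, mul_smul]
    rw [smul_comm r (eps t)]

lemma RedH.coder {F F' H : ℭ} (hH : RedH e H) (hF : RedF e F) (hF' : RedF e F')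
    (h1 : F 1 = 0) (h1' : F' 1 = 0) (he : τ e = -e) (s t : 𝕋) :
    coder ((th τ).comp (hat F')) H (hat F) (s * (ι R e * t)) =
      SphPair.coder ((th τ).comp (hat F')) H (hat F) s * (ι R e * hat F t) -
      th τ (hat F' s) * (ι R e * SphPair.coder ((th τ).comp (hat F')) H (hat F) t) := by
  have cP := isCoalg_hat h1; have cP' := isCoalg_hat h1'; have hP := fun s t => hF.hat h1 s t
  set P := SphPair.hat F with hPdef; set Q := (th τ).comp (SphPair.hat F') with hQ
  have cQ : IsCoalg Q := (isCoalg_th τ).comp cP'; set K := SphPair.coder Q H P with hK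
  have eK : K = convL H P + convL (pr.comp Q) K := cQ.coder_eq H
  have hp : ∀ s, ((ι R).comp (pr.comp Q)).comp (mulLeft R (s * ι R e)) =
      (mulLeft R (ι R (-e))).comp (eps s • eta) := by
    intro s; ext t; simp only [comp_apply, mulLeft_apply, mul_assoc, LinearMap.smul_apply, hQ]
    rw [pr_th, pr_hat h1', hF']; simp [Algebra.algebraMap_eq_smul_one, he]
  have hH0 : ∀ s, ((ι R).comp H).comp (mulLeft R (s * ι R e)) = 0 := by
    intro s; ext t; simp only [comp_apply, mulLeft_apply, mul_assoc]; rw [hH]; simp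
  have hA : K.comp (mulRight R (ι R e * t)) = ((mulRight R (ι R e * P t)).comp (convL H P) -
        (mulRight R (ι R e * K t)).comp eta) +
        convL (pr.comp Q) (K.comp (mulRight R (ι R e * t))) := by
    ext s; rw [comp_apply, mulRight_apply]
    conv_lhs => rw [eK, add_apply, conv_unit, conv_unit, hp, smul_eq_conv_eta, hH0, conv_zero_left]
    have e3 : P.comp (mulRight R (ι R e * t)) = (mulRight R (ι R e * P t)).comp P := by
      ext s; exact hP s t
    rw [e3, conv_mulRight]; simp only [add_apply, sub_apply, comp_apply,
      mulRight_apply, zero_apply, add_zero, map_neg, neg_mul, smul_neg,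
      Algebra.linearMap_apply, ← Algebra.smul_def]; abel
  have hC : (mulRight R (ι R e * P t)).comp K - (mulRight R (ι R e * K t)).comp Q =
      ((mulRight R (ι R e * P t)).comp (convL H P) - (mulRight R (ι R e * K t)).comp eta) +
        convL (pr.comp Q) ((mulRight R (ι R e * P t)).comp K -
          (mulRight R (ι R e * K t)).comp Q) := by
    ext s; have : convL (pr.comp Q) ((mulRight R (ι R e * P t)).comp K -
          (mulRight R (ι R e * K t)).comp Q) s = convL (pr.comp Q) K s * (ι R e * P t) -
          convL (pr.comp Q) Q s * (ι R e * K t) := by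
      rw [convL, conv_sub_right, sub_apply, conv_mulRight, conv_mulRight]
    rw [add_apply, this]; simp only [comp_apply, sub_apply, mulRight_apply]
    have q := lcongr cQ.eq_conv s; have k := lcongr eK s; rw [add_apply] at q k
    conv_lhs => rw [q, k]
    simp only [comp_apply, add_mul]; abel
  have := eq_zero_of_eq_convL cQ.pr_comp_one
    ((sub_eq_sub_of_eq_add hA hC).trans (conv_sub_right _ _ _).symm)
  have := lcongr (sub_eq_zero.1 this) s; exact this

end Unit

/-! ## Operations as cochains on the tensor coalgebra -/

variable (R) in
/-- The word formed by the first `k` terms of a sequence. -/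
def sw (a : ℕ → W) (k : ℕ) : 𝕋 := wd (ofFn fun i : Fin k => a i)

lemma sw_zero (a : ℕ → W) : sw R a 0 = 1 := rfl

lemma sw_congr {a b : ℕ → W} {k : ℕ} (h : ∀ i < k, a i = b i) : sw R a k = sw R b k := by
  unfold sw; congr 2; ext1 i; exact h i i.2

lemma sw_add (a : ℕ → W) (j k : ℕ) : sw R a (j + k) = sw R a j * sw R (fun i => a (j + i)) k := by
  unfold sw; rw [← wd_append, List.ofFn_add]; rfl

lemma sw_one (a : ℕ → W) : sw R a 1 = ι R (a 0) := by simp [sw]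

lemma sw_succ (a : ℕ → W) (k : ℕ) : sw R a (k + 1) = ι R (a 0) * sw R (fun i => a (i + 1)) k := by
  rw [add_comm k 1, sw_add, sw_one]; simp only [add_comm 1]

lemma wd_eq_sw (l : List W) : wd l = sw R (fun i => l.getD i 0) l.length := by
  unfold sw; congr 1; refine List.ext_getElem (by simp) fun i h h' => ?_; simp

lemma linearMap_ext_sw {N : Type*} [AddCommGroup N] [Module R N] {φ ψ : 𝕋 →ₗ[R] N}
    (h : ∀ (a : ℕ → W) (k : ℕ), φ (sw R a k) = ψ (sw R a k)) : φ = ψ :=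
  ext_wd fun l => by rw [wd_eq_sw]; exact h _ _

lemma sw_mem_Tle (a : ℕ → W) (k : ℕ) : sw R a k ∈ Tle R W k := wd_Tle (by simp)

lemma conv_sw {N : Type*} [AddCommGroup N] [Module R N] [Module 𝕋 N] [IsScalarTower R 𝕋 N]
    (p : 𝕋 →ₗ[R] 𝕋) (X : 𝕋 →ₗ[R] N) (a : ℕ → W) (k : ℕ) :
    conv p X (sw R a k) = ∑ x ∈ Finset.HasAntidiagonal.antidiagonal k,
      p (sw R a x.1) • X (sw R (fun i => a (x.1 + i)) x.2) := by
  induction k generalizing a p with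
  | zero => simp [sw_zero, conv_one]
  | succ k ih =>
    rw [Finset.Nat.sum_antidiagonal_succ, sw_succ, conv_cons, ih]
    simp only [sw_zero, zero_add, sw_succ]; congr 1; refine sum_congr rfl fun x _ => ?_
    simp only [comp_apply, mulLeft_apply]; congr 3; ext1 i; congr 1; omega

lemma coder_sw (P : 𝕋 →ₗ[R] 𝕋) (H : 𝕋 →ₗ[R] W) (Q : 𝕋 →ₗ[R] 𝕋) (a : ℕ → W) (k : ℕ) :
    coder P H Q (sw R a k) = ∑ p ∈ Finset.HasAntidiagonal.antidiagonal k,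
      ∑ q ∈ Finset.HasAntidiagonal.antidiagonal p.2, P (sw R a p.1) *
        (ι R (H (sw R (fun i => a (p.1 + i)) q.1)) *
          Q (sw R (fun i => a (p.1 + (q.1 + i))) q.2)) := by
  rw [coder, conv_sw]; refine sum_congr rfl fun p _ => ?_; rw [conv_sw, smul_sum]; rfl

/-- The word of values of `F` on consecutive blocks. -/
def blockWord (F : 𝕋 →ₗ[R] W) : (ℕ → W) → List ℕ → List W
  | _, [] => []
  | a, b :: bs => F (sw R a b) :: blockWord F (fun i => a (b + i)) bs

lemma length_blockWord (F : 𝕋 →ₗ[R] W) (a : ℕ → W) (bs : List ℕ) :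
    (blockWord F a bs).length = bs.length := by
  induction bs generalizing a with
  | nil => rfl
  | cons b bs ih => simp [blockWord, ih]

lemma getElem_blockWord (F : 𝕋 →ₗ[R] W) (a : ℕ → W) (bs : List ℕ) (i : ℕ) (hi : i < bs.length) :
    (blockWord F a bs)[i]'(by rwa [length_blockWord]) =
      F (sw R (fun j => a ((bs.take i).sum + j)) bs[i]) := by
  induction bs generalizing a i with
  | nil => simp at hi
  | cons b bs ih =>
    rcases i with _ | i
    · simp [blockWord]
    · simp only [blockWord, List.getElem_cons_succ, List.take_succ_cons, List.sum_cons]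
      rw [ih _ _ (by simpa using hi)]; simp only [add_assoc]

/-- Prepending a block to a composition. -/
def consComposition (k : ℕ) (x : Σ p : ℕ × ℕ, Composition p.2)
    (hx : x.1 ∈ Finset.HasAntidiagonal.antidiagonal k) : Composition (k + 1) where
  blocks := (x.1.1 + 1) :: x.2.blocks
  blocks_pos := by
    intro i hi; rcases List.mem_cons.1 hi with h | h
    · omega
    · exact x.2.blocks_pos h
  blocks_sum := by
    rw [List.sum_cons, x.2.blocks_sum]; rw [Finset.HasAntidiagonal.mem_antidiagonal] at hx; omega

lemma sum_composition_succ {M : Type*} [AddCommMonoid M] (k : ℕ) (G : List ℕ → M) :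
    ∑ c : Composition (k + 1), G c.blocks =
      ∑ p ∈ Finset.HasAntidiagonal.antidiagonal k, ∑ c : Composition p.2,
        G ((p.1 + 1) :: c.blocks) := by
  rw [Finset.sum_sigma']; symm
  refine Finset.sum_bij (fun x hx => consComposition k x (Finset.mem_sigma.1 hx).1)
    (fun _ _ => mem_univ _) ?_ ?_ (fun x hx => rfl)
  · rintro ⟨⟨i, j⟩, c⟩ h1 ⟨⟨i', j'⟩, c'⟩ h2 h; have h := congrArg Composition.blocks h
    simp only [consComposition, List.cons.injEq, add_left_inj] at h; have hj : j = j' := by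
      have := c.blocks_sum; have := c'.blocks_sum; rw [h.2] at *; simp_all
    obtain ⟨rfl, h2⟩ := h; subst hj; congr 1; exact Composition.ext h2
  · rintro c -; obtain ⟨bs, hpos, hsum⟩ := c; rcases bs with _ | ⟨b, bs⟩
    · simp at hsum
    · have hb := hpos (List.mem_cons_self); rw [List.sum_cons] at hsum
      refine ⟨⟨(b - 1, bs.sum), ⟨bs, fun h => hpos (List.mem_cons_of_mem _ h), rfl⟩⟩, ?_, ?_⟩
      · simp only [Finset.mem_sigma, Finset.HasAntidiagonal.mem_antidiagonal, mem_univ, and_true]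
        omega
      · refine Composition.ext ?_; simp only [consComposition]; congr 1; omega

lemma hat_sw {F : 𝕋 →ₗ[R] W} (hF : F 1 = 0) (a : ℕ → W) (k : ℕ) :
    hat F (sw R a k) = ∑ c : Composition k, wd (blockWord F a c.blocks) := by
  induction k using Nat.strong_induction_on generalizing a with
  | _ k ih =>
    have hP := isCoalg_hat hF; rcases k with _ | k
    · have : ∀ c : Composition 0, c.blocks = [] := fun c => c.blocks_eq_nil.2 rfl
      simp [sw_zero, hP.map_one, this, blockWord, composition_card]
    · rw [sum_composition_succ k (fun l => wd (blockWord F a l)), hP.eq_conv, add_apply,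
        pr_comp_hat hF, conv_sw, Finset.Nat.sum_antidiagonal_succ]
      have e0 : (eta : 𝕋 →ₗ[R] 𝕋) (sw R a (k + 1)) = 0 := by
        rw [sw_succ, comp_apply, eps_cons, map_zero]
      rw [e0, zero_add, comp_apply, sw_zero, hF, map_zero, zero_smul, zero_add]
      refine sum_congr rfl fun p hp => ?_; rw [Finset.HasAntidiagonal.mem_antidiagonal] at hp
      rw [ih p.2 (by omega), smul_sum]; refine sum_congr rfl fun c _ => ?_; simp [blockWord]

/-- A family of multilinear maps as a linear map on the tensor algebra. -/
lemma exists_ofFamily {N : Type*} [AddCommGroup N] [Module R N]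
    (f : ∀ k, MultilinearMap R (fun _ : Fin k => W) N) :
    ∃ φ : 𝕋 →ₗ[R] N, ∀ (a : ℕ → W) (k : ℕ), φ (sw R a k) = f k (fun i => a i) := by
  refine ⟨(DirectSum.toModule R ℕ N fun k => PiTensorProduct.lift (f k)).comp
    (TensorAlgebra.toDirectSum (R := R) (M := W)).toLinearMap, fun a k => ?_⟩
  have : sw R a k = TensorAlgebra.tprod R W k (fun i => a i) := by
    rw [TensorAlgebra.tprod_apply, sw, wd, List.map_ofFn]; rfl
  rw [comp_apply, AlgHom.toLinearMap_apply, this, TensorAlgebra.toDirectSum_tensorPower_tprod]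
  erw [DirectSum.toModule_lof]; simp

end TensorCoalgebra

section Homogeneous

variable {n : ℕ} {R L : Type u} [CommRing R] [AddCommGroup L] [Module R L]

local notation "ℳ" => Mor n R L
local notation "Kz" => koszul (R := R)
local notation "Hm" => hom (R := R)

/-- The six pieces of the space of morphisms. -/
def pieces : Finset (Obj × Obj × ℤ) :=
  open Classical in {(.X, .X, 0), (.Y, .Y, 0), (.X, .X, 1), (.Y, .Y, 1), (.X, .Y, 0), (.Y, .X, 1)}

lemma sum_homProj (x : ℳ) : ∑ p ∈ pieces, homProj (R := R) p.1 p.2.1 p.2.2 x = x := by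
  classical
  obtain ⟨⟨x1, x2⟩, ⟨x3, x4⟩, x5, x6⟩ := x; unfold pieces
  rw [sum_insert, sum_insert, sum_insert, sum_insert, sum_insert, sum_singleton] <;> simp [homProj]

lemma Op.ext_homog {N : Type*} [AddCommGroup N] [Module R N] {k : ℕ}
    {f f' : MultilinearMap R (fun _ : Fin k => ℳ) N}
    (h : ∀ (a b : Fin k → Obj) (d : Fin k → ℤ) (x : Fin k → ℳ),
      (∀ i, x i ∈ Hm (a i) (b i) (d i)) → f x = f' x) : f = f' := by
  ext x; have e : x = fun i => ∑ p ∈ pieces, homProj (R := R) p.1 p.2.1 p.2.2 (x i) := by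
    ext1 i; rw [sum_homProj]
  rw [e, MultilinearMap.map_sum_finset, MultilinearMap.map_sum_finset]
  refine sum_congr rfl fun r _ => ?_
  exact h (fun i => (r i).1) (fun i => (r i).2.1) (fun i => (r i).2.2) _
    fun i => homProj_mem _ _ _ _

lemma koszul_koszul (s t : ℕ) (x : ℳ) : Kz s (Kz t x) = Kz (s + t) x := by
  simp only [koszul, LinearMap.coe_mk, AddHom.coe_mk, smul_smul, pow_add]

lemma koszul_congr {s t : ℕ} (h : s % 2 = t % 2) (x : ℳ) : Kz s x = Kz t x := by
  have : (-1 : R) ^ s = (-1) ^ t := by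
    rw [← Nat.div_add_mod s 2, ← Nat.div_add_mod t 2, pow_add, pow_add, pow_mul, pow_mul, h]; simp
  simp only [koszul, LinearMap.coe_mk, AddHom.coe_mk, this]

lemma koszul_zero (x : ℳ) : Kz 0 x = x := by simp [koszul]

lemma koszul_of_even {s : ℕ} (h : s % 2 = 0) (x : ℳ) : Kz s x = x := by
  rw [koszul_congr (t := 0) h, koszul_zero]

lemma koszul_of_mem {a b : Obj} {d : ℤ} {x : ℳ} (hx : x ∈ Hm a b d) (s : ℕ) :
    Kz s x = ((-1 : R) ^ s) ^ d.natAbs • x := by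
  obtain ⟨h1, h2, h3, h4, h5, h6⟩ := hx; obtain ⟨⟨x1, x2⟩, ⟨x3, x4⟩, x5, x6⟩ := x
  simp only at h1 h2 h3 h4 h5 h6
  have z : ∀ {T : Type u} [AddCommGroup T] [Module R T] (y : T) (p : Prop), (¬ p → y = 0) → (p → d = 0) →
      y = ((-1 : R) ^ s) ^ d.natAbs • y := by
    intro T _ _ y p h h'
    by_cases hp : p
    · simp [h' hp]
    · simp [h hp]
  have o : ∀ {T : Type u} [AddCommGroup T] [Module R T] (y : T) (p : Prop), (¬ p → y = 0) → (p → d = 1) →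
      (-1 : R) ^ s • y = ((-1 : R) ^ s) ^ d.natAbs • y := by
    intro T _ _ y p h h'
    by_cases hp : p
    · simp [h' hp]
    · simp [h hp]
  simp only [koszul, LinearMap.coe_mk, AddHom.coe_mk, Prod.smul_mk, Prod.mk.injEq]
  exact ⟨⟨z _ _ h1 (fun h => h.2.2), z _ _ h2 (fun h => h.2.2)⟩,
    ⟨o _ _ h3 (fun h => h.2.2), o _ _ h4 (fun h => h.2.2)⟩, z _ _ h5 (fun h => h.2.2),
    o _ _ h6 (fun h => h.2.2)⟩

lemma koszul_mem {a b : Obj} {d : ℤ} {x : ℳ} (hx : x ∈ Hm a b d) (s : ℕ) : Kz s x ∈ Hm a b d := by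
  rw [koszul_of_mem hx]; exact smul_mem _ _ hx

lemma neg_one_pow_natAbs (s : ℕ) (d e : ℤ) (h : Even (d - e)) :
    ((-1 : R) ^ s) ^ d.natAbs = ((-1 : R) ^ s) ^ e.natAbs := by
  have key : ((-1 : R) ^ s) * (-1) ^ s = 1 := by rw [← mul_pow]; simp
  have h2 : ∀ m : ℕ, ((-1 : R) ^ s) ^ m = ((-1 : R) ^ s) ^ (m % 2) := by
    intro m
    conv_lhs => rw [← Nat.div_add_mod m 2, pow_add, pow_mul, pow_two, key, one_pow, one_mul]
  rw [h2, h2 e.natAbs]; congr 1; obtain ⟨r, hr⟩ := h; omega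

/-- An operation of degree `t` commutes with the signs up to `(-1)^t`. -/
lemma IsCochain.koszul_apply {k : ℕ} {t : ℤ} {f : Op n R L k} (hf : IsCochain t f) (s e : ℕ)
    (he : Even (t - e)) (x : Fin k → ℳ) :
    Kz s (f x) = (-1 : R) ^ (s * e) • f (fun i => Kz s (x i)) := by
  have : (Kz s).compMultilinearMap f = (-1 : R) ^ (s * e) • f.compLinearMap (fun _ => Kz s) := by
    refine Op.ext_homog fun a b d x hx => ?_
    simp only [LinearMap.compMultilinearMap_apply, smul_apply, MultilinearMap.compLinearMap_apply]
    simp only [fun i => koszul_of_mem (hx i) s]; rw [MultilinearMap.map_smul_univ, smul_smul]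
    by_cases hab : ∃ i j : Fin k, (i : ℕ) + 1 = j ∧ a i ≠ b j
    · rw [hf.zero a b d x hx hab]; simp
    · push Not at hab
      by_cases hk : k = 0
      · subst hk; have h0 := hf.mem (fun _ => .X) d x (fun i => i.elim0); rw [koszul_of_mem h0]
        congr 1
        simp only [Finset.univ_eq_empty, Finset.sum_empty, zero_add, Finset.prod_empty, mul_one,
          pow_mul]; exact neg_one_pow_natAbs s t e he
      · have h0 := hf.mem (fun i => if h : (i : ℕ) = 0 then b ⟨0, by omega⟩
          else a ⟨i - 1, by omega⟩) d x (fun i => by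
            have := hx i
            by_cases hi : (i : ℕ) = 0
            · have : i = ⟨0, by omega⟩ := Fin.ext hi; simpa [hi, this] using hx i
            · have := hab ⟨i - 1, by omega⟩ i (by simp; omega); simpa [hi, this] using hx i)
        rw [koszul_of_mem h0]; congr 1; rw [Finset.prod_pow_eq_pow_sum, pow_mul, ← pow_add]
        have := neg_one_pow_natAbs (R := R) s (∑ i, d i + t) ((e + ∑ i, (d i).natAbs : ℕ) : ℤ) (by
            rw [Nat.cast_add, Nat.cast_sum]; simp only [Int.natCast_natAbs]
            have h3 : Even (∑ i, d i - ∑ i, |d i|) := by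
              rw [← sum_sub_distrib]; refine Finset.even_sum _ fun i _ => ?_
              rcases abs_choice (d i) with h | h <;> rw [h]
              · simp
              · exact ⟨d i, by ring⟩
            have h4 := h3.add he; rwa [show ∑ i, d i + t - ((e : ℤ) + ∑ i, |d i|) =
              (∑ i, d i - ∑ i, |d i|) + (t - e) by ring])
        rwa [Int.natAbs_natCast] at this
  exact congrArg (fun F => F x) this

end Homogeneous

section Twist

open TensorAlgebra (ι)

variable {n : ℕ} {R L : Type u} [CommRing R] [AddCommGroup L] [Module R L]

local notation "Kz" => koszul (R := R)

/-- The tensor algebra on the space of morphisms. -/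
abbrev TM (n : ℕ) (R L : Type u) [CommRing R] [AddCommGroup L] [Module R L] : Type u :=
  TensorAlgebra R (Mor n R L)

variable (n R L) in
/-- The sign `(-1)^(deg - 1)`. -/
def tau : Mor n R L →ₗ[R] Mor n R L := -(Kz 1 : Mor n R L →ₗ[R] Mor n R L)

local notation "ℳ" => Mor n R L
local notation "𝕋" => TM n R L
local notation "ℭ" => TM n R L →ₗ[R] Mor n R L
local notation "ϑ" => tau n R L

lemma tau_apply (x : ℳ) : ϑ x = -Kz 1 x := rfl

lemma tau_tau (x : ℳ) : ϑ (ϑ x) = x := by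
  rw [tau_apply, tau_apply, map_neg, neg_neg, koszul_koszul, koszul_of_even rfl]

/-- The arguments of an operation, with signs. -/
def twOp (k : ℕ) (f : Op n R L k) : Op n R L k := f.compLinearMap (fun i : Fin k => Kz (k - 1 - i))

/-- The cochain on the tensor coalgebra given by a family of operations. -/
def tw (f : ∀ k, Op n R L k) : ℭ := (exists_ofFamily fun k => twOp k (f k)).choose

lemma tw_sw (f : ∀ k, Op n R L k) (a : ℕ → ℳ) (k : ℕ) :
    tw f (sw R a k) = f k (fun i => Kz (k - 1 - i) (a i)) :=
  (exists_ofFamily fun k => twOp k (f k)).choose_spec a k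

/-- The operations given by a cochain on the tensor coalgebra. -/
def untw (φ : ℭ) (k : ℕ) : Op n R L k := twOp k (φ.compMultilinearMap (TensorAlgebra.tprod R ℳ k))

lemma untw_apply (φ : ℭ) (k : ℕ) (a : ℕ → ℳ) :
    untw φ k (fun i => a i) = φ (sw R (fun i => Kz (k - 1 - i) (a i)) k) := by
  simp only [untw, twOp, MultilinearMap.compLinearMap_apply, LinearMap.compMultilinearMap_apply]
  congr 1; rw [TensorAlgebra.tprod_apply, sw, wd, List.map_ofFn]; rfl

lemma tw_untw (φ : ℭ) : tw (untw φ) = φ := by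
  refine linearMap_ext_sw fun a k => ?_; rw [tw_sw, untw_apply φ k (fun i => Kz (k - 1 - i) (a i))]
  congr 1; refine sw_congr fun i _ => ?_; rw [koszul_koszul, koszul_of_even (by omega)]

lemma Op.ext_seq {k : ℕ} {f f' : Op n R L k}
    (h : ∀ a : ℕ → ℳ, f (fun i => a i) = f' (fun i => a i)) : f = f' := by
  ext1 x; have := h (extSeq x); simpa [extSeq] using this

lemma untw_tw (f : ∀ k, Op n R L k) (k : ℕ) : untw (tw f) k = f k := by
  refine Op.ext_seq fun a => ?_; rw [untw_apply, tw_sw]; congr 1; ext1 i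
  rw [koszul_koszul, koszul_of_even (by omega)]

lemma tw_injective {f f' : ∀ k, Op n R L k} (h : tw f = tw f') : f = f' := by
  ext1 k; rw [← untw_tw f, h, untw_tw]

lemma insertSum_eq (f m : ∀ k, Op n R L k) (hm : ∀ k : ℕ, IsCochain (2 - (k : ℤ)) (m k)) (k : ℕ)
    (a : ℕ → ℳ) : insertSum (R := R) f m k a = tw f (bh ϑ (tw m)
      (sw R (fun i => Kz (k - 1 - i) (a i)) k)) := by
  rw [bh, coder_sw, insertSum, map_sum]; refine sum_congr rfl fun p hp => ?_; rw [map_sum]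
  refine sum_congr rfl fun q hq => ?_; obtain ⟨r, p2⟩ := p; obtain ⟨s, t⟩ := q
  simp only [Finset.HasAntidiagonal.mem_antidiagonal] at hp hq ⊢; subst hq
  have hy : tw m (sw R (fun i => Kz (k - 1 - (r + i)) (a (r + i))) s) =
      (-1 : R) ^ (s * t) • Kz t (m s (fun j => a (r + j))) := by
    have h1 := (hm s).koszul_apply t s ⟨1 - s, by ring⟩ (fun j => a (r + j))
    rw [h1, smul_smul, mul_comm t s, ← pow_add, Even.neg_one_pow ⟨s * t, rfl⟩, one_smul, tw_sw]
    congr 1; ext1 i; rw [koszul_koszul]; exact koszul_congr (by omega) _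
  rw [hy, LinearMap.id_apply]; have h2 : th ϑ (sw R (fun i => Kz (k - 1 - i) (a i)) r) =
      (-1 : R) ^ r • sw R (fun i => Kz (k - i) (a i)) r := by
    have : ∀ (r : ℕ) (b b' : ℕ → ℳ), (∀ i < r, ϑ (b i) = - b' i) →
        th ϑ (sw R b r) = (-1 : R) ^ r • sw R b' r := by
      intro r
      induction r with
      | zero => intro b b' _; simp [sw_zero, th_one]
      | succ r ih =>
        intro b b' h; rw [sw_succ, th_mul, th_ι, h 0 (by omega), ih _ (fun i => b' (i + 1))
          (fun i hi => h (i + 1) (by omega)), sw_succ, pow_succ]; simp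
    refine this r _ _ fun i hi => ?_
    rw [tau_apply, koszul_koszul, koszul_congr (by omega : (1 + (k - 1 - i)) % 2 = (k - i) % 2)]
  rw [h2]; simp only [smul_mul_assoc, mul_smul_comm, map_smul]
  have h3 : sw R (fun i => Kz (k - i) (a i)) r * (ι R (Kz t (m s (fun j => a (r + j)))) *
        sw R (fun i => Kz (k - 1 - (r + (s + i))) (a (r + (s + i)))) t) =
      sw R (fun i => if i < r then Kz (k - i) (a i) else if i = r then
        Kz t (m s (fun j => a (r + j))) else
          Kz (k - 1 - (i + s - 1)) (a (i + s - 1))) (r + 1 + t) := by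
    rw [add_assoc r 1 t, sw_add, sw_add _ 1 t, sw_one]
    simp only [add_zero, lt_irrefl, if_true, if_false]; congr 1
    · refine sw_congr fun i hi => ?_; rw [if_pos hi]
    · congr 1; refine sw_congr fun i hi => ?_; rw [if_neg (by omega), if_neg (by omega)]
      have : r + (1 + i) + s - 1 = r + (s + i) := by omega
      rw [this]
  rw [h3, tw_sw, smul_smul, ← pow_add, add_comm (s * t) r]; congr 2; ext1 i; unfold insertAt
  split_ifs with h4 h5
  · rw [koszul_koszul]; exact koszul_congr (by omega) _
  · rw [koszul_koszul, koszul_of_even (by omega)]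
  · rw [koszul_koszul, koszul_of_even (by omega)]

lemma composeSum_eq (m f : ∀ k, Op n R L k) (hf : ∀ k : ℕ, IsCochain (1 - (k : ℤ)) (f k))
    (h1 : tw f 1 = 0) (k : ℕ) (a : ℕ → ℳ) : composeSum (R := R) m f k a = tw m (hat (tw f)
      (sw R (fun i => Kz (k - 1 - i) (a i)) k)) := by
  rw [hat_sw h1, composeSum, map_sum]; refine sum_congr rfl fun c _ => ?_
  have hlen : (blockWord (tw f) (fun i => Kz (k - 1 - i) (a i)) c.blocks).length =
      c.length := by rw [length_blockWord, c.blocks_length]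
  rw [wd_eq_sw, hlen, tw_sw]; have hterm : ∀ l : Fin c.length, Kz (c.length - 1 - l)
      ((blockWord (tw f) (fun i => Kz (k - 1 - i) (a i)) c.blocks).getD l 0) =
      (-1 : R) ^ ((c.length - 1 - l) * (c.blocksFun l - 1)) • f (c.blocksFun l) (fun j =>
        Kz (∑ l' ∈ Finset.Ioi l, (c.blocksFun l' - 1)) (a (c.embedding l j))) := by
    intro l; have hl : (l : ℕ) < c.blocks.length := by rw [c.blocks_length]; exact l.2
    rw [List.getD_eq_getElem _ _ (by rw [hlen]; exact l.2), getElem_blockWord _ _ _ _ hl, tw_sw]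
    have hpos := c.one_le_blocksFun l; have hbl : c.blocks[(l : ℕ)] = c.blocksFun l := rfl; rw [hbl]
    rw [(hf (c.blocksFun l)).koszul_apply (c.length - 1 - l) (c.blocksFun l - 1)
      ⟨1 - c.blocksFun l, by push_cast [hpos]; ring⟩]; congr 2; ext1 j
    have hsz : (c.blocks.take l).sum = c.sizeUpTo l := rfl
    have hemb : ((c.embedding l j : Fin k) : ℕ) = c.sizeUpTo l + j := c.coe_embedding l j
    rw [hsz, hemb, koszul_koszul, koszul_koszul]; refine koszul_congr ?_ _
    have hsum : ∑ l' ∈ Finset.Ioi l, (c.blocksFun l' - 1) + (c.length - 1 - l) =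
        k - c.sizeUpTo (l + 1) := by
      have e1 : ∑ l' ∈ Finset.Ioi l, (c.blocksFun l' - 1) + (c.length - 1 - l) =
          ∑ l' ∈ Finset.Ioi l, c.blocksFun l' := by
        have : c.length - 1 - (l : ℕ) = ∑ l' ∈ Finset.Ioi l, 1 := by
          rw [Finset.sum_const, smul_eq_mul, mul_one, Fin.card_Ioi]
        rw [this, ← sum_add_distrib]; refine sum_congr rfl fun l' _ => ?_
        have := c.one_le_blocksFun l'; omega
      rw [e1]; have e2 : ∑ l' ∈ Finset.Iic l, c.blocksFun l' = c.sizeUpTo (l + 1) := by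
        rw [Composition.sizeUpTo]; rw [← c.ofFn_blocksFun, List.sum_take_ofFn]
        refine sum_congr ?_ fun _ _ => rfl; refine Finset.ext fun l' => ?_
        rw [Finset.mem_Iic, Finset.mem_filter, Fin.le_def, Nat.lt_succ_iff]
        exact ⟨fun h => ⟨mem_univ _, h⟩, fun h => h.2⟩
      have e3 : ∑ l' ∈ Finset.Iic l, c.blocksFun l' + ∑ l' ∈ Finset.Ioi l, c.blocksFun l' = k := by
        refine Eq.trans ?_ c.sum_blocksFun; rw [← Finset.sum_union]
        · congr 1; refine Finset.ext fun l' => ?_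
          rw [Finset.mem_union, Finset.mem_Iic, Finset.mem_Ioi]
          exact ⟨fun _ => mem_univ _, fun _ => le_or_gt _ _⟩
        · rw [Finset.disjoint_left]; intro x hx hx'
          simp only [Finset.mem_Iic, Finset.mem_Ioi] at hx hx'; exact absurd hx' (not_lt.2 hx)
      omega
    have hs := c.sizeUpTo_succ' l; have hle := c.sizeUpTo_le (l + 1); have := j.2; omega
  simp only [hterm]; rw [MultilinearMap.map_smul_univ, Finset.prod_pow_eq_pow_sum]

/-! ## Homogeneity -/

/-- Classes of homogeneous words: the empty word, words which are not composable, and composable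
words with given source, target and (shifted) degree. -/
inductive Gr : Type
  | one
  | zero
  | mk (a b : Obj) (d : ℤ)

namespace Gr

open Classical in
/-- The class of a product of words. -/
def mul : Gr → Gr → Gr
  | one, y => y
  | x, one => x
  | zero, _ => zero
  | _, zero => zero
  | mk a b d, mk a' b' d' => if a = b' then mk a' b (d + d') else zero

instance : Mul Gr := ⟨mul⟩
instance : One Gr := ⟨one⟩

lemma one_def : (1 : Gr) = one := rfl
@[simp] theorem one_mul' (y : Gr) : one * y = y := by cases y <;> rfl
@[simp] theorem mul_one' (x : Gr) : x * one = x := by cases x <;> rfl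
@[simp] theorem zero_mul' (y : Gr) : zero * y = zero := by cases y <;> rfl
@[simp] theorem mul_zero' (x : Gr) : x * zero = zero := by cases x <;> rfl
open Classical in
lemma mk_mul_mk (a b : Obj) (d : ℤ) (a' b' : Obj) (d' : ℤ) :
    mk a b d * mk a' b' d' = if a = b' then mk a' b (d + d') else zero := rfl

instance : Monoid Gr where
  one_mul := one_mul'
  mul_one := mul_one'
  mul_assoc x y z := by
    cases x <;> cases y <;> cases z <;>
      simp only [one_mul', mul_one', zero_mul', mul_zero', mk_mul_mk] <;> split_ifs <;>
      simp_all [mk_mul_mk, add_assoc]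

/-- Shift of the degree. -/
def shift (t : ℤ) : Gr → Gr
  | one => one
  | zero => zero
  | mk a b d => mk a b (d + t)

@[simp] theorem shift_zero (x : Gr) : x.shift 0 = x := by cases x <;> simp [shift]

lemma shift_shift (s t : ℤ) (x : Gr) : (x.shift s).shift t = x.shift (s + t) := by
  cases x <;> simp [shift, add_assoc]

lemma shift_mul_left {x : Gr} (hx : x ≠ one) (t : ℤ) (y : Gr) :
    (x * y).shift t = x.shift t * y := by
  cases x <;> cases y <;> simp_all [shift, mk_mul_mk]
  split_ifs <;> simp; ring

lemma shift_mul_right {y : Gr} (hy : y ≠ one) (t : ℤ) (x : Gr) :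
    (x * y).shift t = x * y.shift t := by
  cases x <;> cases y <;> simp_all [shift, mk_mul_mk]
  split_ifs <;> simp; ring

/-- Letters of a given class. -/
def out (n : ℕ) (R L : Type u) [CommRing R] [AddCommGroup L] [Module R L] :
    Gr → Submodule R (Mor n R L)
  | one => ⊥
  | zero => ⊥
  | mk a b d => hom a b (d + 1)

end Gr

local notation "Hm" => hom (R := R)

/-- The class of a word with letters of given types. -/
def cls (s : List (Obj × Obj × ℤ)) : Gr := (s.map fun p => Gr.mk p.1 p.2.1 p.2.2).prod

lemma cls_cons (p : Obj × Obj × ℤ) (s : List (Obj × Obj × ℤ)) :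
    cls (p :: s) = Gr.mk p.1 p.2.1 p.2.2 * cls s := by simp [cls]

lemma cls_append (s t : List (Obj × Obj × ℤ)) : cls (s ++ t) = cls s * cls t := by simp [cls]

lemma cls_ne_one {s : List (Obj × Obj × ℤ)} (h : s ≠ []) : cls s ≠ Gr.one := by
  rcases s with _ | ⟨p, s⟩
  · exact absurd rfl h
  · rw [cls_cons]
    cases cls s <;> simp only [Gr.mul_one', Gr.mul_zero', Gr.mk_mul_mk] <;>
      try split_ifs
    all_goals simp

/-- The words formed by homogeneous letters, of class `γ`. -/
def IsHomWord (l : List ℳ) (γ : Gr) : Prop :=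
  ∃ s, List.Forall₂ (fun x (p : Obj × Obj × ℤ) => x ∈ (Gr.mk p.1 p.2.1 p.2.2).out n R L) l s ∧
    cls s = γ

lemma isHomWord_nil : IsHomWord ([] : List ℳ) Gr.one := ⟨[], .nil, rfl⟩

lemma IsHomWord.eq_one {γ : Gr} (h : IsHomWord ([] : List ℳ) γ) : γ = Gr.one := by
  obtain ⟨s, hs, rfl⟩ := h
  cases hs
  rfl

lemma IsHomWord.ne_one {a : ℳ} {l : List ℳ} {γ : Gr} (h : IsHomWord (a :: l) γ) : γ ≠ Gr.one := by
  obtain ⟨s, hs, rfl⟩ := h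
  cases hs
  exact cls_ne_one (by simp)

lemma IsHomWord.append {l l' : List ℳ} {γ γ' : Gr} (h : IsHomWord l γ)
    (h' : IsHomWord l' γ') : IsHomWord (l ++ l') (γ * γ') := by
  obtain ⟨s, hs, rfl⟩ := h; obtain ⟨s', hs', rfl⟩ := h'
  exact ⟨s ++ s', List.rel_append hs hs', cls_append _ _⟩

lemma IsHomWord.split {l l' : List ℳ} {γ : Gr} (h : IsHomWord (l ++ l') γ) :
    ∃ α β, IsHomWord l α ∧ IsHomWord l' β ∧ γ = α * β := by
  obtain ⟨s, hs, rfl⟩ := h; have h1 := List.forall₂_take l.length hs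
  have h2 := List.forall₂_drop l.length hs; rw [List.take_left] at h1; rw [List.drop_left] at h2
  refine ⟨cls (s.take l.length), cls (s.drop l.length), ⟨_, h1, rfl⟩, ⟨_, h2, rfl⟩, ?_⟩
  rw [← cls_append, List.take_append_drop]

lemma isHomWord_singleton {x : ℳ} {a b : Obj} {d : ℤ} (h : x ∈ Hm a b (d + 1)) :
    IsHomWord [x] (Gr.mk a b d) := ⟨[(a, b, d)], .cons h .nil, by simp [cls]⟩

variable (n R L) in
/-- The span of the words of class `γ`. -/
def TG (γ : Gr) : Submodule R (TM n R L) := Submodule.span R (wd '' {l | IsHomWord l γ})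

lemma wd_mem_TG {l : List ℳ} {γ : Gr} (h : IsHomWord l γ) : wd l ∈ TG n R L γ :=
  subset_span ⟨l, h, rfl⟩

lemma mul_mem_TG {s t : 𝕋} {γ γ' : Gr} (hs : s ∈ TG n R L γ) (ht : t ∈ TG n R L γ') :
    s * t ∈ TG n R L (γ * γ') := by
  have : s * t ∈ TG n R L γ * TG n R L γ' := Submodule.mul_mem_mul hs ht
  rw [TG, TG, Submodule.span_mul_span] at this; refine Submodule.span_le.2 ?_ this
  rintro _ ⟨_, ⟨l, hl, rfl⟩, _, ⟨l', hl', rfl⟩, rfl⟩; have := wd_mem_TG (IsHomWord.append hl hl')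
  rwa [wd_append] at this

lemma ι_mem_TG {x : ℳ} {γ : Gr} (h : x ∈ γ.out n R L) : ι R x ∈ TG n R L γ := by
  cases γ with
  | one => rw [show x = 0 from h, map_zero]; exact zero_mem _
  | zero => rw [show x = 0 from h, map_zero]; exact zero_mem _
  | mk a b d => simpa using wd_mem_TG (isHomWord_singleton h)

/-- Cochains homogeneous of degree `t`. -/
def Homog (t : ℤ) (F : ℭ) : Prop := ∀ l γ, IsHomWord l γ → F (wd l) ∈ (γ.shift t).out n R L

/-- Endomorphisms homogeneous of degree `t`. -/
def HomogT (t : ℤ) (X : 𝕋 →ₗ[R] 𝕋) : Prop := ∀ l γ, IsHomWord l γ → X (wd l) ∈ TG n R L (γ.shift t)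

lemma Homog.apply {t : ℤ} {F : ℭ} (hF : Homog t F) {γ : Gr} {s : 𝕋}
    (hs : s ∈ TG n R L γ) : F s ∈ (γ.shift t).out n R L := by
  refine (Submodule.span_le (p := ((γ.shift t).out n R L).comap F)).2 ?_ hs; rintro _ ⟨l, hl, rfl⟩
  exact hF l γ hl

lemma HomogT.apply {t : ℤ} {X : 𝕋 →ₗ[R] 𝕋} (hX : HomogT t X) {γ : Gr} {s : 𝕋}
    (hs : s ∈ TG n R L γ) : X s ∈ TG n R L (γ.shift t) := by
  refine (Submodule.span_le (p := (TG n R L (γ.shift t)).comap X)).2 ?_ hs; rintro _ ⟨l, hl, rfl⟩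
  exact hX l γ hl

lemma Homog.comp {s t : ℤ} {F : ℭ} {X : 𝕋 →ₗ[R] 𝕋}
    (hF : Homog t F) (hX : HomogT s X) : Homog (s + t) (F.comp X) := fun l γ h => by
  rw [← Gr.shift_shift]; exact hF.apply (hX l γ h)

lemma HomogT.comp {s t : ℤ} {Y X : 𝕋 →ₗ[R] 𝕋}
    (hY : HomogT t Y) (hX : HomogT s X) : HomogT (s + t) (Y.comp X) := fun l γ h => by
  rw [← Gr.shift_shift]; exact hY.apply (hX l γ h)

lemma homogT_id : HomogT 0 (idL : 𝕋 →ₗ[R] 𝕋) := fun l γ h => by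
  rw [Gr.shift_zero]; exact wd_mem_TG h

lemma Homog.add {t : ℤ} {F F' : ℭ} (hF : Homog t F) (hF' : Homog t F') :
    Homog t (F + F') := fun l γ h => Submodule.add_mem _ (hF l γ h) (hF' l γ h)

lemma Homog.sub {t : ℤ} {F F' : ℭ} (hF : Homog t F) (hF' : Homog t F') :
    Homog t (F - F') := fun l γ h => Submodule.sub_mem _ (hF l γ h) (hF' l γ h)

lemma HomogT.sub {t : ℤ} {F F' : 𝕋 →ₗ[R] 𝕋} (hF : HomogT t F) (hF' : HomogT t F') :
    HomogT t (F - F') := fun l γ h => Submodule.sub_mem _ (hF l γ h) (hF' l γ h)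

lemma Homog.map_one {t : ℤ} {F : ℭ} (hF : Homog t F) : F 1 = 0 := hF [] _ isHomWord_nil

lemma eps_wd {W : Type*} [AddCommGroup W] [Module R W] {l : List W} (h : l ≠ []) :
    eps (wd (R := R) l) = 0 := by
  rcases l with _ | ⟨a, l⟩
  · exact absurd rfl h
  · rw [wd_cons, eps_cons]

lemma Homog.hat {F : ℭ} (hF : Homog 0 F) : HomogT 0 (hat F) := by
  intro l γ hl; rw [Gr.shift_zero]; have hP := isCoalg_hat hF.map_one
  induction hk : l.length using Nat.strong_induction_on generalizing l γ with
  | _ k ih =>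
    rcases l with _ | ⟨a, l⟩
    · rw [wd_nil, hP.map_one, hl.eq_one]; exact wd_mem_TG isHomWord_nil
    · rw [hP.eq_conv, add_apply, comp_apply, eps_wd (by simp),
        map_zero, zero_add, pr_comp_hat hF.map_one]
      refine conv_wd_mem (TG n R L γ).toAddSubmonoid _ _ _ fun u v huv => ?_; rw [← huv] at hl
      obtain ⟨α, β, hα, hβ, rfl⟩ := hl.split
      have hlen : u.length + v.length = k := by rw [← hk, ← huv, length_append]
      rcases u with _ | ⟨b, u⟩
      · simp [hF.map_one]
      · have := hF _ _ hα; rw [Gr.shift_zero] at this; simp only [length_cons] at hlen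
        exact mul_mem_TG (ι_mem_TG this) (ih _ (by omega) v β hβ rfl)

lemma Homog.coder {t : ℤ} {P Q : 𝕋 →ₗ[R] 𝕋} {H : ℭ}
    (hH : Homog t H) (hP : HomogT 0 P) (hQ : HomogT 0 Q) : HomogT t (coder P H Q) := by
  intro l γ hl; refine coder_wd_mem (TG n R L (γ.shift t)).toAddSubmonoid fun u v x huvx => ?_
  rw [← huvx] at hl; obtain ⟨α, δ, hα, hδ, rfl⟩ := hl.split; obtain ⟨β, ε, hβ, hε, rfl⟩ := hδ.split
  rcases v with _ | ⟨b, v⟩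
  · simp [hH.map_one]
  · have hne := hβ.ne_one; have hne' : β * ε ≠ Gr.one := by have := hδ.ne_one; exact this
    have e : (α * (β * ε)).shift t = α * (β.shift t * ε) := by
      rw [Gr.shift_mul_right hne', Gr.shift_mul_left hne]
    rw [e]; have h1 := hP _ _ hα; have h2 := hQ _ _ hε; rw [Gr.shift_zero] at h1 h2
    exact mul_mem_TG h1 (mul_mem_TG (ι_mem_TG (hH _ _ hβ)) h2)

lemma tau_mem_out {x : ℳ} {γ : Gr} (h : x ∈ γ.out n R L) : ϑ x ∈ γ.out n R L := by
  cases γ with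
  | one => rw [show x = 0 from h, map_zero]; exact zero_mem _
  | zero => rw [show x = 0 from h, map_zero]; exact zero_mem _
  | mk a b d => exact Submodule.neg_mem _ (koszul_mem h 1)

lemma homogT_th : HomogT 0 (th ϑ) := by
  intro l γ hl; rw [Gr.shift_zero, th_wd]; refine wd_mem_TG ?_; obtain ⟨s, hs, rfl⟩ := hl
  refine ⟨s, ?_, rfl⟩; rw [List.forall₂_map_left_iff]; exact hs.imp fun _ _ h => tau_mem_out h

lemma Homog.bh {B : ℭ} (hB : Homog 1 B) : HomogT 1 (bh ϑ B) := hB.coder homogT_th homogT_id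

lemma linearMap_ext_homWord {N : Type*} [AddCommGroup N] [Module R N] {φ ψ : 𝕋 →ₗ[R] N}
    (h : ∀ l γ, IsHomWord l γ → φ (wd l) = ψ (wd l)) : φ = ψ := by
  have key : Submodule.span R (wd (R := R) '' {l : List ℳ | ∃ γ, IsHomWord (R := R) l γ}) = ⊤ := by
    refine Submodule.eq_top_iff'.2 fun t => ?_
    induction t using leftInduction with
    | one => exact subset_span ⟨[], ⟨_, isHomWord_nil⟩, rfl⟩
    | cons a t ht =>
      rw [← sum_homProj (R := R) a, map_sum, Finset.sum_mul]
      refine Submodule.sum_mem _ fun p _ => ?_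
      refine Submodule.span_induction (p := fun t _ => _ * t ∈ _) ?_ (by simp) ?_ ?_ ht
      · rintro _ ⟨l, ⟨γ, hl⟩, rfl⟩; have h1 := homProj_mem (R := R) p.1 p.2.1 p.2.2 a
        rw [← sub_add_cancel p.2.2 1] at h1
        exact subset_span ⟨_ :: l, ⟨_, (isHomWord_singleton h1).append hl⟩, by simp⟩
      · intro x y _ _ hx hy; rw [mul_add]; exact Submodule.add_mem _ hx hy
      · intro r x _ hx; rw [mul_smul_comm]; exact smul_mem _ _ hx
    | add s t hs ht => exact Submodule.add_mem _ hs ht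
    | smul r t ht => exact smul_mem _ _ ht
  refine LinearMap.ext_on key ?_; rintro _ ⟨l, ⟨γ, hl⟩, rfl⟩; exact h l γ hl

lemma tau_of_mem_out {x : ℳ} {a b : Obj} {d : ℤ} (h : x ∈ (Gr.mk a b d).out n R L) :
    ϑ x = (-1 : R) ^ d.natAbs • x := by
  rw [tau_apply, koszul_of_mem h, ← neg_smul, pow_one]; congr 1
  have := neg_one_pow_natAbs (R := R) 1 (d + 1) ((d.natAbs + 1 : ℕ) : ℤ) (by
    rcases Int.natAbs_eq d with h | h
    · push_cast; rw [← Int.natCast_natAbs]; exact ⟨0, by omega⟩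
    · exact ⟨d, by omega⟩)
  rw [pow_one, Int.natAbs_natCast] at this; rw [this, pow_succ]; ring

lemma th_wd_of_homWord {l : List ℳ} {a b : Obj} {d : ℤ}
    (h : IsHomWord l (Gr.mk a b d)) : th ϑ (wd l) = (-1 : R) ^ d.natAbs • wd l := by
  have key : ∀ (l : List ℳ) s,
      List.Forall₂ (fun x (p : Obj × Obj × ℤ) => x ∈ (Gr.mk p.1 p.2.1 p.2.2).out n R L) l s →
      ∃ e : ℕ, th ϑ (wd l) = (-1 : R) ^ e • wd l ∧ (cls s = Gr.one → e = 0) ∧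
        ∀ a b d, cls s = Gr.mk a b d → Even (d - e) := by
    intro l s h
    induction h with
    | nil => exact ⟨0, by simp [th_one], fun _ => rfl, fun a b d h => by simp [cls, Gr.one_def] at h⟩
    | @cons x p l s hx hs ih =>
      obtain ⟨e, h1, h1', h2⟩ := ih
      refine ⟨p.2.2.natAbs + e, ?_, fun h => absurd h (cls_ne_one (by simp)), fun a b d hd => ?_⟩
      · rw [wd_cons, th_mul, th_ι, tau_of_mem_out hx, h1, map_smul, smul_mul_smul_comm, pow_add]
      · rw [cls_cons] at hd; have hp : Even (p.2.2 - p.2.2.natAbs) := by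
          rcases Int.natAbs_eq p.2.2 with h | h
          · exact ⟨0, by omega⟩
          · exact ⟨p.2.2, by omega⟩
        push_cast; rcases hc : cls s with _ | _ | ⟨a', b', d'⟩
        · rw [hc, Gr.mul_one'] at hd
          cases hd
          rw [h1' hc]; simpa using hp
        · rw [hc, Gr.mul_zero'] at hd
          cases hd
        · rw [hc, Gr.mk_mul_mk] at hd
          split_ifs at hd
          cases hd
          have := hp.add (h2 _ _ _ hc); obtain ⟨r, hr⟩ := this
          exact ⟨r, by push_cast at hr ⊢; omega⟩
  obtain ⟨s, hs, hc⟩ := h; obtain ⟨e, h1, -, h2⟩ := key l s hs; rw [h1]; congr 1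
  have := neg_one_pow_natAbs (R := R) 1 d e (h2 _ _ _ hc); rw [pow_one, Int.natAbs_natCast] at this
  exact this.symm

lemma Homog.tau_apply {t : ℤ} {F : ℭ} (hF : Homog t F) (s : 𝕋) :
    ϑ (F s) = (-1 : R) ^ t.natAbs • F (th ϑ s) := by
  have : (ϑ).comp F = (-1 : R) ^ t.natAbs • F.comp (th ϑ) := by
    refine linearMap_ext_homWord fun l γ hl => ?_; simp only [comp_apply, LinearMap.smul_apply]
    have h1 := hF l γ hl
    cases γ with
    | one =>
      have h2 := hF.apply (homogT_th l _ hl)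
      rw [show F (wd l) = 0 from h1, show F (th ϑ (wd l)) = 0 from h2]; simp
    | zero =>
      have h2 := hF.apply (homogT_th l _ hl)
      rw [show F (wd l) = 0 from h1, show F (th ϑ (wd l)) = 0 from h2]; simp
    | mk a b d =>
      rw [tau_of_mem_out h1, th_wd_of_homWord hl, map_smul, smul_smul, ← pow_add]; congr 1
      have := neg_one_pow_natAbs (R := R) 1 (d + t) ((t.natAbs + d.natAbs : ℕ) : ℤ) (by
        push_cast; have h3 : ∀ z : ℤ, Even (z - |z|) := fun z => by
          rcases abs_choice z with h | h <;> rw [h]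
          · simp
          · exact ⟨z, by ring⟩
        have := (h3 d).add (h3 t); obtain ⟨r, hr⟩ := this; exact ⟨r, by omega⟩)
      rw [pow_one, Int.natAbs_natCast] at this; exact this
  exact lcongr this s

lemma Homog.isOdd {B : ℭ} {t : ℤ} (hB : Homog t B) (ht : t.natAbs = 1) : IsOdd ϑ B := fun s => by
  rw [hB.tau_apply, ht]; simp

lemma Homog.isEven {F : ℭ} (hF : Homog 0 F) : IsEven ϑ F := fun s => by rw [hF.tau_apply]; simp

lemma hom_eq_zero {d : ℤ} {x : ℳ} (h : x ∈ Hm .X .X d) (h' : x ∈ Hm .Y .Y d) : x = 0 := by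
  obtain ⟨h1, h2, h3, h4, h5, h6⟩ := h; obtain ⟨k1, k2, k3, k4, k5, k6⟩ := h'
  refine Prod.ext (Prod.ext (k1 ?_) (h2 ?_))
    (Prod.ext (Prod.ext (k3 ?_) (h4 ?_)) (Prod.ext (h5 ?_) (h6 ?_))) <;> simp

lemma cls_ofFn : ∀ {k : ℕ} (c : Fin (k + 2) → Obj) (e : Fin (k + 1) → ℤ),
    cls (ofFn fun i : Fin (k + 1) => (c i.succ, c i.castSucc, e i)) =
      Gr.mk (c (Fin.last _)) (c 0) (∑ i, e i)
  | 0, c, e => by rw [List.ofFn_succ, cls_cons]; simp [cls, Gr.one_def]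
  | k + 1, c, e => by
    rw [List.ofFn_succ, cls_cons]; have := cls_ofFn (k := k) (fun i => c i.succ) (fun i => e i.succ)
    simp only [Fin.succ_castSucc] at this; simp only [← Fin.succ_castSucc] at this ⊢
    rw [this, Gr.mk_mul_mk, if_pos rfl, Fin.sum_univ_succ e]; rfl

lemma cls_eq_zero {s : List (Obj × Obj × ℤ)} {i : ℕ} (hi : i + 1 < s.length)
    (h : (s[i]).1 ≠ (s[i + 1]).2.1) : cls s = Gr.zero := by
  rw [← List.take_append_drop i s, cls_append, List.drop_eq_getElem_cons (by omega),
    List.drop_eq_getElem_cons hi, cls_cons, cls_cons, ← mul_assoc (Gr.mk _ _ _), Gr.mk_mul_mk,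
    if_neg h, Gr.zero_mul', Gr.mul_zero']

lemma homog_tw_iff {t : ℤ} {f : ∀ k, Op n R L k} :
    Homog t (tw f) ↔ ∀ k : ℕ, IsCochain (1 - (k : ℤ) + t) (f k) := by
  constructor
  · intro h k; have hval : ∀ x : Fin k → ℳ, f k x = tw f (wd (ofFn fun i : Fin k =>
        Kz (k - 1 - i) (x i))) := by
      intro x; have := untw_apply (tw f) k (extSeq x); rw [untw_tw] at this
      simpa [extSeq, sw] using this
    have hword : ∀ (a b : Fin k → Obj) (d : Fin k → ℤ) (x : Fin k → ℳ),
        (∀ i, x i ∈ Hm (a i) (b i) (d i)) →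
        List.Forall₂ (fun x (p : Obj × Obj × ℤ) => x ∈ (Gr.mk p.1 p.2.1 p.2.2).out n R L)
          (ofFn fun i : Fin k => Kz (k - 1 - i) (x i)) (ofFn fun i => (a i, b i, d i - 1)) := by
      intro a b d x hx; rw [List.forall₂_iff_get]; refine ⟨by simp, fun i h1 h2 => ?_⟩
      simp only [List.get_eq_getElem, List.getElem_ofFn]; change _ ∈ hom _ _ (d _ - 1 + 1)
      rw [sub_add_cancel]; exact koszul_mem (hx _) _
    refine ⟨fun c d x hx => ?_, fun a b d x hx hab => ?_⟩
    · rw [hval]; have := h _ _ ⟨_, hword _ _ d x hx, rfl⟩; rcases k with _ | k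
      · have h0 : tw f (wd (ofFn fun i : Fin 0 => Kz (0 - 1 - i) (x i))) = 0 := this; rw [h0]
        exact zero_mem _
      · rw [cls_ofFn c (fun i => d i - 1)] at this
        have e : ∑ i, (d i - 1) + t + 1 = ∑ i, d i + (1 - ((k + 1 : ℕ) : ℤ) + t) := by
          rw [sum_sub_distrib]; simp; ring
        change _ ∈ hom _ _ (∑ i, (d i - 1) + t + 1) at this; rwa [e] at this
    · rw [hval]; obtain ⟨i, j, hij, hne⟩ := hab; have := h _ _ ⟨_, hword a b d x hx, rfl⟩
      rw [cls_eq_zero (i := i) (by simp; omega) (by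
        simp only [List.getElem_ofFn]
        rw [show (⟨(i : ℕ) + 1, by omega⟩ : Fin k) = j from Fin.ext hij]; exact hne)] at this
      exact this
  · rintro h l γ ⟨s, hs, rfl⟩; have hlen := hs.length_eq
    obtain ⟨k, hk⟩ : ∃ k, k = l.length := ⟨_, rfl⟩; rw [wd_eq_sw, ← hk, tw_sw]
    rw [List.forall₂_iff_get] at hs; have hx : ∀ i : Fin k, Kz (k - 1 - i) (l.getD i 0) ∈
        Hm (s[(i : ℕ)]'(by omega)).1 (s[(i : ℕ)]'(by omega)).2.1
          ((s[(i : ℕ)]'(by omega)).2.2 + 1) := by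
      intro i; rw [List.getD_eq_getElem _ _ (by omega)]
      exact koszul_mem (hs.2 i (by omega) (by omega)) _
    by_cases hab : ∃ i j : Fin k, (i : ℕ) + 1 = j ∧
        (s[(i : ℕ)]'(by omega)).1 ≠ (s[(j : ℕ)]'(by omega)).2.1
    · rw [(h k).zero _ _ _ _ hx hab]; exact zero_mem _
    · push Not at hab
      rcases k with _ | k
      · have h0 : ∀ x, f 0 x = 0 := fun x => hom_eq_zero
          ((h 0).mem (fun _ => .X) (fun i => i.elim0) x (fun i => i.elim0))
          ((h 0).mem (fun _ => .Y) (fun i => i.elim0) x (fun i => i.elim0)); rw [h0]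
        exact zero_mem _
      · set c : Fin (k + 2) → Obj := Fin.cons (s[0]'(by omega)).2.1
          (fun i : Fin (k + 1) => (s[(i : ℕ)]'(by omega)).1) with hc
        have hc1 : ∀ i : Fin (k + 1), c i.succ = (s[(i : ℕ)]'(by omega)).1 := fun i => by simp [hc]
        have hc2 : ∀ i : Fin (k + 1), c i.castSucc = (s[(i : ℕ)]'(by omega)).2.1 := fun i => by
          refine Fin.cases ?_ (fun i => ?_) i
          · rfl
          · rw [← Fin.succ_castSucc, hc1]; exact hab i.castSucc i.succ (by simp)
        have hs' : s = ofFn fun i : Fin (k + 1) =>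
            (c i.succ, c i.castSucc, (s[(i : ℕ)]'(by omega)).2.2) := by
          refine List.ext_getElem (by simp; omega) fun i h1 h2 => ?_
          simp only [List.getElem_ofFn, hc1, hc2]
        have := (h (k + 1)).mem c _ _ (fun i => by rw [hc1, hc2]; exact hx i)
        have hcls := congrArg cls hs'; rw [cls_ofFn] at hcls; rw [hcls]
        change _ ∈ hom _ _ (_ + t + 1); convert this using 2; rw [sum_add_distrib]; simp; ring

/-! ## Minimal structures as coderivations -/

lemma wdInduction {W : Type*} [AddCommGroup W] [Module R W] {C : TensorAlgebra R W → Prop}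
    (word : ∀ l, C (wd l)) (add : ∀ s t, C s → C t → C (s + t))
    (smul : ∀ (r : R) t, C t → C (r • t)) (t : TensorAlgebra R W) : C t := by
  have ht : t ∈ Submodule.span R (Set.range (wd : List W → TensorAlgebra R W)) := by
    rw [span_wd]; trivial
  induction ht using Submodule.span_induction with
  | mem x hx => obtain ⟨l, rfl⟩ := hx; exact word l
  | zero => simpa using smul 0 _ (word [])
  | add x y _ _ hx hy => exact add _ _ hx hy
  | smul r x _ hx => exact smul _ _ hx

lemma pr_wd_eq_zero {W : Type*} [AddCommGroup W] [Module R W] {l : List W} (h : l.length ≠ 1) :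
    pr (wd (R := R) l) = 0 := by
  rcases l with _ | ⟨a, _ | ⟨b, l⟩⟩
  · exact pr_one
  · simp at h
  · rw [wd_cons, pr_cons, eps_wd (by simp), zero_smul]

variable (n R L) in
/-- The sum of the identity morphisms. -/
def oneM : Mor n R L := ((1, 1), 0, 0, 0)

lemma koszul_oneM (s : ℕ) : koszul (R := R) s (oneM n R L) = oneM n R L := by simp [koszul, oneM]

lemma tau_oneM : ϑ (oneM n R L) = -oneM n R L := by rw [tau_apply, koszul_oneM]

/-- The identity morphisms. -/
def idM (n : ℕ) (R L : Type u) [CommRing R] [AddCommGroup L] [Module R L] : Obj → Mor n R L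
  | .X => ((1, 0), 0, 0, 0)
  | .Y => ((0, 1), 0, 0, 0)

lemma idM_mem (v : Obj) : idM n R L v ∈ hom (R := R) v v 0 := by
  cases v <;> refine ⟨?_, ?_, ?_, ?_, ?_, ?_⟩ <;> simp [idM]

lemma exists_smul_idM {v : Obj} {x : ℳ} (hx : x ∈ hom (R := R) v v 0) :
    ∃ r : R, x = r • idM n R L v := by
  obtain ⟨⟨x1, x2⟩, ⟨x3, x4⟩, x5, x6⟩ := x; obtain ⟨h1, h2, h3, h4, h5, h6⟩ := hx
  simp only at h1 h2 h3 h4 h5 h6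
  cases v
  · refine ⟨x1, ?_⟩; rw [h2 (by simp), h3 (by simp), h4 (by simp), h5 (by simp), h6 (by simp)]
    simp [idM]
  · refine ⟨x2, ?_⟩; rw [h1 (by simp), h3 (by simp), h4 (by simp), h5 (by simp), h6 (by simp)]
    simp [idM]

lemma idM_add_idM {v w : Obj} (h : v ≠ w) : idM n R L v + idM n R L w = oneM n R L := by
  cases v <;> cases w <;> simp_all [idM, oneM]

lemma IsReduced.oneM {k : ℕ} {f : Op n R L k} (hf : IsReduced f) (x : Fin k → ℳ)
    (i : Fin k) (hx : x i = oneM n R L) : f x = 0 := by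
  rw [← Function.update_eq_self i x, hx, ← idM_add_idM (v := .X) (w := .Y) (by simp),
    MultilinearMap.map_update_add, hf _ i .X (by simp [idM_mem]), hf _ i .Y (by simp [idM_mem]),
    add_zero]

lemma isReduced_of_oneM {k : ℕ} {t : ℤ} {f : Op n R L k} (hf : IsCochain t f) (hk : 2 ≤ k)
    (h : ∀ (x : Fin k → ℳ) (i : Fin k), x i = oneM n R L → f x = 0) : IsReduced f := by
  classical
  intro x i v hx
  have key : f.compLinearMap (fun j => if j = i then homProj (R := R) v v 0 else idL) = 0 := by
    refine Op.ext_homog fun a b d y hy => ?_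
    have hz : ∀ w, ∀ j, update y i (idM n R L w) j ∈ hom (R := R) (update a i w j) (update b i w j)
          (update d i 0 j) := by
      intro w j
      by_cases hj : j = i
      · subst hj; simpa using idM_mem w
      · simpa [hj] using hy j
    have ho : ∃ o : Obj, ∀ w, w ≠ o → f (update y i (idM n R L w)) = 0 := by
      by_cases hi : (i : ℕ) + 1 < k
      · refine ⟨b ⟨i + 1, hi⟩, fun w hw => hf.zero _ _ _ _ (hz w) ⟨i, ⟨i + 1, hi⟩, rfl, ?_⟩⟩
        have : (⟨i + 1, hi⟩ : Fin k) ≠ i := fun h => by have := congrArg Fin.val h; simp at this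
        simpa [this] using hw
      · refine ⟨a ⟨i - 1, by omega⟩, fun w hw => hf.zero _ _ _ _ (hz w)
          ⟨⟨i - 1, by omega⟩, i, by simp; omega, ?_⟩⟩
        have : (⟨(i : ℕ) - 1, by omega⟩ : Fin k) ≠ i := fun h => by
          have := congrArg Fin.val h; simp at this; omega
        simpa [this] using hw.symm
    obtain ⟨o, ho⟩ := ho; have hv : f (update y i (idM n R L v)) = 0 := by
      by_cases hvo : v = o
      · obtain ⟨w, hw⟩ : ∃ w, w ≠ v := by
          cases v
          · exact ⟨.Y, by simp⟩
          · exact ⟨.X, by simp⟩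
        have h1 := h (update y i (SphPair.oneM n R L)) i (by simp)
        rwa [← idM_add_idM hw.symm, MultilinearMap.map_update_add, ho w (hvo ▸ hw), add_zero] at h1
      · exact ho v hvo
    obtain ⟨r, hr⟩ := exists_smul_idM (homProj_mem (R := R) v v 0 (y i))
    have e : (fun j => (if j = i then homProj (R := R) v v 0 else idL) (y j)) =
        update y i (r • idM n R L v) := by
      ext1 j
      by_cases hj : j = i
      · subst hj; simp [hr]
      · simp [hj]
    rw [MultilinearMap.compLinearMap_apply, e, MultilinearMap.map_update_smul, hv, smul_zero]; rfl
  have := congrArg (fun F => F x) key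
  simp only [MultilinearMap.compLinearMap_apply, _root_.zero_apply] at this; rw [← this]; congr 1
  ext1 j
  by_cases hj : j = i
  · subst hj; simp [mem_hom_iff.1 hx]
  · simp [hj]

/-- Minimal structures on `S(Rⁿ, g)` as cochains on the tensor coalgebra. -/
structure IsStr (N : ℕ∞) (g : Mat n L) (B : ℭ) : Prop where
  homog : Homog 1 B
  red : RedB ϑ (oneM n R L) B
  letter : ∀ a, B (ι R a) = 0
  two : ∀ a b, B (ι R a * ι R b) = compo (R := R) g ![koszul (R := R) 1 a, b]
  top : ∀ l : List ℳ, N < l.length → B (wd l) = 0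
  sq : ∀ k : ℕ, (k : ℕ∞) ≤ N + 1 → ∀ t ∈ Tle R ℳ k, B (bh ϑ B t) = 0

/-- Strictly unital morphisms which are the identity on letters, as cochains. -/
structure IsGauge (F : ℭ) : Prop where
  homog : Homog 0 F
  red : RedF (oneM n R L) F
  letter : ∀ a, F (ι R a) = a

/-- `F` is compatible with the structures `B`, `B'` in arities at most `N`. -/
def GRel (N : ℕ∞) (B B' F : ℭ) : Prop :=
  ∀ k : ℕ, (k : ℕ∞) ≤ N → ∀ t ∈ Tle R ℳ k, F (bh ϑ B t) = B' (hat F t)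

lemma compo_oneM_left (g : Mat n L) (y : ℳ) : compo (R := R) g ![oneM n R L, y] = y := by
  simp [compo, MultilinearMap.mk', oneM]

lemma compo_oneM_right (g : Mat n L) (x : ℳ) : compo (R := R) g ![x, oneM n R L] = x := by
  simp [compo, MultilinearMap.mk', oneM]

lemma tw_ι (f : ∀ k, Op n R L k) (a : ℳ) : tw f (ι R a) = f 1 (fun _ => a) := by
  have := tw_sw f (fun _ => a) 1; rw [sw_one] at this; rw [this]; congr 1; ext1 i
  exact koszul_of_even (by omega) a

lemma tw_ι_mul_ι (f : ∀ k, Op n R L k) (a b : ℳ) :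
    tw f (ι R a * ι R b) = f 2 ![koszul (R := R) 1 a, b] := by
  have := tw_sw f (fun i => if i = 0 then a else b) 2; rw [sw_succ, sw_one] at this
  simp only [zero_add, one_ne_zero, if_true, if_false] at this; rw [this]; congr 1; ext1 i
  refine Fin.cases ?_ (fun i => ?_) i
  · rfl
  · rw [Subsingleton.elim i 0]; simp [koszul_zero]

lemma tw_wd_oneM (f : ∀ k, Op n R L k) (u v : List ℳ)
    (h : ∀ (x : Fin (u.length + 1 + v.length) → ℳ) (i : Fin (u.length + 1 + v.length)),
      x i = oneM n R L → f (u.length + 1 + v.length) x = 0) :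
    tw f (wd u * (ι R (oneM n R L) * wd v)) = 0 := by
  have e : wd u * (ι R (oneM n R L) * wd v) = wd (R := R) (u ++ oneM n R L :: v) := by
    rw [wd_append, wd_cons]
  have hlen : (u ++ oneM n R L :: v).length = u.length + 1 + v.length := by simp; omega
  rw [e, wd_eq_sw, hlen, tw_sw]; refine h _ ⟨u.length, by omega⟩ ?_
  rw [List.getD_eq_getElem _ _ (by simp)]; simp [koszul_oneM]

lemma untw_oneM {B : ℭ} {k : ℕ} (h : ∀ u v : List ℳ, u.length + 1 + v.length = k →
      B (wd u * (ι R (oneM n R L) * wd v)) = 0) (x : Fin k → ℳ) (i : Fin k)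
    (hx : x i = oneM n R L) : untw B k x = 0 := by
  have := untw_apply B k (extSeq x)
  have e1 : (fun i : Fin k => extSeq x i) = x := by ext1 i; simp [extSeq]
  rw [e1] at this; rw [this]; obtain ⟨j, hj⟩ : ∃ j, k = i + (1 + j) := ⟨k - 1 - i, by omega⟩
  have h2 : ∀ b : ℕ → ℳ, b i = oneM n R L → B (sw R b k) = 0 := by
    intro b hb; rw [hj, sw_add, sw_add, sw_one]; simp only [add_zero, hb]
    exact h _ _ (by simp; omega)
  refine h2 _ ?_; have : extSeq x i = oneM n R L := by simp [extSeq, hx]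
  rw [this, koszul_oneM]

lemma MinAInf.isStr {N : ℕ∞} {g : Mat n L} (m : MinAInf (R := R) N g) : IsStr N g (tw m.m) where
  homog := homog_tw_iff.2 fun k => by
    have := m.cochain k; rwa [show (1 : ℤ) - k + 1 = 2 - k by ring]
  red s t := by
    induction s using wdInduction with
    | add a b ha hb => simp only [add_mul, map_add, ha, hb, add_smul, smul_add]; abel
    | smul r a ha =>
      simp only [smul_mul_assoc, map_smul, ha, smul_eq_mul, mul_smul, smul_sub]
      rw [smul_comm r (eps t)]
    | word u =>
      induction t using wdInduction with
      | add a b ha hb => simp only [mul_add, map_add, ha, hb, add_smul, smul_add]; abel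
      | smul r a ha =>
        simp only [mul_smul_comm, map_smul, ha, smul_eq_mul, mul_smul, smul_sub]
        rw [smul_comm r (eps (wd u))]
      | word v =>
        by_cases hk : 3 ≤ u.length + 1 + v.length
        · rw [tw_wd_oneM _ _ _ (fun x i hx => (m.reduced _ hk).oneM x i hx)]
          rcases u with _ | ⟨a, u⟩
          · simp only [length_nil] at hk; rw [pr_wd_eq_zero (l := v) (by omega), wd_nil, pr_one]
            simp
          · rw [eps_wd (l := a :: u) (by simp)]; rcases v with _ | ⟨b, v⟩
            · simp only [length_nil, length_cons] at hk
              rw [pr_wd_eq_zero (l := a :: u) (by rw [length_cons]; omega)]; simp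
            · rw [eps_wd (l := b :: v) (by simp)]; simp
        · rcases u with _ | ⟨a, _ | ⟨a', u⟩⟩
          · rcases v with _ | ⟨b, _ | ⟨b', v⟩⟩
            · simp [tw_ι, m.m_one, pr_one]
            · simp only [wd_nil, wd_cons, mul_one, one_mul]
              rw [tw_ι_mul_ι, m.m_two, koszul_oneM, compo_oneM_left]; simp [pr_one]
            · simp at hk; omega
          · rcases v with _ | ⟨b, v⟩
            · simp only [wd_nil, wd_cons, mul_one]; rw [tw_ι_mul_ι, m.m_two, compo_oneM_right]
              simp [pr_one, tau_apply]
            · simp at hk; omega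
          · simp at hk; omega
  letter a := by rw [tw_ι, m.m_one]; rfl
  two a b := by rw [tw_ι_mul_ι, m.m_two]
  top l hl := by rw [wd_eq_sw, tw_sw, m.m_top _ hl]; rfl
  sq k hk t ht := by
    refine eq_of_Tle (φ := (tw m.m).comp (bh ϑ (tw m.m))) (ψ := 0) (fun l hl => ?_) ht
    have := m.stasheff l.length (le_trans (by exact_mod_cast hl) hk)
      (fun i => koszul (R := R) (l.length - 1 - i) (l.getD i 0))
    rw [insertSum_eq _ _ m.cochain] at this
    have e : sw R (fun i => koszul (R := R) (l.length - 1 - i)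
        (koszul (R := R) (l.length - 1 - i) (l.getD i 0))) l.length = wd l := by
      rw [wd_eq_sw]; refine sw_congr fun i _ => ?_; rw [koszul_koszul, koszul_of_even (by omega)]
    rwa [e] at this

/-- The minimal structure given by a cochain. -/
def IsStr.toMin {N : ℕ∞} {g : Mat n L} {B : ℭ} (h : IsStr N g B) : MinAInf (R := R) N g where
  m := untw B
  cochain k := by
    have := h.homog; rw [← tw_untw B, homog_tw_iff] at this; have := this k
    rwa [show (1 : ℤ) - k + 1 = 2 - k by ring] at this
  reduced k hk := by
    have := h.homog; rw [← tw_untw B, homog_tw_iff] at this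
    refine isReduced_of_oneM (this k) (by omega) (untw_oneM fun u v huv => ?_); rw [h.red]
    rcases u with _ | ⟨a, u⟩
    · simp only [length_nil] at huv; rw [pr_wd_eq_zero (l := v) (by omega), wd_nil, pr_one]; simp
    · rw [eps_wd (l := a :: u) (by simp)]; rcases v with _ | ⟨b, v⟩
      · simp only [length_nil, length_cons] at huv
        rw [pr_wd_eq_zero (l := a :: u) (by rw [length_cons]; omega)]; simp
      · rw [eps_wd (l := b :: v) (by simp)]; simp
  m_one := by refine Op.ext_seq fun a => ?_; rw [untw_apply, sw_one, h.letter]; rfl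
  m_two := by
    refine Op.ext_seq fun a => ?_; rw [untw_apply, sw_succ, sw_one, h.two]; congr 1; ext1 i
    refine Fin.cases ?_ (fun i => ?_) i
    · simp [koszul_koszul, koszul_of_even]
    · rw [Subsingleton.elim i 0]; simp [koszul_zero]
  m_top k hk := by
    refine Op.ext_seq fun a => ?_; rw [untw_apply, sw, h.top _ (by simpa using hk)]; rfl
  stasheff k hk a := by
    have := h.homog; rw [← tw_untw B, homog_tw_iff] at this; rw [insertSum_eq _ _ (fun k => by
      have := this k; rwa [show (1 : ℤ) - k + 1 = 2 - k by ring] at this), tw_untw]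
    exact h.sq k hk _ (sw_mem_Tle _ _)

lemma IsStr.tw_toMin {N : ℕ∞} {g : Mat n L} {B : ℭ}
    (h : IsStr N g B) : tw h.toMin.m = B := tw_untw B

lemma gaugeEquiv_iff {N : ℕ∞} {g : Mat n L} {m m' : MinAInf (R := R) N g} :
    GaugeEquiv m m' ↔ ∃ F, IsGauge F ∧ GRel N (tw m.m) (tw m'.m) F := by
  constructor
  · rintro ⟨f, h1, h2, h3, h4⟩
    have hh : Homog 0 (tw f) := homog_tw_iff.2 fun k => by rw [add_zero]; exact h1 k
    refine ⟨tw f, ⟨hh, fun s t => ?_, fun a => by rw [tw_ι, h3]⟩, fun k hk t ht => ?_⟩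
    · induction s using wdInduction with
      | add a b ha hb => simp only [add_mul, map_add, ha, hb, add_smul]
      | smul r a ha => simp only [smul_mul_assoc, map_smul, ha, smul_eq_mul, mul_smul]
      | word u =>
        induction t using wdInduction with
        | add a b ha hb => simp only [mul_add, map_add, ha, hb, add_smul, smul_add]
        | smul r a ha =>
          simp only [mul_smul_comm, map_smul, ha, smul_eq_mul, mul_smul]
          rw [smul_comm r (eps (wd u))]
        | word v =>
          by_cases hk : 2 ≤ u.length + 1 + v.length
          · rw [tw_wd_oneM _ _ _ (fun x i hx => (h2 _ hk).oneM x i hx)]; rcases u with _ | ⟨a, u⟩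
            · rw [eps_wd (l := v) (by rintro rfl; simp at hk)]; simp
            · rw [eps_wd (l := a :: u) (by simp)]; simp
          · have hu : u = [] := length_eq_zero_iff.1 (by omega)
            have hv : v = [] := length_eq_zero_iff.1 (by omega); subst hu hv; simp [tw_ι, h3]
    · refine eq_of_Tle (φ := (tw f).comp (bh ϑ (tw m.m)))
        (ψ := (tw m'.m).comp (hat (tw f))) (fun l hl => ?_) ht
      have := h4 l.length (le_trans (by exact_mod_cast hl) hk)
        (fun i => koszul (R := R) (l.length - 1 - i) (l.getD i 0))
      rw [insertSum_eq _ _ m.cochain, composeSum_eq _ _ h1 hh.map_one] at this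
      have e : sw R (fun i => koszul (R := R) (l.length - 1 - i)
          (koszul (R := R) (l.length - 1 - i) (l.getD i 0))) l.length = wd l := by
        rw [wd_eq_sw]; refine sw_congr fun i _ => ?_; rw [koszul_koszul, koszul_of_even (by omega)]
      rwa [e] at this
  · rintro ⟨F, hF, hrel⟩; have hc : ∀ k : ℕ, IsCochain (1 - (k : ℤ)) (untw F k) := by
      have := hF.homog; rw [← tw_untw F, homog_tw_iff] at this; intro k; have := this k
      rwa [add_zero] at this
    refine ⟨untw F, hc, fun k hk => isReduced_of_oneM (hc k) hk (untw_oneM fun u v huv => ?_),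
      fun x => ?_, fun k hk a => ?_⟩
    · rw [hF.red]; rcases u with _ | ⟨a, u⟩
      · rw [eps_wd (l := v) (by rintro rfl; simp at huv; omega)]; simp
      · rw [eps_wd (l := a :: u) (by simp)]; simp
    · have := untw_apply F 1 (extSeq x); rw [sw_one, hF.letter, koszul_of_even (by omega)] at this
      have e : x = fun _ => x 0 := by ext1 i; rw [Subsingleton.elim i 0]
      rw [e]; simpa [extSeq] using this
    · rw [insertSum_eq _ _ m.cochain, composeSum_eq _ _ hc (by rw [tw_untw]; exact hF.homog.map_one),
        tw_untw]; exact hrel k hk _ (sw_mem_Tle _ _)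

/-! ## Gauge transformations -/

lemma pr_mul {W : Type*} [AddCommGroup W] [Module R W] (s t : TensorAlgebra R W) :
    pr (s * t) = eps s • pr t + eps t • pr s := by
  induction s using leftInduction with
  | one => simp [pr_one]
  | cons a s _ =>
    rw [mul_assoc, pr_cons, pr_cons, eps_cons, zero_smul, zero_add, smul_smul, mul_comm (eps t)]
    congr 1; exact map_mul TensorAlgebra.algebraMapInv s t
  | add s s' h h' => simp only [add_mul, map_add, h, h', add_smul, smul_add]; abel
  | smul r s h =>
    simp only [smul_mul_assoc, map_smul, h, smul_eq_mul, mul_smul, smul_add]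
    rw [smul_comm r (eps t)]

lemma homog_pr : Homog 0 (pr : ℭ) := by
  intro l γ hl; rw [Gr.shift_zero]; rcases l with _ | ⟨a, _ | ⟨b, l⟩⟩
  · rw [wd_nil, pr_one]; exact zero_mem _
  · obtain ⟨s, hs, rfl⟩ := hl
    cases hs with
    | cons h1 h2 =>
      cases h2
      rw [cls_cons]; simpa [cls, Gr.one_def] using h1
  · rw [pr_wd_eq_zero (by simp)]; exact zero_mem _

lemma isGauge_pr : IsGauge (pr : ℭ) where
  homog := homog_pr
  red s t := by rw [pr_mul, pr_cons, eps_cons, zero_smul, add_zero]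
  letter a := pr_ι a

lemma IsGauge.isCoalg {F : ℭ} (hF : IsGauge F) : IsCoalg (hat F) := isCoalg_hat hF.homog.map_one

lemma IsGauge.pr_hat {F : ℭ} (hF : IsGauge F) (t : 𝕋) :
    pr (hat F t) = F t := SphPair.pr_hat hF.homog.map_one t

lemma IsGauge.pr_hat_ι {F : ℭ} (hF : IsGauge F) (a : ℳ) :
    pr (hat F (ι R a)) = a := by rw [hF.pr_hat, hF.letter]

lemma IsGauge.hat_oneM {F : ℭ} (hF : IsGauge F) (s t : 𝕋) :
    hat F (s * (ι R (oneM n R L) * t)) = hat F s * (ι R (oneM n R L) * hat F t) :=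
  hF.red.hat hF.homog.map_one s t

lemma IsGauge.eps_hat {F : ℭ} (hF : IsGauge F) (s : 𝕋) :
    eps (hat F s) = eps s := lcongr hF.isCoalg.eps_comp s

lemma IsGauge.hat_sub_mem {F : ℭ} (hF : IsGauge F) {k : ℕ}
    {t : 𝕋} (ht : t ∈ Tle R ℳ (k + 1)) : hat F t - t ∈ Tle R ℳ k :=
  hat_sub_id_mem hF.isCoalg hF.pr_hat_ι ht

lemma IsGauge.exists_inv {F : ℭ} (hF : IsGauge F) :
    ∃ G : ℭ, IsGauge G ∧ (∀ t, hat G (hat F t) = t) ∧ (∀ t, hat F (hat G t) = t) := by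
  have hP := hF.isCoalg; obtain ⟨Q, hQ, hQ1, hQP, hPQ, hc⟩ := hP.exists_inv hF.pr_hat_ι
    (fun l => {x | ∀ γ, IsHomWord l γ → x ∈ γ.out n R L})
    (fun l γ h => by simpa using homog_pr l γ h) (fun φ hφ l γ h => by
      have h0 : Homog 0 φ := fun l γ h => by rw [Gr.shift_zero]; exact hφ l γ h
      have := (homog_pr.sub (h0.comp (hF.homog.hat.sub homogT_id))) l γ h
      rwa [Gr.shift_zero] at this)
  have hQ' : hat (pr.comp Q) = Q := hQ.eq_hat.symm
  refine ⟨pr.comp Q, ⟨fun l γ h => by rw [Gr.shift_zero]; exact hc l γ h, fun s t => ?_, hQ1⟩,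
    fun t => ?_, fun t => ?_⟩
  · have hs : s = hat F (Q s) := (lcongr hPQ s).symm
    have ht : t = hat F (Q t) := (lcongr hPQ t).symm
    conv_lhs => rw [hs, ht, ← hF.hat_oneM]
    have := lcongr hQP (Q s * (ι R (oneM n R L) * Q t)); rw [comp_apply, LinearMap.id_apply] at this
    rw [comp_apply, this, isGauge_pr.red]
    have e : ∀ s, eps (Q s) = eps s := fun s => lcongr hQ.eps_comp s; rw [e, e]
  · rw [hQ']; exact lcongr hQP t
  · rw [hQ']; exact lcongr hPQ t

lemma IsGauge.hat_comp {F F' : ℭ} (hF : IsGauge F) (hF' : IsGauge F') :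
    hat (F'.comp (hat F)) = (hat F').comp (hat F) := by
  have := (hF'.isCoalg.comp hF.isCoalg).eq_hat
  rw [← comp_assoc, pr_comp_hat hF'.homog.map_one] at this; exact this.symm

lemma IsGauge.comp {F F' : ℭ} (hF : IsGauge F) (hF' : IsGauge F') : IsGauge (F'.comp (hat F)) where
  homog := by simpa using hF'.homog.comp hF.homog.hat
  red s t := by rw [comp_apply, hF.hat_oneM, hF'.red, hF.eps_hat, hF.eps_hat]
  letter a := by rw [comp_apply, hF.isCoalg.map_ι, hF.pr_hat_ι, hF'.letter]

lemma gRel_refl (N : ℕ∞) (B : ℭ) : GRel N B B pr := by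
  intro k _ t _; rw [pr_bh, hat_pr, LinearMap.id_apply]

lemma GRel.trans {N : ℕ∞} {B B' B'' F F' : ℭ} (hF : IsGauge F)
    (hF' : IsGauge F') (h : GRel N B B' F) (h' : GRel N B' B'' F') :
    GRel N B B'' (F'.comp (hat F)) := by
  intro k hk t ht; rw [comp_apply, hat_comp_bh hF.homog.isEven hF.homog.map_one (h k hk) ht,
    h' k hk _ (hF.isCoalg.mem_Tle ht), hF.hat_comp hF', comp_apply]

lemma GRel.symm {N : ℕ∞} {B B' F : ℭ} (hF : IsGauge F)
    (h : GRel N B B' F) : ∃ G, IsGauge G ∧ GRel N B' B G := by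
  obtain ⟨G, hG, hGF, hFG⟩ := hF.exists_inv; refine ⟨G, hG, fun k hk t ht => ?_⟩
  have := hat_comp_bh hF.homog.isEven hF.homog.map_one (h k hk) (hG.isCoalg.mem_Tle ht)
  rw [hFG] at this; rw [← this, ← hG.pr_hat, hGF, pr_bh]

lemma gaugeEquiv_equivalence (N : ℕ∞) (g : Mat n L) :
    Equivalence (GaugeEquiv (R := R) (N := N) (g := g)) where
  refl m := gaugeEquiv_iff.2 ⟨pr, isGauge_pr, gRel_refl N _⟩
  symm h := by obtain ⟨F, hF, h⟩ := gaugeEquiv_iff.1 h; exact gaugeEquiv_iff.2 (h.symm hF)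
  trans h h' := by
    obtain ⟨F, hF, h⟩ := gaugeEquiv_iff.1 h; obtain ⟨F', hF', h'⟩ := gaugeEquiv_iff.1 h'
    exact gaugeEquiv_iff.2 ⟨_, hF.comp hF', h.trans hF hF' h'⟩

lemma apply_eq_zero_of_mem_Tle_zero {F : ℭ} (h : F 1 = 0) {t : 𝕋} (ht : t ∈ Tle R ℳ 0) : F t = 0 :=
  eq_of_Tle (φ := F) (ψ := 0) (fun l hl => by
    rw [length_eq_zero_iff.1 (Nat.le_zero.1 hl), wd_nil, h, zero_apply]) ht

lemma IsStr.map_one {N : ℕ∞} {g : Mat n L} {B : ℭ} (h : IsStr N g B) : B 1 = 0 := h.homog.map_one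

lemma IsStr.wd_eq_zero {N : ℕ∞} {g : Mat n L} {B : ℭ}
    (h : IsStr N g B) (l : List ℳ) (hl : l.length ≤ 1) : B (wd l) = 0 := by
  rcases l with _ | ⟨a, _ | ⟨b, l⟩⟩
  · exact h.map_one
  · simpa using h.letter a
  · simp at hl

lemma bh_mem_Tle {B : ℭ} {s : ℕ}
    (h : ∀ l : List ℳ, l.length ≤ s → B (wd l) = 0) {j k : ℕ} (hjk : j ≤ k + s)
    {t : 𝕋} (ht : t ∈ Tle R ℳ j) : bh ϑ B t ∈ Tle R ℳ k :=
  coder_mem_Tle (isCoalg_th _) isCoalg_id h hjk ht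

lemma IsStr.apply_eq_zero {N : ℕ∞} {g : Mat n L} {B : ℭ}
    (h : IsStr N g B) {t : 𝕋} (ht : t ∈ Tle R ℳ 1) : B t = 0 :=
  eq_of_Tle (φ := B) (ψ := 0) h.wd_eq_zero ht

lemma IsGauge.apply_of_mem {F : ℭ} (hF : IsGauge F) {t : 𝕋} (ht : t ∈ Tle R ℳ 1) : F t = pr t :=
  eq_of_Tle (φ := F) (ψ := pr) (fun l hl => by
    rcases l with _ | ⟨a, _ | ⟨b, l⟩⟩
    · rw [wd_nil, hF.homog.map_one, pr_one]
    · simpa using hF.letter a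
    · simp at hl) ht

/-- A gauge transformation transports structures. -/
lemma IsGauge.exists_transport {N : ℕ∞} (hN : 2 ≤ N) {g : Mat n L}
    {B F : ℭ} (hF : IsGauge F) (hB : IsStr N g B) : ∃ B', IsStr N g B' ∧ GRel N B B' F := by
  classical
  obtain ⟨G, hG, hGF, hFG⟩ := hF.exists_inv; set b := bh ϑ B with hb
  set B₁ : ℭ := (F.comp b).comp (hat G) with hB₁
  have hB₁h : Homog 1 B₁ := by simpa using (hF.homog.comp hB.homog.bh).comp hG.homog.hat
  have hB₁F : ∀ t, F (b t) = B₁ (hat F t) := fun t => by simp only [hB₁, comp_apply, hGF]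
  have hB₁red : RedB ϑ (oneM n R L) B₁ := by
    intro s t; simp only [hB₁, comp_apply]; rw [hG.hat_oneM, hb, hB.red.bh hB.map_one tau_oneM]
    simp only [map_add, map_sub, map_smul]; rw [hF.red, hF.red]
    simp only [eps_bh, zero_smul, smul_zero, sub_zero, zero_add, hG.eps_hat]
    have e : ∀ t, F (hat G t) = pr t := fun t => by rw [← hF.pr_hat, hFG]
    rw [e, ← hF.homog.isEven, e]
  have hB₁one : ∀ a, B₁ (ι R a) = 0 := by
    intro a; simp only [hB₁, comp_apply]; exact apply_eq_zero_of_mem_Tle_zero hF.homog.map_one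
      (bh_mem_Tle hB.wd_eq_zero le_rfl (hG.isCoalg.mem_Tle (ι_mem_Tle a)))
  have hB₁two : ∀ a a', B₁ (ι R a * ι R a') = compo (R := R) g ![koszul (R := R) 1 a, a'] := by
    intro a a'
    have h2 : ι R a * ι R a' ∈ Tle R ℳ (1 + 1) := mul_mem_Tle (ι_mem_Tle a) (ι_mem_Tle a') le_rfl
    have e : hat G (ι R a * ι R a') = ι R a * ι R a' + (hat G (ι R a * ι R a') - ι R a * ι R a') := by
      abel
    simp only [hB₁, comp_apply]
    rw [e, map_add, map_add, apply_eq_zero_of_mem_Tle_zero hF.homog.map_one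
      (bh_mem_Tle hB.wd_eq_zero le_rfl (hG.hat_sub_mem h2)), add_zero,
      hF.apply_of_mem (bh_mem_Tle hB.wd_eq_zero le_rfl h2), pr_bh, hB.two]
  have hb₁ : ∀ t, bh ϑ B₁ t = hat F (b (hat G t)) := by
    intro t; have := hat_comp_bh (k := _) hF.homog.isEven hF.homog.map_one (B := B) (B' := B₁)
      (fun t _ => hB₁F t) (hG.isCoalg.mem_Tle (exists_mem_Tle t).choose_spec); rw [hFG] at this
    exact this.symm
  have hB₁sq : ∀ k : ℕ, (k : ℕ∞) ≤ N + 1 → ∀ t ∈ Tle R ℳ k, B₁ (bh ϑ B₁ t) = 0 := by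
    intro k hk t ht; rw [hb₁]; simp only [hB₁, comp_apply, hGF]
    rw [hb, bh_bh tau_tau (hB.homog.isOdd rfl) (hB.sq k hk) (hG.isCoalg.mem_Tle ht), map_zero]
  obtain ⟨B', hB'⟩ := exists_assemble (fun k => if (k : ℕ∞) ≤ N then B₁ else 0)
  have hB'eq : ∀ k : ℕ, (k : ℕ∞) ≤ N → ∀ t ∈ Tle R ℳ k, B' t = B₁ t := by
    intro k hk t ht; refine eq_of_Tle (fun l hl => ?_) ht
    rw [hB', if_pos (le_trans (by exact_mod_cast hl) hk)]
  have h2 : ((2 : ℕ) : ℕ∞) ≤ N := by exact_mod_cast hN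
  have h1 : ((1 : ℕ) : ℕ∞) ≤ N := le_trans (by norm_num) h2
  have hB'one : ∀ t ∈ Tle R ℳ 1, B' t = 0 := fun t ht => by
    rw [hB'eq 1 h1 t ht]; refine eq_of_Tle (φ := B₁) (ψ := 0) (fun l hl => ?_) ht
    rcases l with _ | ⟨a, _ | ⟨a', l⟩⟩
    · exact hB₁h.map_one
    · simpa using hB₁one a
    · simp at hl
  refine ⟨B', ⟨fun l γ hl => ?_, fun s t => ?_, fun a => hB'one _ (ι_mem_Tle a), fun a a' => ?_,
    fun l hl => ?_, fun k hk t ht => ?_⟩, fun k hk t ht => ?_⟩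
  · rw [hB']
    split_ifs
    · exact hB₁h l γ hl
    · exact zero_mem _
  · induction s using wdInduction with
    | add a b ha hb => simp only [add_mul, map_add, ha, hb, add_smul, smul_add]; abel
    | smul r a ha =>
      simp only [smul_mul_assoc, map_smul, ha, smul_eq_mul, mul_smul, smul_sub]
      rw [smul_comm r (eps t)]
    | word u =>
      induction t using wdInduction with
      | add a b ha hb => simp only [mul_add, map_add, ha, hb, add_smul, smul_add]; abel
      | smul r a ha =>
        simp only [mul_smul_comm, map_smul, ha, smul_eq_mul, mul_smul, smul_sub]
        rw [smul_comm r (eps (wd u))]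
      | word v =>
        have e : wd u * (ι R (oneM n R L) * wd v) = wd (R := R) (u ++ oneM n R L :: v) := by
          rw [wd_append, wd_cons]
        rw [← hB₁red]
        by_cases hk : ((u ++ oneM n R L :: v).length : ℕ∞) ≤ N
        · rw [e, hB', if_pos hk]
        · have h3 : 3 ≤ u.length + 1 + v.length := by
            by_contra hc; refine hk (le_trans ?_ h2)
            have : (u ++ oneM n R L :: v).length ≤ 2 := by simp; omega
            exact_mod_cast this
          rw [hB₁red, e, hB', if_neg hk, zero_apply]; rcases u with _ | ⟨a, u⟩
          · simp only [length_nil] at h3; rw [pr_wd_eq_zero (l := v) (by omega), wd_nil, pr_one]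
            simp
          · rw [eps_wd (l := a :: u) (by simp)]; rcases v with _ | ⟨b, v⟩
            · simp only [length_nil, length_cons] at h3
              rw [pr_wd_eq_zero (l := a :: u) (by rw [length_cons]; omega)]; simp
            · rw [eps_wd (l := b :: v) (by simp)]; simp
  · rw [hB'eq 2 h2 _ (mul_mem_Tle (ι_mem_Tle a) (ι_mem_Tle a') le_rfl), hB₁two]
  · rw [hB', if_neg (not_le.2 hl), zero_apply]
  · rw [← hB₁sq k hk t ht]; rcases k with _ | k
    · have : t ∈ Tle R ℳ 1 := Tle_mono (by omega) ht
      rw [hB'one _ (bh_mem_Tle (s := 0) (fun l hl => by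
        rw [length_eq_zero_iff.1 (Nat.le_zero.1 hl)]
        exact hB'one _ (one_mem_Tle _)) (by omega) this)]
      rw [hB₁sq 1 (le_trans h1 le_self_add) t this]
    · have hk' : (k : ℕ∞) ≤ N := by
        rw [Nat.cast_add, Nat.cast_one] at hk; exact (ENat.add_le_add_iff_right (by simp)).1 hk
      have e1 : bh ϑ B' t = bh ϑ B₁ t + bh ϑ (B' - B₁) t := by
        rw [bh, bh, bh, ← add_apply, ← coder_add, add_sub_cancel]
      rw [e1, map_add, hB'one (bh ϑ (B' - B₁) t) (bh_mem_Tle (s := k) (fun l hl => by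
        rw [sub_apply, hB'eq k hk' _ (wd_Tle hl), sub_self]) (by omega) ht), add_zero]
      refine hB'eq k hk' _ (bh_mem_Tle (s := 1) (fun l hl => ?_) le_rfl ht)
      rw [← hB'eq 1 h1 _ (wd_Tle hl)]; exact hB'one _ (wd_Tle hl)
  · rw [hB₁F]; exact (hB'eq k hk _ (hF.isCoalg.mem_Tle ht)).symm

/-! ## The Hochschild differential and leading terms -/

local notation "cm" => compo (R := R)

lemma zero_or {α β : Type*} [Zero α] [Zero β] {P Q S : Prop} {a : α} {b : β}
    (ha : ¬P → a = 0) (hb : ¬Q → b = 0) (hS : ¬S) (h : P → Q → S) : a = 0 ∨ b = 0 := by grind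

lemma compo_mem {a b c : Obj} {d e : ℤ} {x y : ℳ} (g : Mat n L)
    (hx : x ∈ Hm b a d) (hy : y ∈ Hm c b e) : cm g ![x, y] ∈ Hm c a (d + e) := by
  obtain ⟨a1, a2, a3, a4, a5, a6⟩ := hx; obtain ⟨b1, b2, b3, b4, b5, b6⟩ := hy
  simp only [compo, MultilinearMap.mk'_apply, Matrix.cons_val_zero, Matrix.cons_val_one, hom,
    Submodule.mem_mk, AddSubmonoid.mem_mk, AddSubsemigroup.mem_mk, Set.mem_ofPred_eq]
  refine ⟨fun h => ?_, fun h => ?_, fun h => ?_, fun h => ?_, fun h => ?_, fun h => ?_⟩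
  · rcases zero_or a1 b1 h (by grind) with h | h <;> simp [h]
  · rcases zero_or a2 b2 h (by grind) with h | h <;> simp [h]
  · rcases zero_or a1 b3 h (by grind) with i | i <;> rcases zero_or a3 b1 h (by grind) with j | j <;>
      rcases zero_or a6 b5 h (by grind) with k | k <;> simp [i, j, k]
  · rcases zero_or a2 b4 h (by grind) with i | i <;> rcases zero_or a4 b2 h (by grind) with j | j <;>
      rcases zero_or a5 b6 h (by grind) with k | k <;> simp [i, j, k]
  · rcases zero_or a2 b5 h (by grind) with i | i <;> rcases zero_or a5 b1 h (by grind) with j | j <;>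
      simp [i, j]
  · rcases zero_or a1 b6 h (by grind) with i | i <;> rcases zero_or a6 b2 h (by grind) with j | j <;>
      simp [i, j]

lemma compo_eq_zero {a b b' c : Obj} {d e : ℤ} {x y : ℳ} (g : Mat n L)
    (hx : x ∈ Hm b a d) (hy : y ∈ Hm c b' e) (hb : b ≠ b') : cm g ![x, y] = 0 := by
  obtain ⟨a1, a2, a3, a4, a5, a6⟩ := hx; obtain ⟨b1, b2, b3, b4, b5, b6⟩ := hy
  simp only [compo, MultilinearMap.mk'_apply, Matrix.cons_val_zero, Matrix.cons_val_one,
    Prod.mk_eq_zero]; have h := not_false; refine ⟨⟨?_, ?_⟩, ⟨?_, ?_⟩, ?_, ?_⟩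
  · rcases zero_or a1 b1 h (by grind) with h | h <;> simp [h]
  · rcases zero_or a2 b2 h (by grind) with h | h <;> simp [h]
  · rcases zero_or a1 b3 h (by grind) with i | i <;> rcases zero_or a3 b1 h (by grind) with j | j <;>
      rcases zero_or a6 b5 h (by grind) with k | k <;> simp [i, j, k]
  · rcases zero_or a2 b4 h (by grind) with i | i <;> rcases zero_or a4 b2 h (by grind) with j | j <;>
      rcases zero_or a5 b6 h (by grind) with k | k <;> simp [i, j, k]
  · rcases zero_or a2 b5 h (by grind) with i | i <;> rcases zero_or a5 b1 h (by grind) with j | j <;>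
      simp [i, j]
  · rcases zero_or a1 b6 h (by grind) with i | i <;> rcases zero_or a6 b2 h (by grind) with j | j <;>
      simp [i, j]

lemma isCochain_compo (g : Mat n L) : IsCochain (R := R) 0 (cm g) where
  mem c d x h := by
    have e : x = ![x 0, x 1] := by ext1 i; fin_cases i <;> rfl
    rw [e, Fin.sum_univ_two, add_zero]; exact compo_mem g (h 0) (h 1)
  zero a b d x h := by
    rintro ⟨i, j, hij, hne⟩; have hi : i = 0 := by omega
    have hj : j = 1 := by omega
    subst hi hj; have e : x = ![x 0, x 1] := by ext1 i; fin_cases i <;> rfl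
    rw [e]; exact compo_eq_zero g (h 0) (h 1) hne

/-- The composition of `S(Rⁿ, g)` as a cochain on the tensor coalgebra. -/
def mu (g : Mat n L) : ℭ := tw (update (fun _ => 0) 2 (cm g))

lemma mu_two (g : Mat n L) (a b : ℳ) : mu g (ι R a * ι R b) = cm g ![Kz 1 a, b] := by
  rw [mu, tw_ι_mul_ι, update_self]

lemma mu_eq_zero (g : Mat n L) {l : List ℳ} (h : l.length ≠ 2) : mu (R := R) g (wd l) = 0 := by
  rw [wd_eq_sw, mu, tw_sw, update_of_ne h]; rfl

lemma homog_mu (g : Mat n L) : Homog 1 (mu (R := R) g) := by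
  refine homog_tw_iff.2 fun k => ?_
  by_cases hk : k = 2
  · subst hk; rw [update_self]; exact isCochain_compo g
  · rw [update_of_ne hk]; exact ⟨fun _ _ _ _ => zero_mem _, fun _ _ _ _ _ _ => rfl⟩

lemma redB_mu (g : Mat n L) : RedB ϑ (oneM n R L) (mu (R := R) g) := by
  intro s t
  induction s using wdInduction with
  | add a b ha hb => simp only [add_mul, map_add, ha, hb, add_smul, smul_add]; abel
  | smul r a ha =>
    simp only [smul_mul_assoc, map_smul, ha, smul_eq_mul, mul_smul, smul_sub]
    rw [smul_comm r (eps t)]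
  | word u =>
    induction t using wdInduction with
    | add a b ha hb => simp only [mul_add, map_add, ha, hb, add_smul, smul_add]; abel
    | smul r a ha =>
      simp only [mul_smul_comm, map_smul, ha, smul_eq_mul, mul_smul, smul_sub]
      rw [smul_comm r (eps (wd u))]
    | word v =>
      have e : wd u * (ι R (oneM n R L) * wd v) = wd (R := R) (u ++ oneM n R L :: v) := by
        rw [wd_append, wd_cons]
      rcases u with _ | ⟨a, _ | ⟨a', u⟩⟩
      · rcases v with _ | ⟨b, _ | ⟨b', v⟩⟩
        · rw [e, mu_eq_zero _ (by simp)]; simp [pr_one]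
        · simp only [wd_nil, wd_cons, one_mul, mul_one]; rw [mu_two, koszul_oneM, compo_oneM_left]
          simp [pr_one, pr_ι]
        · rw [e, mu_eq_zero _ (by simp), pr_wd_eq_zero (l := b :: b' :: v) (by simp)]; simp [pr_one]
      · rcases v with _ | ⟨b, v⟩
        · simp only [wd_nil, wd_cons, mul_one]; rw [mu_two, compo_oneM_right, pr_one, pr_ι]
          simp only [smul_zero, zero_sub, tau]; ext <;> simp [koszul]
        · rw [e, mu_eq_zero _ (by simp), eps_wd (l := b :: v) (by simp),
            eps_wd (l := [a]) (by simp)]; simp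
      · rw [e, mu_eq_zero _ (by simp), eps_wd (l := a :: a' :: u) (by simp),
          pr_wd_eq_zero (l := a :: a' :: u) (by simp)]; simp

lemma mu_apply_of_mem_Tle (g : Mat n L) {t : 𝕋} (ht : t ∈ Tle R ℳ 1) : mu g t = 0 :=
  eq_of_Tle (φ := mu g) (ψ := 0) (fun l hl => mu_eq_zero g (by omega)) ht

lemma mu_wd_le_one (g : Mat n L) (l : List ℳ) (hl : l.length ≤ 1) :
    mu (R := R) g (wd l) = 0 := mu_eq_zero g (by omega)

lemma IsStr.eq_mu {N : ℕ∞} {g : Mat n L} {B : ℭ}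
    (h : IsStr N g B) {t : 𝕋} (ht : t ∈ Tle R ℳ 2) : B t = mu g t := eq_of_Tle (fun l hl => by
    rcases l with _ | ⟨a, _ | ⟨b, _ | ⟨c, l⟩⟩⟩
    · rw [h.wd_eq_zero _ (by simp), mu_eq_zero _ (by simp)]
    · rw [h.wd_eq_zero _ (by simp), mu_eq_zero _ (by simp)]
    · simp only [wd_cons, wd_nil, mul_one]; rw [h.two, mu_two]
    · simp at hl) ht

lemma bh_mu_cons_cons (g : Mat n L) (a b : ℳ) (t : 𝕋) :
    bh ϑ (mu g) (ι R a * (ι R b * t)) = ι R (mu g (ι R a * ι R b)) * t +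
      ι R (ϑ a) * bh ϑ (mu g) (ι R b * t) := by
  rw [bh_cons]; congr 1; rw [convL, conv_cons, conv_cons]
  have h1 : mu (R := R) g 1 = 0 := mu_eq_zero g (l := []) (by simp)
  have h2 : mu (R := R) g (ι R a) = 0 := by simpa using mu_eq_zero (R := R) g (l := [a]) (by simp)
  have e : (((ι R).comp (mu g)).comp (lm a)).comp (lm b) =
      (mulLeft R (ι R (mu g (ι R a * ι R b)))).comp eta := by
    refine ext_wd fun l => ?_; simp only [comp_apply, mulLeft_apply, lm]; rcases l with _ | ⟨c, l⟩
    · simp [wd_nil]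
    · have : mu (R := R) g (ι R a * (ι R b * wd (c :: l))) = 0 := by
        rw [← wd_cons, ← wd_cons]; exact mu_eq_zero g (by simp)
      rw [this, wd_cons, eps_cons]; simp
  rw [e, conv_smul_left, conv_eta_left]; simp [h1, h2, lm]

lemma bh_mu_ι (g : Mat n L) (a : ℳ) : bh ϑ (mu g) (ι R a) = 0 := by
  have h1 : mu (R := R) g 1 = 0 := mu_eq_zero g (l := []) (by simp)
  have h2 : mu (R := R) g (ι R a) = 0 := by simpa using mu_eq_zero (R := R) g (l := [a]) (by simp)
  have := bh_cons (τ := ϑ) (mu g) a 1; rw [mul_one] at this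
  have e : ι R a = ι R a * (1 : 𝕋) := (mul_one _).symm
  rw [this, bh, coder_one (th_one _) rfl, h1, e, convL, conv_cons, conv_one]; simp [h1, h2, lm]

lemma bh_mu_one (g : Mat n L) : bh ϑ (mu g) (1 : 𝕋) = 0 := by
  have h1 : mu (R := R) g 1 = 0 := mu_eq_zero g (l := []) (by simp)
  rw [bh, coder_one (th_one _) rfl, h1, map_zero]

lemma compo_assoc (g : Mat n L) (a b c : ℳ) :
    cm g ![cm g ![a, b], c] = cm g ![a, cm g ![b, c]] := by
  obtain ⟨⟨a1, a2⟩, ⟨a3, a4⟩, a5, a6⟩ := a; obtain ⟨⟨b1, b2⟩, ⟨b3, b4⟩, b5, b6⟩ := b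
  obtain ⟨⟨c1, c2⟩, ⟨c3, c4⟩, c5, c6⟩ := c
  simp only [compo, MultilinearMap.mk'_apply, Matrix.cons_val_zero, Matrix.cons_val_one, Prod.mk.injEq,
    Pi.add_apply, Pi.smul_apply, smul_eq_mul, add_mul, mul_add, sum_add_distrib, add_smul,
    smul_add, smul_smul, smul_sum, Finset.mul_sum]; refine ⟨⟨by ring, by ring⟩, ⟨?_, ?_⟩, ?_, ?_⟩
  · simp only [mul_comm, mul_left_comm]; abel
  · simp only [mul_comm, mul_left_comm]; abel
  · simp only [mul_comm]; abel
  · simp only [mul_comm]; abel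

lemma koszul_compo (g : Mat n L) (a b : ℳ) : Kz 1 (cm g ![a, b]) = cm g ![Kz 1 a, Kz 1 b] := by
  obtain ⟨⟨a1, a2⟩, ⟨a3, a4⟩, a5, a6⟩ := a; obtain ⟨⟨b1, b2⟩, ⟨b3, b4⟩, b5, b6⟩ := b
  simp [compo, koszul, MultilinearMap.mk'_apply]; abel_nf; simp

lemma mu_mu (g : Mat n L) (a b c : ℳ) :
    mu g (ι R (mu g (ι R a * ι R b)) * ι R c) + mu g (ι R (ϑ a) * ι R (mu g (ι R b * ι R c))) = 0 := by
  have h : ι R (ϑ a) * ι R (mu g (ι R b * ι R c)) =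
      -(ι R (Kz 1 a) * ι R (mu g (ι R b * ι R c))) := by rw [tau_apply, map_neg, neg_mul]
  rw [h, map_neg, mu_two, mu_two, mu_two, mu_two, koszul_compo, koszul_koszul,
    koszul_of_even (s := 1 + 1) rfl, compo_assoc, add_neg_cancel]

lemma mu_bh_mu (g : Mat n L) (t : 𝕋) : mu g (bh ϑ (mu g) t) = 0 := by
  suffices h : (mu g).comp (bh ϑ (mu g)) = 0 from lcongr h t
  have h4 : ∀ l : List ℳ, 3 ≤ l.length → ∀ a, mu g (ι R a * bh ϑ (mu g) (wd l)) = 0 := by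
    intro l hl a; refine coder_wd_mem ((AddMonoidHom.mker (mu (R := R) g).toAddMonoidHom).comap
      (mulLeft R (ι R a)).toAddMonoidHom) fun u v x huvx => ?_; change mu g (ι R a * _) = 0
    by_cases hv : v.length = 2
    · have e : ι R a * (th ϑ (wd u) * (ι R (mu g (wd v)) * LinearMap.id (R := R) (wd x))) =
          wd (R := R) (a :: (u.map ϑ ++ mu g (wd (R := R) v) :: x)) := by
        rw [th_wd, wd_cons, wd_append, wd_cons]; rfl
      rw [e, mu_eq_zero]; rw [← huvx] at hl
      simp only [length_append, length_cons, List.length_map] at hl ⊢; omega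
    · rw [mu_eq_zero g hv]; simp
  refine ext_wd fun l => ?_; rw [comp_apply, zero_apply]
  rcases l with _ | ⟨a, _ | ⟨b, _ | ⟨c, _ | ⟨d, l⟩⟩⟩⟩
  · rw [wd_nil, bh_mu_one, map_zero]
  · simp [bh_mu_ι]
  · simp only [wd_cons, wd_nil, mul_one]; have := bh_mu_cons_cons g a b 1
    rw [mul_one, mul_one, bh_mu_ι, mul_zero, add_zero] at this; rw [this]
    simpa using mu_eq_zero (R := R) g (l := [mu g (ι R a * ι R b)]) (by simp)
  · simp only [wd_cons, wd_nil, mul_one]; have := bh_mu_cons_cons g b c 1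
    rw [mul_one, mul_one, bh_mu_ι, mul_zero, add_zero] at this
    rw [bh_mu_cons_cons, this, map_add, mu_mu]
  · rw [wd_cons, wd_cons, bh_mu_cons_cons, map_add, ← wd_cons (R := R) b, h4 _ (by simp), add_zero, ← wd_cons]
    exact mu_eq_zero g (by simp)

lemma bh_mu_bh_mu (g : Mat n L) (t : 𝕋) : bh ϑ (mu g) (bh ϑ (mu g) t) = 0 :=
  bh_bh tau_tau ((homog_mu g).isOdd rfl) (fun t _ => mu_bh_mu g t) (exists_mem_Tle t).choose_spec

/-! ## Leading terms of gauge transformations and homotopies -/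

/-- The Hochschild differential of even cochains. -/
def dEven (g : Mat n L) (f : ℭ) : ℭ := f.comp (bh ϑ (mu g)) - (mu g).comp (coder idL f idL)

/-- The Hochschild differential of odd cochains. -/
def dOdd (g : Mat n L) (f : ℭ) : ℭ := f.comp (bh ϑ (mu g)) + (mu g).comp (bh ϑ f)

lemma IsCoalg.apply_of_mem {P : 𝕋 →ₗ[R] 𝕋} (hP : IsCoalg P)
    (h1 : ∀ a, pr (P (ι R a)) = a) {l : List ℳ} (hl : l.length ≤ 1) : P (wd l) = wd l := by
  rcases l with _ | ⟨a, _ | ⟨b, l⟩⟩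
  · exact hP.map_one
  · simp only [wd_cons, wd_nil, mul_one]; rw [hP.map_ι, h1]
  · simp at hl

/-- Changing `P`, `Q` to maps agreeing on letters does not affect the terms of a coderivation with at
most two letters. -/
lemma coder_congr_of_mem {P Q P' Q' : 𝕋 →ₗ[R] 𝕋}
    (hP : ∀ l : List ℳ, l.length ≤ 1 → P (wd l) = P' (wd l))
    (hQ : ∀ l : List ℳ, l.length ≤ 1 → Q (wd l) = Q' (wd l))
    {H : ℭ} {d : ℕ} (hH : ∀ l : List ℳ, l.length ≤ d → H (wd l) = 0)
    {t : 𝕋} (ht : t ∈ Tle R ℳ (d + 2)) : coder P H Q t = coder P' H Q' t := by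
  refine eq_of_Tle (fun l hl => coder_wd_congr fun u v x huvx => ?_) ht
  have hlen : u.length + (v.length + x.length) = l.length := by
    rw [← huvx, length_append, length_append]
  by_cases hv : v.length ≤ d
  · simp [hH v hv]
  · rw [hP u (by omega), hQ x (by omega)]

lemma apply_eq_zero_of_mem {d : ℕ} {H : ℭ} (hH : ∀ l : List ℳ, l.length ≤ d → H (wd l) = 0) {t : 𝕋}
    (ht : t ∈ Tle R ℳ d) : H t = 0 := eq_of_Tle (φ := H) (ψ := 0) hH ht

lemma IsStr.apply_bh {N : ℕ∞} {g : Mat n L} {B : ℭ} (h : IsStr N g B) {d : ℕ} {H : ℭ}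
    (hH : ∀ l : List ℳ, l.length ≤ d → H (wd l) = 0) {t : 𝕋} (ht : t ∈ Tle R ℳ (d + 2)) :
    H (bh ϑ B t) = H (bh ϑ (mu g) t) := by
  have e : bh ϑ B t = bh ϑ (mu g) t + bh ϑ (B - mu g) t := by
    rw [bh, bh, bh, ← add_apply, ← coder_add, add_sub_cancel]
  have e' := apply_eq_zero_of_mem hH (bh_mem_Tle (s := 2) (B := B - mu g) (fun l hl => by
    rw [sub_apply, h.eq_mu (wd_Tle hl), sub_self]) le_rfl ht)
  rw [e, map_add, e', add_zero]

lemma dEven_apply_eq_zero (g : Mat n L) {d : ℕ} {φ : ℭ}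
    (hφ : ∀ l : List ℳ, l.length ≤ d → φ (wd l) = 0) {t : 𝕋}
    (ht : t ∈ Tle R ℳ (d + 1)) : dEven g φ t = 0 := by
  rw [dEven, sub_apply, comp_apply, comp_apply,
    apply_eq_zero_of_mem hφ (bh_mem_Tle (mu_wd_le_one g) le_rfl ht),
    mu_apply_of_mem_Tle g (coder_mem_Tle isCoalg_id isCoalg_id hφ (by omega) ht), sub_self]

/-- The leading term of the change of a structure under a change of the gauge transformation. -/
lemma GRel.sub_eq {N : ℕ∞} {g : Mat n L}
    {B B' B'' F' F'' : ℭ} (hB : IsStr N g B) (hB'' : IsStr N g B'')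
    (hF' : IsGauge F') (hF'' : IsGauge F'') (h' : GRel N B B' F') (h'' : GRel N B B'' F'')
    {d : ℕ} (hd : ((d + 2 : ℕ) : ℕ∞) ≤ N)
    (hF : ∀ l : List ℳ, l.length ≤ d → F'' (wd l) = F' (wd l)) {t : 𝕋}
    (ht : t ∈ Tle R ℳ (d + 2)) : B'' t - B' t = dEven g (F'' - F') t := by
  have hφ : ∀ l : List ℳ, l.length ≤ d → (F'' - F') (wd l) = 0 := fun l hl => by
    rw [sub_apply, hF l hl, sub_self]
  have key : ∀ s ∈ Tle R ℳ (d + 2), B'' (hat F' s) - B' (hat F' s) = dEven g (F'' - F') s := by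
    intro s hs; have hX := (hF''.isCoalg.sub hF'.isCoalg).eq_coder hF''.isCoalg hF'.isCoalg
    rw [comp_sub, pr_comp_hat hF''.homog.map_one, pr_comp_hat hF'.homog.map_one] at hX
    have hXs := lcongr hX s; rw [sub_apply, coder_congr_of_mem (P' := idL) (Q' := idL)
      (fun l hl => hF''.isCoalg.apply_of_mem hF''.pr_hat_ι hl)
      (fun l hl => hF'.isCoalg.apply_of_mem hF'.pr_hat_ι hl) hφ hs] at hXs; have e1 := h'' _ hd s hs
    have e2 := h' _ hd s hs
    have e3 : hat F' s = hat F'' s - coder idL (F'' - F') idL s := by rw [← hXs]; abel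
    have e4 := hB.apply_bh hφ hs; rw [sub_apply, e1, e2] at e4
    have e5 := hB''.eq_mu (coder_mem_Tle isCoalg_id isCoalg_id hφ (show d + 2 ≤ 2 + d by omega) hs)
    rw [dEven, sub_apply, comp_apply, comp_apply, ← e4, ← e5]
    conv_lhs => enter [1]; rw [e3, map_sub]
    abel
  obtain ⟨G, hG, hGF, hFG⟩ := hF'.exists_inv; have h1 := key (hat G t) (hG.isCoalg.mem_Tle ht)
  rw [hFG] at h1; rw [h1, ← sub_eq_zero, ← map_sub]
  exact dEven_apply_eq_zero g hφ (hG.hat_sub_mem ht)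

lemma isGauge_iff_words {F : ℭ} : IsGauge F ↔ ∀ l : List ℳ,
    F (wd l) ∈ {x | (∀ γ, IsHomWord l γ → x ∈ (γ.shift 0).out n R L) ∧
      (∀ u v, l = u ++ oneM n R L :: v → x = eps (wd (R := R) u) • eps (wd (R := R) v) • oneM n R L) ∧
      ∀ a, l = [a] → x = a} := by
  constructor
  · intro h l; refine ⟨fun γ hγ => h.homog l γ hγ, fun u v e => ?_, fun a e => ?_⟩
    · rw [e, wd_append, wd_cons, h.red]
    · rw [e]; simpa using h.letter a
  · intro h
    refine ⟨fun l γ hγ => (h l).1 γ hγ, fun s t => ?_, fun a => by simpa using (h [a]).2.2 a rfl⟩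
    induction s using wdInduction with
    | add a b ha hb => simp only [add_mul, map_add, ha, hb, add_smul]
    | smul r a ha => simp only [smul_mul_assoc, map_smul, ha, smul_eq_mul, mul_smul]
    | word u =>
      induction t using wdInduction with
      | add a b ha hb => simp only [mul_add, map_add, ha, hb, add_smul, smul_add]
      | smul r a ha =>
        simp only [mul_smul_comm, map_smul, ha, smul_eq_mul, mul_smul]
        rw [smul_comm r (eps (wd u))]
      | word v => rw [← wd_cons, ← wd_append]; exact (h _).2.1 u v rfl

lemma IsStr.sq_le {N : ℕ∞} {g : Mat n L} {B : ℭ}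
    (h : IsStr N g B) {k : ℕ} (hk : (k : ℕ∞) ≤ N) {t : 𝕋} (ht : t ∈ Tle R ℳ k) :
    B (bh ϑ B t) = 0 := h.sq k (le_trans hk le_self_add) t ht

/-- A homotopy changes a gauge transformation, with leading term the differential of the homotopy. -/
lemma GRel.exists_homotopy {N : ℕ∞} {g : Mat n L}
    {B B' F H : ℭ} (hB : IsStr N g B) (hB' : IsStr N g B')
    (hF : IsGauge F) (h : GRel N B B' F) (hHh : Homog (-1) H) (hHr : RedH (oneM n R L) H) {d : ℕ}
    (hH : ∀ l : List ℳ, l.length ≤ d → H (wd l) = 0) :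
    ∃ F', IsGauge F' ∧ GRel N B B' F' ∧ ∀ t ∈ Tle R ℳ (d + 2), F' t = F t + dOdd g H t := by
  have hH0 : ∀ l : List ℳ, l.length ≤ 0 → H (wd l) = 0 := fun l hl => hH l (by omega)
  have hodd := hHh.isOdd rfl
  let Φ : ℭ → ℭ := fun φ => F + B'.comp (coder ((th ϑ).comp (hat φ)) H (hat F)) + H.comp (bh ϑ B)
  have hΦ : ∀ φ, IsGauge φ → IsGauge (Φ φ) := by
    intro φ hφ; have hP : IsCoalg ((th ϑ).comp (hat φ)) := (isCoalg_th _).comp hφ.isCoalg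
    refine ⟨?_, fun s t => ?_, fun a => ?_⟩
    · have h1 : Homog (-1 + 1) (B'.comp (coder ((th ϑ).comp (hat φ)) H (hat F))) := by
        refine hB'.homog.comp (hHh.coder ?_ hF.homog.hat); simpa using homogT_th.comp hφ.homog.hat
      have h2 : Homog (1 + -1) (H.comp (bh ϑ B)) := hHh.comp hB.homog.bh
      rw [show (-1 : ℤ) + 1 = 0 by norm_num] at h1; rw [show (1 : ℤ) + -1 = 0 by norm_num] at h2
      exact (hF.homog.add h1).add h2
    · simp only [Φ, add_apply, comp_apply]
      rw [hF.red, hHr.coder hF.red hφ.red hF.homog.map_one hφ.homog.map_one tau_oneM,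
        hB.red.bh hB.map_one tau_oneM]; simp only [map_add, map_sub, map_smul]
      rw [hB'.red, hB'.red, hHr, hHr]
      have e1 : ∀ s, eps (coder ((th ϑ).comp (hat φ)) H (hat F) s) = 0 := fun s =>
        lcongr (hP.eps_coder (Q := hat F) H) s
      have e2 : ∀ s, pr (coder ((th ϑ).comp (hat φ)) H (hat F) s) = H s := fun s =>
        lcongr (hP.pr_coder hF.isCoalg H) s
      have e3 : ∀ s, eps (th ϑ (hat φ s)) = eps s := fun s => lcongr hP.eps_comp s
      rw [e1, e1, e2, e2, e3, hF.eps_hat, hodd]; simp only [zero_smul, smul_neg]; abel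
    · simp only [Φ, add_apply, comp_apply]
      rw [hF.letter, hB'.apply_eq_zero (coder_mem_Tle hP hF.isCoalg hH0 (show 1 ≤ 1 + 0 by omega)
        (ι_mem_Tle a)), apply_eq_zero_of_mem hH0 (bh_mem_Tle hB.wd_eq_zero
        (show 1 ≤ 0 + 1 by omega) (ι_mem_Tle a)), add_zero, add_zero]
  obtain ⟨F', hF'c, hF'⟩ := exists_fixpoint _ F (isGauge_iff_words.1 hF) Φ
    (fun φ hφ => isGauge_iff_words.1 (hΦ φ (isGauge_iff_words.2 hφ))) (fun φ φ' hφ hφ' l hl => by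
      have g1 := isGauge_iff_words.2 hφ; have g2 := isGauge_iff_words.2 hφ'
      simp only [Φ, add_apply, comp_apply]; congr 3; refine coder_wd_congr fun u v x huvx => ?_
      have hlen : u.length + (v.length + x.length) = l.length := by
        rw [← huvx, length_append, length_append]
      by_cases hv : v.length ≤ 0
      · simp [hH0 v hv]
      · rw [comp_apply, comp_apply, hat_wd_congr g1.homog.map_one g2.homog.map_one (k := u.length)
            (fun l' hl' => hl l' (by omega)) le_rfl])
  have hG := isGauge_iff_words.2 hF'c; refine ⟨F', hG, fun k hk t ht => ?_, fun t ht => ?_⟩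
  · exact homotopy_comm tau_tau hF.homog.map_one hG.homog.map_one hHh.map_one hF.homog.isEven
      hG.homog.isEven hodd (hB.homog.isOdd rfl) (hB'.homog.isOdd rfl) hB.map_one
      (fun t ht => hB.sq_le hk ht) (fun t ht => hB'.sq_le hk ht) (fun t ht => h k hk t ht)
      hF'.symm ht
  · conv_lhs => rw [← hF']
    simp only [Φ, add_apply, comp_apply]
    have hP : IsCoalg ((th ϑ).comp (hat F')) := (isCoalg_th _).comp hG.isCoalg
    rw [hB.apply_bh hH ht, hB'.eq_mu (coder_mem_Tle hP hF.isCoalg hH (show d + 2 ≤ 2 + d by omega) ht),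
      coder_congr_of_mem (P' := th ϑ) (Q' := idL)
      (fun l hl => by rw [comp_apply, hG.isCoalg.apply_of_mem hG.pr_hat_ι hl])
      (fun l hl => hF.isCoalg.apply_of_mem hF.pr_hat_ι hl) hH ht, dOdd, add_apply,
      comp_apply, comp_apply]; change F t + mu g (bh ϑ H t) + H (bh ϑ (mu g) t) = _; abel

lemma coder_id_dOdd (g : Mat n L) {H : ℭ} (hH : IsOdd ϑ H) : coder idL (dOdd g H) idL =
      (bh ϑ (mu g)).comp (bh ϑ H) + (bh ϑ H).comp (bh ϑ (mu g)) := by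
  set b := bh ϑ (mu g) with hb; set K := bh ϑ H with hK
  have hmu : IsOdd ϑ (mu (R := R) g) := (homog_mu g).isOdd rfl
  have hc : IsCoder (idL : 𝕋 →ₗ[R] 𝕋) idL (b.comp K + K.comp b) := by
    refine ⟨?_, ?_⟩
    · rw [comp_add, ← comp_assoc, ← comp_assoc,
        (isCoder_bh _ _).eps_comp, (isCoder_bh _ _).eps_comp, zero_comp, zero_comp, add_zero]
    · rw [comp_add, dec_coder_comp_coder (isCoder_bh _ _).dec_comp (isCoder_bh _ _).dec_comp,
        dec_coder_comp_coder (isCoder_bh _ _).dec_comp (isCoder_bh _ _).dec_comp, ← add_comp]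
      congr 1; rw [th_comp_th tau_tau]; refine TensorProduct.ext' fun x y => ?_
      have h1 := hmu.bh tau_tau x; have h2 := hH.bh tau_tau x
      simp only [add_apply, map_tmul, comp_apply,
        LinearMap.id_apply, ← hb, ← hK, TensorProduct.tmul_add, TensorProduct.add_tmul] at h1 h2 ⊢
      rw [h1, h2, neg_tmul, neg_tmul]; abel
  rw [hc.eq_coder isCoalg_id isCoalg_id]; congr 1; refine LinearMap.ext fun t => ?_
  simp only [comp_apply, add_apply, map_add, hb, hK, pr_bh, dOdd]; abel

lemma bh_dEven (g : Mat n L) {f : ℭ} (hf : IsEven ϑ f) : bh ϑ (dEven g f) =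
      (coder idL f idL).comp (bh ϑ (mu g)) - (bh ϑ (mu g)).comp (coder idL f idL) := by
  set b := bh ϑ (mu g) with hb; set K : 𝕋 →ₗ[R] 𝕋 := coder idL f idL with hK
  have kK : IsCoder idL idL K := isCoalg_id.isCoder isCoalg_id f
  have prK : ∀ t, pr (K t) = f t := fun t => lcongr (isCoalg_id.pr_coder isCoalg_id f) t
  have hth : ∀ t, th ϑ (K t) = K (th ϑ t) := by
    have a := (isCoalg_th ϑ).comp_coder kK; have c := kK.comp_coalg (isCoalg_th ϑ)
    rw [comp_id] at a; rw [id_comp] at c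
    have := (a.sub c).eq_zero' (isCoalg_th _) (LinearMap.ext fun t => by
      simp only [comp_apply, sub_apply, map_sub, pr_th, prK, hf t, sub_self, zero_apply])
    exact fun t => sub_eq_zero.1 (lcongr this t)
  have hc : IsCoder (th ϑ) idL (K.comp b - b.comp K) := by
    refine ⟨?_, ?_⟩
    · rw [comp_sub, ← comp_assoc, ← comp_assoc, kK.eps_comp,
        (isCoder_bh _ _).eps_comp, zero_comp, zero_comp, sub_zero]
    · rw [comp_sub, dec_coder_comp_coder kK.dec_comp (isCoder_bh _ _).dec_comp,
        dec_coder_comp_coder (isCoder_bh _ _).dec_comp kK.dec_comp, ← sub_comp]; congr 1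
      refine TensorProduct.ext' fun x y => ?_
      simp only [add_apply, sub_apply, map_tmul, comp_apply, LinearMap.id_apply, ← hb, tmul_sub,
        sub_tmul, hth]; abel
  rw [hc.eq_coder (isCoalg_th _) isCoalg_id, bh]; congr 1; refine LinearMap.ext fun t => ?_
  simp only [comp_apply, sub_apply, map_sub, hb, prK, pr_bh, dEven, ← hK]

/-- The square of the Hochschild differential vanishes. -/
lemma dEven_dOdd (g : Mat n L) {H : ℭ} (hH : IsOdd ϑ H) : dEven g (dOdd g H) = 0 := by
  refine LinearMap.ext fun t => ?_; rw [dEven, coder_id_dOdd g hH]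
  simp only [sub_apply, comp_apply, add_apply, dOdd, bh_mu_bh_mu,
    map_zero, map_add, mu_bh_mu, zero_apply]; abel

lemma dOdd_dEven (g : Mat n L) {f : ℭ} (hf : IsEven ϑ f) : dOdd g (dEven g f) = 0 := by
  refine LinearMap.ext fun t => ?_; rw [dOdd, bh_dEven g hf]
  simp only [sub_apply, comp_apply, add_apply, dEven, bh_mu_bh_mu,
    map_zero, map_sub, mu_bh_mu, zero_apply]; abel

/-! ## Reduced cochains and normal forms -/

/-- Reduced homogeneous cochains of arity `k`. -/
structure IsC (t : ℤ) (k : ℕ) (F : ℭ) : Prop where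
  homog : Homog t F
  red : RedH (oneM n R L) F
  supp : ∀ l : List ℳ, l.length ≠ k → F (wd l) = 0

lemma redH_iff {F : ℭ} : RedH (oneM n R L) F ↔
    ∀ u v : List ℳ, F (wd (u ++ oneM n R L :: v)) = 0 := by
  refine ⟨fun h u v => by rw [wd_append, wd_cons, h], fun h s t => ?_⟩
  induction s using wdInduction with
  | add a b ha hb => simp only [add_mul, map_add, ha, hb, add_zero]
  | smul r a ha => simp only [smul_mul_assoc, map_smul, ha, smul_zero]
  | word u =>
    induction t using wdInduction with
    | add a b ha hb => simp only [mul_add, map_add, ha, hb, add_zero]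
    | smul r a ha => simp only [mul_smul_comm, map_smul, ha, smul_zero]
    | word v => rw [← wd_cons, ← wd_append, h]

lemma Homog.smul {t : ℤ} {F : ℭ} (hF : Homog t F) (r : R) :
    Homog t (r • F) := fun l γ h => smul_mem _ _ (hF l γ h)

lemma IsC.add {t : ℤ} {k : ℕ} {F G : ℭ} (hF : IsC t k F) (hG : IsC t k G) : IsC t k (F + G) :=
  ⟨hF.homog.add hG.homog, fun s t => by rw [add_apply, hF.red, hG.red, add_zero],
    fun l hl => by rw [add_apply, hF.supp l hl, hG.supp l hl, add_zero]⟩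

lemma IsC.smul {t : ℤ} {k : ℕ} {F : ℭ} (hF : IsC t k F) (r : R) : IsC t k (r • F) :=
  ⟨hF.homog.smul r, fun s t => by rw [LinearMap.smul_apply, hF.red, smul_zero],
    fun l hl => by rw [LinearMap.smul_apply, hF.supp l hl, smul_zero]⟩

lemma IsC.neg {t : ℤ} {k : ℕ} {F : ℭ} (hF : IsC t k F) : IsC t k (-F) := by
  rw [← neg_one_smul R F]; exact hF.smul (-1)

lemma IsC.sub {t : ℤ} {k : ℕ} {F G : ℭ} (hF : IsC t k F) (hG : IsC t k G) : IsC t k (F - G) := by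
  rw [sub_eq_add_neg]; exact hF.add hG.neg

lemma isC_zero (t : ℤ) (k : ℕ) : IsC t k (0 : ℭ) :=
  ⟨fun _ _ _ => zero_mem _, fun _ _ => rfl, fun _ _ => rfl⟩

lemma IsC.ext {t : ℤ} {k : ℕ} {F G : ℭ} (hF : IsC t k F) (hG : IsC t k G)
    (h : ∀ l : List ℳ, l.length = k → F (wd l) = G (wd l)) : F = G := by
  refine ext_wd fun l => ?_
  by_cases hl : l.length = k
  · exact h l hl
  · rw [hF.supp l hl, hG.supp l hl]

lemma comp_coder_wd_eq_zero {A F : ℭ} {P : 𝕋 →ₗ[R] 𝕋} {j k : ℕ}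
    (hA : ∀ l : List ℳ, l.length ≠ j → A (wd l) = 0)
    (hF : ∀ l : List ℳ, l.length ≠ k → F (wd l) = 0)
    (hP : ∀ l : List ℳ, ∃ l' : List ℳ, l'.length = l.length ∧ P (wd l) = wd l')
    {l : List ℳ} (hl : l.length + 1 ≠ j + k) : A (coder P F idL (wd l)) = 0 := by
  refine coder_wd_mem (AddMonoidHom.mker A.toAddMonoidHom) fun u v x huvx => ?_
  change A (P (wd u) * (ι R (F (wd v)) * wd x)) = 0
  have hlen : u.length + (v.length + x.length) = l.length := by
    rw [← huvx, length_append, length_append]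
  by_cases hv : v.length = k
  · obtain ⟨u', hu', e⟩ := hP u; rw [e, ← wd_cons, ← wd_append]; refine hA _ ?_
    rw [length_append, length_cons]; omega
  · rw [hF v hv]; simp

lemma th_wd_length (l : List ℳ) : ∃ l' : List ℳ, l'.length = l.length ∧ th ϑ (wd l) = wd l' :=
  ⟨l.map ϑ, by simp, th_wd _ _⟩

lemma id_wd_length (l : List ℳ) :
    ∃ l' : List ℳ, l'.length = l.length ∧ LinearMap.id (R := R) (wd l) = wd (R := R) l' :=
  ⟨l, rfl, rfl⟩

lemma mu_supp (g : Mat n L) (l : List ℳ) (h : l.length ≠ 2) :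
    mu (R := R) g (wd l) = 0 := mu_eq_zero g h

lemma IsC.dOdd {t : ℤ} {k : ℕ} {F : ℭ} (hF : IsC t k F) (ht : t.natAbs = 1)
    (g : Mat n L) : IsC (t + 1) (k + 1) (dOdd g F) := by
  refine ⟨?_, fun s s' => ?_, fun l hl => ?_⟩
  · refine Homog.add ?_ ?_
    · rw [add_comm]; exact hF.homog.comp (homog_mu g).bh
    · exact (homog_mu g).comp (hF.homog.coder homogT_th homogT_id)
  · have h1 : bh ϑ F (s * (ι R (oneM n R L) * s')) = bh ϑ F s * (ι R (oneM n R L) * s') -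
          th ϑ s * (ι R (oneM n R L) * bh ϑ F s') := by
      have := hF.red.coder (F := pr) (F' := pr) (τ := ϑ) (fun s t => isGauge_pr.red s t)
        (fun s t => isGauge_pr.red s t) pr_one pr_one tau_oneM s s'; rw [hat_pr, comp_id] at this
      exact this
    rw [SphPair.dOdd, add_apply, comp_apply, comp_apply, h1,
      (redB_mu g).bh (homog_mu g).map_one tau_oneM]; simp only [map_add, map_sub, map_smul]
    rw [hF.red, hF.red, redB_mu, redB_mu]; rw [eps_bh, eps_bh, pr_bh, pr_bh, hF.homog.isOdd ht,
      show eps (th ϑ s) = eps s from lcongr (isCoalg_th ϑ).eps_comp s]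
    simp only [zero_smul, smul_neg]; abel
  · rw [SphPair.dOdd, add_apply, comp_apply, comp_apply,
      bh, bh, comp_coder_wd_eq_zero hF.supp (mu_supp g) th_wd_length (by omega),
      comp_coder_wd_eq_zero (mu_supp g) hF.supp th_wd_length (by omega), add_zero]

lemma isStr_mu (N : ℕ∞) (hN : 2 ≤ N) (g : Mat n L) : IsStr N g (mu (R := R) g) where
  homog := homog_mu g
  red := redB_mu g
  letter a := by simpa using mu_eq_zero (R := R) g (l := [a]) (by simp)
  two := mu_two g
  top l hl := mu_eq_zero g (fun h => by
    rw [h] at hl; exact absurd hl (not_lt.2 (by exact_mod_cast hN)))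
  sq _ _ t _ := mu_bh_mu g t

lemma IsC.isGauge_add {d : ℕ} (hd : 1 ≤ d) {F f : ℭ} (hF : IsGauge F)
    (hf : IsC 0 (d + 1) f) : IsGauge (F + f) where
  homog := hF.homog.add hf.homog
  red s t := by rw [add_apply, hF.red, hf.red, add_zero]
  letter a := by
    have := hf.supp [a] (by simp; omega); simp only [wd_cons, wd_nil, mul_one] at this
    rw [add_apply, hF.letter, this, add_zero]

lemma IsC.dEven {d : ℕ} (hd : 1 ≤ d) {f : ℭ} (hf : IsC 0 (d + 1) f)
    (g : Mat n L) : IsC 1 (d + 2) (dEven g f) := by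
  have hs : ∀ l : List ℳ, l.length ≠ d + 2 → SphPair.dEven g f (wd l) = 0 := fun l hl => by
    rw [SphPair.dEven, sub_apply, comp_apply, comp_apply,
      bh, comp_coder_wd_eq_zero hf.supp (mu_supp g) th_wd_length (by omega),
      comp_coder_wd_eq_zero (mu_supp g) hf.supp id_wd_length (by omega), sub_zero]
  refine ⟨?_, redH_iff.2 fun u v => ?_, hs⟩
  · refine Homog.sub ?_ ?_
    · exact hf.homog.comp (homog_mu g).bh
    · simpa using (homog_mu g).comp (hf.homog.coder homogT_id homogT_id)
  · by_cases hl : (u ++ oneM n R L :: v).length = d + 2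
    · have hG := hf.isGauge_add hd isGauge_pr
      obtain ⟨B, hB, hrel⟩ := hG.exists_transport (N := ⊤) le_top (isStr_mu ⊤ le_top g)
      have := GRel.sub_eq (isStr_mu ⊤ le_top g) hB isGauge_pr hG (gRel_refl ⊤ _) hrel (d := d) le_top
        (fun l hl => by rw [add_apply, hf.supp l (by omega), add_zero]) (wd_Tle hl.le)
      rw [add_sub_cancel_left] at this; rw [← this, wd_append, wd_cons, hB.red, redB_mu, sub_self]
    · exact hs _ hl

lemma exists_part (k : ℕ) (F : ℭ) : ∃ G : ℭ,
    ∀ l : List ℳ, G (wd l) = if l.length = k then F (wd l) else 0 := by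
  obtain ⟨G, hG⟩ := exists_assemble (fun j => if j = k then F else 0); refine ⟨G, fun l => ?_⟩
  rw [hG]
  split_ifs <;> rfl

/-- The part of a cochain of arity `k`. -/
def part (k : ℕ) : ℭ →ₗ[R] ℭ where
  toFun F := (exists_part k F).choose
  map_add' F G := ext_wd fun l => by
    rw [add_apply, (exists_part k F).choose_spec, (exists_part k G).choose_spec,
      (exists_part k (F + G)).choose_spec]
    split_ifs <;> simp
  map_smul' r F := ext_wd fun l => by
    rw [RingHom.id_apply, LinearMap.smul_apply, (exists_part k F).choose_spec,
      (exists_part k (r • F)).choose_spec]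
    split_ifs <;> simp

lemma part_wd (k : ℕ) (F : ℭ) (l : List ℳ) :
    part k F (wd l) = if l.length = k then F (wd l) else 0 := (exists_part k F).choose_spec l

lemma part_congr {k : ℕ} {F G : ℭ}
    (h : ∀ l : List ℳ, l.length = k → F (wd l) = G (wd l)) : part k F = part k G := by
  refine ext_wd fun l => ?_; rw [part_wd, part_wd]
  split_ifs with hl
  · exact h l hl
  · rfl

lemma Homog.part {t : ℤ} {F : ℭ} (hF : Homog t F) (k : ℕ) : Homog t (part k F) := fun l γ h => by
  rw [part_wd]
  split_ifs
  · exact hF l γ h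
  · exact zero_mem _

lemma IsStr.isC_part {N : ℕ∞} {g : Mat n L} {B : ℭ}
    (h : IsStr N g B) {d : ℕ} (hd : 1 ≤ d) : IsC 1 (d + 2) (part (d + 2) B) := by
  refine ⟨h.homog.part _, redH_iff.2 fun u v => ?_, fun l hl => by rw [part_wd, if_neg hl]⟩
  rw [part_wd]
  split_ifs with hl
  · simp only [length_append, length_cons] at hl; rw [wd_append, wd_cons, h.red]
    rcases u with _ | ⟨a, u⟩
    · simp only [length_nil] at hl; rw [pr_wd_eq_zero (l := v) (by omega), wd_nil, pr_one]; simp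
    · rw [eps_wd (l := a :: u) (by simp)]; rcases v with _ | ⟨b, v⟩
      · simp only [length_nil, length_cons] at hl
        rw [pr_wd_eq_zero (l := a :: u) (by rw [length_cons]; omega)]; simp
      · rw [eps_wd (l := b :: v) (by simp)]; simp
  · rfl

lemma IsGauge.isC_part {F : ℭ} (h : IsGauge F) {d : ℕ} (hd : 1 ≤ d) :
    IsC 0 (d + 1) (part (d + 1) F) := by
  refine ⟨h.homog.part _, redH_iff.2 fun u v => ?_, fun l hl => by rw [part_wd, if_neg hl]⟩
  rw [part_wd]
  split_ifs with hl
  · simp only [length_append, length_cons] at hl; rw [wd_append, wd_cons, h.red]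
    rcases u with _ | ⟨a, u⟩
    · rcases v with _ | ⟨b, v⟩
      · simp at hl; omega
      · rw [eps_wd (l := b :: v) (by simp)]; simp
    · rw [eps_wd (l := a :: u) (by simp)]; simp
  · rfl

/-- Contractions of the reduced Hochschild complex in the degrees governing gauge transformations
and structures. -/
structure Splitting (g : Mat n L) where
  r₀ : ℕ → ℭ →ₗ[R] ℭ
  r₁ : ℕ → ℭ →ₗ[R] ℭ
  r₂ : ℕ → ℭ →ₗ[R] ℭ
  mem₀ : ∀ d F, IsC (-1) d (r₀ d F)
  mem₁ : ∀ d F, IsC 0 (d + 1) (r₁ d F)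
  mem₂ : ∀ d F, IsC 1 (d + 2) (r₂ d F)
  r₁_d : ∀ d, 1 ≤ d → ∀ f, IsC 0 (d + 1) f → r₁ d (dEven g f) = f - dOdd g (r₀ d f)
  r₂_d : ∀ d, 3 ≤ d → ∀ m, IsC 1 (d + 2) m → r₂ d (dOdd g m) = m - dEven g (r₁ d m)

variable {g : Mat n L}

/-- The structure `B` is in normal form with respect to the splitting `S`. -/
def IsNormal (S : Splitting (R := R) g) (N : ℕ∞) (B : ℭ) : Prop :=
  ∀ d : ℕ, 1 ≤ d → ((d + 2 : ℕ) : ℕ∞) ≤ N → dEven g (S.r₁ d (part (d + 2) B)) = 0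

lemma dEven_sub (g : Mat n L) (F G : ℭ) : dEven g (F - G) = dEven g F - dEven g G := by
  have h := coder_add (idL : 𝕋 →ₗ[R] 𝕋) (F - G) G idL; rw [sub_add_cancel] at h
  rw [dEven, dEven, dEven, h]; refine LinearMap.ext fun t => ?_
  simp only [sub_apply, comp_apply, add_apply, map_add]; abel

lemma Splitting.dEven_r₁_dEven (S : Splitting (R := R) g) {d : ℕ} (hd : 1 ≤ d)
    {f : ℭ} (hf : IsC 0 (d + 1) f) : dEven g (S.r₁ d (dEven g f)) = dEven g f := by
  rw [S.r₁_d d hd f hf, dEven_sub, dEven_dOdd g ((S.mem₀ d f).homog.isOdd rfl), sub_zero]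

lemma part_dEven {d : ℕ} (g : Mat n L) {B B' φ f : ℭ}
    (hf : ∀ l : List ℳ, l.length ≤ d + 1 → f (wd l) = φ (wd l))
    (hs : ∀ l : List ℳ, l.length ≠ d + 2 → dEven g f (wd l) = 0)
    (h : ∀ t ∈ Tle R ℳ (d + 2), B' t - B t = dEven g φ t) :
    part (d + 2) B' - part (d + 2) B = dEven g f := by
  rw [← map_sub]; refine ext_wd fun l => ?_; rw [part_wd]
  split_ifs with hl
  · rw [sub_apply, h _ (wd_Tle hl.le), ← sub_eq_zero, ← sub_apply, ← dEven_sub]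
    exact dEven_apply_eq_zero g (d := d + 1) (fun l hl => by
      rw [sub_apply, hf l hl, sub_self]) (wd_Tle hl.le)
  · rw [hs l hl]

lemma IsGauge.part_eq {F : ℭ} {d : ℕ} (hd : 1 ≤ d)
    (h : ∀ l : List ℳ, l.length ≤ d → F (wd l) = pr (wd (R := R) l)) {l : List ℳ}
    (hl : l.length ≤ d + 1) : part (d + 1) F (wd l) = (F - pr : ℭ) (wd l) := by
  rw [part_wd, sub_apply]
  split_ifs with h'
  · rw [pr_wd_eq_zero (by omega), sub_zero]
  · rw [h l (by omega), sub_self]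

lemma IsNormal.step (S : Splitting (R := R) g) {N : ℕ∞} {B B' F : ℭ}
    (hB : IsStr N g B) (hB' : IsStr N g B') (nB : IsNormal S N B) (nB' : IsNormal S N B')
    (hF : IsGauge F) (h : GRel N B B' F) {d : ℕ} (hd : 1 ≤ d) (hdN : ((d + 2 : ℕ) : ℕ∞) ≤ N)
    (hFd : ∀ l : List ℳ, l.length ≤ d → F (wd l) = pr (wd (R := R) l)) :
    part (d + 2) B = part (d + 2) B' ∧ ∃ F', IsGauge F' ∧ GRel N B B' F' ∧
      ∀ l : List ℳ, l.length ≤ d + 1 → F' (wd l) = pr (wd (R := R) l) := by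
  have hf : IsC 0 (d + 1) (part (d + 1) F) := hF.isC_part hd
  have e := part_dEven g (fun l hl => IsGauge.part_eq hd hFd hl) (hf.dEven hd g).supp
    (fun t ht => GRel.sub_eq hB hB' isGauge_pr hF (gRel_refl N B) h hdN hFd ht)
  have e0 : dEven g (part (d + 1) F) = 0 := by
    rw [← S.dEven_r₁_dEven hd hf, ← e, map_sub, dEven_sub, nB d hd hdN, nB' d hd hdN, sub_zero]
  refine ⟨by rw [e0, sub_eq_zero] at e; exact e.symm, ?_⟩; have e1 := S.r₁_d d hd _ hf
  rw [e0, map_zero] at e1; obtain ⟨d, rfl⟩ := Nat.exists_eq_add_of_le' hd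
  have hH := (S.mem₀ (d + 1) (part (d + 1 + 1) F)).neg
  obtain ⟨F', hF', hrel, hF'F⟩ := h.exists_homotopy hB hB' hF hH.homog hH.red (d := d)
    (fun l hl => hH.supp l (by omega)); refine ⟨F', hF', hrel, fun l hl => ?_⟩
  rw [hF'F _ (wd_Tle hl)]; have e2 : dOdd g (-(S.r₀ (d + 1)) (part (d + 1 + 1) F)) =
      -dOdd g ((S.r₀ (d + 1)) (part (d + 1 + 1) F)) := by
    refine LinearMap.ext fun t => ?_
    have hb := coder_add (th ϑ) (-(S.r₀ (d + 1)) (part (d + 1 + 1) F))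
      ((S.r₀ (d + 1)) (part (d + 1 + 1) F)) idL; rw [neg_add_cancel] at hb
    have h0 : coder (th ϑ) (0 : ℭ) idL = 0 := by
      have := coder_add (th ϑ) (0 : ℭ) 0 idL; rw [add_zero] at this; exact left_eq_add.1 this
    rw [h0] at hb; rw [dOdd, dOdd, bh, bh, eq_neg_of_add_eq_zero_left hb.symm]
    simp only [LinearMap.neg_apply, add_apply, comp_apply, map_neg]; abel
  rw [e2, ← sub_eq_zero.1 e1.symm, LinearMap.neg_apply, IsGauge.part_eq hd hFd hl, sub_apply]; abel

/-- Gauge equivalent structures in normal form are equal. -/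
lemma IsNormal.eq_of_gRel (S : Splitting (R := R) g) {N : ℕ∞} {B B' F : ℭ}
    (hB : IsStr N g B) (hB' : IsStr N g B') (nB : IsNormal S N B) (nB' : IsNormal S N B')
    (hF : IsGauge F) (h : GRel N B B' F) : B = B' := by
  have key : ∀ d : ℕ, 1 ≤ d → ((d + 1 : ℕ) : ℕ∞) ≤ N → ∃ F, IsGauge F ∧ GRel N B B' F ∧
      ∀ l : List ℳ, l.length ≤ d → F (wd l) = pr (wd (R := R) l) := by
    intro d hd
    induction d, hd using Nat.le_induction with
    | base => exact fun _ => ⟨F, hF, h, fun l hl => hF.apply_of_mem (wd_Tle hl)⟩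
    | succ d hd ih =>
      intro hN; obtain ⟨F₁, h1, h2, h3⟩ := ih (le_trans (by exact_mod_cast Nat.le_succ _) hN)
      exact (IsNormal.step S hB hB' nB nB' h1 h2 hd hN h3).2
  refine ext_wd fun l => ?_
  by_cases hN : (l.length : ℕ∞) ≤ N
  · by_cases hl : l.length ≤ 2
    · rw [hB.eq_mu (wd_Tle hl), hB'.eq_mu (wd_Tle hl)]
    · obtain ⟨d, hd⟩ : ∃ d, l.length = d + 2 := ⟨l.length - 2, by omega⟩; rw [hd] at hN
      obtain ⟨F₁, h1, h2, h3⟩ := key d (by omega) (le_trans (by exact_mod_cast Nat.le_succ _) hN)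
      have := lcongr (IsNormal.step S hB hB' nB nB' h1 h2 (by omega) hN h3).1 (wd l)
      rwa [part_wd, part_wd, if_pos hd, if_pos hd] at this
  · rw [hB.top l (not_le.1 hN), hB'.top l (not_le.1 hN)]

/-- Every structure is gauge equivalent to one in normal form. -/
lemma IsStr.exists_normal (S : Splitting (R := R) g) {N : ℕ∞} (hN : 2 ≤ N)
    {B : ℭ} (hB : IsStr N g B) :
    ∃ B' F, IsStr N g B' ∧ IsNormal S N B' ∧ IsGauge F ∧ GRel N B B' F := by
  let T : {F : ℭ // IsGauge F} → ℭ := fun F => (F.2.exists_transport hN hB).choose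
  have hT : ∀ F, IsStr N g (T F) ∧ GRel N B (T F) F.1 := fun F =>
    (F.2.exists_transport hN hB).choose_spec
  let G : ℕ → {F : ℭ // IsGauge F} := fun d => Nat.rec ⟨pr, isGauge_pr⟩
    (fun d F => ⟨F.1 + -S.r₁ (d + 1) (part (d + 3) (T F)),
      (S.mem₁ (d + 1) _).neg.isGauge_add (by omega) F.2⟩) d
  have hG : ∀ d, (G (d + 1)).1 = (G d).1 + -S.r₁ (d + 1) (part (d + 3) (T (G d))) := fun d => rfl
  have hGe : ∀ d e, d ≤ e → ∀ l : List ℳ, l.length ≤ d + 1 → (G e).1 (wd l) = (G d).1 (wd l) := by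
    intro d e hde l hl
    induction e, hde using Nat.le_induction with
    | base => rfl
    | succ e hde ih => rw [hG, add_apply, (S.mem₁ (e + 1) _).neg.supp l (by omega), add_zero, ih]
  obtain ⟨F, hF⟩ := exists_assemble (fun k => (G k).1)
  have hFG : ∀ d, ∀ l : List ℳ, l.length ≤ d + 1 → F (wd l) = (G d).1 (wd l) := by
    intro d l hl; rw [hF]
    by_cases h : l.length ≤ d
    · exact (hGe l.length d h l (by omega)).symm
    · exact hGe d l.length (by omega) l hl
  have hFg : IsGauge F := isGauge_iff_words.2 fun l => by
    rw [hF]; exact isGauge_iff_words.1 (G l.length).2 l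
  obtain ⟨hTs, hTr⟩ := hT ⟨F, hFg⟩; refine ⟨T ⟨F, hFg⟩, F, hTs, fun d hd hdN => ?_, hFg, hTr⟩
  have e1 : part (d + 2) (T ⟨F, hFg⟩) = part (d + 2) (T (G d)) := part_congr fun l hl => by
    have := GRel.sub_eq hB hTs (G d).2 hFg (hT (G d)).2 hTr hdN (fun l hl => hFG d l (by omega))
      (wd_Tle hl.le); rw [dEven_apply_eq_zero g (d := d + 1) (fun l hl => by
      rw [sub_apply, hFG d l hl, sub_self]) (wd_Tle hl.le)] at this
    exact sub_eq_zero.1 this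
  obtain ⟨d, rfl⟩ := Nat.exists_eq_add_of_le' hd
  have hφ := (S.mem₁ (d + 1) (part (d + 3) (T (G d)))).neg
  have e2 := part_dEven g (B := T (G d)) (B' := T (G (d + 1))) (d := d + 1)
    (φ := (G (d + 1)).1 - (G d).1) (f := -S.r₁ (d + 1) (part (d + 3) (T (G d))))
    (fun l _ => by rw [hG, add_sub_cancel_left]) (hφ.dEven hd g).supp
    (fun t ht => GRel.sub_eq hB (hT _).1 (G d).2 (G (d + 1)).2 (hT _).2 (hT _).2 hdN
      (fun l hl => hGe d (d + 1) (by omega) l hl) ht); have e3 := S.dEven_r₁_dEven hd hφ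
  rw [← e2, map_sub, dEven_sub, e2] at e3
  have e4 : dEven g (-S.r₁ (d + 1) (part (d + 3) (T (G d)))) =
      -dEven g (S.r₁ (d + 1) (part (d + 3) (T (G d)))) := by
    have z := dEven_sub g (0 : ℭ) 0; rw [sub_zero, sub_self] at z
    rw [← zero_sub, dEven_sub, z, zero_sub]
  rw [e4] at e3; rw [e1, sub_eq_iff_eq_add.1 e3, neg_add_cancel]

lemma bh_add (B C : ℭ) : bh ϑ (B + C) = bh ϑ B + bh ϑ C := coder_add _ _ _ _

/-- The identities for the operations of arity at most `d + 2`, in terms of the Hochschild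
differential of the operation of arity `d + 2`. -/
lemma comp_bh_eq {C β : ℭ} {d : ℕ} (hd : 1 ≤ d) (hC : ∀ t ∈ Tle R ℳ 2, C t = mu g t)
    (hβ : ∀ l : List ℳ, l.length ≠ d + 2 → β (wd l) = 0) {l : List ℳ}
    (hl : l.length = d + 3) : (C + β) (bh ϑ (C + β) (wd l)) =
      C (bh ϑ C (wd l)) + dOdd g β (wd l) := by
  have h1 : C (bh ϑ β (wd l)) = mu g (bh ϑ β (wd l)) :=
    hC _ (bh_mem_Tle (s := d + 1) (fun l hl => hβ l (by omega)) (by omega) (wd_Tle le_rfl))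
  have h2 : β (bh ϑ C (wd l)) = β (bh ϑ (mu g) (wd l)) := by
    have e : bh ϑ C (wd l) = bh ϑ (mu g) (wd l) + bh ϑ (C - mu g) (wd l) := by
      rw [bh, bh, bh, ← add_apply, ← coder_add, add_sub_cancel]
    have e' := apply_eq_zero_of_mem (H := β) (d := d + 1) (fun l hl => hβ l (by omega))
      (bh_mem_Tle (s := 2) (B := C - mu g) (t := wd l) (fun l hl => by
      rw [sub_apply, hC _ (wd_Tle hl), sub_self]) le_rfl (wd_Tle (by omega)))
    rw [e, map_add, e', add_zero]
  have h3 : β (bh ϑ β (wd l)) = 0 := comp_coder_wd_eq_zero hβ hβ th_wd_length (by omega)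
  rw [bh_add, add_apply, add_apply, map_add, map_add, h1, h2, h3, dOdd,
    add_apply, comp_apply, comp_apply]; abel

end Twist

/-! ## Exactness of the bar complex over a field -/

/-- Letters for the reduced bar complex of `S(Rⁿ, g)`, with `κ` indexing generators of `L`. -/
inductive Letter (κ : Type) (n : ℕ) : Type
  | xi (k : κ)
  | eta
  | v (i : Fin n)
  | w (i : Fin n)

/-- Words in the letters, for `L` of rank one. -/
notation "Wd" n:max => List (Letter Unit n)

namespace Letter

/-- Source, target and degree of a letter, the degree being shifted by one. -/
def ty {κ : Type} {n : ℕ} : Letter κ n → Obj × Obj × ℤ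
  | xi _ => (.X, .X, 0)
  | eta => (.Y, .Y, 0)
  | v _ => (.X, .Y, -1)
  | w _ => (.Y, .X, 0)

section

variable {n : ℕ} {K M : Type*} [Field K] [AddCommGroup M] [Module K M] (G : Mat n K)

/-- The functional `φ`, precomposed with the contraction by a covector. -/
def cw (p : Fin n → K) (φ : Wd n → M) : Wd n → M
  | v j :: s => (∑ i, p i * G i j) • φ s
  | _ => 0

/-- The functional `φ`, precomposed with the contraction by a vector. -/
def cv (q : Fin n → K) (φ : Wd n → M) : Wd n → M
  | w j :: s => q j • φ s
  | _ => 0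

/-- The dual of the bar differential. -/
def D : Wd n → (Wd n → M) → M
  | [], _ => 0
  | xi _ :: t, φ => D t (fun s => φ (xi () :: s))
  | eta :: t, φ => D t (fun s => φ (eta :: s))
  | v i :: t, φ => cv (single i (1 : K)) (fun s => φ (eta :: s)) t - D t (fun s => φ (v i :: s))
  | w i :: t, φ => D t (fun s => φ (w i :: s)) - cw G (single i 1) (fun s => φ (xi () :: s)) t

/-- The number of letters `ξ` and `η`. -/
def weight : Wd n → ℕ
  | [] => 0
  | xi _ :: t => weight t + 1
  | eta :: t => weight t + 1
  | v _ :: t => weight t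
  | w _ :: t => weight t

lemma D_congr {t : Wd n} {φ ψ : Wd n → M}
    (h : ∀ s, s.length + 1 = t.length → weight s = weight t + 1 → φ s = ψ s) : D G t φ = D G t ψ := by
  induction t generalizing φ ψ with
  | nil => rfl
  | cons a t ih =>
    cases a with
    | xi _ => exact ih fun s h1 h2 => h _ (by simp [h1]) (by simp [weight, h2])
    | eta => exact ih fun s h1 h2 => h _ (by simp [h1]) (by simp [weight, h2])
    | v i =>
      rw [D, D, ih fun s h1 h2 => h _ (by simp [h1]) (by simp [weight, h2])]; congr 1
      rcases t with _ | ⟨b, t⟩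
      · rfl
      · cases b <;> simp only [cv]
        rw [h _ (by simp) (by simp [weight])]
    | w i =>
      rw [D, D, ih fun s h1 h2 => h _ (by simp [h1]) (by simp [weight, h2])]; congr 1
      rcases t with _ | ⟨b, t⟩
      · rfl
      · cases b <;> simp only [cw]
        rw [h _ (by simp) (by simp [weight])]

lemma shift_mul_cls {t : ℤ} (p : Obj × Obj × ℤ) (γ : Gr) :
    (Gr.mk p.1 p.2.1 p.2.2 * γ).shift t = (Gr.mk p.1 p.2.1 (p.2.2 + t)) * γ :=
  Gr.shift_mul_left (by simp) t γ

lemma D_congr_cls {t : Wd n} {φ ψ : Wd n → M}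
    (h : ∀ s, s.length + 1 = t.length → cls (s.map ty) = (cls (t.map ty)).shift 1 → φ s = ψ s) :
    D G t φ = D G t ψ := by
  have key : ∀ (a : Letter Unit n) (t s : Wd n), s ≠ [] →
      cls (s.map ty) = (cls (t.map ty)).shift 1 →
      cls ((a :: s).map ty) = (cls ((a :: t).map ty)).shift 1 := by
    intro a t s hs hst; rw [map_cons, map_cons, cls_cons, cls_cons, hst]
    refine (Gr.shift_mul_right (fun h1 => ?_) 1 _).symm; rw [h1] at hst
    exact cls_ne_one (by simpa using hs) hst
  induction t generalizing φ ψ with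
  | nil => rfl
  | cons a t ih =>
    have hk : ∀ s, s.length + 1 = t.length → cls (s.map ty) = (cls (t.map ty)).shift 1 →
        φ (a :: s) = ψ (a :: s) := fun s h1 h2 => h _ (by simp [h1]) (by
      rcases s with _ | ⟨b, s⟩
      · have : t.length = 1 := by simpa using h1.symm
        obtain ⟨c, rfl⟩ := List.length_eq_one_iff.1 this
        cases c <;> simp [cls, ty, Gr.shift, Gr.one_def] at h2
      · exact key a t _ (by simp) h2)
    cases a with
    | xi k => exact ih hk
    | eta => exact ih hk
    | v i =>
      rw [D, D, ih hk]; congr 1; rcases t with _ | ⟨b, t⟩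
      · rfl
      · cases b <;> simp only [cv]
        rw [h _ (by simp) (by
          simp only [map_cons, cls_cons, ty]; rw [← mul_assoc, Gr.mk_mul_mk, if_pos rfl]
          exact (shift_mul_cls (t := 1) (.Y, .Y, -1) _).symm)]
    | w i =>
      rw [D, D, ih hk]; congr 1; rcases t with _ | ⟨b, t⟩
      · rfl
      · cases b <;> simp only [cw]
        rw [h _ (by simp) (by
          simp only [map_cons, cls_cons, ty]; rw [← mul_assoc, Gr.mk_mul_mk, if_pos rfl]
          exact (shift_mul_cls (t := 1) (.X, .X, -1) _).symm)]

lemma D_map {M' : Type*} [AddCommGroup M'] [Module K M'] (f : M →ₗ[K] M') (t : Wd n)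
    (φ : Wd n → M) : D G t (fun s => f (φ s)) = f (D G t φ) := by
  induction t generalizing φ with
  | nil => simp [D]
  | cons a t ih =>
    cases a with
    | xi k => exact ih _
    | eta => exact ih _
    | v i =>
      rw [D, D, map_sub, ih]; congr 1; rcases t with _ | ⟨b, t⟩
      · simp [cv]
      · cases b <;> simp [cv]
    | w i =>
      rw [D, D, map_sub, ih]; congr 1; rcases t with _ | ⟨b, t⟩
      · simp [cw]
      · cases b <;> simp [cw]

lemma cw_add (p : Fin n → K) (φ ψ : Wd n → M) (t : Wd n) :
    cw G p (fun s => φ s + ψ s) t = cw G p φ t + cw G p ψ t := by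
  rcases t with _ | ⟨b, t⟩
  · simp [cw]
  · cases b <;> simp [cw]

lemma cv_add (q : Fin n → K) (φ ψ : Wd n → M) (t : Wd n) :
    cv q (fun s => φ s + ψ s) t = cv q φ t + cv q ψ t := by
  rcases t with _ | ⟨b, t⟩
  · simp [cv]
  · cases b <;> simp [cv]

lemma cw_smul (p : Fin n → K) (c : K) (φ : Wd n → M) (t : Wd n) :
    cw G p (fun s => c • φ s) t = c • cw G p φ t := by
  rcases t with _ | ⟨b, t⟩
  · simp [cw]
  · cases b <;> simp [cw, smul_smul, mul_comm]

lemma cv_smul (q : Fin n → K) (c : K) (φ : Wd n → M) (t : Wd n) :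
    cv q (fun s => c • φ s) t = c • cv q φ t := by
  rcases t with _ | ⟨b, t⟩
  · simp [cv]
  · cases b <;> simp [cv, smul_smul, mul_comm]

lemma D_add (t : Wd n) (φ ψ : Wd n → M) : D G t (fun s => φ s + ψ s) = D G t φ + D G t ψ := by
  induction t generalizing φ ψ with
  | nil => simp [D]
  | cons a t ih => cases a <;> simp only [D, ih, cw_add, cv_add] <;> abel

lemma D_smul (t : Wd n) (c : K) (φ : Wd n → M) : D G t (fun s => c • φ s) = c • D G t φ := by
  induction t generalizing φ with
  | nil => simp [D]
  | cons a t ih => cases a <;> simp only [D, ih, cw_smul, cv_smul, smul_sub]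

lemma D_zero (t : Wd n) : D G t (fun _ => (0 : M)) = 0 := by
  have := D_smul G t (0 : K) (fun _ => (0 : M)); simpa using this

lemma D_neg (t : Wd n) (φ : Wd n → M) : D G t (fun s => -φ s) = -D G t φ := by
  have := D_smul G t (-1 : K) φ; simpa using this

lemma D_sub (t : Wd n) (φ ψ : Wd n → M) : D G t (fun s => φ s - ψ s) = D G t φ - D G t ψ := by
  simp only [sub_eq_add_neg, D_add, D_neg]

lemma D_sum (t : Wd n) (p : Fin n → K) (φ : Fin n → Wd n → M) :
    D G t (fun s => ∑ i, p i • φ i s) = ∑ i, p i • D G t (φ i) := by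
  have : ∀ S : Finset (Fin n), D G t (fun s => ∑ i ∈ S, p i • φ i s) = ∑ i ∈ S, p i • D G t (φ i) := by
    intro S
    induction S using Finset.induction_on with
    | empty => simp [D_zero]
    | insert a S ha ih => simp only [sum_insert ha, D_add, D_smul, ih]
  exact this _

lemma sum_cw (p : Fin n → K) (φ : Wd n → M) (t : Wd n) :
    ∑ i, p i • cw G (single i 1) φ t = cw G p φ t := by
  rcases t with _ | ⟨b, t⟩
  · simp [cw]
  · cases b <;> simp [cw, single_apply, smul_smul, sum_smul]

lemma sum_cv (q : Fin n → K) (φ : Wd n → M) (t : Wd n) :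
    ∑ i, q i • cv (single i (1 : K)) φ t = cv q φ t := by
  rcases t with _ | ⟨b, t⟩
  · simp [cv]
  · cases b <;> simp [cv, single_apply]

lemma sum_D_w (p : Fin n → K) (φ : Wd n → M) (t : Wd n) :
    ∑ i, p i • D G (w i :: t) φ = D G t (fun s => ∑ i, p i • φ (w i :: s)) -
      cw G p (fun s => φ (xi () :: s)) t := by
  simp only [D, smul_sub, sum_sub_distrib, sum_cw, D_sum]

lemma sum_D_v (q : Fin n → K) (φ : Wd n → M) (t : Wd n) :
    ∑ i, q i • D G (v i :: t) φ = cv q (fun s => φ (eta :: s)) t -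
      D G t (fun s => ∑ i, q i • φ (v i :: s)) := by
  simp only [D, smul_sub, sum_sub_distrib, sum_cv, D_sum]

lemma cw_zero (p : Fin n → K) (t : Wd n) : cw G p (fun _ => (0 : M)) t = 0 := by
  rcases t with _ | ⟨b, t⟩
  · simp [cw]
  · cases b <;> simp [cw]

lemma cv_zero (q : Fin n → K) (t : Wd n) : cv q (fun _ => (0 : M)) t = 0 := by
  rcases t with _ | ⟨b, t⟩
  · simp [cv]
  · cases b <;> simp [cv]

lemma D_cw (p : Fin n → K) (ψ : Wd n → M) (t : Wd n) :
    D G t (cw G p ψ) = -cw G p (fun s => D G s ψ) t := by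
  rcases t with _ | ⟨b, t⟩
  · simp [cw, D]
  · cases b with
    | w i => simp [D, cw_zero, D_zero, show ∀ s, cw G p ψ (xi () :: s) = 0 from fun s => rfl,
        show ∀ s, cw G p ψ (w i :: s) = 0 from fun s => rfl, show ∀ φ : Wd n → M,
        cw G p φ (w i :: t) = 0 from fun s => rfl]
    | _ => simp [cw, D, D_zero, cv_zero, D_smul]

lemma D_cv (q : Fin n → K) (ψ : Wd n → M) (t : Wd n) :
    D G t (cv q ψ) = cv q (fun s => D G s ψ) t := by
  rcases t with _ | ⟨b, t⟩
  · simp [cv, D]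
  · cases b with
    | v i => simp [D, cv_zero, D_zero, show ∀ s, cv q ψ (eta :: s) = 0 from fun s => rfl,
        show ∀ s, cv q ψ (v i :: s) = 0 from fun s => rfl, show ∀ φ : Wd n → M,
        cv q φ (v i :: t) = 0 from fun s => rfl]
    | _ => simp [cv, D, D_zero, cw_zero, D_smul]

lemma exists_dual {q : Fin n → K} (hq : q ≠ 0) : ∃ p : Fin n → K, ∑ i, p i * q i = 1 := by
  obtain ⟨i, hi⟩ := Function.ne_iff.1 hq; refine ⟨single i (q i)⁻¹, ?_⟩
  simp only [single_apply, ite_mul, zero_mul, Finset.sum_ite_eq', mem_univ, if_true]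
  exact inv_mul_cancel₀ hi

lemma exists_orthogonal (hn : 2 ≤ n) (q : Fin n → K) :
    ∃ p : Fin n → K, p ≠ 0 ∧ ∑ i, p i * q i = 0 := by
  let i₀ : Fin n := ⟨0, by omega⟩; let i₁ : Fin n := ⟨1, by omega⟩
  have h01 : i₀ ≠ i₁ := by simp [i₀, i₁]
  by_cases h : q i₀ = 0
  · refine ⟨single i₀ 1, by simp, ?_⟩; simp [single_apply, h]
  · refine ⟨single i₁ (q i₀) - single i₀ (q i₁), fun h' => h ?_, ?_⟩
    · have := congrFun h' i₁; simpa [single_apply, h01.symm] using this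
    · simp only [Pi.sub_apply, single_apply, sub_mul, ite_mul, zero_mul, sum_sub_distrib,
        Finset.sum_ite_eq', mem_univ, if_true]; ring

variable {G}

lemma eq_of_D_eq_cw {p v₁ : Fin n → K} (h1 : ∑ j, v₁ j * ∑ i, p i * G i j = 1)
    {θ χ : Wd n → M} {z : Wd n} (h : ∀ j, D G (v j :: z) χ = cw G p θ (v j :: z)) :
    θ z = cv v₁ (fun s => χ (eta :: s)) z - D G z (fun s => ∑ i, v₁ i • χ (v i :: s)) := by
  rw [← sum_D_v]; simp only [h, cw, smul_smul, ← sum_smul, h1, one_smul]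

lemma eq_of_D_eq_cv {q w₁ : Fin n → K} (h1 : ∑ j, w₁ j * q j = 1)
    {θ χ : Wd n → M} {z : Wd n} (h : ∀ j, D G (w j :: z) χ = cv q θ (w j :: z)) :
    θ z = D G z (fun s => ∑ i, w₁ i • χ (w i :: s)) - cw G w₁ (fun s => χ (xi () :: s)) z := by
  rw [← sum_D_w]; simp only [h, cv, smul_smul, ← sum_smul, h1, one_smul]

lemma cv_congr {q : Fin n → K} {k : ℕ} {φ ψ : Wd n → M}
    (h : ∀ z, z.length = k → weight z = 0 → φ z = ψ z) {z : Wd n} (hz : z.length = k + 1)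
    (hw : weight z = 0) : cv q φ z = cv q ψ z := by
  rcases z with _ | ⟨b, z⟩
  · rfl
  · cases b <;> simp only [cv]
    rw [h z (by simpa using hz) (by simpa [weight] using hw)]

lemma cw_congr {p : Fin n → K} {k : ℕ} {φ ψ : Wd n → M}
    (h : ∀ z, z.length = k → weight z = 0 → φ z = ψ z) {z : Wd n} (hz : z.length = k + 1)
    (hw : weight z = 0) : cw G p φ z = cw G p ψ z := by
  rcases z with _ | ⟨b, z⟩
  · rfl
  · cases b <;> simp only [cw]
    rw [h z (by simpa using hz) (by simpa [weight] using hw)]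

lemma exists_contractions (hn : 2 ≤ n) (hG : IsUnit G.det) (k : ℕ) :
    (∀ (p : Fin n → K), p ≠ 0 → ∀ θ χ : Wd n → M,
      (∀ u, u.length = k + 1 → weight u = 0 → D G u χ = cw G p θ u) →
      ∃ ψ : Wd n → M, ∀ z, z.length = k → weight z = 0 → θ z = D G z ψ) ∧
    (∀ (q : Fin n → K), q ≠ 0 → ∀ θ χ : Wd n → M,
      (∀ u, u.length = k + 1 → weight u = 0 → D G u χ = cv q θ u) →
      ∃ ψ : Wd n → M, ∀ z, z.length = k → weight z = 0 → θ z = D G z ψ) := by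
  have hpG : ∀ p : Fin n → K, p ≠ 0 → (fun j => ∑ i, p i * G i j) ≠ 0 := by
    intro p hp h; apply hp; have h' : Matrix.vecMul p G = 0 := h
    have := congrArg (fun x => Matrix.vecMul x G⁻¹) h'
    simpa [Matrix.vecMul_vecMul, Matrix.mul_nonsing_inv _ hG] using this
  induction k with
  | zero =>
    refine ⟨fun p hp θ χ h => ⟨0, fun z hz hw => ?_⟩, fun q hq θ χ h => ⟨0, fun z hz hw => ?_⟩⟩
    · obtain ⟨v₁, h1⟩ := exists_dual (hpG p hp)
      rw [eq_of_D_eq_cw h1 (fun j => h (v j :: z) (by simp [hz]) (by simp [weight, hw])),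
        length_eq_zero_iff.1 hz]; simp [cv, D]
    · obtain ⟨w₁, h1⟩ := exists_dual hq
      rw [eq_of_D_eq_cv h1 (fun j => h (w j :: z) (by simp [hz]) (by simp [weight, hw])),
        length_eq_zero_iff.1 hz]; simp [cw, D]
  | succ k ih =>
    refine ⟨fun p hp θ χ h => ?_, fun q hq θ χ h => ?_⟩
    · obtain ⟨v₁, h1⟩ := exists_dual (hpG p hp)
      obtain ⟨v', hv', h0⟩ := exists_orthogonal hn (fun j => ∑ i, p i * G i j)
      obtain ⟨ψ, hψ⟩ := ih.2 v' hv' (fun s => χ (eta :: s)) (fun s => ∑ i, v' i • χ (v i :: s))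
        (fun u hu hw => by
          have := sum_D_v G v' χ u
          simp only [fun j => h (v j :: u) (by simp [hu]) (by simp [weight, hw]), cw, smul_smul,
            ← sum_smul, h0, zero_smul] at this; exact (sub_eq_zero.1 this.symm).symm)
      refine ⟨fun s => cv v₁ ψ s - ∑ i, v₁ i • χ (v i :: s), fun z hz hw => ?_⟩
      rw [eq_of_D_eq_cw h1 (fun j => h (v j :: z) (by simp [hz]) (by simp [weight, hw])), D_sub,
        cv_congr hψ hz hw]; exact congrArg (· - _) (D_cv G v₁ ψ z).symm
    · obtain ⟨w₁, h1⟩ := exists_dual hq; obtain ⟨w', hw', h0⟩ := exists_orthogonal hn q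
      obtain ⟨ψ, hψ⟩ := ih.1 w' hw' (fun s => χ (xi () :: s)) (fun s => ∑ i, w' i • χ (w i :: s))
        (fun u hu hw => by
          have := sum_D_w G w' χ u
          simp only [fun j => h (w j :: u) (by simp [hu]) (by simp [weight, hw]), cv, smul_smul,
            ← sum_smul, h0, zero_smul] at this; exact sub_eq_zero.1 this.symm)
      refine ⟨fun s => (∑ i, w₁ i • χ (w i :: s)) + cw G w₁ ψ s, fun z hz hw => ?_⟩
      rw [eq_of_D_eq_cv h1 (fun j => h (w j :: z) (by simp [hz]) (by simp [weight, hw])), D_add,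
        cw_congr hψ hz hw, sub_eq_add_neg]; exact congrArg (_ + ·) (D_cw G w₁ ψ z).symm

/-- A cocycle vanishing on words of weight zero is a coboundary, on words of given length. -/
lemma exists_D_eq (hn : 2 ≤ n) (hG : IsUnit G.det) (k : ℕ) (φ : Wd n → M)
    (h : ∀ t, t.length = k + 1 → D G t φ = 0) (h0 : ∀ t, t.length = k → weight t = 0 → φ t = 0) :
    ∃ ψ : Wd n → M, ∀ t, t.length = k → φ t = D G t ψ := by
  induction k generalizing φ with
  | zero => refine ⟨0, fun t ht => ?_⟩; rw [length_eq_zero_iff.1 ht, h0 [] rfl rfl, D]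
  | succ k ih =>
    have glue : ∀ θ ψ'' : Wd n → M, (∀ t, t.length = k + 1 → D G t θ = 0) →
        (∀ z, z.length = k → weight z = 0 → θ z = D G z ψ'') →
        ∃ ψ : Wd n → M, (∀ t, weight t = 0 → ψ t = 0) ∧ ∀ t, t.length = k → θ t = D G t ψ := by
      intro θ ψ'' hθ hψ''
      obtain ⟨ψ', hψ'⟩ := ih (fun s => if weight s = 0 then 0 else θ s) (fun t ht => by
        rw [← hθ t ht]
        exact D_congr G fun s _ hs => by rw [if_neg (by omega)]) (fun t _ hw => if_pos hw)
      refine ⟨fun s => if weight s = 0 then 0 else if weight s = 1 then ψ'' s else ψ' s,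
        fun t ht => if_pos ht, fun t ht => ?_⟩
      by_cases hw : weight t = 0
      · rw [hψ'' t ht hw]
        exact D_congr G fun s _ hs => by rw [if_neg (by omega), if_pos (by omega)]
      · have := hψ' t ht; rw [if_neg hw] at this; rw [this]
        exact D_congr G fun s _ hs => by rw [if_neg (by omega), if_neg (by omega)]
    let i₀ : Fin n := ⟨0, by omega⟩; have hs0 : (single i₀ 1 : Fin n → K) ≠ 0 := by simp
    obtain ⟨ψx'', hx''⟩ := (exists_contractions (M := M) hn hG k).1 _ hs0 (fun s => φ (xi () :: s))
      (fun s => φ (w i₀ :: s)) (fun u hu _ => sub_eq_zero.1 (h (w i₀ :: u) (by simp [hu])))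
    obtain ⟨ψe'', he''⟩ := (exists_contractions (M := M) hn hG k).2 _ hs0 (fun s => φ (eta :: s))
      (fun s => φ (v i₀ :: s)) (fun u hu _ => (sub_eq_zero.1 (h (v i₀ :: u) (by simp [hu]))).symm)
    obtain ⟨ψx, hx0, hx⟩ := glue (fun s => φ (xi () :: s)) ψx'' (fun t ht => h (xi () :: t) (by simp [ht])) hx''
    obtain ⟨ψe, he0, he⟩ := glue (fun s => φ (eta :: s)) ψe'' (fun t ht => h (eta :: t) (by simp [ht])) he''
    have hw : ∀ i, ∃ ψ : Wd n → M, ∀ t, t.length = k →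
        φ (w i :: t) + cw G (single i 1) ψx t = D G t ψ := by
      intro i
      refine ih (fun t => φ (w i :: t) + cw G (single i 1) ψx t) (fun t ht => ?_) (fun t ht hw => ?_)
      · rw [D_add]
        have e : cw G (single i 1) (fun s => D G s ψx) t = cw G (single i 1) (fun s => φ (xi () :: s)) t := by
          rcases t with _ | ⟨b, t⟩
          · rfl
          · cases b <;> simp only [cw]
            rw [hx t (by simpa using ht)]
        have := D_cw G (single i 1) ψx t; rw [e] at this
        exact (congrArg (_ + ·) this).trans ((sub_eq_add_neg _ _).symm.trans (h (w i :: t) (by simp [ht])))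
      · rw [h0 (w i :: t) (by simp [ht]) (by simpa [weight] using hw), zero_add]
        rcases t with _ | ⟨b, t⟩
        · rfl
        · cases b <;> simp only [cw]
          rw [hx0 t (by simpa [weight] using hw), smul_zero]
    have hv : ∀ i, ∃ ψ : Wd n → M, ∀ t, t.length = k →
        φ (v i :: t) - cv (single i (1 : K)) ψe t = D G t ψ := by
      intro i; refine ih (fun t => φ (v i :: t) - cv (single i (1 : K)) ψe t) (fun t ht => ?_)
        (fun t ht hw => ?_)
      · rw [D_sub]; have e : cv (single i (1 : K)) (fun s => D G s ψe) t =
            cv (single i (1 : K)) (fun s => φ (eta :: s)) t := by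
          rcases t with _ | ⟨b, t⟩
          · rfl
          · cases b <;> simp only [cv]
            rw [he t (by simpa using ht)]
        have := D_cv G (single i (1 : K)) ψe t; rw [e] at this
        have h' := h (v i :: t) (by simp [ht]); rw [D, sub_eq_zero] at h'
        exact (congrArg (_ - ·) this).trans (sub_eq_zero.2 h'.symm)
      · rw [h0 (v i :: t) (by simp [ht]) (by simpa [weight] using hw), zero_sub, neg_eq_zero]
        rcases t with _ | ⟨b, t⟩
        · rfl
        · cases b <;> simp only [cv]
          rw [he0 t (by simpa [weight] using hw), smul_zero]
    choose ψw hψw using hw; choose ψv hψv using hv; let ψ : Wd n → M := fun t => match t with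
      | [] => 0
      | xi _ :: t => ψx t
      | eta :: t => ψe t
      | v i :: t => -ψv i t
      | w i :: t => ψw i t
    refine ⟨ψ, fun t ht => ?_⟩; rcases t with _ | ⟨b, t⟩
    · simp at ht
    · have ht' : t.length = k := by simpa using ht
      cases b with
      | xi _ => exact hx t ht'
      | eta => exact he t ht'
      | v i => change _ = cv _ ψe t - D G t (fun s => -ψv i s); rw [D_neg, ← hψv i t ht']; abel
      | w i => change _ = D G t (ψw i) - cw G _ ψx t; rw [← hψw i t ht']; abel

end

end Letter

/-! ## Coordinates on the reduced bar complex -/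

section Coordinates

open TensorAlgebra (ι)
open scoped Classical

/-- Letters as a sum type. -/
def Letter.sumEquiv (κ : Type) (n : ℕ) : κ ⊕ Unit ⊕ Fin n ⊕ Fin n ≃ Letter κ n where
  toFun := Sum.elim .xi (Sum.elim (fun _ => .eta) (Sum.elim .v .w))
  invFun := fun
    | .xi k => .inl k
    | .eta => .inr (.inl ())
    | .v i => .inr (.inr (.inl i))
    | .w i => .inr (.inr (.inr i))
  left_inv := by rintro (_ | _ | _ | _) <;> rfl
  right_inv := by rintro (_ | _ | _ | _) <;> rfl

instance {κ : Type} [Fintype κ] {n : ℕ} : Fintype (Letter κ n) :=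
  Fintype.ofEquiv _ (Letter.sumEquiv κ n)

lemma Letter.sum_eq {κ : Type} [Fintype κ] {n : ℕ} {M : Type*} [AddCommMonoid M]
    (f : Letter κ n → M) :
    ∑ j, f j = ∑ k, f (.xi k) + (f .eta + (∑ i, f (.v i) + ∑ i, f (.w i))) := by
  rw [← Equiv.sum_comp (Letter.sumEquiv κ n)]
  simp only [Fintype.sum_sum_type, Finset.univ_unique, sum_singleton]; rfl

instance : Fintype Obj := ⟨{.X, .Y}, by rintro (_ | _) <;> simp⟩

/-- Generators `l k` of the invertible module `L`, with functionals `lam k` such that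
`∑ lam k ⊗ l k` corresponds to the identity. -/
structure Frame (κ : Type) [Fintype κ] (R L : Type u) [CommRing R] [AddCommGroup L] [Module R L] where
  l : κ → L
  lam : κ → L →ₗ[R] R
  sum : ∀ x, ∑ k, lam k x • l k = x
  comm : ∀ k x y, lam k x • y = lam k y • x

variable {n : ℕ} {R L : Type u} [CommRing R] [AddCommGroup L] [Module R L]

local notation "ℳ" => Mor n R L
local notation "𝕋" => TM n R L
local notation "ℭ" => TM n R L →ₗ[R] Mor n R L
local notation "ϑ" => tau n R L

/-- The projection onto the morphisms of class `γ`. -/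
def gproj : Gr → ℳ →ₗ[R] ℳ
  | .one => 0
  | .zero => 0
  | .mk a b d => homProj a b (d + 1)

lemma gproj_mem (γ : Gr) (x : ℳ) : gproj (R := R) γ x ∈ γ.out n R L := by
  cases γ with
  | one => exact zero_mem _
  | zero => exact zero_mem _
  | mk a b d => exact homProj_mem _ _ _ _

lemma gproj_of_mem {γ : Gr} {x : ℳ} (h : x ∈ γ.out n R L) : gproj (R := R) γ x = x := by
  cases γ with
  | one => exact ((mem_bot R).1 h).symm
  | zero => exact ((mem_bot R).1 h).symm
  | mk a b d => exact mem_hom_iff.1 h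

variable {κ : Type} [Fintype κ] (f : Frame κ R L)

namespace Frame

/-- The generator of the space of morphisms corresponding to a letter. -/
def el : Letter κ n → ℳ
  | .xi k => (0, (f.l k, 0), 0, 0)
  | .eta => (0, (0, 1), 0, 0)
  | .v i => (0, 0, single i 1, 0)
  | .w i => (0, 0, 0, single i 1)

/-- The coordinate corresponding to a letter. -/
def co : Letter κ n → ℳ →ₗ[R] R
  | .xi k => (f.lam k).comp (LinearMap.fst R L R ∘ₗ LinearMap.fst R _ _ ∘ₗ LinearMap.snd R _ _)
  | .eta => LinearMap.snd R L R ∘ₗ LinearMap.fst R _ _ ∘ₗ LinearMap.snd R _ _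
  | .v i => LinearMap.proj i ∘ₗ LinearMap.fst R _ _ ∘ₗ LinearMap.snd R _ _ ∘ₗ LinearMap.snd R _ _
  | .w i => LinearMap.proj i ∘ₗ LinearMap.snd R _ _ ∘ₗ LinearMap.snd R _ _ ∘ₗ LinearMap.snd R _ _

lemma el_mem (j : Letter κ n) : f.el j ∈ (Gr.mk j.ty.1 j.ty.2.1 j.ty.2.2).out n R L := by
  cases j <;> refine ⟨?_, ?_, ?_, ?_, ?_, ?_⟩ <;> simp [el, Letter.ty]

lemma co_eq_zero {j : Letter κ n} {p : Obj × Obj × ℤ} {x : ℳ}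
    (hx : x ∈ (Gr.mk p.1 p.2.1 p.2.2).out n R L) (h : j.ty ≠ p) : f.co j x = 0 := by
  obtain ⟨a, b, d⟩ := p; obtain ⟨h1, h2, h3, h4, h5, h6⟩ := hx
  cases j with
  | xi k =>
    have := h3 fun ⟨(e1 : a = _), (e2 : b = _), (e3 : d + 1 = _)⟩ => h (by subst e1 e2; simp [Letter.ty]; omega)
    simp [co, this]
  | eta =>
    exact h4 fun ⟨(e1 : a = _), (e2 : b = _), (e3 : d + 1 = _)⟩ => h (by subst e1 e2; simp [Letter.ty]; omega)
  | v i =>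
    exact congrFun (h5 fun ⟨(e1 : a = _), (e2 : b = _), (e3 : d + 1 = _)⟩ =>
      h (by subst e1 e2; simp [Letter.ty]; omega)) i
  | w i =>
    exact congrFun (h6 fun ⟨(e1 : a = _), (e2 : b = _), (e3 : d + 1 = _)⟩ =>
      h (by subst e1 e2; simp [Letter.ty]; omega)) i

lemma co_idM (j : Letter κ n) (o : Obj) : f.co j (idM n R L o) = 0 := by
  cases j <;> cases o <;> simp [co, idM]

lemma sum_co (x : ℳ) : x = x.1.1 • idM n R L .X + x.1.2 • idM n R L .Y +
    ∑ j, f.co j x • f.el j := by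
  rw [Letter.sum_eq]; obtain ⟨⟨a, b⟩, ⟨c, d⟩, v, w⟩ := x
  refine Prod.ext (Prod.ext ?_ ?_) (Prod.ext (Prod.ext ?_ ?_) (Prod.ext ?_ ?_)) <;>
    simp [co, el, idM, Prod.fst_sum, Prod.snd_sum, f.sum, ← pi_eq_sum_univ']

/-- The word corresponding to a list of letters. -/
def wl (s : List (Letter κ n)) : 𝕋 := wd (s.map f.el)

lemma isHomWord (s : List (Letter κ n)) : IsHomWord (s.map f.el) (cls (s.map Letter.ty)) := by
  refine ⟨s.map Letter.ty, ?_, rfl⟩; rw [List.forall₂_map_left_iff, List.forall₂_map_right_iff]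
  exact List.forall₂_same.2 fun j _ => f.el_mem j

lemma exists_cow_cons (j : Letter κ n) (c : 𝕋 →ₗ[R] R) :
    ∃ φ : 𝕋 →ₗ[R] R, φ 1 = 0 ∧ ∀ a t, φ (ι R a * t) = f.co j a * c t := by
  obtain ⟨φ, h1, h2⟩ := exists_leftRec (R := R) (W := ℳ) (N := R) 0
    { toFun := fun a => f.co j a • c.comp (LinearMap.fst R 𝕋 R)
      map_add' := fun a b => by rw [map_add, add_smul]
      map_smul' := fun r a => by rw [map_smul, smul_assoc, RingHom.id_apply] }; exact ⟨φ, h1, h2⟩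

/-- The coordinate on the tensor algebra corresponding to a list of letters. -/
def cow : List (Letter κ n) → 𝕋 →ₗ[R] R
  | [] => eps
  | j :: s => (f.exists_cow_cons j (cow s)).choose

lemma cow_one (j : Letter κ n) (s : List (Letter κ n)) : f.cow (j :: s) 1 = 0 :=
  (f.exists_cow_cons j (f.cow s)).choose_spec.1

lemma cow_cons (j : Letter κ n) (s : List (Letter κ n)) (a : ℳ) (t : 𝕋) :
    f.cow (j :: s) (ι R a * t) = f.co j a * f.cow s t :=
  (f.exists_cow_cons j (f.cow s)).choose_spec.2 a t

lemma cow_of_length_ne {s : List (Letter κ n)} {l : List ℳ} (h : s.length ≠ l.length) :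
    f.cow s (wd l) = 0 := by
  induction s generalizing l with
  | nil => exact eps_wd (by rintro rfl; exact h rfl)
  | cons j s ih =>
    cases l with
    | nil => exact f.cow_one j s
    | cons a l => rw [wd_cons, cow_cons, ih (by simpa using h), mul_zero]

lemma cow_idM (s : List (Letter κ n)) (u v : List ℳ) (o : Obj) :
    f.cow s (wd (u ++ idM n R L o :: v)) = 0 := by
  induction u generalizing s with
  | nil =>
    cases s with
    | nil => exact eps_wd (by simp)
    | cons j s => rw [List.nil_append, wd_cons, cow_cons, co_idM, zero_mul]
  | cons a u ih =>
    cases s with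
    | nil => exact eps_wd (by simp)
    | cons j s => rw [List.cons_append, wd_cons, cow_cons, ih, mul_zero]

lemma cow_eq_zero {s : List (Letter κ n)} {l : List ℳ} {p : List (Obj × Obj × ℤ)}
    (hl : List.Forall₂ (fun x (p : Obj × Obj × ℤ) => x ∈ (Gr.mk p.1 p.2.1 p.2.2).out n R L) l p)
    (h : s.map Letter.ty ≠ p) : f.cow s (wd l) = 0 := by
  induction hl generalizing s with
  | nil =>
    cases s with
    | nil => exact absurd rfl h
    | cons j s => exact f.cow_one j s
  | @cons a p l ps hx _ ih =>
    cases s with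
    | nil => exact eps_wd (by simp)
    | cons j s =>
      rw [wd_cons, cow_cons]
      by_cases hj : j.ty = p
      · rw [ih (by rintro rfl; exact h (by simp [hj])), mul_zero]
      · rw [f.co_eq_zero hx hj, zero_mul]

lemma sum_consEquiv {α M : Type*} [Fintype α] [AddCommMonoid M] (k : ℕ) (F : List α → M) :
    ∑ s : Fin (k + 1) → α, F (ofFn s) = ∑ a, ∑ s : Fin k → α, F (a :: ofFn s) := by
  rw [← Fintype.sum_prod_type', ← (Fin.consEquiv fun _ : Fin (k + 1) => α).sum_comp]
  refine sum_congr rfl fun x _ => ?_; simp [Fin.consEquiv, List.ofFn_succ]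

lemma sum_cow {N : Type*} [AddCommGroup N] [Module R N] {F : 𝕋 →ₗ[R] N}
    (hF : ∀ (u v : List ℳ) (o : Obj), F (wd (u ++ idM n R L o :: v)) = 0) {k : ℕ}
    {l : List ℳ} (hl : l.length = k) :
    F (wd l) = ∑ s : Fin k → Letter κ n, f.cow (ofFn s) (wd l) • F (f.wl (ofFn s)) := by
  induction k generalizing l F with
  | zero => obtain rfl := length_eq_zero_iff.1 hl; simp [cow, wl]
  | succ k ih =>
    rcases l with _ | ⟨a, l⟩
    · simp at hl
    rw [sum_consEquiv k fun s => f.cow s (wd (a :: l)) • F (f.wl s)]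
    have h1 : ∀ o, F (ι R (idM n R L o) * wd l) = 0 := fun o => by rw [← wd_cons]; exact hF [] l o
    rw [wd_cons]
    conv_lhs => rw [f.sum_co a]
    simp only [map_add, map_smul, map_sum, add_mul, smul_mul_assoc, Finset.sum_mul, h1, smul_zero,
      zero_add, cow_cons]; refine sum_congr rfl fun j _ => ?_
    have := ih (F := F.comp (lm (f.el j))) (fun u v o => by
      have := hF (f.el j :: u) v o
      rwa [List.cons_append, wd_cons] at this) (l := l) (by simpa using hl)
    simp only [comp_apply, mulLeft_apply] at this; rw [this, smul_sum]
    refine sum_congr rfl fun s _ => ?_; rw [wl, wl, map_cons, wd_cons, smul_smul]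

end Frame

lemma IsC.apply_idM {t : ℤ} {k : ℕ} {F : TM n R L →ₗ[R] Mor n R L} (hF : IsC t k F)
    (u v : List (Mor n R L)) (o : Obj) : F (wd (u ++ idM n R L o :: v)) = 0 := by
  have key : ∀ (u v : List (Mor n R L)) (α β : Gr), IsHomWord u α → IsHomWord v β → ∀ o,
      F (wd (u ++ idM n R L o :: v)) = 0 := by
    intro u v α β hu hv; have hc : ∀ o, F (wd (u ++ idM n R L o :: v)) ∈
        ((α * (Gr.mk o o (-1) * β)).shift t).out n R L := fun o =>
      hF.homog _ _ (hu.append ((isHomWord_singleton (by simpa using idM_mem o)).append hv))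
    have hs : ∀ o o', o ≠ o' → F (wd (u ++ idM n R L o :: v)) = -F (wd (u ++ idM n R L o' :: v)) := by
      intro o o' h; have := redH_iff.1 hF.red u v; rw [← idM_add_idM h] at this
      simp only [wd_append, wd_cons, map_add, add_mul, mul_add] at this ⊢
      exact eq_neg_of_add_eq_zero_left this
    have hz : ∀ o, (α * (Gr.mk o o (-1) * β) = Gr.zero ∨ ∃ o', o ≠ o' ∧
        α * (Gr.mk o' o' (-1) * β) = Gr.zero) ∨ (α = .one ∧ β = .one) := by
      intro o; have h2 : ∀ (a b : Obj), a ≠ o → a ≠ b → b = o := by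
        rintro (_ | _) (_ | _) <;> cases o <;> simp
      have h3 : ∃ o', o ≠ o' := by cases o <;> [exact ⟨.Y, by simp⟩; exact ⟨.X, by simp⟩]
      obtain ⟨o', ho'⟩ := h3
      have hz1 : ∀ x : Gr, x * Gr.zero = .zero := fun x => by cases x <;> rfl
      have hz2 : ∀ x : Gr, Gr.zero * x = .zero := fun x => by cases x <;> rfl
      cases α with
      | zero => exact .inl (.inl (hz2 _))
      | mk a b d =>
        by_cases h : a = o
        · exact .inl (.inr ⟨o', ho', by rw [← mul_assoc, Gr.mk_mul_mk, if_neg (h ▸ ho'), hz2]⟩)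
        · exact .inl (.inl (by rw [← mul_assoc, Gr.mk_mul_mk, if_neg h, hz2]))
      | one =>
        cases β with
        | one => exact .inr ⟨rfl, rfl⟩
        | zero => exact .inl (.inl rfl)
        | mk a b d =>
          by_cases h : o = b
          · exact .inl (.inr ⟨o', ho', by rw [Gr.mk_mul_mk, if_neg (h ▸ ho'.symm), hz1]⟩)
          · exact .inl (.inl (by rw [Gr.mk_mul_mk, if_neg h, hz1]))
    intro o; rcases hz o with (h | ⟨o', ho', h⟩) | ⟨rfl, rfl⟩
    · have := hc o; rw [h] at this; exact (mem_bot R).1 this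
    · have := hc o'; rw [h] at this; rw [hs o o' ho', (mem_bot R).1 this, neg_zero]
    · have hX := hc .X; have hY := hc .Y; have hXY := hs .X .Y (by simp)
      have : F (wd (u ++ idM n R L .X :: v)) = 0 :=
        hom_eq_zero hX (by rw [hXY]; exact Submodule.neg_mem _ hY)
      cases o with
      | X => exact this
      | Y => rw [hs .Y .X (by simp), this, neg_zero]
  have h1 : ∀ v β, IsHomWord v β → ∀ u : TM n R L, F (u * (ι R (idM n R L o) * wd v)) = 0 := by
    intro v β hv u; refine lcongr (linearMap_ext_homWord
      (φ := F.comp (mulRight R (ι R (idM n R L o) * wd v))) (ψ := 0) fun l γ hl => ?_) u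
    simpa [wd_append, mul_assoc] using key l v γ β hl hv o
  have h2 : ∀ v : TM n R L, F (wd u * (ι R (idM n R L o) * v)) = 0 := fun v =>
    lcongr (linearMap_ext_homWord (φ := F.comp (mulLeft R (wd u) ∘ₗ
      mulLeft R (ι R (idM n R L o)))) (ψ := 0) fun l γ hl => h1 l γ hl (wd u)) v
  rw [wd_append, wd_cons]; exact h2 _

namespace Frame

/-- The reduced cochain of degree `t` with given values on the words of length `k` in the letters. -/
def ext (t : ℤ) (k : ℕ) (ψ : (Fin k → Letter κ n) → Mor n R L) : TM n R L →ₗ[R] Mor n R L :=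
  ∑ s, (f.cow (ofFn s)).smulRight (gproj (R := R) ((cls ((ofFn s).map Letter.ty)).shift t) (ψ s))

lemma ext_apply (t : ℤ) (k : ℕ) (ψ : (Fin k → Letter κ n) → Mor n R L) (x : TM n R L) :
    f.ext t k ψ x = ∑ s, f.cow (ofFn s) x •
      gproj (R := R) ((cls ((ofFn s).map Letter.ty)).shift t) (ψ s) := by simp [ext]

lemma isC_ext (t : ℤ) (k : ℕ) (ψ : (Fin k → Letter κ n) → Mor n R L) : IsC t k (f.ext t k ψ) where
  homog l γ hl := by
    obtain ⟨p, hp, rfl⟩ := hl; rw [ext_apply]; refine Submodule.sum_mem _ fun s _ => ?_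
    by_cases h : (ofFn s).map Letter.ty = p
    · rw [← h]; exact smul_mem _ _ (gproj_mem _ _)
    · rw [f.cow_eq_zero hp h, zero_smul]; exact zero_mem _
  red := redH_iff.2 fun u v => by
    rw [ext_apply, ← idM_add_idM (show Obj.X ≠ .Y by simp)]; refine Finset.sum_eq_zero fun s _ => ?_
    have := fun o => f.cow_idM (ofFn s) u v o
    simp only [wd_append, wd_cons, map_add, add_mul, mul_add] at this ⊢
    rw [this, this, add_zero, zero_smul]
  supp l hl := by
    rw [ext_apply]; refine Finset.sum_eq_zero fun s _ => ?_
    rw [f.cow_of_length_ne (by simpa using hl.symm), zero_smul]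

lemma mem_out_of_homog {t : ℤ} {F : TM n R L →ₗ[R] Mor n R L} (hF : Homog t F)
    (s : List (Letter κ n)) : F (f.wl s) ∈ ((cls (s.map Letter.ty)).shift t).out n R L :=
  hF _ _ (f.isHomWord s)

lemma ext_values {t : ℤ} {k : ℕ} {F : TM n R L →ₗ[R] Mor n R L} (hF : IsC t k F) :
    f.ext t k (fun s => F (f.wl (ofFn s))) = F := by
  refine (f.isC_ext t k _).ext hF fun l hl => ?_; rw [ext_apply, f.sum_cow hF.apply_idM hl]
  exact sum_congr rfl fun s _ => by rw [gproj_of_mem (f.mem_out_of_homog hF.homog _)]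

lemma isC_eq {t : ℤ} {k : ℕ} {F G : TM n R L →ₗ[R] Mor n R L} (hF : IsC t k F) (hG : IsC t k G)
    (h : ∀ s : List (Letter κ n), s.length = k → F (f.wl s) = G (f.wl s)) : F = G := by
  rw [← f.ext_values hF, ← f.ext_values hG]; congr 1; funext s; exact h _ (by simp)

end Frame

end Coordinates

/-! ## Exactness of the Hochschild complex over a field -/

section Linear

open TensorAlgebra (ι)

variable {n : ℕ} {R L : Type u} [CommRing R] [AddCommGroup L] [Module R L]

local notation "ℳ" => Mor n R L
local notation "𝕋" => TM n R L
local notation "ℭ" => TM n R L →ₗ[R] Mor n R L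
local notation "ϑ" => tau n R L

lemma coder_smul {W : Type*} [AddCommGroup W] [Module R W] (r : R)
    (P : TensorAlgebra R W →ₗ[R] TensorAlgebra R W) (H : TensorAlgebra R W →ₗ[R] W)
    (Q : TensorAlgebra R W →ₗ[R] TensorAlgebra R W) : coder P (r • H) Q = r • coder P H Q :=
  linearMap_ext_sw fun a k => by
    simp only [coder_sw, LinearMap.smul_apply, map_smul, smul_mul_assoc, mul_smul_comm, smul_sum]

/-- The Hochschild differential on even cochains. -/
def dEvenL (g : Mat n L) : ℭ →ₗ[R] ℭ where
  toFun := dEven g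
  map_add' F F' := by simp only [dEven, coder_add, add_comp, comp_add]; abel
  map_smul' r F := by
    simp only [dEven, coder_smul, LinearMap.smul_comp, LinearMap.comp_smul, smul_sub, RingHom.id_apply]

/-- The Hochschild differential on odd cochains. -/
def dOddL (g : Mat n L) : ℭ →ₗ[R] ℭ where
  toFun := dOdd g
  map_add' F F' := by simp only [dOdd, bh_add, add_comp, comp_add]; abel
  map_smul' r F := by
    simp only [dOdd, bh, coder_smul, LinearMap.smul_comp, LinearMap.comp_smul, smul_add,
      RingHom.id_apply]

/-- The components of a morphism: multiples of the identities, `V ⊕ V^∨`, and the rest. -/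
def wpart : Fin 3 → ℳ →ₗ[R] ℳ
  | 0 => LinearMap.inl R _ _ ∘ₗ LinearMap.fst R _ _
  | 1 => LinearMap.inr R _ _ ∘ₗ LinearMap.inr R _ _ ∘ₗ LinearMap.snd R _ _ ∘ₗ LinearMap.snd R _ _
  | 2 => LinearMap.inr R _ _ ∘ₗ LinearMap.inl R _ _ ∘ₗ LinearMap.fst R _ _ ∘ₗ LinearMap.snd R _ _

lemma wpart_wpart {i j : Fin 3} (h : i ≠ j) (x : ℳ) :
    wpart (R := R) i (wpart (R := R) j x) = 0 := by
  fin_cases i <;> fin_cases j <;> first | exact absurd rfl h | simp [wpart]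

lemma wpart_wpart_self (j : Fin 3) (x : ℳ) :
    wpart (R := R) j (wpart (R := R) j x) = wpart (R := R) j x := by fin_cases j <;> simp [wpart]

lemma eq_zero_of_wpart {x : ℳ} (h : ∀ i, wpart (R := R) i x = 0) : x = 0 := by
  have h0 := h 0; have h1 := h 1; have h2 := h 2
  simp only [wpart, comp_apply, LinearMap.fst_apply, LinearMap.snd_apply,
    LinearMap.inl_apply, LinearMap.inr_apply, Prod.mk_eq_zero] at h0 h1 h2
  exact Prod.ext h0.1 (Prod.ext h2.2.1 h1.2.2)

lemma gproj_wpart (γ : Gr) (i : Fin 3) (x : ℳ) :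
    gproj (R := R) γ (wpart (R := R) i x) = wpart (R := R) i (gproj (R := R) γ x) := by
  cases γ with
  | one => simp [gproj]
  | zero => simp [gproj]
  | mk a b d =>
    fin_cases i <;> simp only [gproj, homProj, wpart, LinearMap.coe_mk, AddHom.coe_mk,
      comp_apply, LinearMap.fst_apply, LinearMap.snd_apply, LinearMap.inl_apply,
      LinearMap.inr_apply, Prod.fst_zero, Prod.snd_zero, ite_self] <;> rfl

lemma wpart_mu_left (g : Mat n L) {x y : ℳ} (hx : x.1 = 0) {j : Fin 3}
    (hy : ∀ i < j, wpart (R := R) i y = 0) {i : Fin 3} (hi : i ≤ j) :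
    wpart (R := R) i (mu g (ι R x * ι R y)) = 0 := by
  obtain ⟨x1, ⟨x2, x3⟩, x4, x5⟩ := x; obtain ⟨⟨y1, y1'⟩, ⟨y2, y3⟩, y4, y5⟩ := y
  obtain rfl : x1 = 0 := hx; rw [mu_two]
  have e0 : 0 < j → y1 = 0 ∧ y1' = 0 := fun h => by simpa [wpart] using hy 0 h
  have e1 : 1 < j → y4 = 0 ∧ y5 = 0 := fun h => by simpa [wpart] using hy 1 h
  fin_cases i
  · simp [wpart, compo, koszul]
  · obtain ⟨rfl, rfl⟩ := e0 hi; simp [wpart, compo, koszul]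
  · obtain ⟨rfl, rfl⟩ := e0 (lt_of_lt_of_le (by decide) hi)
    obtain ⟨rfl, rfl⟩ := e1 (lt_of_lt_of_le (by decide) hi); simp [wpart, compo, koszul]

lemma wpart_mu_right (g : Mat n L) {x y : ℳ} (hx : x.1 = 0) {j : Fin 3}
    (hy : ∀ i < j, wpart (R := R) i y = 0) {i : Fin 3} (hi : i ≤ j) :
    wpart (R := R) i (mu g (ι R y * ι R x)) = 0 := by
  obtain ⟨x1, ⟨x2, x3⟩, x4, x5⟩ := x; obtain ⟨⟨y1, y1'⟩, ⟨y2, y3⟩, y4, y5⟩ := y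
  obtain rfl : x1 = 0 := hx; rw [mu_two]
  have e0 : 0 < j → y1 = 0 ∧ y1' = 0 := fun h => by simpa [wpart] using hy 0 h
  have e1 : 1 < j → y4 = 0 ∧ y5 = 0 := fun h => by simpa [wpart] using hy 1 h
  fin_cases i
  · simp [wpart, compo, koszul]
  · obtain ⟨rfl, rfl⟩ := e0 hi; simp [wpart, compo, koszul]
  · obtain ⟨rfl, rfl⟩ := e0 (lt_of_lt_of_le (by decide) hi)
    obtain ⟨rfl, rfl⟩ := e1 (lt_of_lt_of_le (by decide) hi); simp [wpart, compo, koszul]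

variable {κ : Type} [Fintype κ] (f : Frame κ R L)

/-- `F` vanishes modulo the `j`-th step of the filtration by weights. -/
def Frame.Low (j : ℕ) (F : ℭ) : Prop :=
  ∀ (i : Fin 3) (s : List (Letter κ n)), (i : ℕ) < j → wpart (R := R) i (F (f.wl s)) = 0

lemma Frame.el_fst (j : Letter κ n) : (f.el j).1 = 0 := by cases j <;> rfl

lemma Frame.wpart_mu_coder (g : Mat n L) {F : ℭ} {j : Fin 3} (hF : f.Low j F) {P : 𝕋 →ₗ[R] 𝕋}
    (hP : ∀ a : List (Letter κ n), ∃ b : List ℳ, b.length = a.length ∧ (∀ x ∈ b, x.1 = 0) ∧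
      P (f.wl a) = wd b)
    {i : Fin 3} (hi : i ≤ j) (s : List (Letter κ n)) :
    wpart (R := R) i (mu g (coder P F idL (f.wl s))) = 0 := by
  refine coder_wd_mem ((LinearMap.ker ((wpart (R := R) i).comp (mu g))).toAddSubmonoid) fun u v x h => ?_
  obtain ⟨u, vx, -, rfl, h'⟩ := List.map_eq_append_iff.1 h.symm
  obtain ⟨v, x, -, rfl, rfl⟩ := List.map_eq_append_iff.1 h'
  change wpart (R := R) i (mu g (P (f.wl u) * (ι R (F (f.wl v)) * wd (x.map f.el)))) = 0
  obtain ⟨b, hb, hb', e⟩ := hP u; rw [e, ← wd_cons, ← wd_append]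
  have hv : ∀ i < j, wpart (R := R) i (F (f.wl v)) = 0 := fun i hi => hF i v hi
  by_cases hl : b.length + (x.length + 1) = 2
  · rcases b with _ | ⟨c, b⟩
    · obtain ⟨y, rfl⟩ : ∃ y, x = [y] := List.length_eq_one_iff.1 (by simpa using hl)
      simpa using wpart_mu_right g (f.el_fst y) hv hi
    · simp only [length_cons] at hl; obtain rfl := length_eq_zero_iff.1 (show b.length = 0 by omega)
      obtain rfl := length_eq_zero_iff.1 (show x.length = 0 by omega)
      simpa using wpart_mu_left g (hb' c (by simp)) hv hi
  · rw [mu_eq_zero g (by simpa using hl), map_zero]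

lemma Frame.wpart_dOdd (g : Mat n L) {F : ℭ} {j : Fin 3}
    (hF : f.Low j F) {i : Fin 3} (hi : i ≤ j) (s : List (Letter κ n)) :
    wpart (R := R) i (dOdd g F (f.wl s)) = wpart (R := R) i (F (bh ϑ (mu g) (f.wl s))) := by
  rw [dOdd, add_apply, map_add, comp_apply, comp_apply, bh, bh,
    f.wpart_mu_coder g hF (fun a => ⟨(a.map f.el).map ϑ, by simp, fun x hx => ?_, th_wd _ _⟩)
      hi, add_zero]; obtain ⟨y, hy, rfl⟩ := List.mem_map.1 hx
  obtain ⟨z, -, rfl⟩ := List.mem_map.1 hy; simp [tau_apply, koszul, f.el_fst]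

lemma Frame.wpart_dEven (g : Mat n L) {F : ℭ} {j : Fin 3}
    (hF : f.Low j F) {i : Fin 3} (hi : i ≤ j) (s : List (Letter κ n)) :
    wpart (R := R) i (dEven g F (f.wl s)) = wpart (R := R) i (F (bh ϑ (mu g) (f.wl s))) := by
  rw [dEven, sub_apply, map_sub, comp_apply, comp_apply,
    f.wpart_mu_coder g hF (fun a => ⟨a.map f.el, by simp, fun x hx => ?_, rfl⟩) hi, sub_zero]
  obtain ⟨z, -, rfl⟩ := List.mem_map.1 hx; exact f.el_fst z

end Linear

section Field

open TensorAlgebra (ι)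
open scoped Classical

variable {n : ℕ} {K L : Type u} [Field K] [AddCommGroup L] [Module K L] (f : Frame Unit K L)
  (hl : f.lam () (f.l ()) = 1) (G : Mat n K)

/-- The matrix with entries `G i j` times the generator of `L`. -/
def Frame.mat : Mat n L := G.map fun c => c • f.l ()

lemma Frame.mu_el (a b : Letter Unit n) : mu (f.mat G) (ι K (f.el a) * ι K (f.el b)) =
    match a, b with
    | .w i, .v j => -(G i j • f.el (.xi ()))
    | .v i, .w j => (single i (1 : K) : Fin n → K) j • f.el .eta
    | _, _ => 0 := by
  rw [mu_two]
  cases a <;> cases b <;> simp [compo, koszul, Frame.el, Frame.mat, single_apply]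
  split_ifs <;> rfl

lemma Frame.apply_bh_mu {M : Type*} [AddCommGroup M] [Module K M] (F : TM n K L →ₗ[K] M)
    (s : Wd n) :
    F (bh (tau n K L) (mu (f.mat G)) (f.wl s)) = Letter.D G s (fun s => F (f.wl s)) := by
  have h3 : ∀ a : Letter Unit n, tau n K L (f.el a) = match a with
      | .v _ => -f.el a
      | _ => f.el a := by
    intro a
    cases a <;> simp [tau_apply, koszul, Frame.el]
  induction s generalizing F with
  | nil => simp [Frame.wl, bh_mu_one, Letter.D]
  | cons a s ih =>
    rcases s with _ | ⟨b, s⟩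
    · have : f.wl [a] = ι K (f.el a) := by simp [Frame.wl]
      rw [this, bh_mu_ι, map_zero]
      cases a <;> simp [Letter.D, Letter.cv, Letter.cw]
    · have h1 : f.wl (a :: b :: s) = ι K (f.el a) * (ι K (f.el b) * f.wl s) := by simp [Frame.wl]
      have h2 : ∀ (c : Letter Unit n) s, f.wl (c :: s) = ι K (f.el c) * f.wl s := fun c s => by
        simp [Frame.wl]
      have h4 := ih (F.comp (lm (f.el a))); simp only [comp_apply, mulLeft_apply, ← h2] at h4
      rw [h1, bh_mu_cons_cons, f.mu_el, h3, ← h2 b s, map_add]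
      cases a with
      | xi k => simp [h4, Letter.D]
      | eta => simp [h4, Letter.D]
      | v i => cases b <;> simp [h4, Letter.D, Letter.cv, ← h2, sub_eq_add_neg]
      | w i =>
        cases b <;> simp [h4, Letter.D, Letter.cw, ← h2, sub_eq_add_neg, single_apply, add_comm]

include hl in
lemma Frame.cow_wl (s s' : Wd n) : f.cow s (f.wl s') = if s = s' then 1 else 0 := by
  have h1 : ∀ j j' : Letter Unit n, f.co j (f.el j') = if j = j' then 1 else 0 := by
    intro j j'
    cases j <;> cases j' <;> simp [Frame.co, Frame.el, hl, single_apply]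
  induction s generalizing s' with
  | nil =>
    cases s' with
    | nil => simp [Frame.wl, Frame.cow]
    | cons j s' => exact eps_wd (by simp)
  | cons j s ih =>
    cases s' with
    | nil => exact f.cow_one j s
    | cons j' s' =>
      have : f.wl (j' :: s') = ι K (f.el j') * f.wl s' := by simp [Frame.wl]
      rw [this, f.cow_cons, ih, h1]
      by_cases e1 : j = j' <;> by_cases e2 : s = s' <;> simp [e1, e2]

include hl in
lemma Frame.ext_wl (t : ℤ) {k : ℕ} (ψ : Wd n → Mor n K L) {s : Wd n}
    (hs : s.length = k) : f.ext t k (fun s => ψ (ofFn s)) (f.wl s) =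
      gproj (R := K) ((cls (s.map Letter.ty)).shift t) (ψ s) := by
  obtain ⟨s, rfl⟩ : ∃ s' : Fin k → Letter Unit n, s = ofFn s' := by
    subst hs; exact ⟨fun i => s[i], by simp⟩
  rw [f.ext_apply, Finset.sum_eq_single s]
  · simp [f.cow_wl hl]
  · intro b _ hb; rw [f.cow_wl hl, if_neg fun h => hb (List.ofFn_injective h), zero_smul]
  · simp

/-- Objects as numbers. -/
def Obj.pos : Obj → ℤ
  | .X => 0
  | .Y => 1

lemma Letter.cls_of_weight_eq_zero {s : Wd n} (hs : Letter.weight s = 0) {a b : Obj}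
    {e : ℤ} (h : cls (s.map Letter.ty) = Gr.mk a b e) : 2 * e = -(s.length + b.pos - a.pos) := by
  induction s generalizing a b e with
  | nil => simp [cls, Gr.one_def] at h
  | cons j s ih =>
    obtain ⟨p, q, r, hj, hw, hr⟩ : ∃ p q r, j.ty = (p, q, r) ∧ Letter.weight s = 0 ∧
        2 * r = -(1 + q.pos - p.pos) := by
      cases j <;> simp [Letter.weight] at hs <;> simp [Letter.ty, hs, Obj.pos]
    rw [map_cons, cls_cons, hj] at h; rcases hc : cls (s.map Letter.ty) with _ | _ | ⟨a', b', e'⟩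
    · have : s = [] := by by_contra hne; exact cls_ne_one (by simpa using hne) hc
      subst this; rw [hc] at h; obtain ⟨rfl, rfl, rfl⟩ := Gr.mk.inj h; simpa using hr
    · rw [hc] at h
      cases h
    · rw [hc, Gr.mk_mul_mk] at h; have := ih hw hc
      split_ifs at h with hp
      obtain ⟨rfl, rfl, rfl⟩ := Gr.mk.inj h; simp only at hp; subst hp; push_cast [length_cons]
      linarith

lemma hom_eq_bot {R : Type u} [CommRing R] [Module R L] {a b : Obj} {d : ℤ}
    (h : 2 * d < a.pos - b.pos) {x : Mor n R L} (hx : x ∈ hom (R := R) a b d) : x = 0 := by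
  obtain ⟨h1, h2, h3, h4, h5, h6⟩ := hx
  refine Prod.ext (Prod.ext (h1 ?_) (h2 ?_)) (Prod.ext (Prod.ext (h3 ?_) (h4 ?_))
    (Prod.ext (h5 ?_) (h6 ?_)))
  all_goals
    rintro ⟨rfl, rfl, rfl⟩; simp [Obj.pos] at h

lemma Letter.cls_nonpos {κ : Type} {s : List (Letter κ n)} {a b : Obj} {e : ℤ}
    (h : cls (s.map Letter.ty) = Gr.mk a b e) : e ≤ 0 := by
  induction s generalizing a b e with
  | nil => simp [cls, Gr.one_def] at h
  | cons j s ih =>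
    have hj : j.ty.2.2 ≤ 0 := by cases j <;> simp [Letter.ty]
    rw [map_cons, cls_cons] at h; rcases hc : cls (s.map Letter.ty) with _ | _ | ⟨a', b', e'⟩
    · rw [hc] at h; obtain ⟨-, -, rfl⟩ := Gr.mk.inj h; exact hj
    · rw [hc] at h
      cases h
    · rw [hc, Gr.mk_mul_mk] at h; have := ih hc
      split_ifs at h
      obtain ⟨-, -, rfl⟩ := Gr.mk.inj h; omega

lemma IsC.eq_zero (f : Frame Unit K L) {t : ℤ} (ht : t ≤ -2) {k : ℕ} {F : TM n K L →ₗ[K] Mor n K L} (hF : IsC t k F) :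
    F = 0 := by
  refine f.isC_eq hF (isC_zero t k) fun s _ => ?_; have := f.mem_out_of_homog hF.homog s
  rcases hc : cls (s.map Letter.ty) with _ | _ | ⟨a, b, e⟩ <;> rw [hc] at this
  · exact (mem_bot K).1 this
  · exact (mem_bot K).1 this
  · have he := Letter.cls_nonpos hc; refine hom_eq_bot ?_ this
    cases a <;> cases b <;> simp [Obj.pos] <;> omega

lemma IsC.apply_of_weight_eq_zero (f : Frame Unit K L) {t : ℤ} {k : ℕ} (hk : 2 * t + 2 < k)
    {F : TM n K L →ₗ[K] Mor n K L} (hF : IsC t k F) {s : Wd n} (hs : s.length = k)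
    (hw : Letter.weight s = 0) : F (f.wl s) = 0 := by
  have := f.mem_out_of_homog hF.homog s
  rcases hc : cls (s.map Letter.ty) with _ | _ | ⟨a, b, e⟩ <;> rw [hc] at this
  · exact (mem_bot K).1 this
  · exact (mem_bot K).1 this
  · have he := Letter.cls_of_weight_eq_zero hw hc; rw [hs] at he
    exact hom_eq_bot (by linarith) this

include hl in
/-- Exactness of the Hochschild complex in arities that are large compared to the degree. -/
lemma Frame.exists_eq_d (hn : 2 ≤ n) (hG : IsUnit G.det) {t : ℤ} {k : ℕ} (hk : 2 * t + 2 < k + 1)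
    (Δ Δ' : (TM n K L →ₗ[K] Mor n K L) →ₗ[K] (TM n K L →ₗ[K] Mor n K L))
    (hΔ : ∀ Ψ, IsC (t - 1) k Ψ → IsC t (k + 1) (Δ Ψ) ∧ Δ' (Δ Ψ) = 0)
    (ho : ∀ Ψ (j : Fin 3), f.Low j Ψ → ∀ i ≤ j, ∀ s, wpart (R := K) i (Δ Ψ (f.wl s)) =
      wpart (R := K) i (Ψ (bh (tau n K L) (mu (f.mat G)) (f.wl s))))
    (ho' : ∀ Ψ (j : Fin 3), f.Low j Ψ → ∀ i ≤ j, ∀ s, wpart (R := K) i (Δ' Ψ (f.wl s)) =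
      wpart (R := K) i (Ψ (bh (tau n K L) (mu (f.mat G)) (f.wl s))))
    {F : TM n K L →ₗ[K] Mor n K L} (hF : IsC t (k + 1) F) (hF' : Δ' F = 0) :
    ∃ Ψ, IsC (t - 1) k Ψ ∧ F = Δ Ψ := by
  have step : ∀ (j : Fin 3) (F : TM n K L →ₗ[K] Mor n K L), IsC t (k + 1) F → Δ' F = 0 →
      f.Low j F → ∃ Ψ, IsC (t - 1) k Ψ ∧ f.Low (j + 1) (F - Δ Ψ) := by
    intro j F hF hF' hlow
    obtain ⟨ψ, hψ⟩ := Letter.exists_D_eq (G := G) hn hG (k + 1) (fun s => wpart (R := K) j (F (f.wl s)))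
      (fun s _ => by
        rw [Letter.D_map, ← f.apply_bh_mu, ← ho' F j hlow j le_rfl, hF', zero_apply, map_zero])
      (fun s hs hw => by
        rw [IsC.apply_of_weight_eq_zero f (by push_cast; exact hk) hF hs hw, map_zero])
    have hC := f.isC_ext (t - 1) k (fun s => wpart (R := K) j (ψ (ofFn s)))
    have hv : ∀ s, s.length = k → f.ext (t - 1) k (fun s => wpart (R := K) j (ψ (ofFn s)))
        (f.wl s) = wpart (R := K) j (gproj (R := K) ((cls (s.map Letter.ty)).shift (t - 1)) (ψ s)) :=
      fun s hs => by rw [f.ext_wl hl (t - 1) (fun s => wpart (R := K) j (ψ s)) hs, gproj_wpart]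
    refine ⟨_, hC, fun i s hi => ?_⟩
    have hlow' : f.Low j (f.ext (t - 1) k (fun s => wpart (R := K) j (ψ (ofFn s)))) := by
      intro i s hi
      by_cases hs : s.length = k
      · rw [hv s hs, wpart_wpart]; rintro rfl; omega
      · rw [Frame.wl, hC.supp _ (by simpa using hs), map_zero]
    rw [sub_apply, map_sub, ho _ j hlow' i (by omega)]
    by_cases hs : s.length = k + 1
    · rw [f.apply_bh_mu, Letter.D_congr_cls (φ := fun s => (f.ext (t - 1) k
        (fun s => wpart (R := K) j (ψ (ofFn s)))) (f.wl s)) (ψ := fun u =>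
          ((wpart (R := K) j).comp (gproj (R := K) ((cls (s.map Letter.ty)).shift t))) (ψ u)) G
          (fun u hu hc => by
            rw [hv u (by omega), hc, Gr.shift_shift, comp_apply]
            ring_nf), Letter.D_map, ← hψ s hs, comp_apply, gproj_wpart,
          gproj_of_mem (f.mem_out_of_homog hF.homog s), wpart_wpart_self]
      rcases lt_or_eq_of_le (show i ≤ j by omega) with h | rfl
      · rw [wpart_wpart h.ne, hlow i s h, sub_zero]
      · rw [wpart_wpart_self, sub_self]
    · rw [← ho _ j hlow' i (by omega), Frame.wl, hF.supp _ (by simpa using hs),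
        (hΔ _ hC).1.supp _ (by simpa using hs), sub_self]
  obtain ⟨Ψ₀, h₀, l₀⟩ := step 0 F hF hF' (fun i s hi => absurd hi (by simp))
  obtain ⟨Ψ₁, h₁, l₁⟩ := step 1 (F - Δ Ψ₀) (hF.sub (hΔ _ h₀).1)
    (by rw [map_sub, hF', (hΔ _ h₀).2, sub_zero]) (by simpa using l₀)
  obtain ⟨Ψ₂, h₂, l₂⟩ := step 2 (F - Δ Ψ₀ - Δ Ψ₁) ((hF.sub (hΔ _ h₀).1).sub (hΔ _ h₁).1)
    (by rw [map_sub, map_sub, hF', (hΔ _ h₀).2, (hΔ _ h₁).2, sub_zero, sub_zero]) (by simpa using l₁)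
  refine ⟨Ψ₀ + Ψ₁ + Ψ₂, (h₀.add h₁).add h₂, ?_⟩; have hz : F - Δ Ψ₀ - Δ Ψ₁ - Δ Ψ₂ = 0 :=
    f.isC_eq (((hF.sub (hΔ _ h₀).1).sub (hΔ _ h₁).1).sub (hΔ _ h₂).1) (isC_zero _ _) fun s _ =>
      eq_zero_of_wpart fun i => l₂ i s i.2; rw [map_add, map_add, ← sub_eq_zero, ← hz]; abel

include hl in
lemma Frame.dOdd_injective (hn : 2 ≤ n) (hG : IsUnit G.det) {k : ℕ} (hk : 1 ≤ k)
    {F : TM n K L →ₗ[K] Mor n K L} (hF : IsC (-1) k F) (h : dOdd (f.mat G) F = 0) : F = 0 := by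
  obtain ⟨k, rfl⟩ := Nat.exists_eq_add_of_le' hk
  obtain ⟨Ψ, h1, rfl⟩ := f.exists_eq_d hl G hn hG (t := -1) (k := k) (by omega) (dEvenL (f.mat G))
    (dOddL (f.mat G)) (fun Ψ hΨ => by
      rw [hΨ.eq_zero f (by omega), map_zero, map_zero]; exact ⟨isC_zero _ _, rfl⟩)
    (fun Ψ j h i hi s => f.wpart_dEven _ h hi s) (fun Ψ j h i hi s => f.wpart_dOdd _ h hi s) hF h
  rw [h1.eq_zero f (by omega), map_zero]

include hl in
lemma Frame.exists_eq_dOdd (hn : 2 ≤ n) (hG : IsUnit G.det) {d : ℕ} (hd : 2 ≤ d)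
    {F : TM n K L →ₗ[K] Mor n K L} (hF : IsC 0 (d + 1) F) (h : dEven (f.mat G) F = 0) :
    ∃ Ψ, IsC (-1) d Ψ ∧ F = dOdd (f.mat G) Ψ :=
  f.exists_eq_d hl G hn hG (t := 0) (k := d) (by omega) (dOddL (f.mat G)) (dEvenL (f.mat G))
    (fun Ψ hΨ => ⟨hΨ.dOdd rfl _, dEven_dOdd _ (hΨ.homog.isOdd rfl)⟩)
    (fun Ψ j h i hi s => f.wpart_dOdd _ h hi s) (fun Ψ j h i hi s => f.wpart_dEven _ h hi s) hF h

include hl in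
lemma Frame.exists_eq_dEven (hn : 2 ≤ n) (hG : IsUnit G.det) {d : ℕ} (hd : 3 ≤ d)
    {F : TM n K L →ₗ[K] Mor n K L} (hF : IsC 1 (d + 2) F) (h : dOdd (f.mat G) F = 0) :
    ∃ Ψ, IsC 0 (d + 1) Ψ ∧ F = dEven (f.mat G) Ψ :=
  f.exists_eq_d hl G hn hG (t := 1) (k := d + 1) (by push_cast; omega) (dEvenL (f.mat G))
    (dOddL (f.mat G)) (fun Ψ hΨ => ⟨IsC.dEven (by omega) hΨ _, dOdd_dEven _ hΨ.homog.isEven⟩)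
    (fun Ψ j h i hi s => f.wpart_dEven _ h hi s) (fun Ψ j h i hi s => f.wpart_dOdd _ h hi s) hF h

end Field

/-! ### Gauge transformations of arity two -/

section Scalar

variable {K : Type*} [Field K] {n : ℕ} {G P Q : Mat n K} {α β : K}

lemma exists_ne_zero_of_det (hG : IsUnit G.det) (j : Fin n) : ∃ k, G j k ≠ 0 := by
  by_contra! h
  exact hG.ne_zero (Matrix.det_eq_zero_of_row_eq_zero j h)

lemma offDiag_eq_zero (hn : 2 ≤ n) (hG : IsUnit G.det)
    (hgood : 3 ≤ n ∨ ¬((2 : K) = 0 ∧ ∃ c : K, G = c • (1 : Mat n K)))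
    (h : ∀ i j k m, (if i = j then Q m k else 0) + G j k * P m i -
      (if m = i then (P * G) j k + α * G j k else 0) -
      (if m = k then Q j i - (if i = j then β else 0) else 0) = 0) {i m : Fin n} (him : m ≠ i) :
    P m i = 0 := by
  by_contra hne; have e1 : ∀ j ≠ i, ∀ k ≠ m, G j k = 0 := fun j hj k hk => by
    have := h i j k m
    rw [if_neg hj.symm, if_neg him, if_neg hk.symm, zero_add, sub_zero, sub_zero] at this
    exact (mul_eq_zero.1 this).resolve_right hne
  by_cases hn3 : 3 ≤ n
  · obtain ⟨j, hj, hji⟩ : ∃ j, j ≠ m ∧ j ≠ i := by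
      have : 2 < (Finset.univ : Finset (Fin n)).card := by simpa using (show 2 < n by omega)
      obtain ⟨j, -, hj⟩ := Finset.exists_mem_notMem_of_card_lt_card
        (t := Finset.univ) (lt_of_le_of_lt (Finset.card_insert_le m {i}) (by simpa using this))
      exact ⟨j, by simpa using hj⟩
    have hGm : G j m ≠ 0 := by
      obtain ⟨k, hk⟩ := exists_ne_zero_of_det hG j
      by_cases hkm : k = m
      · rwa [← hkm]
      · exact absurd (e1 j hji k hkm) hk
    refine hG.ne_zero (Matrix.exists_vecMul_eq_zero_iff.1
      ⟨G j m • single m 1 - G m m • single j 1, fun h0 => hGm ?_, ?_⟩)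
    · simpa [hj.symm] using congrFun h0 m
    · funext k
      rw [Matrix.sub_vecMul, Matrix.smul_vecMul, Matrix.smul_vecMul, Matrix.single_one_vecMul,
        Matrix.single_one_vecMul]
      by_cases hk : k = m
      · subst hk; simp [mul_comm]
      · simp [e1 m him k hk, e1 j hji k hk]
  · obtain rfl : n = 2 := by omega
    have hs : ∀ F : Fin 2 → K, ∑ a, F a = F i + F m := by
      intro F
      fin_cases i <;> fin_cases m <;> simp at him <;> simp [Fin.sum_univ_two, add_comm]
    have hx : ∀ k : Fin 2, k = i ∨ k = m := by intro k; omega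
    have him' := him.symm; have g1 : G m i = 0 := e1 m him i him'; have q1 := h i m m m
    have q2 := h i i i m; have q3 := h m m i m; have q4 := h m i m i; have q5 := h i i i i
    have q6 := h m m m m
    simp only [Matrix.mul_apply, hs, him, him', if_true, if_false, g1] at q1 q2 q3 q4 q5 q6
    have c1 : G m m = G i i := mul_right_cancel₀ hne (by linear_combination q1 + q3)
    have c2 : G m m + G i i = 0 := mul_right_cancel₀ hne (by linear_combination q1 + q2)
    have hGi : G i i ≠ 0 := by
      obtain ⟨k, hk⟩ := exists_ne_zero_of_det hG m; rcases hx k with rfl | rfl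
      · exact absurd g1 hk
      · rwa [← c1]
    have h2 : (2 : K) = 0 := mul_right_cancel₀ hGi (by linear_combination c2 - c1)
    have hGim : G i m ≠ 0 := fun h0 => by
      refine (hgood.resolve_left hn3) ⟨h2, G i i, ?_⟩; ext a b
      rcases hx a with rfl | rfl <;> rcases hx b with rfl | rfl <;>
        simp [h0, g1, c1, him, him']
    have p0 : P i m = 0 := by
      refine (mul_eq_zero.1 (?_ : G i m * P i m = 0)).resolve_left hGim; linear_combination q4
    have : P m i * G i m = 0 := by rw [p0] at q5; rw [c1] at q6; linear_combination q5 - q6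
    exact (mul_ne_zero hne hGim) this

lemma scalar_of_cocycle (hn : 2 ≤ n) (hG : IsUnit G.det)
    (hgood : 3 ≤ n ∨ ¬((2 : K) = 0 ∧ ∃ c : K, G = c • (1 : Mat n K)))
    (h : ∀ i j k m, (if i = j then Q m k else 0) + G j k * P m i -
      (if m = i then (P * G) j k + α * G j k else 0) -
      (if m = k then Q j i - (if i = j then β else 0) else 0) = 0) :
    α = 0 ∧ β = 0 ∧ ∃ p q : K, P = p • (1 : Mat n K) ∧ Q = q • (1 : Mat n K) := by
  have hP : ∀ m i, m ≠ i → P m i = 0 := fun m i him => offDiag_eq_zero hn hG hgood h him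
  have hPG : ∀ j k, (P * G) j k = P j j * G j k := fun j k => by
    rw [Matrix.mul_apply, Finset.sum_eq_single j (fun b _ hb => by rw [hP j b hb.symm, zero_mul])
      (by simp)]
  simp only [hPG] at h; have hQ : ∀ j i, j ≠ i → Q j i = 0 := fun j i hji => by
    have := h i j j j; simp only [hji, hji.symm, hP j i hji, if_true, if_false] at this
    linear_combination -this
  have hα : ∀ i j, i ≠ j → P i i - P j j = α := fun i j hij => by
    obtain ⟨k, hk⟩ := exists_ne_zero_of_det hG j; have := h i j k i
    simp only [hij, hQ j i hij.symm, if_true, if_false, sub_zero, ite_self] at this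
    exact mul_right_cancel₀ hk (by linear_combination this)
  have h1 : ∀ i k, i ≠ k → α * G i k = 0 := fun i k hik => by
    have := h i i k i; simp only [hik, hQ i k hik, if_true, if_false, sub_zero] at this
    linear_combination -this
  have h2 : ∀ i, β = α * G i i := fun i => by
    have := h i i i i; simp only [if_true] at this; linear_combination this
  have h3 : ∀ i k, k ≠ i → Q k k - Q i i + β = 0 := fun i k hik => by
    have := h i i k k; simp only [hik, hP k i hik, if_true, if_false, sub_zero] at this
    linear_combination this
  let o : Fin n := ⟨0, by omega⟩; let o' : Fin n := ⟨1, by omega⟩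
  have ho : o ≠ o' := by simp [o, o']
  have ha : α = 0 := by
    by_contra hne; rcases hgood with hn3 | hg
    · let o'' : Fin n := ⟨2, by omega⟩; refine hne ?_
      linear_combination -hα o o' ho - hα o' o'' (by simp [o', o'']) + hα o o'' (by simp [o, o''])
    · refine hg ⟨mul_right_cancel₀ hne (by linear_combination -hα o o' ho - hα o' o ho.symm),
        β / α, ?_⟩; ext i k
      by_cases hik : i = k
      · subst hik; rw [h2 i]; simp [hne]
      · simpa [hik, hne] using h1 i k hik
  have hb : β = 0 := by rw [h2 o, ha, zero_mul]
  refine ⟨ha, hb, P o o, Q o o, ?_, ?_⟩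
  · ext i k
    by_cases hik : i = k
    · subst hik
      by_cases hi : i = o
      · simp [hi]
      · have := hα i o hi; simp only [Matrix.smul_apply, Matrix.one_apply_eq, smul_eq_mul, mul_one]
        linear_combination this + ha
    · simp [hik, hP i k hik]
  · ext i k
    by_cases hik : i = k
    · subst hik
      by_cases hi : i = o
      · simp [hi]
      · have := h3 o i hi; simp only [Matrix.smul_apply, Matrix.one_apply_eq, smul_eq_mul, mul_one]
        linear_combination this - hb
    · simp [hik, hQ i k hik]

end Scalar

section Arity

open TensorAlgebra (ι)
open scoped Classical

variable {n : ℕ} {R L : Type u} [CommRing R] [AddCommGroup L] [Module R L]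

local notation "ℳ" => Mor n R L
local notation "𝕋" => TM n R L
local notation "ℭ" => TM n R L →ₗ[R] Mor n R L
local notation "ϑ" => tau n R L

lemma dEven_three (g : Mat n L) {F : ℭ}
    (hF : ∀ l : List ℳ, l.length ≠ 2 → F (wd l) = 0) (a b c : ℳ) :
    dEven g F (ι R a * (ι R b * ι R c)) = F (ι R (mu g (ι R a * ι R b)) * ι R c) +
      F (ι R (ϑ a) * ι R (mu g (ι R b * ι R c))) -
      (mu g (ι R a * ι R (F (ι R b * ι R c))) + mu g (ι R (F (ι R a * ι R b)) * ι R c)) := by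
  have e1 : bh ϑ (mu g) (ι R a * (ι R b * ι R c)) =
      ι R (mu g (ι R a * ι R b)) * ι R c + ι R (ϑ a) * ι R (mu g (ι R b * ι R c)) := by
    have h := bh_mu_cons_cons g b c 1
    rw [bh_mu_cons_cons, ← mul_one (ι R c), h, mul_one, mul_one, bh_mu_ι, mul_zero, add_zero]
  have h0 : F 1 = 0 := hF [] (by simp)
  have h1 : ∀ x, F (ι R x) = 0 := fun x => by simpa using hF [x] (by simp)
  have h3 : ∀ x y z, F (ι R x * (ι R y * ι R z)) = 0 := fun x y z => by
    simpa using hF [x, y, z] (by simp)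
  have e2 : coder idL F idL (ι R a * (ι R b * ι R c)) =
      ι R a * ι R (F (ι R b * ι R c)) + ι R (F (ι R a * ι R b)) * ι R c := by
    let s : ℕ → ℳ := fun i => if i = 0 then a else if i = 1 then b else c
    have : ι R a * (ι R b * ι R c) = sw R s 3 := by simp [sw_succ, sw_zero, s]
    rw [this, coder_sw]; simp [Finset.Nat.antidiagonal_succ, sw_succ, sw_zero, s, h0, h1, h3]; abel
  rw [dEven, sub_apply, comp_apply, comp_apply, e1, e2, map_add, map_add]

lemma dOdd_two (g : Mat n L) {F : ℭ} (hF : ∀ l : List ℳ, l.length ≠ 1 → F (wd l) = 0) (a b : ℳ) :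
    dOdd g F (ι R a * ι R b) = F (ι R (mu g (ι R a * ι R b))) +
      (mu g (ι R (ϑ a) * ι R (F (ι R b))) + mu g (ι R (F (ι R a)) * ι R b)) := by
  have h0 : F 1 = 0 := hF [] (by simp)
  have h2 : ∀ x y, F (ι R x * ι R y) = 0 := fun x y => by simpa using hF [x, y] (by simp)
  have e1 : bh ϑ (mu g) (ι R a * ι R b) = ι R (mu g (ι R a * ι R b)) := by
    have h := bh_mu_cons_cons g a b 1; rwa [mul_one, mul_one, bh_mu_ι, mul_zero, add_zero] at h
  have e2 : bh ϑ F (ι R a * ι R b) = ι R (ϑ a) * ι R (F (ι R b)) + ι R (F (ι R a)) * ι R b := by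
    let s : ℕ → ℳ := fun i => if i = 0 then a else b
    have : ι R a * ι R b = sw R s 2 := by simp [sw_succ, sw_zero, s]
    rw [this, bh, coder_sw]
    simp [Finset.Nat.antidiagonal_succ, sw_succ, sw_zero, s, h0, h2, th_ι, th_one]; abel
  rw [dOdd, add_apply, comp_apply, comp_apply, e1, e2, map_add]

lemma eq_zero_of_mem_hom {a b : Obj} {d : ℤ} {x : ℳ} (hx : x ∈ hom (R := R) a b d)
    (h1 : a = .X ∧ b = .X ∧ d = 0 → x.1.1 = 0) (h2 : a = .Y ∧ b = .Y ∧ d = 0 → x.1.2 = 0)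
    (h3 : a = .X ∧ b = .X ∧ d = 1 → x.2.1.1 = 0) (h4 : a = .Y ∧ b = .Y ∧ d = 1 → x.2.1.2 = 0)
    (h5 : a = .X ∧ b = .Y ∧ d = 0 → x.2.2.1 = 0) (h6 : a = .Y ∧ b = .X ∧ d = 1 → x.2.2.2 = 0) :
    x = 0 := Prod.ext (Prod.ext (by_cases h1 hx.1) (by_cases h2 hx.2.1)) (Prod.ext (Prod.ext
    (by_cases h3 hx.2.2.1) (by_cases h4 hx.2.2.2.1)) (Prod.ext (by_cases h5 hx.2.2.2.2.1)
    (by_cases h6 hx.2.2.2.2.2)))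

lemma mu_two_V (g : Mat n L) (x y : ℳ) :
    (mu g (ι R x * ι R y)).2.2.1 = x.1.2 • y.2.2.1 + y.1.1 • x.2.2.1 := by
  rw [mu_two]; simp [compo, koszul]

lemma mu_two_Y (g : Mat n L) (x y : ℳ) :
    (mu g (ι R x * ι R y)).2.1.2 = x.1.2 * y.2.1.2 - y.1.2 * x.2.1.2 +
      ∑ i, x.2.2.1 i * y.2.2.2 i := by rw [mu_two]; simp [compo, koszul, sub_eq_add_neg]

lemma mu_two_X (g : Mat n L) (x y : ℳ) :
    (mu g (ι R x * ι R y)).2.1.1 = x.1.1 • y.2.1.1 - y.1.1 • x.2.1.1 -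
      ∑ i, ∑ j, (x.2.2.2 i * y.2.2.1 j) • g i j := by
  rw [mu_two]; simp [compo, koszul, sub_eq_add_neg]

variable {K : Type u} [Field K] [Module K L] (f : Frame Unit K L)
  (hl : f.lam () (f.l ()) = 1) (G : Mat n K)

set_option linter.unusedSimpArgs false in
include hl in
/-- Cocycles of arity two and degree zero are scalar on `V`, and vanish if the scalars do. -/
lemma Frame.scalar_of_dEven_eq_zero (hn : 2 ≤ n) (hG : IsUnit G.det)
    (hgood : 3 ≤ n ∨ ¬((2 : K) = 0 ∧ ∃ c : K, G = c • (1 : Mat n K)))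
    {F : TM n K L →ₗ[K] Mor n K L} (hF : IsC 0 2 F) (h : dEven (f.mat G) F = 0) : ∃ p q : K,
      (∀ m i, (F (ι K (f.el (.v i)) * ι K (f.el (.xi ())))).2.2.1 m = if m = i then p else 0) ∧
      (∀ m i, (F (ι K (f.el .eta) * ι K (f.el (.v i)))).2.2.1 m = if m = i then q else 0) ∧
      (p = 0 → q = 0 → F = 0) := by
  have hd : ∀ a b c : Letter Unit n, F (ι K (mu (f.mat G) (ι K (f.el a) * ι K (f.el b))) * ι K (f.el c)) +
      F (ι K (tau n K L (f.el a)) * ι K (mu (f.mat G) (ι K (f.el b) * ι K (f.el c)))) -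
      (mu (f.mat G) (ι K (f.el a) * ι K (F (ι K (f.el b) * ι K (f.el c)))) +
        mu (f.mat G) (ι K (F (ι K (f.el a) * ι K (f.el b))) * ι K (f.el c))) = 0 := fun a b c => by
    rw [← dEven_three _ hF.supp, h, zero_apply]
  have hm : ∀ a b : Letter Unit n, F (ι K (f.el a) * ι K (f.el b)) ∈
      ((cls [a.ty, b.ty]).shift 0).out n K L := fun a b => by
    simpa [Frame.wl] using f.mem_out_of_homog hF.homog [a, b]
  have tx : ∀ k, tau n K L (f.el (.xi k)) = f.el (.xi k) := fun k => by
    simp [tau_apply, koszul, Frame.el]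
  have te : tau n K L (f.el .eta) = f.el .eta := by simp [tau_apply, koszul, Frame.el]
  have tv : ∀ i, tau n K L (f.el (.v i)) = -f.el (.v i) := fun i => by
    simp [tau_apply, koszul, Frame.el]
  have tw : ∀ i, tau n K L (f.el (.w i)) = f.el (.w i) := fun i => by
    simp [tau_apply, koszul, Frame.el]
  have v1 : ∀ i : Fin n, (f.el (.v i)).2.2.1 = single (M := fun _ => K) i 1 := fun i => rfl
  have v2 : ∀ i : Fin n, (f.el (.v i)).2.2.2 = (0 : Fin n → K) := fun i => rfl
  have v3 : ∀ i : Fin n, (f.el (.v i)).2.1 = 0 := fun i => rfl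
  have w1 : ∀ i : Fin n, (f.el (.w i)).2.2.1 = (0 : Fin n → K) := fun i => rfl
  have w2 : ∀ i : Fin n, (f.el (.w i)).2.2.2 = single (M := fun _ => K) i 1 := fun i => rfl
  have w3 : ∀ i : Fin n, (f.el (.w i)).2.1 = 0 := fun i => rfl
  have x1 : (f.el (n := n) (.xi ())).2.2 = 0 := rfl
  have x2 : (f.el (n := n) (.xi ())).2.1 = (f.l (), 0) := rfl
  have y1 : (f.el (n := n) .eta).2.2 = 0 := rfl; have y2 : (f.el (n := n) .eta).2.1 = (0, 1) := rfl
  set Fl : Letter Unit n → Letter Unit n → Mor n K L :=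
    fun a b => F (ι K (f.el a) * ι K (f.el b)) with hFl
  have hFl' : ∀ a b, F (ι K (f.el a) * ι K (f.el b)) = Fl a b := fun a b => rfl
  let P : Mat n K := fun m i => (Fl (.v i) (.xi ())).2.2.1 m
  let Q : Mat n K := fun m i => (Fl .eta (.v i)).2.2.1 m
  let A : Mat n K := fun j k => (Fl (.w j) (.v k)).1.1
  let α : K := f.lam () (Fl (.xi ()) (.xi ())).2.1.1; let β : K := (Fl .eta .eta).2.1.2
  have hα : (Fl (.xi ()) (.xi ())).2.1.1 = α • f.l () := by
    simpa using (f.sum (Fl (.xi ()) (.xi ())).2.1.1).symm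
  have s1 : ∀ k i, (Fl (.xi ()) (.w k)).2.2.2 i = -P k i := fun k i => by
    have := congrArg (fun z => z.2.1.2) (hd (.v i) (.xi ()) (.w k))
    simp [f.mu_el, hFl', mu_two_Y, f.el_fst, v1, v2, v3, w1, w2, w3, single_apply] at this
    change _ = -(Fl (.v i) (.xi ())).2.2.1 k; linear_combination -this
  have s2 : ∀ i k, (Fl (.v i) (.w k)).1.2 = Q k i - if i = k then β else 0 := fun i k => by
    have := congrArg (fun z => z.2.1.2) (hd .eta (.v i) (.w k))
    change _ = (Fl .eta (.v i)).2.2.1 k - if i = k then (Fl .eta .eta).2.1.2 else 0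
    by_cases hik : i = k
    · subst hik
      simp [f.mu_el, hFl', mu_two_Y, f.el_fst, te, v1, v2, v3, w1, w2, w3, y1, y2, single_apply] at this ⊢
      linear_combination this
    · simp [f.mu_el, hFl', mu_two_Y, f.el_fst, te, v1, v2, v3, w1, w2, w3, y1, y2, hik, single_apply,
        Ne.symm hik] at this ⊢; linear_combination this
  have s3 : ∀ k i, (Fl (.w k) .eta).2.2.2 i = (if i = k then β else 0) - (Fl (.v i) (.w k)).1.2 :=
      fun k i => by
    have := congrArg (fun z => z.2.1.2) (hd (.v i) (.w k) .eta)
    change _ = (if i = k then (Fl .eta .eta).2.1.2 else 0) - _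
    by_cases hik : i = k
    · subst hik
      simp [f.mu_el, hFl', mu_two_Y, f.el_fst, tv, v1, v2, v3, w1, w2, w3, y1, y2, single_apply] at this ⊢
      linear_combination -this
    · simp [f.mu_el, hFl', mu_two_Y, f.el_fst, tv, v1, v2, v3, w1, w2, w3, y1, y2, hik, single_apply,
        Ne.symm hik] at this ⊢; linear_combination -this
  have s4 : ∀ i j, A i j = (P * G) i j + α * G i j := fun i j => by
    have := congrArg (fun z => f.lam () z.2.1.1) (hd (.xi ()) (.w i) (.v j))
    simp only [f.mu_el] at this
    simp [hFl', mu_two_X, f.el_fst, tx, v1, v2, v3, w1, w2, w3, x1, x2, single_apply, hα,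
      hl, s1, Frame.mat] at this; rw [Matrix.mul_apply]; change (Fl (.w i) (.v j)).1.1 = _
    linear_combination this
  have s5 : ∀ i j k m, (if i = j then Q m k else 0) + G j k * P m i -
      (if m = i then (P * G) j k + α * G j k else 0) -
      (if m = k then Q j i - (if i = j then β else 0) else 0) = 0 := fun i j k m => by
    have := congrArg (fun z => z.2.2.1 m) (hd (.v i) (.w j) (.v k)); rw [← s4]
    change (if i = j then (Fl .eta (.v k)).2.2.1 m else 0) + G j k * (Fl (.v i) (.xi ())).2.2.1 m -
      (if m = i then (Fl (.w j) (.v k)).1.1 else 0) - _ = 0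
    by_cases hij : i = j
    · subst hij
      simp [f.mu_el, hFl', mu_two_V, f.el_fst, tv, v1, v2, v3, w1, w2, w3, single_apply, s2] at this ⊢
      linear_combination this
    · simp [f.mu_el, hFl', mu_two_V, f.el_fst, tv, v1, v2, v3, w1, w2, w3, single_apply, s2, hij,
        Ne.symm hij] at this ⊢; linear_combination this
  obtain ⟨ha, hb, p, q, hP, hQ⟩ := scalar_of_cocycle hn hG hgood s5
  refine ⟨p, q, fun m i => ?_, fun m i => ?_, ?_⟩
  · exact (congrFun (congrFun hP m) i).trans (by simp [Matrix.one_apply])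
  · exact (congrFun (congrFun hQ m) i).trans (by simp [Matrix.one_apply])
  rintro rfl rfl; rw [zero_smul] at hP hQ; refine f.isC_eq hF (isC_zero _ _) fun s hs => ?_
  obtain ⟨a, b, rfl⟩ := List.length_eq_two.1 hs; have hab := hm a b
  have e : f.wl [a, b] = ι K (f.el a) * ι K (f.el b) := by simp [Frame.wl]
  have s2' : ∀ i k, (Fl (.v i) (.w k)).1.2 = 0 := fun i k => by rw [s2, hQ, hb]; simp
  have s4' : ∀ i k, (Fl (.w i) (.v k)).1.1 = 0 := fun i k => (s4 i k).trans (by rw [hP, ha]; simp)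
  rw [e, hFl', zero_apply]
  cases a <;> cases b <;>
    simp only [cls, Letter.ty, map_cons, List.map_nil, List.prod_cons, List.prod_nil, mul_one,
      Gr.mk_mul_mk, if_true, reduceCtorEq, if_false, Gr.shift, Gr.out] at hab
  all_goals first
    | exact (mem_bot K).1 hab
    | (refine eq_zero_of_mem_hom hab ?_ ?_ ?_ ?_ ?_ ?_ <;> intro he <;> simp at he)
  · rw [hα, ha, zero_smul]
  · funext m; rw [s1, hP]; simp
  · exact hb
  · funext m; exact congrFun (congrFun hQ m) _
  · funext m; exact congrFun (congrFun hP m) _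
  · exact s2' _ _
  · funext m; rw [s3, s2', hb]; simp
  · exact s4' _ _

include hl in
lemma Frame.exists_eq_dOdd_one (hn : 2 ≤ n) (hG : IsUnit G.det)
    (hgood : 3 ≤ n ∨ ¬((2 : K) = 0 ∧ ∃ c : K, G = c • (1 : Mat n K)))
    {F : TM n K L →ₗ[K] Mor n K L} (hF : IsC 0 2 F) (h : dEven (f.mat G) F = 0) :
    ∃ Ψ, IsC (-1) 1 Ψ ∧ F = dOdd (f.mat G) Ψ := by
  obtain ⟨p, q, hp, hq, -⟩ := f.scalar_of_dEven_eq_zero hl G hn hG hgood hF h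
  let ψ : Wd n → Mor n K L := fun s => match s with
    | [.xi ()] => -p • idM n K L .X
    | [.eta] => q • idM n K L .Y
    | _ => 0
  let Ψ : TM n K L →ₗ[K] Mor n K L := f.ext (-1) 1 fun s => ψ (ofFn s)
  have hΨ : IsC (-1) 1 Ψ := f.isC_ext _ _ _
  have hΨx : Ψ (ι K (f.el (.xi ()))) = -p • idM n K L .X := by
    have := f.ext_wl hl (-1) ψ (s := [.xi ()]) (k := 1) rfl
    rw [gproj_of_mem (smul_mem _ _ (idM_mem .X))] at this
    exact (congrArg Ψ (by simp [Frame.wl])).trans this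
  have hΨe : Ψ (ι K (f.el .eta)) = q • idM n K L .Y := by
    have := f.ext_wl hl (-1) ψ (s := [.eta]) (k := 1) rfl
    rw [gproj_of_mem (smul_mem _ _ (idM_mem .Y))] at this
    exact (congrArg Ψ (by simp [Frame.wl])).trans this
  have hE : IsC 0 2 (F - dOdd (f.mat G) Ψ) := hF.sub (hΨ.dOdd rfl _)
  obtain ⟨p', q', hp', hq', h0⟩ := f.scalar_of_dEven_eq_zero hl G hn hG hgood hE
    (by rw [dEven_sub, h, dEven_dOdd _ (hΨ.homog.isOdd rfl), sub_zero])
  have x1 : (f.el (n := n) (.xi ())).2.2.1 = 0 := rfl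
  have y1 : (f.el (n := n) .eta).2.2.1 = 0 := rfl; refine ⟨Ψ, hΨ, sub_eq_zero.1 (h0 ?_ ?_)⟩
  · have := hp' ⟨0, by omega⟩ ⟨0, by omega⟩; rw [if_pos rfl] at this
    rw [← this, sub_apply, dOdd_two _ hΨ.supp, f.mu_el, hΨx]
    simp [mu_two_V, f.el_fst, hp, x1, idM, tau_apply, koszul]; simp [Frame.el]
  · have := hq' ⟨0, by omega⟩ ⟨0, by omega⟩; rw [if_pos rfl] at this
    rw [← this, sub_apply, dOdd_two _ hΨ.supp, f.mu_el, hΨe]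
    simp [mu_two_V, f.el_fst, hq, y1, idM, tau_apply, koszul]; simp [Frame.el]

end Arity

/-! ## Naturality -/

section Natural

open TensorAlgebra (ι)
open scoped Classical

variable {n : ℕ} {R R' : Type u} [CommRing R] [CommRing R'] {ρ : R →+* R'}
  {L L' : Type u} [AddCommGroup L] [Module R L] [AddCommGroup L'] [Module R' L'] (φ : L →ₛₗ[ρ] L')

local notation "ℳ" => Mor n R L
local notation "𝕋" => TM n R L
local notation "ℭ" => TM n R L →ₗ[R] Mor n R L
local notation "ϑ" => tau n R L

lemma exists_tmap : ∃ T : 𝕋 →ₛₗ[ρ] TM n R' L', T 1 = 1 ∧ (∀ s t, T (s * t) = T s * T t) ∧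
    ∀ x, T (ι R x) = ι R' (morMap n φ x) := by
  let _ : Algebra R (TM n R' L') := Algebra.compHom (TM n R' L') ρ; let f : ℳ →ₗ[R] TM n R' L' :=
    { toFun := fun x => ι R' (morMap n φ x)
      map_add' := fun x y => by rw [map_add, map_add]
      map_smul' := fun c x => by rw [LinearMap.map_smulₛₗ, map_smul]; rfl }
  refine ⟨{ toFun := TensorAlgebra.lift R f, map_add' := map_add _,
            map_smul' := fun c x => (map_smul (TensorAlgebra.lift R f) c x) },
    map_one (TensorAlgebra.lift R f), map_mul (TensorAlgebra.lift R f), fun x => ?_⟩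
  exact TensorAlgebra.lift_ι_apply f x

/-- The map on tensor algebras induced by `morMap`. -/
def tmap : 𝕋 →ₛₗ[ρ] TM n R' L' := (exists_tmap φ).choose

lemma tmap_one : tmap φ (1 : 𝕋) = 1 := (exists_tmap φ).choose_spec.1

lemma tmap_mul (s t : 𝕋) : tmap φ (s * t) = tmap φ s * tmap φ t :=
  (exists_tmap φ).choose_spec.2.1 s t

lemma tmap_ι (x : ℳ) : tmap φ (ι R x) = ι R' (morMap n φ x) := (exists_tmap φ).choose_spec.2.2 x

lemma tmap_sw (a : ℕ → ℳ) (k : ℕ) : tmap φ (sw R a k) = sw R' (fun i => morMap n φ (a i)) k := by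
  induction k generalizing a with
  | zero => exact tmap_one φ
  | succ k ih => rw [sw_succ, sw_succ, tmap_mul, tmap_ι, ih]

lemma tmap_wd (l : List ℳ) : tmap φ (wd l) = wd (l.map (morMap n φ)) := by
  induction l with
  | nil => exact tmap_one φ
  | cons a l ih => rw [map_cons, wd_cons, wd_cons, tmap_mul, tmap_ι, ih]

/-- `F'` is obtained from `F` by extension of scalars. -/
def IsBC (F : ℭ) (F' : TM n R' L' →ₗ[R'] Mor n R' L') : Prop :=
  ∀ t, F' (tmap φ t) = morMap n φ (F t)

/-- `X'` is obtained from `X` by extension of scalars. -/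
def NatT (X : 𝕋 →ₗ[R] 𝕋) (X' : TM n R' L' →ₗ[R'] TM n R' L') : Prop :=
  ∀ t, X' (tmap φ t) = tmap φ (X t)

variable {φ} {F H : TM n R L →ₗ[R] Mor n R L} {F' H' : TM n R' L' →ₗ[R'] Mor n R' L'}
  {X Y : TM n R L →ₗ[R] TM n R L} {X' Y' : TM n R' L' →ₗ[R'] TM n R' L'}

lemma isBC_of_wd (h : ∀ l : List ℳ, F' (wd (l.map (morMap n φ))) = morMap n φ (F (wd l))) :
    IsBC φ F F' := fun t => by
  induction t using wdInduction with
  | word l => rw [tmap_wd, h]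
  | add s t hs ht => simp only [map_add, hs, ht]
  | smul r t ht => simp only [LinearMap.map_smulₛₗ, ht, RingHom.id_apply]

lemma natT_of_sw (h : ∀ (a : ℕ → ℳ) (k : ℕ),
    X' (sw R' (fun i => morMap n φ (a i)) k) = tmap φ (X (sw R a k))) : NatT φ X X' := fun t => by
  induction t using wdInduction with
  | word l => rw [wd_eq_sw, tmap_sw, h]
  | add s t hs ht => simp only [map_add, hs, ht]
  | smul r t ht => simp only [LinearMap.map_smulₛₗ, ht, RingHom.id_apply]

lemma IsBC.add (hF : IsBC φ F F') (hH : IsBC φ H H') : IsBC φ (F + H) (F' + H') := fun t => by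
  rw [add_apply, add_apply, hF, hH, map_add]

lemma IsBC.sub (hF : IsBC φ F F') (hH : IsBC φ H H') : IsBC φ (F - H) (F' - H') := fun t => by
  rw [sub_apply, sub_apply, hF, hH, map_sub]

lemma isBC_zero : IsBC φ (0 : ℭ) (0 : TM n R' L' →ₗ[R'] Mor n R' L') := fun t => by simp

lemma IsBC.comp (hF : IsBC φ F F') (hX : NatT φ X X') : IsBC φ (F.comp X) (F'.comp X') := fun t => by
  rw [comp_apply, comp_apply, hX, hF]

lemma natT_id : NatT φ (idL : 𝕋 →ₗ[R] 𝕋) (idL : TM n R' L' →ₗ[R'] TM n R' L') := fun _ => rfl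

lemma NatT.coder (hX : NatT φ X X') (hF : IsBC φ F F') (hY : NatT φ Y Y') :
    NatT φ (coder X F Y) (coder X' F' Y') := natT_of_sw fun a k => by
  rw [coder_sw, coder_sw, map_sum]; refine sum_congr rfl fun p _ => ?_; rw [map_sum]
  refine sum_congr rfl fun q _ => ?_
  rw [tmap_mul, tmap_mul, tmap_ι, ← hX, ← hF, ← hY, tmap_sw, tmap_sw, tmap_sw]

lemma tau_morMap (x : ℳ) : tau n R' L' (morMap n φ x) = morMap n φ (ϑ x) := by
  rw [tau_apply, tau_apply, koszul_morMap, map_neg]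

lemma natT_th : NatT φ (th ϑ) (th (tau n R' L')) := natT_of_sw fun a k => by
  rw [sw, sw, th_wd, th_wd, tmap_wd]; congr 1; simp [List.map_ofFn, Function.comp_def, tau_morMap]

lemma IsBC.bh (hF : IsBC φ F F') : NatT φ (bh ϑ F) (bh (tau n R' L') F') := natT_th.coder hF natT_id

lemma isBC_mu {g : Mat n L} {g' : Mat n L'} (hg : g' = g.map φ) :
    IsBC φ (mu (R := R) g) (mu (R := R') g') := isBC_of_wd fun l => by
  by_cases h : l.length = 2
  · obtain ⟨a, b, rfl⟩ := List.length_eq_two.1 h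
    have := extends_compo (R := R) φ g ![koszul (R := R) 1 a, b]
    simp only [map_cons, List.map_nil, wd_cons, wd_nil, mul_one, mu_two]
    rw [hg, ← this, koszul_morMap]; congr 1; funext i
    fin_cases i <;> rfl
  · rw [mu_eq_zero _ h, mu_eq_zero _ (by simpa using h), map_zero]

lemma IsBC.dEven {g : Mat n L} {g' : Mat n L'} (hg : g' = g.map φ)
    (hF : IsBC φ F F') : IsBC φ (dEven g F) (dEven g' F') :=
  (hF.comp (isBC_mu hg).bh).sub ((isBC_mu hg).comp (natT_id.coder hF natT_id))

lemma IsBC.dOdd {g : Mat n L} {g' : Mat n L'} (hg : g' = g.map φ)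
    (hF : IsBC φ F F') : IsBC φ (dOdd g F) (dOdd g' F') :=
  (hF.comp (isBC_mu hg).bh).add ((isBC_mu hg).comp hF.bh)

lemma IsBC.part (hF : IsBC φ F F') (k : ℕ) : IsBC φ (part k F) (part k F') := isBC_of_wd fun l => by
  rw [part_wd, part_wd, List.length_map, ← tmap_wd, hF]
  split_ifs <;> simp

lemma isBC_tw {f : ∀ k, Op n R L k} {f' : ∀ k, Op n R' L' k} (h : ∀ k, Extends φ (f k) (f' k)) :
    IsBC φ (tw f) (tw f') := isBC_of_wd fun l => by
  rw [← tmap_wd, wd_eq_sw, tmap_sw, tw_sw, tw_sw, ← h]; simp only [koszul_morMap]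

variable {κ : Type} [Fintype κ] {f : Frame κ R L} {f' : Frame κ R' L'}

/-- The frame `f'` is obtained from `f` by extension of scalars. -/
structure Frame.Compat (φ : L →ₛₗ[ρ] L') (f : Frame κ R L) (f' : Frame κ R' L') : Prop where
  l : ∀ k, f'.l k = φ (f.l k)
  lam : ∀ k x, f'.lam k (φ x) = ρ (f.lam k x)

lemma gproj_morMap (γ : Gr) (x : ℳ) :
    gproj (R := R') γ (morMap n φ x) = morMap n φ (gproj (R := R) γ x) := by
  cases γ with
  | one => simp [gproj]
  | zero => simp [gproj]
  | mk a b d => exact homProj_morMap φ a b (d + 1) x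

/-- Generators of the space of morphisms: letters and identities. -/
abbrev Out (κ : Type) (n : ℕ) : Type := Letter κ n ⊕ Obj

/-- The generators of the space of morphisms. -/
def Frame.elO (f : Frame κ R L) : Out κ n → ℳ := Sum.elim f.el (idM n R L)

/-- The coordinates on the space of morphisms. -/
def Frame.coO (f : Frame κ R L) : Out κ n → ℳ →ₗ[R] R := Sum.elim f.co fun
    | .X => LinearMap.fst R R R ∘ₗ LinearMap.fst R _ _
    | .Y => LinearMap.snd R R R ∘ₗ LinearMap.fst R _ _

lemma Frame.sum_coO (f : Frame κ R L) (x : ℳ) : ∑ o, f.coO o x • f.elO o = x := by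
  rw [Fintype.sum_sum_type]
  conv_rhs => rw [f.sum_co x]
  rw [add_comm, show (Finset.univ : Finset Obj) = {.X, .Y} from rfl, Finset.sum_pair (by simp)]; rfl

lemma Frame.eq_of_coO (f : Frame κ R L) {x y : ℳ} (h : ∀ o, f.coO o x = f.coO o y) : x = y := by
  rw [← f.sum_coO x, ← f.sum_coO y]; simp only [h]

lemma Frame.linearMap_ext {N : Type*} [AddCommGroup N] [Module R N] (f : Frame κ R L)
    {A B : 𝕋 →ₗ[R] N} {P : ℕ → Prop}
    (h : ∀ s : List (Out κ n), P s.length → A (wd (s.map f.elO)) = B (wd (s.map f.elO)))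
    {l : List ℳ} (hl : P l.length) : A (wd l) = B (wd l) := by
  induction l generalizing A B P with
  | nil => exact h [] hl
  | cons a l ih =>
    rw [wd_cons, ← f.sum_coO a]; simp only [map_sum, map_smul, Finset.sum_mul, smul_mul_assoc]
    refine sum_congr rfl fun o _ => congrArg _ ?_
    exact ih (A := A.comp (lm (f.elO o))) (B := B.comp (lm (f.elO o))) (P := fun k => P (k + 1))
      (fun s hs => by simpa using h (o :: s) hs) hl

namespace Frame.Compat

variable (hf : Frame.Compat φ f f')
include hf

lemma elO (o : Out κ n) : f'.elO o = morMap n φ (f.elO o) := by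
  rcases o with (k | _ | i | i) | (_ | _) <;>
    refine Prod.ext (Prod.ext ?_ ?_) (Prod.ext (Prod.ext ?_ ?_) (Prod.ext (funext fun j => ?_)
      (funext fun j => ?_))) <;>
    simp [Frame.elO, Frame.el, idM, morMap, hf.l, single_apply, apply_ite ρ]

lemma coO (o : Out κ n) (x : ℳ) : f'.coO o (morMap n φ x) = ρ (f.coO o x) := by
  rcases o with (k | _ | i | i) | (_ | _) <;> simp [Frame.coO, Frame.co, morMap, hf.lam]

lemma wl (s : List (Letter κ n)) : tmap φ (f.wl s) = f'.wl s := by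
  rw [Frame.wl, Frame.wl, tmap_wd, List.map_map]; congr 1
  exact List.map_congr_left fun j _ => (hf.elO (.inl j)).symm

lemma cow (s : List (Letter κ n)) (t : 𝕋) : f'.cow s (tmap φ t) = ρ (f.cow s t) := by
  induction s generalizing t with
  | nil =>
    induction t using leftInduction with
    | one => simp [tmap_one, Frame.cow]
    | cons a t _ => change eps _ = ρ (eps _); rw [tmap_mul, tmap_ι, eps_cons, eps_cons, map_zero]
    | add s t hs ht => rw [map_add, map_add, hs, ht, map_add, map_add]
    | smul r t ht =>
      rw [LinearMap.map_smulₛₗ, map_smul, map_smul, ht, smul_eq_mul, smul_eq_mul, map_mul]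
  | cons j s ih =>
    induction t using leftInduction with
    | one => rw [tmap_one, Frame.cow_one, Frame.cow_one, map_zero]
    | cons a t _ =>
      rw [tmap_mul, tmap_ι, Frame.cow_cons, Frame.cow_cons, ih, map_mul]; congr 1
      exact hf.coO (.inl j) a
    | add s t hs ht => rw [map_add, map_add, hs, ht, map_add, map_add]
    | smul r t ht =>
      rw [LinearMap.map_smulₛₗ, map_smul, map_smul, ht, smul_eq_mul, smul_eq_mul, map_mul]

lemma isBC_ext {t : ℤ} {k : ℕ} {ψ : (Fin k → Letter κ n) → ℳ}
    {ψ' : (Fin k → Letter κ n) → Mor n R' L'} (h : ∀ s, ψ' s = morMap n φ (ψ s)) :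
    IsBC φ (f.ext t k ψ) (f'.ext t k ψ') := fun x => by
  rw [f.ext_apply, f'.ext_apply, map_sum]; refine sum_congr rfl fun s _ => ?_
  rw [hf.cow, h, gproj_morMap, LinearMap.map_smulₛₗ]

lemma isBC_unique {H : TM n R' L' →ₗ[R'] Mor n R' L'} (h1 : IsBC φ F F') (h2 : IsBC φ F H) : F' = H :=
  ext_wd fun l => f'.linearMap_ext (P := fun _ => True) (fun s _ => by
    have : wd (R := R') (s.map f'.elO) = tmap φ (wd (s.map f.elO)) := by
      rw [tmap_wd, List.map_map]; congr 1; exact List.map_congr_left fun o _ => hf.elO o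
    rw [this, h1, h2]) trivial

end Frame.Compat

/-! ### Matrices -/

variable (f)

/-- The index set for coordinates of cochains of arity `k`. -/
abbrev Idx (κ : Type) (n k : ℕ) : Type := (Fin k → Letter κ n) × Out κ n

/-- The coordinates of a cochain of arity `k`. -/
def Frame.cf (k : ℕ) : ℭ →ₗ[R] (Idx κ n k → R) where
  toFun F x := f.coO x.2 (F (f.wl (ofFn x.1)))
  map_add' F F' := by ext x; simp
  map_smul' c F := by ext x; simp

/-- The cochain with given coordinates. -/
def Frame.rc (t : ℤ) (k : ℕ) : (Idx κ n k → R) →ₗ[R] ℭ where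
  toFun c := f.ext t k fun s => ∑ o, c (s, o) • f.elO o
  map_add' c c' := by
    refine LinearMap.ext fun x => ?_
    simp only [add_apply, f.ext_apply, Pi.add_apply, add_smul, sum_add_distrib, map_add, smul_add]
  map_smul' r c := by
    refine LinearMap.ext fun x => ?_
    simp only [LinearMap.smul_apply, f.ext_apply, Pi.smul_apply, smul_assoc, ← smul_sum, map_smul,
      RingHom.id_apply, smul_comm _ r]

lemma Frame.isC_rc (t : ℤ) (k : ℕ) (c : Idx κ n k → R) : IsC t k (f.rc t k c) := f.isC_ext _ _ _

lemma Frame.rc_cf {t : ℤ} {k : ℕ} {F : ℭ} (hF : IsC t k F) : f.rc t k (f.cf k F) = F := by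
  conv_rhs => rw [← f.ext_values hF]
  change f.ext t k _ = _; congr 1; funext s; exact f.sum_coO (F (f.wl (ofFn s)))

variable {f}

lemma Frame.Compat.cf (hf : Frame.Compat φ f f') (hF : IsBC φ F F') (k : ℕ) :
    f'.cf k F' = fun x => ρ (f.cf k F x) := by
  funext x; change f'.coO _ (F' _) = ρ (f.coO _ _); rw [← hf.wl, hF, hf.coO]

lemma Frame.Compat.rc (hf : Frame.Compat φ f f') (t : ℤ) {k : ℕ} (c : Idx κ n k → R) :
    IsBC φ (f.rc t k c) (f'.rc t k fun x => ρ (c x)) := hf.isBC_ext fun s => by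
    rw [map_sum]; exact sum_congr rfl fun o _ => by rw [LinearMap.map_smulₛₗ, hf.elO]

end Natural

/-! ## Splittings over the base -/

section Split

open scoped Classical Matrix

/-- A factorization of one matrix through another exists if it exists modulo all maximal ideals. -/
lemma exists_mul_eq {A : Type*} [CommRing A] {J J' : Type*} [Fintype J] [Fintype J']
    {p : Matrix J J A} {D : Matrix J' J A} (hp : p * p = p) (hD : D * p = D)
    (h : ∀ (m : Ideal A) [m.IsMaximal] (x : J → A ⧸ m), D.map (qmk m) *ᵥ x = 0 →
      p.map (qmk m) *ᵥ x = 0) : ∃ r : Matrix J J' A, r * D = p := by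
  let I : Ideal A :=
    { carrier := {a | ∃ r : Matrix J J' A, r * D = a • p}
      add_mem' := by
        rintro a b ⟨r, hr⟩ ⟨s, hs⟩; exact ⟨r + s, by rw [Matrix.add_mul, hr, hs, add_smul]⟩
      zero_mem' := ⟨0, by simp⟩
      smul_mem' := by
        rintro c a ⟨r, hr⟩; exact ⟨c • r, by rw [Matrix.smul_mul, hr, smul_assoc]⟩ }
  by_cases hI : I = ⊤
  · obtain ⟨r, hr⟩ : (1 : A) ∈ I := hI ▸ Submodule.mem_top; exact ⟨r, by rw [hr, one_smul]⟩
  exfalso; obtain ⟨m, hm, hIm⟩ := Ideal.exists_le_maximal I hI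
  let _ : Field (A ⧸ m) := Ideal.Quotient.field m
  have key : ∀ i, ∃ c : J' → A, ∀ j, p i j - (c ᵥ* D) j ∈ m := fun i => by
    have hs : LinearMap.proj i ∘ₗ (p.map (qmk m)).mulVecLin ∈
        Submodule.span (A ⧸ m) (Set.range fun k => LinearMap.proj k ∘ₗ
          (D.map (qmk m)).mulVecLin) := by
      refine mem_span_of_iInf_ker_le_ker fun x hx => ?_
      have h0 := h m x (funext fun k => (Submodule.mem_iInf _).1 hx k); exact congrFun h0 i
    obtain ⟨c, hc⟩ := (Submodule.mem_span_range_iff_exists_fun _).1 hs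
    choose c' hc' using fun k => Ideal.Quotient.mk_surjective (c k)
    refine ⟨c', fun j => Ideal.Quotient.eq.1 ?_⟩; have := lcongr hc (single j 1)
    simp only [LinearMap.sum_apply, LinearMap.smul_apply, comp_apply, LinearMap.proj_apply,
      Matrix.mulVecLin_apply, Matrix.mulVec_single_one, Matrix.col_apply, Matrix.map_apply] at this
    rw [← this, Matrix.vecMul, dotProduct, map_sum]; refine sum_congr rfl fun k _ => ?_
    rw [map_mul, hc', smul_eq_mul]
  choose r hr using key; let r' : Matrix J J' A := Matrix.of r
  have hM : p - r' * D = (p - r' * D) * p := by rw [Matrix.sub_mul, hp, Matrix.mul_assoc, hD]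
  have h1 : (1 - (p - r' * D)) * p = r' * D := by rw [Matrix.sub_mul, ← hM, Matrix.one_mul]; abel
  have hdet : (1 - (p - r' * D)).det ∈ I := ⟨(1 - (p - r' * D)).adjugate * r', by
    have := congrArg ((1 - (p - r' * D)).adjugate * ·) h1; rw [Matrix.mul_assoc, ← this]
    simp only [← Matrix.mul_assoc, Matrix.adjugate_mul, Matrix.smul_mul, Matrix.one_mul]⟩
  refine hm.ne_top ((Ideal.eq_top_iff_one m).2 ?_); have h2 : qmk m (1 - (p - r' * D)).det = 1 := by
    rw [RingHom.map_det]; have : (qmk m).mapMatrix (1 - (p - r' * D)) = 1 := by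
      rw [map_sub, map_one, sub_eq_self]; ext i j; exact Ideal.Quotient.eq_zero_iff_mem.2 (hr i j)
    rw [this, Matrix.det_one]
  have h3 := Ideal.Quotient.eq_zero_iff_mem.2 (hIm hdet); rw [h2] at h3
  rwa [← Ideal.Quotient.eq_zero_iff_mem, map_one]

/-- One step in the construction of a contraction of a complex of finite projective modules which is
exact modulo all maximal ideals. -/
lemma exists_mul_eq_sub {A : Type*} [CommRing A] {J₀ J J' : Type*} [Fintype J₀] [Fintype J]
    [Fintype J'] {e : Matrix J J A} {D₀ : Matrix J J₀ A} {a : Matrix J₀ J A} {D : Matrix J' J A}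
    (he : e * e = e) (he₀ : e * D₀ = D₀) (ha : D₀ * a * D₀ = D₀) (hDe : D * e = D) (hD : D * D₀ = 0)
    (h : ∀ (m : Ideal A) [m.IsMaximal] (x : J → A ⧸ m), D.map (qmk m) *ᵥ x = 0 →
      ∃ y, e.map (qmk m) *ᵥ x = D₀.map (qmk m) *ᵥ y) :
    ∃ b : Matrix J J' A, b * D = e - D₀ * a * e ∧ D * b * D = D := by
  have h' : D * (e - D₀ * a * e) = D := by
    rw [Matrix.mul_sub, hDe, ← Matrix.mul_assoc, ← Matrix.mul_assoc, hD, Matrix.zero_mul,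
      Matrix.zero_mul, sub_zero]
  suffices H : ∃ b : Matrix J J' A, b * D = e - D₀ * a * e by
    obtain ⟨b, hb⟩ := H; exact ⟨b, hb, by rw [Matrix.mul_assoc, hb, h']⟩
  refine exists_mul_eq ?_ h' fun m _ x hx => ?_
  · rw [Matrix.mul_sub, Matrix.sub_mul, Matrix.sub_mul, he, Matrix.mul_assoc _ e e, he,
      ← Matrix.mul_assoc, ← Matrix.mul_assoc e, he₀, ← Matrix.mul_assoc, ← Matrix.mul_assoc,
      Matrix.mul_assoc _ e D₀, he₀, ha, sub_self, sub_zero]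
  · obtain ⟨y, hy⟩ := h m x hx; have : (e - D₀ * a * e).map (qmk m) = e.map (qmk m) -
        D₀.map (qmk m) * a.map (qmk m) * e.map (qmk m) := by
      simp only [Matrix.map_sub, map_sub, Matrix.map_mul, implies_true]
    rw [this, Matrix.sub_mulVec, ← Matrix.mulVec_mulVec, hy, Matrix.mulVec_mulVec, ← Matrix.map_mul,
      ← Matrix.map_mul, ha, sub_self]

variable {n : ℕ} {R R' : Type u} [CommRing R] [CommRing R'] {ρ : R →+* R'}
  {L L' : Type u} [AddCommGroup L] [Module R L] [AddCommGroup L'] [Module R' L'] {φ : L →ₛₗ[ρ] L'}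
  {κ : Type} [Fintype κ] {f : Frame κ R L} {f' : Frame κ R' L'}

/-- The complexes of cochains are exact where splittings are needed. -/
structure IsExact (g : Mat n L) : Prop where
  inj : ∀ d, 1 ≤ d → ∀ F : TM n R L →ₗ[R] Mor n R L, IsC (-1) d F → dOdd g F = 0 → F = 0
  ex₁ : ∀ d, 1 ≤ d → ∀ F : TM n R L →ₗ[R] Mor n R L, IsC 0 (d + 1) F → dEven g F = 0 →
    ∃ Ψ, IsC (-1) d Ψ ∧ F = dOdd g Ψ
  ex₂ : ∀ d, 3 ≤ d → ∀ F : TM n R L →ₗ[R] Mor n R L, IsC 1 (d + 2) F → dOdd g F = 0 →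
    ∃ Ψ, IsC 0 (d + 1) Ψ ∧ F = dEven g Ψ

/-- The matrix of an operator on cochains. -/
def Frame.opMat (f : Frame κ R L) (t : ℤ) (k k' : ℕ)
    (Φ : (TM n R L →ₗ[R] Mor n R L) →ₗ[R] (TM n R L →ₗ[R] Mor n R L)) :
    Matrix (Idx κ n k') (Idx κ n k) R := LinearMap.toMatrix' (f.cf k' ∘ₗ Φ ∘ₗ f.rc t k)

lemma Frame.opMat_mulVec (f : Frame κ R L) (t : ℤ) (k k' : ℕ)
    (Φ : (TM n R L →ₗ[R] Mor n R L) →ₗ[R] (TM n R L →ₗ[R] Mor n R L)) (c : Idx κ n k → R) :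
    f.opMat t k k' Φ *ᵥ c = f.cf k' (Φ (f.rc t k c)) := by
  rw [Frame.opMat, LinearMap.toMatrix'_mulVec]; rfl

lemma Frame.opMat_mul (f : Frame κ R L) {t t' : ℤ} {k k' k'' : ℕ}
    {Φ Φ' : (TM n R L →ₗ[R] Mor n R L) →ₗ[R] (TM n R L →ₗ[R] Mor n R L)}
    (h : ∀ F, IsC t k F → IsC t' k' (Φ F)) :
    f.opMat t' k' k'' Φ' * f.opMat t k k' Φ = f.opMat t k k'' (Φ' ∘ₗ Φ) := by
  refine Matrix.mulVec_injective (funext fun c => ?_)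
  rw [← Matrix.mulVec_mulVec, f.opMat_mulVec, f.opMat_mulVec, f.opMat_mulVec,
    f.rc_cf (h _ (f.isC_rc t k c))]; rfl

lemma Frame.Compat.opMat (hf : Frame.Compat φ f f') (t : ℤ) (k k' : ℕ)
    {Φ : (TM n R L →ₗ[R] Mor n R L) →ₗ[R] (TM n R L →ₗ[R] Mor n R L)}
    {Φ' : (TM n R' L' →ₗ[R'] Mor n R' L') →ₗ[R'] (TM n R' L' →ₗ[R'] Mor n R' L')}
    (h : ∀ F F', IsBC φ F F' → IsBC φ (Φ F) (Φ' F')) :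
    (f.opMat t k k' Φ).map ρ = f'.opMat t k k' Φ' := by
  ext i j; have h1 := congrFun (f.opMat_mulVec t k k' Φ (single j 1)) i
  have h2 := congrFun (f'.opMat_mulVec t k k' Φ' (single j 1)) i
  rw [Matrix.mulVec_single_one, Matrix.col_apply] at h1 h2
  have e : (single j 1 : Idx κ n k → R') = fun x => ρ ((single j 1 : Idx κ n k → R) x) := by
    funext x; simp [single_apply, apply_ite ρ]
  rw [Matrix.map_apply, h1, h2, e, hf.cf (h _ _ (hf.rc t _)) k']

/-- Matrices from which splittings over all extensions of the base are obtained. -/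
structure Frame.MatSplit (f : Frame κ R L) (g : Mat n L) where
  r₀ : ∀ d, Matrix (Idx κ n d) (Idx κ n (d + 1)) R
  r₁ : ∀ d, Matrix (Idx κ n (d + 1)) (Idx κ n (d + 2)) R
  r₂ : ∀ d, Matrix (Idx κ n (d + 2)) (Idx κ n (d + 3)) R
  h₁ : ∀ d, 1 ≤ d → r₁ d * f.opMat 0 (d + 1) (d + 2) (dEvenL g) = f.opMat 0 (d + 1) (d + 1) idL -
    f.opMat (-1) d (d + 1) (dOddL g) * r₀ d * f.opMat 0 (d + 1) (d + 1) idL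
  h₂ : ∀ d, 3 ≤ d → r₂ d * f.opMat 1 (d + 2) (d + 3) (dOddL g) = f.opMat 1 (d + 2) (d + 2) idL -
      f.opMat 0 (d + 1) (d + 2) (dEvenL g) * r₁ d * f.opMat 1 (d + 2) (d + 2) idL

lemma Frame.exists_retraction (f : Frame κ R L) {t₀ t t₁ : ℤ} {k₀ k k₁ : ℕ}
    {Φ₀ Φ : (TM n R L →ₗ[R] Mor n R L) →ₗ[R] (TM n R L →ₗ[R] Mor n R L)}
    (h₀ : ∀ F, IsC t₀ k₀ F → IsC t k (Φ₀ F)) (hΦ : ∀ F, IsC t₀ k₀ F → Φ (Φ₀ F) = 0)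
    {a : Matrix (Idx κ n k₀) (Idx κ n k) R}
    (ha : f.opMat t₀ k₀ k Φ₀ * a * f.opMat t₀ k₀ k Φ₀ = f.opMat t₀ k₀ k Φ₀)
    (h : ∀ (m : Ideal R) [m.IsMaximal], ∃ (L' : Type u) (_ : AddCommGroup L') (_ : Module (R ⧸ m) L')
      (φ : L →ₛₗ[qmk m] L') (f' : Frame κ (R ⧸ m) L')
      (Φ₀' Φ' : (TM n (R ⧸ m) L' →ₗ[R ⧸ m] Mor n (R ⧸ m) L') →ₗ[R ⧸ m]
        (TM n (R ⧸ m) L' →ₗ[R ⧸ m] Mor n (R ⧸ m) L')),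
      Frame.Compat φ f f' ∧ (∀ F F', IsBC φ F F' → IsBC φ (Φ₀ F) (Φ₀' F')) ∧
      (∀ F F', IsBC φ F F' → IsBC φ (Φ F) (Φ' F')) ∧ (∀ F, IsC t k F → IsC t₁ k₁ (Φ' F)) ∧
      ∀ F, IsC t k F → Φ' F = 0 → ∃ Ψ, IsC t₀ k₀ Ψ ∧ F = Φ₀' Ψ) :
    ∃ b : Matrix (Idx κ n k) (Idx κ n k₁) R, b * f.opMat t k k₁ Φ = f.opMat t k k idL -
      f.opMat t₀ k₀ k Φ₀ * a * f.opMat t k k idL ∧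
      f.opMat t k k₁ Φ * b * f.opMat t k k₁ Φ = f.opMat t k k₁ Φ := by
  have hid : f.opMat t k k₁ Φ * f.opMat t k k idL = f.opMat t k k₁ Φ := f.opMat_mul fun F hF => hF
  have h0 : f.opMat t k k₁ Φ * f.opMat t₀ k₀ k Φ₀ = 0 := by
    rw [f.opMat_mul h₀]; refine Matrix.mulVec_injective (funext fun c => ?_)
    rw [f.opMat_mulVec, comp_apply, hΦ _ (f.isC_rc _ _ _), map_zero, Matrix.zero_mulVec]
  have he : f.opMat t k k idL * f.opMat t k k idL =
      f.opMat (n := n) t k k idL := f.opMat_mul fun F hF => hF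
  have he₀ : f.opMat t k k idL * f.opMat t₀ k₀ k Φ₀ = f.opMat t₀ k₀ k Φ₀ := f.opMat_mul h₀
  exact exists_mul_eq_sub he he₀ ha hid h0 fun m _ x hx => by
      obtain ⟨L', _, _, φ, f', Φ₀', Φ', hf, h1, h2, h3, hE⟩ := h m
      rw [hf.opMat t k k (Φ' := idL) fun _ _ h => h, hf.opMat t₀ k₀ k h1]
      rw [hf.opMat t k k₁ h2, f'.opMat_mulVec] at hx; have h4 := f'.rc_cf (h3 _ (f'.isC_rc t k x))
      rw [hx, map_zero] at h4; obtain ⟨Ψ, hΨ, e⟩ := hE _ (f'.isC_rc _ _ _) h4.symm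
      refine ⟨f'.cf k₀ Ψ, ?_⟩; rw [f'.opMat_mulVec, f'.opMat_mulVec, f'.rc_cf hΨ]
      exact congrArg _ e

lemma isC_dOddL_zero (g : Mat n L) {d : ℕ} {F : TM n R L →ₗ[R] Mor n R L}
    (hF : IsC (-1) d F) : IsC 0 (d + 1) (dOddL g F) := by
  have h := hF.dOdd rfl g; rwa [neg_add_cancel] at h

lemma Frame.exists_matSplit (f : Frame κ R L) (g : Mat n L)
    (h : ∀ (m : Ideal R) [m.IsMaximal], ∃ (L' : Type u) (_ : AddCommGroup L') (_ : Module (R ⧸ m) L')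
      (φ : L →ₛₗ[qmk m] L') (f' : Frame κ (R ⧸ m) L'),
      Frame.Compat φ f f' ∧ IsExact (R := R ⧸ m) (g.map φ)) : Nonempty (f.MatSplit g) := by
  have H : ∀ d, ∃ (a : Matrix (Idx κ n d) (Idx κ n (d + 1)) R)
      (b : Matrix (Idx κ n (d + 1)) (Idx κ n (d + 2)) R), 1 ≤ d → b * f.opMat 0 (d + 1) (d + 2) (dEvenL g) =
      f.opMat 0 (d + 1) (d + 1) idL -
        f.opMat (-1) d (d + 1) (dOddL g) * a * f.opMat 0 (d + 1) (d + 1) idL ∧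
      f.opMat 0 (d + 1) (d + 2) (dEvenL g) * b * f.opMat 0 (d + 1) (d + 2) (dEvenL g) =
      f.opMat 0 (d + 1) (d + 2) (dEvenL g) := fun d => by
    by_cases hd : 1 ≤ d
    · obtain ⟨a, -, ha⟩ := f.exists_retraction (t₀ := -2) (t := -1) (t₁ := 0) (k₀ := 0) (k := d)
        (k₁ := d + 1) (Φ₀ := 0) (Φ := dOddL g) (fun _ _ => isC_zero _ _) (fun _ _ => map_zero _) (a := 0)
        (by
          refine Matrix.mulVec_injective (funext fun c => ?_)
          rw [Matrix.mul_zero, Matrix.zero_mul, f.opMat_mulVec, Matrix.zero_mulVec]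
          exact (map_zero _).symm)
        fun m _ => by
          obtain ⟨L', _, _, φ, f', hf, hE⟩ := h m
          exact ⟨L', _, _, φ, f', 0, dOddL (g.map φ), hf, fun _ _ _ => isBC_zero, fun _ _ h => h.dOdd rfl,
            fun F hF => isC_dOddL_zero _ hF, fun F hF h0 => ⟨0, isC_zero _ _, hE.inj d hd F hF h0⟩⟩
      obtain ⟨b, hb, hb'⟩ := f.exists_retraction (t₁ := 1) (k₁ := d + 2) (Φ := dEvenL g)
        (fun F hF => isC_dOddL_zero g hF)
        (fun F hF => dEven_dOdd g (hF.homog.isOdd rfl)) ha fun m _ => by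
          obtain ⟨L', _, _, φ, f', hf, hE⟩ := h m
          exact ⟨L', _, _, φ, f', dOddL (g.map φ), dEvenL (g.map φ), hf, fun _ _ h => h.dOdd rfl,
            fun _ _ h => h.dEven rfl, fun F hF => IsC.dEven hd hF _, fun F hF h0 => hE.ex₁ d hd F hF h0⟩
      exact ⟨a, b, fun _ => ⟨hb, hb'⟩⟩
    · exact ⟨0, 0, fun h => absurd h hd⟩
  choose a b hb using H
  have hc : ∀ d, ∃ c : Matrix (Idx κ n (d + 2)) (Idx κ n (d + 3)) R, 3 ≤ d → c * f.opMat 1 (d + 2) (d + 3) (dOddL g) =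
      f.opMat 1 (d + 2) (d + 2) idL -
        f.opMat 0 (d + 1) (d + 2) (dEvenL g) * b d * f.opMat 1 (d + 2) (d + 2) idL := fun d => by
    by_cases hd : 3 ≤ d
    · obtain ⟨c, hc, -⟩ := f.exists_retraction (t := 1) (t₁ := 2) (k₁ := d + 3) (Φ := dOddL g)
        (fun F hF => IsC.dEven (by omega) hF g)
        (fun F hF => dOdd_dEven g hF.homog.isEven) (hb d (by omega)).2 fun m _ => by
          obtain ⟨L', _, _, φ, f', hf, hE⟩ := h m
          exact ⟨L', _, _, φ, f', dEvenL (g.map φ), dOddL (g.map φ), hf, fun _ _ h => h.dEven rfl,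
            fun _ _ h => h.dOdd rfl, fun F hF => hF.dOdd rfl _, fun F hF h0 => hE.ex₂ d hd F hF h0⟩
      exact ⟨c, fun _ => hc⟩
    · exact ⟨0, fun h => absurd h hd⟩
  choose c hc using hc; exact ⟨⟨a, b, c, fun d hd => (hb d hd).1, hc⟩⟩

variable {g : Mat n L}

/-- The splitting over an extension of the base. -/
def Frame.MatSplit.toSplitting (S : f.MatSplit g) (hf : Frame.Compat φ f f')
    {g' : Mat n L'} (hg : g' = g.map φ) : Splitting (R := R') g' where
  r₀ d := f'.rc (-1) d ∘ₗ ((S.r₀ d).map ρ).mulVecLin ∘ₗ f'.cf (d + 1)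
  r₁ d := f'.rc 0 (d + 1) ∘ₗ ((S.r₁ d).map ρ).mulVecLin ∘ₗ f'.cf (d + 2)
  r₂ d := f'.rc 1 (d + 2) ∘ₗ ((S.r₂ d).map ρ).mulVecLin ∘ₗ f'.cf (d + 3)
  mem₀ d F := f'.isC_rc _ _ _
  mem₁ d F := f'.isC_rc _ _ _
  mem₂ d F := f'.isC_rc _ _ _
  r₁_d d hd F hF := by
    have h := congrArg (fun M => f'.rc 0 (d + 1) (M.map ρ *ᵥ f'.cf (d + 1) F)) (S.h₁ d hd)
    simp only [Matrix.map_sub, map_sub, Matrix.map_mul, implies_true, ← Matrix.mulVec_mulVec,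
      Matrix.sub_mulVec] at h
    rw [hf.opMat 0 (d + 1) (d + 2) (Φ' := dEvenL g') fun _ _ h => h.dEven hg,
      hf.opMat 0 (d + 1) (d + 1) (Φ' := idL) fun _ _ h => h,
      hf.opMat (-1) d (d + 1) (Φ' := dOddL g') fun _ _ h => h.dOdd hg, f'.opMat_mulVec,
      f'.opMat_mulVec, f'.opMat_mulVec, LinearMap.id_apply, f'.rc_cf hF, f'.rc_cf hF] at h
    refine h.trans (congrArg _ (f'.rc_cf (isC_dOddL_zero _ (f'.isC_rc (-1) d _))))
  r₂_d d hd F hF := by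
    have h := congrArg (fun M => f'.rc 1 (d + 2) (M.map ρ *ᵥ f'.cf (d + 2) F)) (S.h₂ d hd)
    simp only [Matrix.map_sub, map_sub, Matrix.map_mul, implies_true, ← Matrix.mulVec_mulVec,
      Matrix.sub_mulVec] at h
    rw [hf.opMat 1 (d + 2) (d + 3) (Φ' := dOddL g') fun _ _ h => h.dOdd hg,
      hf.opMat 1 (d + 2) (d + 2) (Φ' := idL) fun _ _ h => h,
      hf.opMat 0 (d + 1) (d + 2) (Φ' := dEvenL g') fun _ _ h => h.dEven hg, f'.opMat_mulVec,
      f'.opMat_mulVec, f'.opMat_mulVec, LinearMap.id_apply, f'.rc_cf hF, f'.rc_cf hF] at h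
    refine h.trans (congrArg _ (f'.rc_cf (IsC.dEven (by omega) (f'.isC_rc 0 (d + 1) _) _)))

end Split

/-! ## Frames of the line bundle `O(1)` -/

section PglFrame

variable {n : ℕ}

lemma isHomogeneous_adjugate (i j : Fin n) :
    ((Matrix.mvPolynomialX (Fin n) (Fin n) (ULift.{u} ℤ)).adjugate i j).IsHomogeneous (n - 1) := by
  rw [Matrix.adjugate_apply, Matrix.det_apply]
  refine MvPolynomial.IsHomogeneous.sum _ _ _ fun σ _ => ?_
  have h : (∏ c, (Matrix.mvPolynomialX (Fin n) (Fin n) (ULift.{u} ℤ)).updateRow j (single i 1)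
      (σ c) c).IsHomogeneous (n - 1) := by
    have := MvPolynomial.IsHomogeneous.prod Finset.univ
      (fun c => (Matrix.mvPolynomialX (Fin n) (Fin n) (ULift.{u} ℤ)).updateRow j (single i 1) (σ c) c)
      (fun c => if σ c = j then 0 else 1) (fun c _ => by
        by_cases hc : σ c = j
        · rw [if_pos hc, hc, Matrix.updateRow_self, single_apply]
          split_ifs
          · exact MvPolynomial.isHomogeneous_one _ _
          · exact MvPolynomial.isHomogeneous_zero _ _ _
        · rw [if_neg hc, Matrix.updateRow_ne hc]; exact MvPolynomial.isHomogeneous_X _ _)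
    rwa [Equiv.sum_comp σ (fun c => if c = j then 0 else 1), Finset.sum_ite, Finset.sum_const_zero,
      zero_add, Finset.sum_const, smul_eq_mul, mul_one, Finset.filter_ne', Finset.card_erase_of_mem
      (mem_univ _), Finset.card_univ, Fintype.card_fin] at this
  rcases Int.units_eq_one_or (Equiv.Perm.sign σ) with hs | hs
  · rw [hs, one_smul]; exact h
  · rw [hs, Units.neg_smul, one_smul]; exact h.neg

/-- The generic matrix over `ℤ[x_{ij}][det⁻¹]`. -/
def glMat (n : ℕ) : Matrix (Fin n) (Fin n) (GLRing.{u} n) :=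
  (Matrix.mvPolynomialX (Fin n) (Fin n) (ULift.{u} ℤ)).map (algebraMap _ _)

lemma det_glMat : (glMat.{u} n).det = algebraMap _ (GLRing.{u} n) (genDet n) :=
  (RingHom.map_det (algebraMap (MatRing.{u} n) (GLRing.{u} n)) _).symm

lemma isUnit_det_glMat : IsUnit (glMat.{u} n).det := by
  rw [det_glMat]; exact IsLocalization.Away.algebraMap_isUnit _

lemma inv_mul_mem_glPart (j k : Fin n) {b : GLRing.{u} n} (hb : b ∈ glPart n 1) :
    (glMat n)⁻¹ j k * b ∈ glPart n 0 := by
  obtain ⟨e, p, hp, hb⟩ := hb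
  refine ⟨e + 1, (Matrix.mvPolynomialX (Fin n) (Fin n) (ULift.{u} ℤ)).adjugate j k * p, ?_, ?_⟩
  · have h := (isHomogeneous_adjugate j k).mul hp; have hn : 0 < n := j.pos
    rwa [show n - 1 + (n * e + 1) = n * (e + 1) + 0 by rw [mul_add]; omega] at h
  · have h1 : algebraMap _ (GLRing.{u} n) (genDet n) * (glMat n)⁻¹ j k = (glMat n).adjugate j k := by
      rw [Matrix.inv_def, Matrix.smul_apply, smul_eq_mul, ← mul_assoc, ← det_glMat,
        Ring.mul_inverse_cancel _ isUnit_det_glMat, one_mul]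
    have h2 : (glMat.{u} n).adjugate j k =
        algebraMap _ _ ((Matrix.mvPolynomialX (Fin n) (Fin n) (ULift.{u} ℤ)).adjugate j k) :=
      (congrFun (congrFun (RingHom.map_adjugate (algebraMap (MatRing.{u} n) (GLRing.{u} n)) _) j) k).symm
    rw [map_mul, ← hb, ← h2, ← h1]; ring

/-- The coefficients of the inverse of the generic matrix, as functionals on `O(1)`. -/
def invCoef (j k : Fin n) : O1.{u} n →ₗ[PGLRing.{u} n] PGLRing.{u} n where
  toFun b := (⟨(glMat n)⁻¹ j k * b.1, inv_mul_mem_glPart j k b.2⟩ : pglSubring.{u} n)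
  map_add' b c := Subtype.ext (mul_add _ _ _)
  map_smul' c b := Subtype.ext (mul_left_comm ((glMat n)⁻¹ j k) c.1 b.1)

variable {R R' : Type u} [CommRing R] [CommRing R'] {ψ : PGLRing.{u} n →+* R}
  {ψ' : PGLRing.{u} n →+* R'}

lemma exists_coefY (ψ : PGLRing.{u} n →+* R) (j k : Fin n) : ∃ Y : Lb ψ →ₗ[R] R,
    ∀ b, Y (Pull.of ψ b) = ψ (invCoef j k b) :=
  (Pull.exists_lift ψ (fun b => ψ (invCoef j k b)) (fun x y => by rw [map_add, map_add])
    (fun c x => by rw [map_smul, smul_eq_mul, map_mul, smul_eq_mul])).exists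

/-- The coefficients of the inverse matrix, as functionals on the line bundle. -/
def coefY (ψ : PGLRing.{u} n →+* R) (j k : Fin n) : Lb ψ →ₗ[R] R := (exists_coefY ψ j k).choose

lemma coefY_of (j k : Fin n) (b : O1.{u} n) : coefY ψ j k (Pull.of ψ b) = ψ (invCoef j k b) :=
  (exists_coefY ψ j k).choose_spec b

lemma coefY_map (ρ : R →+* R') (h : ρ.comp ψ = ψ') (j k : Fin n) (x : Lb ψ) :
    coefY ψ' j k (Pull.map ρ h x) = ρ (coefY ψ j k x) := by
  have : (coefY ψ' j k).comp (Pull.map ρ h) = ρ.toSemilinearMap.comp (coefY ψ j k) :=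
    Pull.semilinear_ext fun b => by
      rw [LinearMap.comp_apply, LinearMap.comp_apply, Pull.map_of, coefY_of, coefY_of, ← h]; rfl
  exact LinearMap.congr_fun this x

lemma sum_coefY_left (i k : Fin n) : ∑ j, coefY ψ j k (matOf ψ i j) = if i = k then 1 else 0 := by
  have h : ∑ j, invCoef j k (univMat.{u} n i j) = if i = k then 1 else 0 := by
    have h1 := congrFun (congrFun (Matrix.mul_nonsing_inv (glMat.{u} n) isUnit_det_glMat) i) k
    refine Subtype.ext ?_; rw [Matrix.mul_apply, Matrix.one_apply] at h1
    refine (map_sum (pglSubring.{u} n).subtype _ _).trans (Eq.trans ?_ (h1.trans ?_))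
    · exact sum_congr rfl fun j _ => mul_comm _ _
    · split_ifs <;> rfl
  simp only [matOf, Matrix.map_apply, coefY_of, ← map_sum, h, apply_ite ψ, map_one, map_zero]

lemma sum_coefY_right (j i : Fin n) : ∑ k, coefY ψ j k (matOf ψ k i) = if j = i then 1 else 0 := by
  have h : ∑ k, invCoef j k (univMat.{u} n k i) = if j = i then 1 else 0 := by
    have h1 := congrFun (congrFun (Matrix.nonsing_inv_mul (glMat.{u} n) isUnit_det_glMat) j) i
    refine Subtype.ext ?_; rw [Matrix.mul_apply, Matrix.one_apply] at h1
    refine (map_sum (pglSubring.{u} n).subtype _ _).trans (h1.trans ?_)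
    split_ifs <;> rfl
  simp only [matOf, Matrix.map_apply, coefY_of, ← map_sum, h, apply_ite ψ, map_one, map_zero]

lemma coefY_comm (j k : Fin n) (x y : Lb ψ) : coefY ψ j k x • y = coefY ψ j k y • x := by
  have h2 : ∀ b x, coefY ψ j k x • Pull.of ψ b = coefY ψ j k (Pull.of ψ b) • x := fun b x => by
    have : (LinearMap.toSpanSingleton R (Lb ψ) (Pull.of ψ b)).comp (coefY ψ j k) =
        coefY ψ j k (Pull.of ψ b) • idL := Pull.semilinear_ext fun c => by
      change coefY ψ j k (Pull.of ψ c) • Pull.of ψ b = coefY ψ j k (Pull.of ψ b) • Pull.of ψ c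
      rw [coefY_of, coefY_of, ← Pull.of_smul, ← Pull.of_smul]; refine congrArg _ (Subtype.ext ?_)
      change ((glMat n)⁻¹ j k * c.1) * b.1 = ((glMat n)⁻¹ j k * b.1) * c.1; ring
    exact LinearMap.congr_fun this x
  have : (LinearMap.toSpanSingleton R (Lb ψ) y).comp (coefY ψ j k) = coefY ψ j k y • idL :=
    Pull.semilinear_ext fun b => (h2 b y).symm; exact LinearMap.congr_fun this x

/-- The frame of the line bundle given by the first column of the matrix. -/
def pglFrame (hn : 0 < n) (ψ : PGLRing.{u} n →+* R) : Frame (Fin n) R (Lb ψ) where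
  l k := matOf ψ k ⟨0, hn⟩
  lam k := coefY ψ ⟨0, hn⟩ k
  sum x := by simp only [coefY_comm _ _ x, ← sum_smul, sum_coefY_right, if_true, one_smul]
  comm k x y := coefY_comm _ _ x y

lemma pglFrame_compat (hn : 0 < n) (ρ : R →+* R') (h : ρ.comp ψ = ψ') :
    Frame.Compat (Pull.map ρ h) (pglFrame hn ψ) (pglFrame hn ψ') where
  l k := congrFun (congrFun (matOf_map ρ h) k) _
  lam k x := coefY_map ρ h _ k x

/-- The points of `PGL_n` at which the moduli functors are considered: for `n = 2`, the unit in
characteristic `2` has to be avoided. -/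
def Good (ψ : PGLRing.{u} n →+* R) : Prop :=
  3 ≤ n ∨ n = 2 ∧ ∀ (K : Type u) [Field K] (σ : R →+* K), (2 : K) = 0 →
    ¬∃ l, ∀ i j, matOf (σ.comp ψ) i j = if i = j then l else 0

lemma isExact_matOf {K : Type u} [Field K] {ψ : PGLRing.{u} n →+* K} (hψ : Good ψ) :
    IsExact (R := K) (matOf ψ) := by
  have hn : 2 ≤ n := by rcases hψ with h | h <;> omega
  obtain ⟨k, hk⟩ : ∃ k, coefY ψ ⟨0, by omega⟩ k (matOf ψ k ⟨0, by omega⟩) ≠ 0 := by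
    by_contra! h
    have h1 := sum_coefY_right (ψ := ψ) ⟨0, by omega⟩ ⟨0, by omega⟩; simp [h] at h1
  set Y := coefY ψ ⟨0, by omega⟩ k; set l := matOf ψ k ⟨0, by omega⟩; let f : Frame Unit K (Lb ψ) :=
    { l := fun _ => l
      lam := fun _ => (Y l)⁻¹ • Y
      sum := fun x => by
        rw [Finset.univ_unique, sum_singleton, LinearMap.smul_apply, smul_assoc, coefY_comm,
          smul_smul, inv_mul_cancel₀ hk, one_smul]
      comm := fun _ x y => by
        rw [LinearMap.smul_apply, LinearMap.smul_apply, smul_assoc, smul_assoc, coefY_comm] }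
  have hl : f.lam () (f.l ()) = 1 := inv_mul_cancel₀ hk; let G : Mat n K := (matOf ψ).map (f.lam ())
  have hG : f.mat G = matOf ψ := by
    ext i j; have := f.sum (matOf ψ i j); rwa [Finset.univ_unique, sum_singleton] at this
  have hdet : IsUnit G.det := by
    have h1 : G * Matrix.of (fun j k => coefY ψ j k l) = 1 := by
      ext i k; rw [Matrix.mul_apply, Matrix.one_apply, ← sum_coefY_left (ψ := ψ) i k]
      refine sum_congr rfl fun j _ => ?_
      conv_rhs => rw [← hG]
      exact (map_smul (coefY ψ j k) (G i j) l).symm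
    exact (Matrix.isUnit_iff_isUnit_det _).1 (IsUnit.of_mul_eq_one _ h1)
  have hgood : 3 ≤ n ∨ ¬((2 : K) = 0 ∧ ∃ c : K, G = c • (1 : Mat n K)) := by
    refine hψ.imp_right fun h hc => ?_; have h2 := h.2 K (RingHom.id K) hc.1
    rw [RingHom.id_comp] at h2; obtain ⟨c, hc⟩ := hc.2; refine h2 ⟨c • l, fun i j => ?_⟩
    change matOf ψ i j = _; rw [← hG, hc]; change (c • (1 : Mat n K) i j) • l = _
    rw [Matrix.one_apply]
    split_ifs <;> simp
  rw [← hG]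
  refine ⟨fun d hd F hF h => f.dOdd_injective hl G hn hdet hd hF h, fun d hd F hF h => ?_,
    fun d hd F hF h => f.exists_eq_dEven hl G hn hdet hd hF h⟩
  obtain rfl | hd : d = 1 ∨ 2 ≤ d := by omega
  · exact f.exists_eq_dOdd_one hl G hn hdet hgood hF h
  · exact f.exists_eq_dOdd hl G hn hdet hd hF h

lemma Good.map (hψ : Good ψ) (ρ : R →+* R') : Good (ρ.comp ψ) :=
  hψ.imp_right fun h => ⟨h.1, fun K _ σ => h.2 K (σ.comp ρ)⟩

lemma Good.pos (hψ : Good ψ) : 0 < n := by rcases hψ with h | h <;> omega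

lemma Good.nonempty_matSplit (hψ : Good ψ) : Nonempty ((pglFrame hψ.pos ψ).MatSplit (matOf ψ)) := by
  refine (pglFrame hψ.pos ψ).exists_matSplit _ fun m _ => ?_
  refine ⟨Lb ((qmk m).comp ψ), inferInstance, inferInstance, Pull.map _ rfl,
    pglFrame hψ.pos _, pglFrame_compat _ _ _, ?_⟩; rw [← matOf_map _ rfl]
  let _ : Field (R ⧸ m) := Ideal.Quotient.field m; exact isExact_matOf (hψ.map _)

end PglFrame

/-! ## Equations for normal forms -/

section Equations

open TensorAlgebra (ι)
open scoped Classical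

variable {n : ℕ} {R R' : Type u} [CommRing R] [CommRing R'] {ρ : R →+* R'}
  {L L' : Type u} [AddCommGroup L] [Module R L] [AddCommGroup L'] [Module R' L'] {φ : L →ₛₗ[ρ] L'}
  {κ : Type} [Fintype κ] {f : Frame κ R L} {f' : Frame κ R' L'} {g : Mat n L}
  {g' : Mat n L'} {T : Splitting (R := R) g} {T' : Splitting (R := R') g'}

local notation "ℳ" => Mor n R L
local notation "𝕋" => TM n R L
local notation "ℭ" => TM n R L →ₗ[R] Mor n R L
local notation "ϑ" => tau n R L

/-- Coordinates of the operations of arity `3` and `4`. -/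
abbrev Crd (κ : Type) (n : ℕ) (R : Type u) : Type u := Idx κ n 3 ⊕ Idx κ n 4 → R

/-- The coordinates of the operations of arity `3` and `4`. -/
def Frame.crd (f : Frame κ R L) (B : ℭ) : Crd κ n R := Sum.elim (f.cf 3 B) (f.cf 4 B)

/-- The sum of the operations of arities `3, …, j + 4` of a structure in normal form, determined by
those of arity `3` and `4`. -/
def higher (f : Frame κ R L) (T : Splitting (R := R) g) (c : Crd κ n R) : ℕ → ℭ
  | 0 => f.rc 1 3 (fun x => c (.inl x)) + f.rc 1 4 (fun x => c (.inr x))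
  | j + 1 => higher f T c j - T.r₂ (j + 3) (part (j + 6) ((mu g + higher f T c j).comp
      (bh ϑ (mu g + higher f T c j))))

lemma exists_higherTo (f : Frame κ R L) (T : Splitting (R := R) g) (N : ℕ∞) (c : Crd κ n R) :
    ∃ D : ℭ, ∀ l : List ℳ,
      D (wd l) = if (l.length : ℕ∞) ≤ N then higher f T c l.length (wd l) else 0 := by
  obtain ⟨D, hD⟩ := exists_assemble fun k => if (k : ℕ∞) ≤ N then higher f T c k else 0
  exact ⟨D, fun l => by rw [hD]; split_ifs <;> rfl⟩

/-- The operations of arities `3, …, N`. -/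
def higherTo (f : Frame κ R L) (T : Splitting (R := R) g) (N : ℕ∞) (c : Crd κ n R) : ℭ :=
  (exists_higherTo f T N c).choose

/-- The candidate for a structure in normal form with given operations of arity `3` and `4`. -/
def cand (f : Frame κ R L) (T : Splitting (R := R) g) (N : ℕ∞) (c : Crd κ n R) : ℭ :=
  mu g + higherTo f T N c

lemma cand_wd (N : ℕ∞) (c : Crd κ n R) (l : List ℳ) : cand f T N c (wd l) =
    mu g (wd l) + if (l.length : ℕ∞) ≤ N then higher f T c l.length (wd l) else 0 := by
  rw [cand, add_apply, higherTo, (exists_higherTo f T N c).choose_spec]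

lemma higher_spec (c : Crd κ n R) (j : ℕ) : Homog 1 (higher f T c j) ∧
    RedH (oneM n R L) (higher f T c j) ∧
    ∀ l : List ℳ, l.length ≤ 2 ∨ j + 4 < l.length → higher f T c j (wd l) = 0 := by
  induction j with
  | zero =>
    have h1 := f.isC_rc (n := n) 1 3 fun x => c (.inl x)
    have h2 := f.isC_rc (n := n) 1 4 fun x => c (.inr x)
    refine ⟨h1.homog.add h2.homog, fun s t => ?_, fun l hl => ?_⟩
    · rw [higher, add_apply, h1.red, h2.red, add_zero]
    · rw [higher, add_apply, h1.supp _ (by omega), h2.supp _ (by omega), add_zero]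
  | succ j ih =>
    obtain ⟨h1, h2, h3⟩ := ih; have h := T.mem₂ (j + 3) (part (j + 6) ((mu g + higher f T c j).comp
      (bh ϑ (mu g + higher f T c j)))); refine ⟨h1.sub h.homog, fun s t => ?_, fun l hl => ?_⟩
    · rw [higher, sub_apply, h2, h.red, sub_zero]
    · rw [higher, sub_apply, h3 _ (by omega), h.supp _ (by omega), sub_zero]

lemma higher_stable (c : Crd κ n R) {j k : ℕ} (hjk : j ≤ k) {l : List ℳ}
    (hl : l.length ≤ j + 4) : higher f T c k (wd l) = higher f T c j (wd l) := by
  induction k, hjk using Nat.le_induction with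
  | base => rfl
  | succ k hjk ih => rw [higher, sub_apply, (T.mem₂ (k + 3) _).supp _ (by omega), sub_zero, ih]

lemma cand_apply {N : ℕ∞} (c : Crd κ n R) {j : ℕ} {l : List ℳ} (hN : (l.length : ℕ∞) ≤ N)
    (hl : l.length ≤ j + 4) : cand f T N c (wd l) = (mu g + higher f T c j : ℭ) (wd l) := by
  rw [cand_wd, if_pos hN, add_apply]; congr 1; rcases le_total j l.length with h | h
  · exact higher_stable c h hl
  · exact (higher_stable c h (by omega)).symm

lemma isStr_cand {N : ℕ∞} (hN : 2 ≤ N) {c : Crd κ n R} (h : ∀ l : List ℳ, (l.length : ℕ∞) ≤ N + 1 →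
      ((cand f T N c).comp (bh ϑ (cand f T N c))) (wd l) = 0) : IsStr N g (cand f T N c) := by
  have hD := (exists_higherTo f T N c).choose_spec; change ∀ l, higherTo f T N c (wd l) = _ at hD
  have h2 : ∀ l : List ℳ, l.length ≤ 2 → cand f T N c (wd l) = mu g (wd l) := fun l hl => by
    rw [cand_wd, (higher_spec c _).2.2 l (.inl hl), ite_self, add_zero]
  refine ⟨(homog_mu g).add fun l γ hγ => ?_, fun s t => ?_, fun a => ?_, fun a b => ?_,
    fun l hl => ?_, fun k hk t ht => ?_⟩
  · rw [hD]
    split_ifs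
    · exact (higher_spec c _).1 l γ hγ
    · exact zero_mem _
  · have : RedH (oneM n R L) (higherTo f T N c) := redH_iff.2 fun u v => by
      rw [hD, redH_iff.1 (higher_spec c _).2.1, ite_self]
    rw [cand, add_apply, redB_mu g s t, this, add_zero]
  · simpa using (h2 [a] (by simp)).trans (mu_eq_zero g (l := [a]) (by simp))
  · simpa [mu_two] using h2 [a, b] (by simp)
  · rw [cand_wd, if_neg (not_le.2 hl), add_zero, mu_eq_zero]; intro h; rw [h] at hl
    exact absurd hN (not_le.2 (by exact_mod_cast hl))
  · exact eq_of_Tle (φ := (cand f T N c).comp (bh ϑ (cand f T N c))) (ψ := 0)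
      (fun l hl => h l (le_trans (by exact_mod_cast hl) hk)) ht

lemma IsNormal.cand_crd {N : ℕ∞} (h2 : 2 ≤ N) {B : ℭ} (hB : IsStr N g B) (nB : IsNormal T N B) :
    cand f T N (f.crd B) = B := by
  have key : ∀ j, ∀ l : List ℳ, (l.length : ℕ∞) ≤ N → l.length ≤ j + 4 →
      (mu g + higher f T (f.crd B) j : ℭ) (wd l) = B (wd l) := by
    intro j
    induction j with
    | zero =>
      intro l hN hl
      have e : ∀ d, 1 ≤ d → f.rc 1 (d + 2) (f.cf (d + 2) B) = part (d + 2) B := fun d hd => by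
        rw [← f.rc_cf (hB.isC_part hd)]; congr 1; funext x
        change f.coO _ (B (wd _)) = f.coO _ (part _ B (wd _)); rw [part_wd, if_pos (by simp)]
      rw [add_apply, higher, add_apply]
      change mu g (wd l) + (f.rc 1 (1 + 2) (f.cf (1 + 2) B) (wd l) +
        f.rc 1 (2 + 2) (f.cf (2 + 2) B) (wd l)) = _
      rw [e 1 le_rfl, e 2 (by omega), part_wd, part_wd]
      obtain h | h | h : l.length ≤ 2 ∨ l.length = 3 ∨ l.length = 4 := by omega
      · rw [if_neg (by omega), if_neg (by omega), hB.eq_mu (wd_Tle h), add_zero, add_zero]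
      · rw [if_pos (by omega), if_neg (by omega), mu_eq_zero g (by omega), zero_add, add_zero]
      · rw [if_neg (by omega), if_pos (by omega), mu_eq_zero g (by omega), zero_add, zero_add]
    | succ j ih =>
      intro l hN hl
      by_cases hj : l.length ≤ j + 4
      · rw [add_apply, higher_stable _ (Nat.le_succ j) hj, ← add_apply, ih l hN hj]
      have hl' : l.length = j + 3 + 2 := by omega
      rw [hl'] at hN; set C := mu g + higher f T (f.crd B) j with hC
      have hC2 : ∀ t ∈ Tle R ℳ 2, C t = mu g t := fun t ht => eq_of_Tle (fun l hl => by
        rw [hC, add_apply, (higher_spec _ _).2.2 l (.inl hl), add_zero]) ht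
      have hβ : ∀ l : List ℳ, l.length ≠ j + 3 + 2 → part (j + 3 + 2) B (wd l) = 0 :=
        fun l hl => by rw [part_wd, if_neg hl]
      have hag : ∀ l : List ℳ, l.length ≤ j + 3 + 2 → (C + part (j + 3 + 2) B) (wd l) = B (wd l) :=
        fun l hl => by
          rw [add_apply, part_wd]
          split_ifs with h
          · rw [hC, add_apply, (higher_spec _ _).2.2 l (.inr (by omega)), mu_eq_zero g (by omega),
              add_zero, zero_add]
          · rw [add_zero, ih l (le_trans (by exact_mod_cast hl) hN) (by omega)]
      have h0 : part (j + 6) (C.comp (bh ϑ C)) = -dOdd g (part (j + 3 + 2) B) := ext_wd fun m => by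
          have hd := (hB.isC_part (d := j + 3) (by omega)).dOdd rfl g; rw [part_wd]
          split_ifs with hm
          · have h1 := comp_bh_eq (g := g) (by omega) hC2 hβ hm
            have h2 : (C + part (j + 3 + 2) B) (bh ϑ (C + part (j + 3 + 2) B) (wd m)) = 0 := by
              have hm' : wd m ∈ Tle R ℳ (j + 6) := wd_Tle hm.le; have h3 := hB.sq (j + 6) (by
                have := add_le_add_left hN 1; exact_mod_cast this) (wd m) hm'
              have h4 : ∀ t ∈ Tle R ℳ (j + 3 + 2), (C + part (j + 3 + 2) B) t = B t :=
                fun t ht => eq_of_Tle hag ht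
              have h5 : bh ϑ B (wd m) = bh ϑ (C + part (j + 3 + 2) B) (wd m) +
                  bh ϑ (B - (C + part (j + 3 + 2) B)) (wd m) := by
                rw [← add_apply, ← bh_add, add_sub_cancel]
              rw [h5, map_add, hB.apply_eq_zero (bh_mem_Tle (s := j + 5)
                (B := B - (C + part (j + 3 + 2) B)) (fun l hl => by
                rw [sub_apply, hag l hl, sub_self]) (by omega) hm'), add_zero, ← h4] at h3
              · exact h3
              · exact bh_mem_Tle (s := 1) (fun l hl => by
                  rw [hag l (by omega), hB.wd_eq_zero l hl]) (by omega) hm'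
            rw [h2] at h1; exact eq_neg_of_add_eq_zero_left h1.symm
          · rw [LinearMap.neg_apply, hd.supp m (by omega), neg_zero]
      rw [add_apply, higher, sub_apply, ← add_sub_assoc, ← add_apply, ← hC, h0, map_neg,
        T.r₂_d (j + 3) (by omega) _ (hB.isC_part (by omega)), nB (j + 3) (by omega) hN, sub_zero,
        LinearMap.neg_apply, sub_neg_eq_add, ← add_apply, hag l hl'.le]
  refine ext_wd fun l => ?_
  by_cases hN : (l.length : ℕ∞) ≤ N
  · rw [cand_apply (j := l.length) _ hN (by omega), key _ l hN (by omega)]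
  · rw [hB.top l (not_le.1 hN), cand_wd, if_neg hN, mu_eq_zero, add_zero]; intro h
    exact hN (h ▸ h2)

/-- Compatibility of splittings with extension of scalars. -/
structure Splitting.Compat (φ : L →ₛₗ[ρ] L') (T : Splitting (R := R) g) (T' : Splitting (R := R') g') :
    Prop where
  r₁ : ∀ d F F', IsBC φ F F' → IsBC φ (T.r₁ d F) (T'.r₁ d F')
  r₂ : ∀ d F F', IsBC φ F F' → IsBC φ (T.r₂ d F) (T'.r₂ d F')

section

variable (hf : Frame.Compat φ f f') (hg : g' = g.map φ) (hT : Splitting.Compat φ T T')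
include hf hg hT

lemma isBC_cand (N : ℕ∞) (c : Crd κ n R) :
    IsBC φ (cand f T N c) (cand f' T' N fun x => ρ (c x)) := by
  have h : ∀ j, IsBC φ (higher f T c j) (higher f' T' (fun x => ρ (c x)) j) := fun j => by
    induction j with
    | zero => exact (hf.rc 1 _).add (hf.rc 1 _)
    | succ j ih => have h := (isBC_mu hg).add ih; exact ih.sub (hT.r₂ _ _ _ ((h.comp h.bh).part _))
  refine isBC_of_wd fun l => ?_
  rw [cand_wd, cand_wd, List.length_map, ← tmap_wd, isBC_mu hg, h, map_add]
  split_ifs <;> simp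

lemma isBC_normal (N : ℕ∞) (c : Crd κ n R) (d : ℕ) :
    IsBC φ (dEven g (T.r₁ d (part (d + 2) (cand f T N c))))
      (dEven g' (T'.r₁ d (part (d + 2) (cand f' T' N fun x => ρ (c x))))) :=
  (hT.r₁ _ _ _ ((isBC_cand hf hg hT N c).part _)).dEven hg

lemma crd_cand_map (N : ℕ∞) (c : Crd κ n R) :
    f'.crd (cand f' T' N fun x => ρ (c x)) = fun x => ρ (f.crd (cand f T N c) x) := by
  have h := isBC_cand hf hg hT N c; funext x; rcases x with x | x
  · exact congrFun (hf.cf h 3) x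
  · exact congrFun (hf.cf h 4) x

end

/-- The coordinates of the values of a cochain on words whose length satisfies `P`. -/
def Frame.vals (f : Frame κ R L) (P : ℕ → Prop) (F : ℭ) : Set R :=
  {e | ∃ (s : List (Out κ n)) (o : Out κ n), P s.length ∧ f.coO o (F (wd (s.map f.elO))) = e}

lemma Frame.Compat.vals (hf : Frame.Compat φ f f') {F : ℭ} {F' : TM n R' L' →ₗ[R'] Mor n R' L'}
    (hF : IsBC φ F F') (P : ℕ → Prop) : f'.vals P F' = ρ '' f.vals P F := by
  have h : ∀ (s : List (Out κ n)) o, f'.coO o (F' (wd (s.map f'.elO))) =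
      ρ (f.coO o (F (wd (s.map f.elO)))) := fun s o => by
    rw [← hf.coO, ← hF, tmap_wd, List.map_map]; congr 4; exact funext hf.elO
  ext e; constructor
  · rintro ⟨s, o, hs, rfl⟩; exact ⟨_, ⟨s, o, hs, rfl⟩, (h s o).symm⟩
  · rintro ⟨_, ⟨s, o, hs, rfl⟩, rfl⟩; exact ⟨s, o, hs, h s o⟩

lemma Frame.vals_subset {P : ℕ → Prop} {F : ℭ} :
    f.vals P F ⊆ {0} ↔ ∀ l : List ℳ, P l.length → F (wd l) = 0 := by
  constructor
  · intro h l hl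
    refine f.linearMap_ext (A := F) (B := 0) (P := P) (fun s hs => f.eq_of_coO fun o => ?_) hl
    exact (h ⟨s, o, hs, rfl⟩ : _ = (0 : R)).trans (map_zero (f.coO o)).symm
  · rintro h _ ⟨s, o, hs, rfl⟩; rw [h _ (by simpa using hs), map_zero]; rfl

/-- The equations on the coordinates of structures in normal form. -/
def eqs (f : Frame κ R L) (T : Splitting (R := R) g) (N : ℕ∞) (c : Crd κ n R) : Set R :=
  (Set.range fun x => c x - f.crd (cand f T N c) x) ∪
    (f.vals (fun k => (k : ℕ∞) ≤ N + 1) ((cand f T N c).comp (bh ϑ (cand f T N c))) ∪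
    ⋃ d ∈ {d : ℕ | 1 ≤ d ∧ ((d + 2 : ℕ) : ℕ∞) ≤ N},
      f.vals (fun _ => True) (dEven g (T.r₁ d (part (d + 2) (cand f T N c)))))

lemma eqs_map (hf : Frame.Compat φ f f') (hg : g' = g.map φ) (hT : Splitting.Compat φ T T') (N : ℕ∞)
    (c : Crd κ n R) : eqs f' T' N (fun x => ρ (c x)) = ρ '' eqs f T N c := by
  have h := isBC_cand hf hg hT N c
  simp only [eqs, Set.image_union, Set.image_iUnion, hf.vals (h.comp h.bh),
    hf.vals (isBC_normal hf hg hT N c _), crd_cand_map hf hg hT, ← map_sub]; rw [← Set.range_comp]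
  rfl

/-- The vector `c` is the vector of coordinates of a structure in normal form, of class `x`. -/
def Rep (f : Frame κ R L) (T : Splitting (R := R) g) (N : ℕ∞) (c : Crd κ n R) (x : Classes R N g) : Prop :=
  ∃ m : MinAInf (R := R) N g, Quot.mk _ m = x ∧ tw m.m = cand f T N c ∧ IsNormal T N (cand f T N c) ∧
    f.crd (cand f T N c) = c

lemma Rep.eq {N : ℕ∞} {c : Crd κ n R} {x y : Classes R N g} (hx : Rep f T N c x) (hy : Rep f T N c y) :
    x = y := by
  obtain ⟨m, rfl, h, -⟩ := hx; obtain ⟨m', rfl, h', -⟩ := hy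
  exact congrArg _ (MinAInf.ext (tw_injective (h.trans h'.symm)))

lemma existsUnique_rep (f : Frame κ R L) (T : Splitting (R := R) g) {N : ℕ∞} (hN : 2 ≤ N)
    (x : Classes R N g) : ∃! c, Rep f T N c x := by
  induction x using Quot.ind with
  | mk m =>
    obtain ⟨B, F, hB, nB, hF, hr⟩ := m.isStr.exists_normal T hN
    have h := nB.cand_crd (f := f) hN hB
    have hm : GaugeEquiv m hB.toMin := gaugeEquiv_iff.2 ⟨F, hF, by rwa [hB.tw_toMin]⟩
    refine ⟨f.crd B, ⟨hB.toMin, Quot.sound ((gaugeEquiv_equivalence N g).symm hm), by rw [hB.tw_toMin, h], by rwa [h], by rw [h]⟩, ?_⟩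
    rintro c ⟨m', e, h1, h2, h3⟩
    have e' := (gaugeEquiv_equivalence N g).eqvGen_iff.1 (Quot.eqvGen_exact e)
    obtain ⟨F', hF', hr'⟩ := gaugeEquiv_iff.1 ((gaugeEquiv_equivalence N g).trans e' hm)
    rw [hB.tw_toMin, h1] at hr'; rw [← h3, IsNormal.eq_of_gRel T (h1 ▸ m'.isStr) hB h2 nB hF' hr']

lemma exists_rep_iff {N : ℕ∞} (hN : 2 ≤ N) {c : Crd κ n R} :
    (∃ x, Rep f T N c x) ↔ eqs f T N c ⊆ {0} := by
  rw [eqs, Set.union_subset_iff, Set.union_subset_iff, Set.iUnion₂_subset_iff, Frame.vals_subset]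
  constructor
  · rintro ⟨x, m, -, h1, h2, h3⟩; have hs := m.isStr; rw [h1] at hs
    refine ⟨?_, fun l hl => hs.sq _ hl _ (wd_Tle le_rfl), fun d hd => ?_⟩
    · rintro _ ⟨x, rfl⟩; change c x - f.crd _ x = 0; rw [h3, sub_self]
    · rw [Frame.vals_subset, h2 d hd.1 hd.2]; exact fun _ _ => rfl
  · rintro ⟨h1, h2, h3⟩; have hs := isStr_cand hN h2
    refine ⟨_, hs.toMin, rfl, hs.tw_toMin, fun d hd hdN => ext_wd fun l =>
      Frame.vals_subset.1 (h3 d ⟨hd, hdN⟩) l trivial, funext fun x => ?_⟩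
    exact (sub_eq_zero.1 (h1 ⟨x, rfl⟩)).symm

lemma Rep.push (hf : Frame.Compat φ f f') (hg : g' = g.map φ) (hT : Splitting.Compat φ T T') {N : ℕ∞}
    (hφ : IsUniv φ) {c : Crd κ n R} {x : Classes R N g} (h : Rep f T N c x) :
    Rep f' T' N (fun x => ρ (c x)) (x.push hφ hg) := by
  obtain ⟨m, rfl, h1, h2, h3⟩ := h; have hc := isBC_cand hf hg hT N c
  refine ⟨m.push hφ hg, rfl, ?_, fun d hd hdN => ?_, ?_⟩
  · have := isBC_tw (m.push_extends hφ hg); rw [h1] at this; exact hf.isBC_unique this hc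
  · have := isBC_normal hf hg hT N c d; rw [h2 d hd hdN] at this
    exact hf.isBC_unique this isBC_zero
  · rw [crd_cand_map hf hg hT, h3]

lemma Rep.trunc {N : ℕ} (hN : 4 ≤ N) {c : Crd κ n R} {x : Classes R ⊤ g} (h : Rep f T ⊤ c x) :
    Rep f T N c (x.trunc N (by omega)) := by
  obtain ⟨m, rfl, h1, h2, h3⟩ := h
  have e : ∀ l : List ℳ, l.length ≤ N → cand f T N c (wd l) = cand f T ⊤ c (wd l) :=
    fun l hl => by rw [cand_wd, cand_wd, if_pos (by exact_mod_cast hl), if_pos le_top]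
  have e' : ∀ k ≤ N, part k (cand f T N c) = part k (cand f T ⊤ c) := fun k hk =>
    part_congr fun l hl => e l (hl.trans_le hk)
  refine ⟨m.trunc N _, rfl, ext_wd fun l => ?_, fun d hd hdN => ?_, ?_⟩
  · by_cases hl : l.length ≤ N
    · rw [e l hl, ← h1, wd_eq_sw, tw_sw, tw_sw]; simp only [MinAInf.trunc, if_pos hl]
    · rw [wd_eq_sw, tw_sw, ← wd_eq_sw, cand_wd, if_neg (by exact_mod_cast hl), mu_eq_zero g (by omega)]
      simp only [MinAInf.trunc, if_neg hl]; simp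
  · rw [e' _ (by exact_mod_cast hdN), h2 d hd le_top]
  · rw [← h3]
    conv_lhs => rw [h3]
    funext x; rcases x with x | x <;>
    · change f.coO _ (cand f T N c (wd _)) = f.coO _ (cand f T ⊤ c (wd _))
      rw [e _ (by simp; omega)]

end Equations

/-! ## Universal structures -/

section Universal

variable {n : ℕ} {A B C C' : Type u} [CommRing A] [CommRing B] [CommRing C] [CommRing C']
  {ψ : PGLRing.{u} n →+* A}

/-- The class `u` over the `A`-algebra `B` is universal among classes over `A`-algebras. -/
def IsUniversal {N : ℕ∞} (i : A →+* B) (u : Moduli N (i.comp ψ)) : Prop :=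
  ∀ (C : Type u) [CommRing C] (σ : A →+* C) (x : Moduli N (σ.comp ψ)),
    ∃! f : B →+* C, ∃ h : f.comp i = σ, Moduli.map f (by rw [← h]; rfl) u = x

namespace Good

variable (hψ : Good ψ)

/-- A splitting over each extension of the base. -/
def split (σ : A →+* C) : Splitting (R := C) (matOf (σ.comp ψ)) :=
  hψ.nonempty_matSplit.some.toSplitting (pglFrame_compat hψ.pos σ rfl) (matOf_map σ rfl)

lemma split_compat (σ : A →+* C) (τ : C →+* C') :
    Splitting.Compat (Pull.map τ rfl) (hψ.split σ) (hψ.split (τ.comp σ)) := by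
  have hf : Frame.Compat (Pull.map τ rfl) (pglFrame hψ.pos (σ.comp ψ))
      (pglFrame hψ.pos ((τ.comp σ).comp ψ)) := pglFrame_compat hψ.pos τ rfl
  have key : ∀ (k k' : ℕ) (t : ℤ) (M : Matrix (Idx (Fin n) n k') (Idx (Fin n) n k) A) {F F'},
      IsBC (Pull.map τ rfl) F F' → IsBC (Pull.map τ rfl)
        ((pglFrame hψ.pos (σ.comp ψ)).rc t k' ((M.map σ).mulVecLin
          ((pglFrame hψ.pos (σ.comp ψ)).cf k F)))
        ((pglFrame hψ.pos ((τ.comp σ).comp ψ)).rc t k' ((M.map (τ.comp σ)).mulVecLin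
          ((pglFrame hψ.pos ((τ.comp σ).comp ψ)).cf k F'))) := fun k k' t M F F' h => by
    rw [hf.cf h]
    suffices e : (M.map (τ.comp σ)).mulVecLin (fun x => τ ((pglFrame hψ.pos (σ.comp ψ)).cf k F x)) =
        fun x => τ ((M.map σ).mulVecLin ((pglFrame hψ.pos (σ.comp ψ)).cf k F) x) by
      rw [e]; exact hf.rc t _
    funext x; change ∑ y, (τ.comp σ) (M x y) * τ _ = τ (∑ y, σ (M x y) * _); rw [map_sum]
    exact sum_congr rfl fun y _ => (map_mul τ _ _).symm
  exact ⟨fun d F F' h => key _ _ 0 _ h, fun d F F' h => key _ _ 1 _ h⟩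

/-- The vector `c` is the vector of coordinates of a normal form of `x`. -/
abbrev Rep {N : ℕ∞} (σ : A →+* C) (c : Crd (Fin n) n C) (x : Moduli N (σ.comp ψ)) : Prop :=
  SphPair.Rep (pglFrame hψ.pos (σ.comp ψ)) (hψ.split σ) N c x

lemma Rep.map {N : ℕ∞} {σ : A →+* C} {c : Crd (Fin n) n C} {x : Moduli N (σ.comp ψ)} (τ : C →+* C')
    (h : hψ.Rep σ c x) : hψ.Rep (τ.comp σ) (fun j => τ (c j)) (Moduli.map τ rfl x) :=
  SphPair.Rep.push (pglFrame_compat hψ.pos τ rfl) (matOf_map τ rfl) (hψ.split_compat σ τ)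
    (Pull.isUniv_map τ rfl) h

/-- The equations on coordinates, at the generic point. -/
def ideal (N : ℕ∞) : Ideal (MvPolynomial (Idx (Fin n) n 3 ⊕ Idx (Fin n) n 4) A) :=
  Ideal.span (eqs (pglFrame hψ.pos (MvPolynomial.C.comp ψ)) (hψ.split MvPolynomial.C) N MvPolynomial.X)

lemma exists_rep_iff {N : ℕ∞} (hN : 2 ≤ N)
    (τ : MvPolynomial (Idx (Fin n) n 3 ⊕ Idx (Fin n) n 4) A →+* C) :
    (∃ x : Moduli N ((τ.comp MvPolynomial.C).comp ψ),
      hψ.Rep (τ.comp MvPolynomial.C) (fun j => τ (MvPolynomial.X j)) x) ↔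
      hψ.ideal N ≤ RingHom.ker τ := by
  refine (SphPair.exists_rep_iff hN).trans ?_
  have h := eqs_map (pglFrame_compat hψ.pos τ rfl) (matOf_map τ rfl) (hψ.split_compat MvPolynomial.C τ) N
    MvPolynomial.X; rw [ideal, Ideal.span_le]
  refine (Eq.to_iff (congrArg (· ⊆ ({0} : Set C)) h)).trans ?_; rw [Set.image_subset_iff]; rfl

/-- The structure over the quotient of the polynomial ring by the equations is universal. -/
lemma isUniversal {N : ℕ∞} (hN : 2 ≤ N)
    {u : Moduli N (((qmk (hψ.ideal N)).comp MvPolynomial.C).comp ψ)}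
    (hu : hψ.Rep ((qmk (hψ.ideal N)).comp MvPolynomial.C) (fun j => qmk _ (MvPolynomial.X j)) u) :
    IsUniversal ((qmk (hψ.ideal N)).comp MvPolynomial.C) u := by
  intro C _ σ x
  obtain ⟨c, hc, huniq⟩ := existsUnique_rep (pglFrame hψ.pos (σ.comp ψ)) (hψ.split σ) hN x
  obtain ⟨τ, rfl, hτ⟩ : ∃ τ : MvPolynomial (Idx (Fin n) n 3 ⊕ Idx (Fin n) n 4) A →+* C,
      τ.comp MvPolynomial.C = σ ∧ ∀ j, τ (MvPolynomial.X j) = c j :=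
    ⟨MvPolynomial.eval₂Hom σ c, MvPolynomial.eval₂Hom_comp_C _ _, MvPolynomial.eval₂Hom_X' _ _⟩
  obtain rfl : (fun j => τ (MvPolynomial.X j)) = c := funext hτ
  have hk := (hψ.exists_rep_iff hN τ).1 ⟨x, hc⟩
  refine ⟨Ideal.Quotient.lift _ τ hk, ⟨rfl, (Rep.map hψ (Ideal.Quotient.lift _ τ hk) hu).eq hc⟩, ?_⟩
  rintro f ⟨hf, hfx⟩
  refine Ideal.Quotient.ringHom_ext (MvPolynomial.ringHom_ext (fun a => ?_) fun j => ?_)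
  · exact RingHom.congr_fun hf a
  · have h1 : ∀ (σ' : A →+* C) (hσ : f.comp ((qmk (hψ.ideal N)).comp MvPolynomial.C) = σ'),
        hψ.Rep σ' (fun j => f (qmk _ (MvPolynomial.X j))) (Moduli.map f (by rw [← hσ]; rfl) u) := by
      rintro _ rfl; exact Rep.map hψ f hu
    have h2 := h1 _ hf; rw [hfx] at h2; exact congrFun (huniq _ h2) j

include hψ in
/-- There are universal structures, over algebras of finite type. -/
lemma exists_universal : ∃ (B B₄ : Type u) (_ : CommRing B) (_ : CommRing B₄) (i : A →+* B)
    (i₄ : A →+* B₄) (u : Moduli ⊤ (i.comp ψ)) (u₄ : Moduli (4 : ℕ) (i₄.comp ψ)) (q : B₄ →+* B)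
    (hq : q.comp i₄ = i), i.FiniteType ∧ i₄.FiniteType ∧ Function.Surjective q ∧ IsUniversal i u ∧
      IsUniversal i₄ u₄ ∧ Moduli.map q (by rw [← hq]; rfl) u₄ = Classes.trunc 4 (by norm_num) u := by
  have h4 : (2 : ℕ∞) ≤ (4 : ℕ) := by norm_num
  have hft : ∀ N, ((qmk (hψ.ideal N)).comp MvPolynomial.C).FiniteType := fun N => by
    refine RingHom.FiniteType.comp (RingHom.FiniteType.of_surjective _ Ideal.Quotient.mk_surjective) ?_
    exact RingHom.finiteType_algebraMap.2 inferInstance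
  obtain ⟨u, hu⟩ := (hψ.exists_rep_iff le_top (qmk (hψ.ideal ⊤))).2 Ideal.mk_ker.ge
  obtain ⟨u₄, hu₄⟩ := (hψ.exists_rep_iff h4 (qmk (hψ.ideal (4 : ℕ)))).2 Ideal.mk_ker.ge
  have ht : hψ.Rep _ _ (Classes.trunc 4 (by norm_num) u) := SphPair.Rep.trunc le_rfl hu
  have hle : hψ.ideal (4 : ℕ) ≤ hψ.ideal ⊤ :=
    ((hψ.exists_rep_iff h4 (qmk (hψ.ideal ⊤))).1 ⟨_, ht⟩).trans Ideal.mk_ker.le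
  exact ⟨_, _, _, _, _, _, u, u₄, Ideal.Quotient.factor hle, rfl, hft _, hft _,
    Ideal.Quotient.factor_surjective hle, hψ.isUniversal le_top hu, hψ.isUniversal h4 hu₄,
    (Rep.map hψ (Ideal.Quotient.factor hle) hu₄).eq ht⟩

end Good

end Universal

/-! ## The coordinate ring of `PGL_n` -/

section PglRing

variable {n : ℕ}

/-- The products of the coefficients of the generic matrix and of its inverse. -/
def adCoef (p : (Fin n × Fin n) × Fin n × Fin n) : PGLRing.{u} n :=
  invCoef p.2.1 p.2.2 (univMat n p.1.1 p.1.2)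

lemma closure_adCoef (n : ℕ) : Subring.closure (Set.range (adCoef.{u} (n := n))) = ⊤ := by
  set S := Subring.closure (Set.range (adCoef.{u} (n := n)))
  let v : PGLRing.{u} n →+* GLRing.{u} n := (pglSubring.{u} n).subtype
  let ι : MatRing.{u} n →+* GLRing.{u} n := algebraMap _ _; let d : GLRing.{u} n := (glMat n)⁻¹.det
  have hd : ι (genDet n) * d = 1 := by
    rw [← det_glMat, ← Matrix.det_mul, Matrix.mul_nonsing_inv _ isUnit_det_glMat, Matrix.det_one]
  have hC : ∀ a : ULift.{u} ℤ, ι (MvPolynomial.C a) ∈ S.map v := by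
    intro a; have : ι (MvPolynomial.C a) = ((a.down : ℤ) : GLRing.{u} n) :=
      DFunLike.congr_fun (RingHom.ext_int ((ι.comp MvPolynomial.C).comp
          (ULift.ringEquiv : ULift.{u} ℤ ≃+* ℤ).symm.toRingHom) (Int.castRingHom _)) a.down
    rw [this]; exact intCast_mem _ _
  have h1 : ∀ p ∈ MvPolynomial.homogeneousSubmodule (Fin n × Fin n) (ULift.{u} ℤ) n,
      ι p * d ∈ S.map v := by
    intro p hp
    rw [← MvPolynomial.homogeneousSubmodule_one_pow, MvPolynomial.homogeneousSubmodule_one_eq_span_X,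
      Submodule.span_pow] at hp
    induction hp using Submodule.span_induction with
    | zero => rw [map_zero, zero_mul]; exact Subring.zero_mem _
    | add p q _ _ hp hq => rw [map_add, add_mul]; exact Subring.add_mem _ hp hq
    | smul a p _ hp =>
      rw [MvPolynomial.smul_eq_C_mul, map_mul, mul_assoc]; exact Subring.mul_mem _ (hC a) hp
    | mem p hp =>
      obtain ⟨s, rfl⟩ := Set.mem_pow.1 hp; choose t ht using fun i => (s i).2
      rw [List.prod_ofFn, map_prod, show d = _ from Matrix.det_apply _, Finset.mul_sum]
      refine Subring.sum_mem _ fun σ _ => ?_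
      rw [mul_smul_comm, ← Finset.prod_mul_distrib, Units.smul_def]
      refine Subring.zsmul_mem _ (Subring.prod_mem _ fun i _ => ?_) _
      refine ⟨adCoef (t i, σ i, i), Subring.subset_closure ⟨_, rfl⟩, ?_⟩; rw [← ht]
      exact mul_comm _ _
  have h2 : ∀ k, ∀ p : MatRing.{u} n, p.IsHomogeneous (n * k) → ι p * d ^ k ∈ S.map v := by
    intro k p hp
    replace hp : p ∈ MvPolynomial.homogeneousSubmodule (Fin n × Fin n) (ULift.{u} ℤ) (n * k) := hp
    rw [← MvPolynomial.homogeneousSubmodule_one_pow, pow_mul,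
      MvPolynomial.homogeneousSubmodule_one_pow] at hp
    induction hp using Submodule.pow_induction_on_left' with
    | algebraMap a => rw [pow_zero, mul_one]; exact hC a
    | add p q k _ _ hp hq => rw [map_add, add_mul]; exact Subring.add_mem _ hp hq
    | mem_mul m hm k p _ hp =>
      rw [map_mul, pow_succ', mul_mul_mul_comm]; exact Subring.mul_mem _ (h1 m hm) hp
  refine eq_top_iff.2 fun b _ => ?_; obtain ⟨k, p, hp, hb⟩ := b.2; obtain ⟨b', hb', e⟩ := h2 k p hp
  have e' : b'.1 = b.1 := by
    refine Eq.trans e ?_; change algebraMap _ _ p * _ = _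
    rw [← hb, mul_right_comm, ← mul_pow, hd, one_pow, one_mul]
  rwa [← Subtype.ext e']

instance (n : ℕ) : Algebra.FiniteType ℤ (PGLRing.{u} n) := ⟨⟨(Set.finite_range adCoef).toFinset, by
    rw [Set.Finite.coe_toFinset, Algebra.adjoin_int, closure_adCoef]; rfl⟩⟩

lemma pgl_hom_ext {R : Type*} [CommRing R] {χ χ' : PGLRing.{u} n →+* R}
    (h : ∀ p, χ (adCoef p) = χ' (adCoef p)) : χ = χ' :=
  RingHom.eq_of_eqOn_set_dense (closure_adCoef n) (by rintro _ ⟨p, rfl⟩; exact h p)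

variable {R R' : Type u} [CommRing R] [CommRing R'] {ψ : PGLRing.{u} n →+* R}

lemma map_adCoef (p : (Fin n × Fin n) × Fin n × Fin n) :
    ψ (adCoef p) = coefY ψ p.2.1 p.2.2 (matOf ψ p.1.1 p.1.2) := by
  rw [matOf, Matrix.map_apply, coefY_of]; rfl

lemma pglUnitMod2_adCoef (p : (Fin n × Fin n) × Fin n × Fin n) : pglUnitMod2.{u} n (adCoef p) =
    (if p.2.1 = p.2.2 then 1 else 0) * if p.1.1 = p.1.2 then 1 else 0 := by
  have hX : ∀ i j, glUnitMod2.{u} n (glMat n i j) = (1 : Matrix (Fin n) (Fin n) (ZMod 2)) i j :=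
    fun i j => by
      rw [glMat, Matrix.map_apply, Matrix.mvPolynomialX_apply, glUnitMod2, IsLocalization.Away.lift_eq,
        MvPolynomial.eval₂Hom_X']
  have h : (glUnitMod2.{u} n).mapMatrix (glMat n) = 1 := Matrix.ext hX
  have h' : (glUnitMod2.{u} n).mapMatrix (glMat n)⁻¹ = 1 := by
    have := congrArg (glUnitMod2.{u} n).mapMatrix
      (Matrix.nonsing_inv_mul (glMat.{u} n) isUnit_det_glMat)
    rwa [map_mul, h, mul_one, map_one] at this
  have e : pglUnitMod2.{u} n (adCoef p) = glUnitMod2.{u} n ((glMat n)⁻¹ p.2.1 p.2.2 * glMat n p.1.1 p.1.2) := by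
    rw [glMat, Matrix.map_apply, Matrix.mvPolynomialX_apply]; rfl
  have h2 := congrFun (congrFun h' p.2.1) p.2.2
  rw [RingHom.mapMatrix_apply, Matrix.map_apply, Matrix.one_apply] at h2
  rw [e, map_mul, hX, h2, Matrix.one_apply]

/-- A point of `PGL_n` in characteristic `2` with scalar matrix is the unit point. -/
lemma ker_le_of_scalar {K : Type u} [Field K] {ψ : PGLRing.{u} n →+* K} (h2 : (2 : K) = 0) {l : Lb ψ}
    (h : ∀ i j, matOf ψ i j = if i = j then l else 0) :
    RingHom.ker (pglUnitMod2.{u} n) ≤ RingHom.ker ψ := by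
  have : CharP K 2 := CharTwo.of_one_ne_zero_of_two_eq_zero one_ne_zero h2
  have hψ : ψ = (ZMod.castHom (dvd_refl 2) K).comp (pglUnitMod2.{u} n) := pgl_hom_ext fun p => by
    have h1 := sum_coefY_left (ψ := ψ) p.2.1 p.2.2
    simp only [h, apply_ite (coefY ψ _ _), map_zero, Finset.sum_ite_eq, mem_univ, if_true] at h1
    rw [map_adCoef, h, RingHom.comp_apply, pglUnitMod2_adCoef, map_mul, apply_ite (coefY ψ _ _), h1]
    split_ifs <;> simp
  intro x hx; rw [RingHom.mem_ker] at hx ⊢; rw [hψ, RingHom.comp_apply, hx, map_zero]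

/-- The function `tr(g) tr(g⁻¹)` on `PGL_n`. -/
def trCoef (n : ℕ) : PGLRing.{u} n := ∑ j, invCoef j j (univMat n).trace

lemma map_trCoef : ψ (trCoef n) = ∑ j, coefY ψ j j (matOf ψ).trace := by
  rw [trCoef, map_sum]; refine sum_congr rfl fun j _ => ?_
  simp only [Matrix.trace, Matrix.diag, map_sum, matOf, Matrix.map_apply, coefY_of]

lemma trInvertible_iff {ψ : PGLRing.{u} 2 →+* R} : TrInvertible ψ ↔ IsUnit (ψ (trCoef 2)) := by
  rw [map_trCoef]; constructor
  · intro h; have hs : ∀ x, ∃ c : R, c • (matOf ψ).trace = x := fun x =>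
      Submodule.mem_span_singleton.1 (h ▸ Submodule.mem_top)
    choose a ha using fun i j => hs (matOf ψ i j)
    have h1 : Matrix.of a * Matrix.of (fun j k => coefY ψ j k (matOf ψ).trace) = 1 := by
      ext i k; rw [Matrix.mul_apply, Matrix.one_apply, ← sum_coefY_left (ψ := ψ) i k]
      refine sum_congr rfl fun j _ => ?_; rw [← ha i j, map_smul]; rfl
    have h2 : (Matrix.of a).trace = 1 := by
      have h0 : ((Matrix.of a).trace - 1) • (matOf ψ).trace = 0 := by
        rw [sub_smul, one_smul, sub_eq_zero, Matrix.trace_fin_two, Matrix.trace_fin_two, add_smul]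
        exact congrArg₂ _ (ha 0 0) (ha 1 1)
      have h3 := sum_coefY_right (ψ := ψ) 0 0; rw [if_pos rfl] at h3
      have h6 : ∀ k, ((Matrix.of a).trace - 1) * coefY ψ 0 k (matOf ψ k 0) = 0 := fun k => by
        rw [← smul_eq_mul, ← map_smul, ← ha, smul_comm, h0, smul_zero, map_zero]
      have h7 := Finset.sum_eq_zero fun k (_ : k ∈ Finset.univ) => h6 k
      rwa [← Finset.mul_sum, h3, mul_one, sub_eq_zero] at h7
    have h4 : (Matrix.of fun j k => coefY ψ j k (matOf ψ).trace) * Matrix.of a = 1 :=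
      mul_eq_one_comm.1 h1; have h5 := congrArg (fun M => (M * (Matrix.of a).adjugate).trace) h4
    simp only [Matrix.mul_assoc, Matrix.mul_adjugate, Matrix.one_mul, Matrix.mul_smul, Matrix.mul_one,
      Matrix.trace_smul] at h5
    rw [Matrix.trace_fin_two (Matrix.adjugate _), Matrix.adjugate_fin_two] at h5
    refine IsUnit.of_mul_eq_one (Matrix.of a).det ?_; rw [mul_comm]; refine h5.trans ?_
    rw [← h2, Matrix.trace_fin_two]; exact add_comm _ _
  · rintro ⟨t, ht⟩
    refine eq_top_iff.2 fun x _ => Submodule.mem_span_singleton.2 ⟨↑t⁻¹ * ∑ j, coefY ψ j j x, ?_⟩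
    rw [mul_smul, sum_smul]; simp only [coefY_comm _ _ x]
    rw [← sum_smul, ← ht, smul_smul, Units.inv_mul, one_smul]

lemma good_away : Good (algebraMap (PGLRing.{u} 2) (Localization.Away (trCoef.{u} 2))) := by
  refine .inr ⟨rfl, fun K _ σ h2 => ?_⟩; rintro ⟨l, hl⟩
  have h0 : (matOf (σ.comp (algebraMap (PGLRing.{u} 2) (Localization.Away (trCoef.{u} 2))))).trace = 0 := by
    rw [Matrix.trace_fin_two, hl, hl, if_pos rfl, if_pos rfl, ← two_smul K, h2, zero_smul]
  have h1 := map_trCoef (ψ := σ.comp (algebraMap (PGLRing.{u} 2) (Localization.Away (trCoef.{u} 2))))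
  have hu : IsUnit (σ (algebraMap (PGLRing.{u} 2) (Localization.Away (trCoef.{u} 2)) (trCoef 2))) :=
    (IsLocalization.Away.algebraMap_isUnit _).map σ; rw [h0] at h1; refine hu.ne_zero (h1.trans ?_)
  simp

end PglRing

/-! ## Representability over affine bases -/

section Affine

/-- A functor is corepresented by an object with a universal element. -/
def corepOf {C : Type*} [Category.{u} C] (F : C ⥤ Type u) {X : C} (x : F.obj X)
    (h : ∀ (Y : C) (y : F.obj Y), ∃! f : X ⟶ Y, F.map f x = y) : F.CorepresentableBy X where
  homEquiv {Y} := Equiv.ofBijective (fun f => F.map f x) ((Function.bijective_iff_existsUnique _).2 (h Y))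
  homEquiv_comp g f := by change F.map (f ≫ g) x = F.map g (F.map f x); rw [F.map_comp]; rfl

variable {n : ℕ} {N : ℕ∞}

/-- The functor of classes is corepresented by the base ring of a universal class. -/
def IsUniversal.corep {B : Type u} [CommRing B] {i : PGLRing.{u} n →+* B}
    {u : Moduli N (i.comp (RingHom.id _))} (h : IsUniversal i u) :
    letI := i.toAlgebra
    (modFunctor.{u} N n).CorepresentableBy (.of (PGLRing.{u} n) B) :=
  letI := i.toAlgebra
  corepOf (modFunctor N n) (X := .of (PGLRing.{u} n) B) u fun C y => by
    obtain ⟨f, ⟨h1, h2⟩, h3⟩ := h C (algebraMap _ C) y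
    refine ⟨CommAlgCat.ofHom { f with commutes' := fun a => RingHom.congr_fun h1 a }, h2, fun f' hf' => ?_⟩
    have := h3 f'.hom.toRingHom ⟨f'.hom.comp_algebraMap, hf'⟩; ext x; exact RingHom.congr_fun this x

lemma exists_corep_modFunctor (hn : 3 ≤ n) :
    ∃ (B B₄ : CommAlgCat.{u} (PGLRing.{u} n)) (h : (modFunctor.{u} ⊤ n).CorepresentableBy B)
      (h₄ : (modFunctor.{u} (4 : ℕ) n).CorepresentableBy B₄),
      Algebra.FiniteType (PGLRing.{u} n) B ∧ Algebra.FiniteType (PGLRing.{u} n) B₄ ∧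
      ∃ q : B₄ ⟶ B, Function.Surjective q.hom ∧ ∀ (C : CommAlgCat.{u} (PGLRing.{u} n)) (f : B ⟶ C),
          h₄.homEquiv (q ≫ f) = (modTrunc.{u} 4 (by norm_num) n).app C (h.homEquiv f) := by
  obtain ⟨B, B₄, _, _, i, i₄, u, u₄, q, hq, hi, hi₄, hs, hu, hu₄, e⟩ :=
    Good.exists_universal (ψ := RingHom.id (PGLRing.{u} n)) (.inl hn); let _ := i.toAlgebra
  let _ := i₄.toAlgebra
  let q' : CommAlgCat.of (PGLRing.{u} n) B₄ ⟶ CommAlgCat.of (PGLRing.{u} n) B :=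
    CommAlgCat.ofHom { q with commutes' := fun a => RingHom.congr_fun hq a }
  refine ⟨.of _ B, .of _ B₄, hu.corep, hu₄.corep, hi, hi₄, q', hs, fun C f => ?_⟩
  have h1 : hu₄.corep.homEquiv q' = (modTrunc.{u} 4 (by norm_num) n).app _ (hu.corep.homEquiv (𝟙 _)) := by
    refine e.trans (congrArg (Classes.trunc 4 _) ?_); exact (Moduli.map_id _ _).symm
  rw [hu₄.corep.homEquiv_comp, h1, ← Category.id_comp f, hu.corep.homEquiv_comp]
  exact (ConcreteCategory.congr_hom ((modTrunc.{u} 4 (by norm_num) n).naturality _) _).symm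

lemma exists_universal_sph {A : Type u} [CommRing A] {ψ : PGLRing.{u} n →+* A} (hψ : Good ψ)
    (hA : ψ.FiniteType) (he : ∀ (R : Type u) [CommRing R] (σ σ' : A →+* R), σ.comp ψ = σ'.comp ψ → σ = σ') :
    ∃ (B : CommRingCat.{u}) (x : (sphFunctor.{u} n).obj B), Algebra.FiniteType ℤ B ∧
      (∃ i, x.1 = RingHom.comp i ψ) ∧ ∀ (R : CommRingCat.{u}) (y : (sphFunctor.{u} n).obj R),
        (∃ σ, y.1 = RingHom.comp σ ψ) → ∃! f : B ⟶ R, (sphFunctor.{u} n).map f x = y := by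
  obtain ⟨B, -, _, -, i, -, u, -, -, -, hi, -, -, hu, -⟩ := hψ.exists_universal
  refine ⟨.of B, ⟨i.comp ψ, u⟩, ?_, ⟨i, rfl⟩, ?_⟩
  · refine RingHom.finiteType_algebraMap.1 ?_
    rw [RingHom.ext_int (algebraMap ℤ B) ((i.comp ψ).comp (algebraMap ℤ (PGLRing.{u} n)))]
    exact (hi.comp hA).comp (RingHom.finiteType_algebraMap.2 inferInstance)
  · rintro R ⟨_, y⟩ ⟨σ, rfl⟩; obtain ⟨f, ⟨rfl, rfl⟩, h⟩ := hu R σ y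
    refine ⟨CommRingCat.ofHom f, rfl, fun f' hf' => ?_⟩; have h1 := congrArg Sigma.fst hf'
    have h2 : f'.hom.comp i = f.comp i := he _ _ _ h1
    refine CommRingCat.hom_ext (h f'.hom ⟨h2, ?_⟩)
    have key : ∀ {ψ₁ ψ₂ : PGLRing.{u} n →+* R} (x₁ : Moduli ⊤ ψ₁) (x₂ : Moduli ⊤ ψ₂) (e : ψ₁ = ψ₂),
        (⟨ψ₁, x₁⟩ : Σ ψ, Moduli ⊤ ψ) = ⟨ψ₂, x₂⟩ → Moduli.map (RingHom.id R) e x₁ = x₂ := by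
      rintro ψ₁ _ x₁ x₂ rfl h; rw [Moduli.map_id]; exact eq_of_heq (Sigma.mk.inj h).2
    rw [← key _ _ h1 hf']; exact Moduli.map_comp f'.hom rfl (RingHom.id R) h1 h1 u

lemma exists_corep_sphFunctor (hn : 3 ≤ n) : ∃ B : CommRingCat.{u}, Algebra.FiniteType ℤ B ∧
    Nonempty ((sphFunctor.{u} n).CorepresentableBy B) := by
  obtain ⟨B, x, hB, -, h⟩ := exists_universal_sph (ψ := RingHom.id (PGLRing.{u} n)) (.inl hn)
    (.id _) fun R _ σ σ' h => h; exact ⟨B, hB, ⟨corepOf _ x fun R y => h R y ⟨y.1, rfl⟩⟩⟩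

lemma exists_corep_sphTrFunctor : ∃ B : CommRingCat.{u}, Algebra.FiniteType ℤ B ∧
    Nonempty ((sphTrFunctor.{u} 2).CorepresentableBy B) := by
  obtain ⟨B, x, hB, ⟨i, hi⟩, h⟩ := exists_universal_sph good_away.{u}
    (RingHom.finiteType_algebraMap.2 inferInstance) fun R _ σ σ' h =>
      IsLocalization.ringHom_ext (Submonoid.powers (trCoef.{u} 2)) h
  refine ⟨B, hB, ⟨corepOf (sphTrFunctor.{u} 2) (X := B) ⟨x, trInvertible_iff.2 ?_⟩ fun R y => ?_⟩⟩
  · rw [hi]; exact (IsLocalization.Away.algebraMap_isUnit (trCoef.{u} 2)).map i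
  · obtain ⟨f, hf, hu⟩ := h R y.1 ⟨IsLocalization.Away.lift (trCoef.{u} 2) (trInvertible_iff.1 y.2),
      (IsLocalization.Away.lift_comp (trCoef.{u} 2) _).symm⟩
    exact ⟨f, Subtype.ext hf, fun f' hf' => hu f' (congrArg Subtype.val hf')⟩

end Affine

/-- The base scheme `U`. -/
abbrev BaseU : Scheme.{u} := PGL2U.{u}

/-- Affine open subsets of `U`. -/
abbrev AffOp : Type u := (PGL2U.{u} : Scheme.{u}).affineOpens

/-! ### Sheaves on affine schemes over `U` -/

section Sheaves

open Limits

lemma isSheaf_baseTopology {F : AffU.{u}ᵒᵖ ⥤ Type u}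
    (h : ∀ (ι : Type u) (W : ι → BaseU.{u}.Opens), (⨆ i, W i) = ⊤ → ∀ T : AffU.{u},
      Presieve.IsSheafFor F (baseSieve W T).arrows) : Presieve.IsSheaf baseTopology.{u} F := by
  have hle : baseTopology.{u} ≤ Sheaf.finestTopologySingle F :=
    sInf_le fun ι W hW T T' f => h ι W hW T'; intro T S hS; simpa using hle _ hS T (𝟙 T)

/-- The object of `AffU` with underlying scheme `Spec R` and structure map `f`. -/
abbrev AffU.mk {R : CommRingCat.{u}} (f : Spec R ⟶ BaseU.{u}) : AffU.{u} :=
  CostructuredArrow.mk (S := Scheme.Spec.{u}) (Y := op R) f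

/-- The underlying scheme of an object of `AffU`. -/
abbrev AffU.sp (T : AffU.{u}) : Scheme.{u} := Spec T.left.unop

/-- The morphism of schemes underlying a morphism of `AffU`. -/
abbrev AffU.spMap {T T' : AffU.{u}} (f : T ⟶ T') : T.sp ⟶ T'.sp := Spec.map f.left.unop

lemma AffU.w {T T' : AffU.{u}} (f : T ⟶ T') : AffU.spMap f ≫ T'.hom = T.hom := CostructuredArrow.w f

/-- A morphism over `U` between affine schemes, as a morphism of `AffU`. -/
def AffU.homOf {T T' : AffU.{u}} (f : T.sp ⟶ T'.sp) (w : f ≫ T'.hom = T.hom) : T ⟶ T' :=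
  CostructuredArrow.homMk (Spec.preimage f).op (by
    refine Eq.trans ?_ w; exact congrArg (· ≫ T'.hom) (Spec.map_preimage f))

@[simp]
lemma AffU.spMap_homOf {T T' : AffU.{u}} (f : T.sp ⟶ T'.sp) (w : f ≫ T'.hom = T.hom) :
    AffU.spMap (AffU.homOf f w) = f := Spec.map_preimage f

@[simp]
lemma AffU.spMap_comp {T T' T'' : AffU.{u}} (f : T ⟶ T') (g : T' ⟶ T'') :
    AffU.spMap (f ≫ g) = AffU.spMap f ≫ AffU.spMap g := Spec.map_comp _ _

lemma AffU.hom_ext {T T' : AffU.{u}} {f g : T ⟶ T'} (h : AffU.spMap f = AffU.spMap g) : f = g :=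
  CostructuredArrow.hom_ext _ _ (Quiver.Hom.unop_inj (Spec.map_injective h))

open SphPair.AffU (spMap homOf spMap_homOf spMap_comp)

/-- The morphisms over `U` from an affine scheme to `Z`. -/
abbrev homU (Z : Over BaseU.{u}) : AffU.{u}ᵒᵖ ⥤ Type u :=
  (CostructuredArrow.toOver Scheme.Spec.{u} PGL2U.{u}).op ⋙ yoneda.obj Z

lemma homU_map_left {Z : Over BaseU.{u}} {T T' : AffU.{u}} (f : T' ⟶ T) (x : (homU Z).obj (op T)) :
    CommaMorphism.left ((homU Z).map f.op x) = spMap f ≫ CommaMorphism.left x := rfl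

lemma range_comp_ι {X Y : Scheme.{u}} {V : Y.Opens} (f : X ⟶ V) :
    Set.range (f ≫ V.ι) ⊆ (V : Set Y) := by
  rintro _ ⟨y, rfl⟩; rw [Scheme.Hom.comp_apply]; exact (f y).2

lemma isSheafFor_homU (Z : Over BaseU.{u}) {ι : Type u}
    (W : ι → BaseU.{u}.Opens) (hW : (⨆ i, W i) = ⊤) (T : AffU.{u}) :
    Presieve.IsSheafFor (homU Z) (baseSieve W T).arrows := by
  intro x hx; have key {T₁ T₂ : AffU.{u}} {f₁ : T₁ ⟶ T} {f₂ : T₂ ⟶ T} (h₁ : baseSieve W T f₁)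
      (h₂ : baseSieve W T f₂) {Y : Scheme.{u}} (a : Y ⟶ T₁.sp) (b : Y ⟶ T₂.sp)
      (hab : a ≫ spMap f₁ = b ≫ spMap f₂) : a ≫ (x f₁ h₁).left = b ≫ (x f₂ h₂).left := by
    have hc {R : CommRingCat.{u}} (c : Spec R ⟶ Y) :
        c ≫ a ≫ (x f₁ h₁).left = c ≫ b ≫ (x f₂ h₂).left := by
      let T₃ : AffU.{u} := .mk (c ≫ a ≫ T₁.hom)
      have := hx (Z := T₃) (homOf (T := T₃) (c ≫ a) (assoc _ _ _)) (homOf (T := T₃) (c ≫ b) (by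
          rw [← AffU.w f₂, assoc, ← reassoc_of% hab, AffU.w f₁]; rfl)) h₁ h₂
        (AffU.hom_ext (by rw [spMap_comp, spMap_comp, spMap_homOf, spMap_homOf, assoc, assoc, hab]))
      have := congrArg CommaMorphism.left this
      rw [homU_map_left, homU_map_left, spMap_homOf, spMap_homOf] at this
      exact (assoc _ _ _).symm.trans (this.trans (assoc _ _ _))
    exact Y.affineOpenCover.openCover.hom_ext _ _ fun k => hc _
  let 𝒱 := Scheme.OpenCover.affineRefinement
    ((Scheme.openCoverOfIsOpenCover _ W hW).pullback₁ T.hom)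
  let Tj (j) : AffU.{u} := .mk (𝒱.f j ≫ T.hom); let fj (j) : Tj j ⟶ T := homOf (𝒱.f j) rfl
  have hj (j) : baseSieve W T (fj j) := by
    have h : (Tj j).hom = ((Scheme.affineCover _).f j.2 ≫ pullback.snd T.hom (W j.1).ι) ≫
        (W j.1).ι := (assoc _ _ _).trans
      ((congrArg (_ ≫ ·) pullback.condition).trans (assoc _ _ _).symm)
    exact ⟨j.1, h ▸ range_comp_ι _⟩
  let m : T.sp ⟶ Z.left := 𝒱.openCover.glueMorphisms (fun j => (x (fj j) (hj j)).left) fun i j =>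
    key _ _ _ _ (by rw [spMap_homOf, spMap_homOf]; exact pullback.condition)
  have hm (j) : 𝒱.f j ≫ m = (x (fj j) (hj j)).left := 𝒱.openCover.ι_glueMorphisms _ _ j
  let t : (CostructuredArrow.toOver Scheme.Spec.{u} PGL2U.{u}).obj T ⟶ Z := Over.homMk m (by
    refine 𝒱.openCover.hom_ext _ _ fun j => ?_; exact (reassoc_of% hm j) _ |>.trans (Over.w _))
  refine ⟨t, fun T' f hf => ?_, fun t' ht' => ?_⟩
  · refine Over.OverMorphism.ext ?_
    refine Scheme.Cover.hom_ext (𝒱.openCover.pullback₁ (spMap f)) _ _ fun j => ?_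
    have h := key hf (hj j) (pullback.fst (spMap f) (𝒱.f j)) (pullback.snd _ _) (by
      rw [spMap_homOf]; exact pullback.condition)
    refine Eq.trans ?_ h.symm; exact (pullback.condition_assoc (f := spMap f) (g := 𝒱.f j) m).trans
      (congrArg (pullback.snd (spMap f) (𝒱.f j) ≫ ·) (hm j))
  · refine Over.OverMorphism.ext (𝒱.openCover.hom_ext _ _ fun j => ?_)
    refine Eq.trans ?_ (hm j).symm; rw [← ht' (fj j) (hj j)]
    exact congrArg (· ≫ t'.left) (spMap_homOf (T := Tj j) (𝒱.f j) rfl).symm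

lemma isSheafFor_yoneda (T₀ : AffU.{u}) {ι : Type u}
    (W : ι → BaseU.{u}.Opens) (hW : (⨆ i, W i) = ⊤) (T : AffU.{u}) :
    Presieve.IsSheafFor (yoneda.obj T₀) (baseSieve W T).arrows :=
  Presieve.isSheafFor_iso (NatIso.ofComponents (fun T => (Functor.FullyFaithful.homEquiv (.ofFullyFaithful
      (CostructuredArrow.toOver Scheme.Spec.{u} PGL2U.{u})) (X := T.unop)).symm.toIso) fun f => by
      ext x; exact (Functor.FullyFaithful.ofFullyFaithful
        (CostructuredArrow.toOver Scheme.Spec.{u} PGL2U.{u})).map_injective (by simp))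
    (isSheafFor_homU ((CostructuredArrow.toOver Scheme.Spec.{u} PGL2U.{u}).obj T₀) W hW T)

/-! ### Relatively representable presheaves -/

/-- A family of affine `T`-schemes that represents the restrictions of `F` to the affine
`U`-schemes `T`. -/
structure AffRep (F : AffU.{u}ᵒᵖ ⥤ Type u) where
  obj : AffU.{u} → AffU.{u}
  proj (T : AffU.{u}) : obj T ⟶ T
  elt (T : AffU.{u}) : F.obj (op (obj T))
  existsUnique_lift {T T' : AffU.{u}} (s : T' ⟶ T) (x : F.obj (op T')) :
    ∃! l : T' ⟶ obj T, l ≫ proj T = s ∧ F.map l.op (elt T) = x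

variable {F F' : AffU.{u}ᵒᵖ ⥤ Type u}

lemma map_op_comp {T T' T'' : AffU.{u}} (f : T ⟶ T') (g : T' ⟶ T'') (x : F.obj (op T'')) :
    F.map (f ≫ g).op x = F.map f.op (F.map g.op x) := by simp

namespace AffRep

variable (R : AffRep F) (R' : AffRep F')

/-- The morphism to `R.obj T` that corresponds to an element of `F`. -/
def lift {T T' : AffU.{u}} (s : T' ⟶ T) (x : F.obj (op T')) : T' ⟶ R.obj T :=
  (R.existsUnique_lift s x).choose

@[simp]
lemma lift_proj {T T' : AffU.{u}} (s : T' ⟶ T) (x : F.obj (op T')) :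
    R.lift s x ≫ R.proj T = s := (R.existsUnique_lift s x).choose_spec.1.1

@[simp]
lemma map_lift {T T' : AffU.{u}} (s : T' ⟶ T) (x : F.obj (op T')) :
    F.map (R.lift s x).op (R.elt T) = x := (R.existsUnique_lift s x).choose_spec.1.2

variable {R} in
lemma hom_ext {T T' : AffU.{u}} {l l' : T' ⟶ R.obj T} (h : l ≫ R.proj T = l' ≫ R.proj T)
    (h' : F.map l.op (R.elt T) = F.map l'.op (R.elt T)) : l = l' :=
  (R.existsUnique_lift _ _).unique ⟨h, h'⟩ ⟨rfl, rfl⟩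

include R in
lemma isSheafFor {ι : Type u} (W : ι → BaseU.{u}.Opens) (hW : (⨆ i, W i) = ⊤)
    (T : AffU.{u}) : Presieve.IsSheafFor F (baseSieve W T).arrows := by
  intro x hx; have hs {T₀ : AffU.{u}} {a b : T ⟶ T₀}
      (h : ∀ ⦃T' : AffU.{u}⦄ (f : T' ⟶ T), baseSieve W T f → f ≫ a = f ≫ b) : a = b :=
    (isSheafFor_yoneda T₀ W hW T).isSeparatedFor.ext h
  obtain ⟨L, hL, -⟩ := isSheafFor_yoneda (R.obj T) W hW T
    (fun T' f hf => R.lift f (x f hf)) fun T₁ T₂ T₃ g₁ g₂ f₁ f₂ h₁ h₂ hg => by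
      refine hom_ext ?_ ?_
      · simpa using hg
      · simpa using hx g₁ g₂ h₁ h₂ hg
  have hL' {T' : AffU.{u}} (f : T' ⟶ T) (hf) : f ≫ L = R.lift f (x f hf) := hL f hf
  refine ⟨F.map L.op (R.elt T), fun T' f hf => ?_, fun y hy => ?_⟩
  · rw [← map_op_comp, hL' f hf, map_lift]
  · have h : L = R.lift (𝟙 T) y := hs fun T' f hf => by
      rw [hL' f hf]; refine hom_ext (by simp) ?_; rw [map_op_comp, map_lift, map_lift]
      exact (hy f hf).symm
    rw [h, map_lift]

/-- The morphism `R.obj T ⟶ R.obj T'` over `T ⟶ T'`. -/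
def map {T T' : AffU.{u}} (f : T ⟶ T') : R.obj T ⟶ R.obj T' := R.lift (R.proj T ≫ f) (R.elt T)

lemma isPullback {T T' : AffU.{u}} (f : T ⟶ T') : IsPullback (spMap (R.map f))
    (spMap (R.proj T)) (spMap (R.proj T')) (spMap f) := by
  have hw : R.map f ≫ R.proj T' = R.proj T ≫ f := R.lift_proj _ _
  suffices h : IsPullback (R.map f).left (R.proj T).left (R.proj T').left f.left from
    h.map Scheme.Spec
  refine ⟨⟨congrArg CommaMorphism.left hw⟩, ⟨PullbackCone.isLimitAux' _ fun s => ?_⟩⟩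
  let T₀ : AffU.{u} := CostructuredArrow.mk (S := Scheme.Spec.{u}) (Scheme.Spec.map s.snd ≫ T.hom)
  let b : T₀ ⟶ T := CostructuredArrow.homMk s.snd rfl
  let a : T₀ ⟶ R.obj T' := CostructuredArrow.homMk s.fst (by
    rw [← CostructuredArrow.w (R.proj T'), ← assoc, ← Scheme.Spec.map_comp, s.condition,
      Scheme.Spec.map_comp, assoc, CostructuredArrow.w f]; rfl)
  have hab : a ≫ R.proj T' = b ≫ f := CostructuredArrow.hom_ext _ _ s.condition
  have ha : R.lift b (F.map a.op (R.elt T')) ≫ R.map f = a := by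
    refine hom_ext ?_ ?_
    · rw [assoc, hw, ← assoc, lift_proj, hab]
    · rw [map_op_comp, map, map_lift, map_lift]
  refine ⟨(R.lift b (F.map a.op (R.elt T'))).left, congrArg CommaMorphism.left ha,
    congrArg CommaMorphism.left (R.lift_proj _ _), fun {m} h₁ h₂ => ?_⟩
  change s.pt ⟶ (R.obj T).left at m; change m ≫ (R.proj T).left = s.snd at h₂
  let m' : T₀ ⟶ R.obj T := CostructuredArrow.homMk m (by
    rw [← CostructuredArrow.w (R.proj T), ← assoc, ← Scheme.Spec.map_comp, h₂]; rfl)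
  have hm : m' ≫ R.map f = a := CostructuredArrow.hom_ext _ _ h₁
  have : m' = R.lift b (F.map a.op (R.elt T')) := by
    refine hom_ext ?_ ?_
    · rw [lift_proj]; exact CostructuredArrow.hom_ext _ _ h₂
    · rw [map_lift, ← hm, map_op_comp, map, map_lift]
  exact congrArg CommaMorphism.left this

end AffRep

/-! ### Gluing over `U` -/

lemma isAffineOpen_coe (W : AffOp.{u}) : IsAffineOpen W.1 := W.2

/-- An affine open subset of `U` as an object of `AffU`. -/
abbrev AffU.ofOpen (W : AffOp.{u}) : AffU.{u} := .mk (isAffineOpen_coe W).fromSpec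

lemma AffU.range_ofOpen (W : AffOp.{u}) :
    Set.range (AffU.ofOpen W).hom = (W.1 : Set BaseU.{u}) := W.2.range_fromSpec

lemma AffU.range_subset {T T' : AffU.{u}} (f : T ⟶ T') : Set.range T.hom ⊆ Set.range T'.hom := by
  rw [← AffU.w f]; rintro _ ⟨y, rfl⟩; exact ⟨_, (Scheme.Hom.comp_apply _ _ _).symm⟩

/-- The morphism to an affine open subset of `U` that contains the image of `T`. -/
def AffU.toOpen {T : AffU.{u}} {W : AffOp.{u}}
    (h : Set.range T.hom ⊆ (W.1 : Set BaseU.{u})) : T ⟶ .ofOpen W :=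
  homOf (IsOpenImmersion.lift (isAffineOpen_coe W).fromSpec T.hom (h.trans (AffU.range_ofOpen W).symm.subset))
    (IsOpenImmersion.lift_fac _ _ _)

lemma AffU.hom_eq {T : AffU.{u}} {W : AffOp.{u}} (f g : T ⟶ .ofOpen W) : f = g :=
  AffU.hom_ext ((cancel_mono (isAffineOpen_coe W).fromSpec).1 ((AffU.w f).trans (AffU.w g).symm))

/-- The inclusion of affine open subsets, as a morphism of `AffU`. -/
abbrev AffU.ofLE {W W' : AffOp.{u}} (h : W ≤ W') :
    AffU.ofOpen W ⟶ AffU.ofOpen W' := AffU.toOpen ((AffU.range_ofOpen W).subset.trans h)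

lemma iSup_affineOpens : (⨆ W : AffOp.{u}, W.1) = ⊤ := iSup_affineOpens_eq_top _

/-- The covering of `U` by the spectra of its affine open subsets. -/
def specCover : BaseU.{u}.OpenCover where
  I₀ := AffOp.{u}
  X W := (AffU.ofOpen W).sp
  f W := (isAffineOpen_coe W).fromSpec
  mem₀ := by
    rw [Scheme.presieve₀_mem_precoverage_iff]
    refine ⟨fun x => ?_, fun W => inferInstanceAs (IsOpenImmersion (isAffineOpen_coe W).fromSpec)⟩
    obtain ⟨W, hW⟩ := TopologicalSpace.Opens.mem_iSup.1
      (iSup_affineOpens ▸ TopologicalSpace.Opens.mem_top x)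
    exact ⟨W, (AffU.range_ofOpen W).symm.subset hW⟩

instance (W : specCover.{u}.I₀) : IsOpenImmersion (specCover.f W) :=
  inferInstanceAs (IsOpenImmersion (isAffineOpen_coe W).fromSpec)

instance : Preorder specCover.{u}.I₀ := inferInstanceAs (Preorder AffOp.{u})

instance : Small.{u} specCover.{u}.I₀ := inferInstanceAs (Small.{u} AffOp.{u})

lemma opensRange_specCover (W : specCover.{u}.I₀) : (specCover.f W).opensRange = W.1 := W.2.opensRange_fromSpec

instance : specCover.{u}.LocallyDirected :=
  .ofIsBasisOpensRange (fun {i j} => by rw [opensRange_specCover, opensRange_specCover]; rfl) (by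
    convert BaseU.{u}.isBasis_affineOpens; ext V; constructor
    · rintro ⟨W, rfl⟩; exact Set.mem_of_eq_of_mem (opensRange_specCover W) W.2
    · exact fun h => ⟨⟨V, h⟩, opensRange_specCover ⟨V, h⟩⟩)

lemma trans_specCover {i j : specCover.{u}.I₀} (h : i ⟶ j) :
    specCover.trans h = spMap (AffU.ofLE (leOfHom h)) := by
  refine (cancel_mono (specCover.f j)).1 ?_; rw [Scheme.Cover.trans_map]
  exact (AffU.w (AffU.ofLE (leOfHom h))).symm

instance : BaseU.{u}.IsSeparated := ⟨by rw [← terminal.comp_from (PGL2U.{u}).ι]; infer_instance⟩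

lemma of_isPullback_openCover {P : MorphismProperty Scheme.{u}} [IsZariskiLocalAtTarget P]
    {X Y : Scheme.{u}} {f : X ⟶ Y} (𝒰 : Y.OpenCover) {X' : 𝒰.I₀ → Scheme.{u}}
    (a : ∀ i, X' i ⟶ X) (f' : ∀ i, X' i ⟶ 𝒰.X i) (h : ∀ i, IsPullback (f' i) (a i) (𝒰.f i) f)
    (hP : ∀ i, P (f' i)) : P f := by
  refine IsZariskiLocalAtTarget.of_openCover 𝒰 fun i => ?_
  exact (P.cancel_left_of_respectsIso (h i).flip.isoPullback.hom (pullback.snd f (𝒰.f i))).1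
    ((h i).flip.isoPullback_hom_snd.symm ▸ hP i)

namespace AffRep

variable {F F' : AffU.{u}ᵒᵖ ⥤ Type u} (R : AffRep F) (R' : AffRep F')

/-- The gluing datum of the schemes that represent `F` over the affine open subsets of `U`. -/
def gluing : Scheme.Cover.RelativeGluingData specCover.{u} where
  functor :=
    { obj W := (R.obj (.ofOpen W)).sp
      map h := spMap (R.map (AffU.ofLE (leOfHom h)))
      map_id W := by
        refine Eq.trans (congrArg spMap (a₂ := 𝟙 (R.obj (.ofOpen W))) ?_) (Spec.map_id _)
        refine hom_ext (AffU.hom_eq _ _) ?_; simp [map]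
      map_comp f g := by
        rw [← spMap_comp]; congr 1; refine hom_ext (AffU.hom_eq _ _) ?_
        simp only [map_op_comp, map, map_lift] }
  natTrans :=
    { app W := spMap (R.proj (.ofOpen W))
      naturality W W' h := (R.isPullback _).w.trans
        (congrArg (spMap (R.proj _) ≫ ·) (trans_specCover h).symm) }
  equifibered W W' h := by
    have := R.isPullback (AffU.ofLE (leOfHom h)); rw [← trans_specCover] at this; exact this

/-- The `U`-scheme glued from the schemes that represent `F` over affine open subsets. -/
def total : Over BaseU.{u} := Over.mk R.gluing.toBase

/-- The inclusion of the scheme that represents `F` over an affine open subset. -/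
def incl (W : AffOp.{u}) : (R.obj (.ofOpen W)).sp ⟶ R.total.left := colimit.ι R.gluing.functor W

lemma isPullback_incl (W : AffOp.{u}) :
    IsPullback (spMap (R.proj (.ofOpen W))) (R.incl W) (isAffineOpen_coe W).fromSpec R.total.hom :=
  R.gluing.isPullback_natTrans_ι_toBase W

lemma total_of_proj {P : MorphismProperty Scheme.{u}} [IsZariskiLocalAtTarget P]
    (h : ∀ T, P (spMap (R.proj T))) : P R.total.hom :=
  of_isPullback_openCover specCover.{u} R.incl (fun W => spMap (R.proj (.ofOpen W)))
    R.isPullback_incl fun W => h (.ofOpen W)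

instance (W : AffOp.{u}) : Mono (R.incl W) :=
  have : IsOpenImmersion (R.incl W) := R.gluing.cover.map_prop W
  inferInstance

lemma map_incl {W W' : AffOp.{u}} (h : W ≤ W') :
    spMap (R.map (AffU.ofLE h)) ≫ R.incl W' = R.incl W :=
  colimit.w R.gluing.functor (homOfLE h : (show specCover.{u}.I₀ from W) ⟶ W')

lemma incl_hom (W : AffOp.{u}) : R.incl W ≫ R.total.hom = (R.obj (.ofOpen W)).hom :=
  (R.isPullback_incl W).w.symm.trans (AffU.w _)

lemma exists_incl {T : AffU.{u}} {W : AffOp.{u}}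
    (h : Set.range T.hom ⊆ (W.1 : Set BaseU.{u})) {m : T.sp ⟶ R.total.left}
    (hm : m ≫ R.total.hom = T.hom) : ∃ l : T ⟶ R.obj (.ofOpen W), spMap l ≫ R.incl W = m := by
  have hw : spMap (AffU.toOpen h) ≫ (isAffineOpen_coe W).fromSpec = m ≫ R.total.hom := (AffU.w _).trans hm.symm
  refine ⟨homOf ((R.isPullback_incl W).lift _ m hw) ?_, ?_⟩
  · rw [← incl_hom, IsPullback.lift_snd_assoc, hm]
  · rw [spMap_homOf, IsPullback.lift_snd]

lemma incl_eq_iff {T : AffU.{u}} {W W' : AffOp.{u}}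
    (l : T ⟶ R.obj (.ofOpen W)) (l' : T ⟶ R.obj (.ofOpen W')) :
    spMap l ≫ R.incl W = spMap l' ≫ R.incl W' ↔ F.map l.op (R.elt _) = F.map l'.op (R.elt _) := by
  let V : AffOp.{u} := ⟨W.1 ⊓ W'.1, W.2.inf W'.2⟩; have hV : V ≤ W := inf_le_left (a := W.1)
  have hV' : V ≤ W' := inf_le_right (a := W.1)
  have hT : Set.range T.hom ⊆ (V.1 : Set BaseU.{u}) := Set.subset_inter
    ((AffU.range_subset (l ≫ R.proj _)).trans (AffU.range_ofOpen _).subset)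
    ((AffU.range_subset (l' ≫ R.proj _)).trans (AffU.range_ofOpen _).subset); constructor
  · intro h
    obtain ⟨m, hm⟩ := R.exists_incl hT (m := spMap l ≫ R.incl W) (by rw [assoc, incl_hom, AffU.w])
    have h₁ : m ≫ R.map (AffU.ofLE hV) = l := AffU.hom_ext (by
      rw [← cancel_mono (R.incl W), spMap_comp, assoc, map_incl, hm])
    have h₂ : m ≫ R.map (AffU.ofLE hV') = l' := AffU.hom_ext (by
      rw [← cancel_mono (R.incl W'), spMap_comp, assoc, map_incl, hm, h])
    rw [← h₁, ← h₂, map_op_comp, map_op_comp, map, map, map_lift, map_lift]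
  · intro h; have h₁ : R.lift (AffU.toOpen hT) (F.map l.op (R.elt _)) ≫ R.map (AffU.ofLE hV) = l :=
      hom_ext (AffU.hom_eq _ _) (by rw [map_op_comp, map, map_lift, map_lift])
    have h₂ : R.lift (AffU.toOpen hT) (F.map l.op (R.elt _)) ≫ R.map (AffU.ofLE hV') = l' :=
      hom_ext (AffU.hom_eq _ _) (by rw [map_op_comp, map, map_lift, map_lift, h])
    rw [← h₁, spMap_comp, assoc, map_incl, ← R.map_incl hV', ← assoc, ← spMap_comp, h₂]

/-- The morphism of schemes underlying an element of `homU Z`. -/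
def mor {Z : Over BaseU.{u}} {T : AffU.{u}} (m : (homU Z).obj (op T)) :
    T.sp ⟶ Z.left := CommaMorphism.left m

/-- A `U`-morphism from an affine scheme, as an element of `homU Z`. -/
def ofMor {Z : Over BaseU.{u}} {T : AffU.{u}} (f : T.sp ⟶ Z.left)
    (w : f ≫ Z.hom = T.hom) : (homU Z).obj (op T) := Over.homMk f w

lemma mor_map {Z : Over BaseU.{u}} {T T' : AffU.{u}} (f : T' ⟶ T)
    (m : (homU Z).obj (op T)) : mor ((homU Z).map f.op m) = spMap f ≫ mor m := rfl

@[simp]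
lemma mor_hom {Z : Over BaseU.{u}} {T : AffU.{u}} (m : (homU Z).obj (op T)) :
    mor m ≫ Z.hom = T.hom := Over.w m

/-- A `U`-morphism to the glued scheme corresponds to an element of `F`. -/
def Rel {T : AffU.{u}} (m : (homU R.total).obj (op T)) (y : F.obj (op T)) : Prop :=
  ∀ ⦃W : AffOp.{u}⦄ ⦃T' : AffU.{u}⦄ (f : T' ⟶ T)
    (l : T' ⟶ R.obj (.ofOpen W)), spMap l ≫ R.incl W = spMap f ≫ mor m →
    F.map f.op y = F.map l.op (R.elt _)

lemma range_subset_of_hom {T : AffU.{u}} {W : AffOp.{u}}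
    (l : T ⟶ R.obj (.ofOpen W)) : Set.range T.hom ⊆ (W.1 : Set BaseU.{u}) :=
  (AffU.range_subset (l ≫ R.proj _)).trans (AffU.range_ofOpen _).subset

lemma existsUnique_rel_left {T : AffU.{u}} (m : (homU R.total).obj (op T)) : ∃! y, R.Rel m y := by
  have hl {T' : AffU.{u}} (f : T' ⟶ T) (hf : baseSieve (fun W => Subtype.val W) T f) :
      ∃ (W : AffOp.{u}) (l : T' ⟶ R.obj (.ofOpen W)), spMap l ≫ R.incl W = spMap f ≫ mor m :=
    ⟨_, R.exists_incl hf.choose_spec (by rw [assoc, mor_hom, AffU.w])⟩; choose W l hl using @hl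
  obtain ⟨y, hy, hu⟩ := R.isSheafFor _ iSup_affineOpens T
    (fun T' f hf => F.map (l f hf).op (R.elt _)) fun T₁ T₂ T₃ g₁ g₂ f₁ f₂ h₁ h₂ hg => by
      rw [← map_op_comp, ← map_op_comp, ← incl_eq_iff, spMap_comp, spMap_comp,
        assoc, assoc, hl, hl, ← assoc, ← assoc, ← spMap_comp, ← spMap_comp, hg]
  refine ⟨y, fun W' T' f l' h => ?_, fun y' hy' => hu y' fun T' f hf => hy' f _ (hl f hf)⟩
  have hf : baseSieve (fun W => Subtype.val W) T f := ⟨W', R.range_subset_of_hom l'⟩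
  rw [hy f hf, ← incl_eq_iff, hl, h]

lemma existsUnique_rel_right {T : AffU.{u}} (y : F.obj (op T)) : ∃! m, R.Rel m y := by
  have hl {T' : AffU.{u}} (f : T' ⟶ T) (hf : baseSieve (fun W => Subtype.val W) T f) :
      ∃ (W : AffOp.{u}) (l : T' ⟶ R.obj (.ofOpen W)), F.map l.op (R.elt _) = F.map f.op y :=
    ⟨_, _, R.map_lift (AffU.toOpen hf.choose_spec) _⟩; choose W l hl using @hl
  obtain ⟨m, hm, hu⟩ := isSheafFor_homU R.total _ iSup_affineOpens T
    (fun T' f hf => ofMor (spMap (l f hf) ≫ R.incl _) (by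
      rw [assoc, incl_hom, AffU.w])) fun T₁ T₂ T₃ g₁ g₂ f₁ f₂ h₁ h₂ hg => by
      refine Over.OverMorphism.ext ?_
      change spMap g₁ ≫ spMap (l f₁ h₁) ≫ R.incl _ = spMap g₂ ≫ spMap (l f₂ h₂) ≫ R.incl _
      rw [← assoc, ← assoc, ← spMap_comp, ← spMap_comp, incl_eq_iff,
        map_op_comp, map_op_comp, hl, hl, ← map_op_comp, ← map_op_comp, hg]
  have hm' {T' : AffU.{u}} (f : T' ⟶ T) (hf) : spMap f ≫ mor m = spMap (l f hf) ≫ R.incl _ :=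
    congrArg mor (hm f hf); refine ⟨m, fun W' T' f l' h => ?_, fun m' h' => hu m' fun T' f hf => ?_⟩
  · have hf : baseSieve (fun W => Subtype.val W) T f := ⟨W', R.range_subset_of_hom l'⟩
    rw [← hl f hf, ← incl_eq_iff, ← hm', h]
  · obtain ⟨l', hl'⟩ := R.exists_incl (m := spMap f ≫ mor m') hf.choose_spec (by
      rw [assoc, mor_hom, AffU.w])
    refine Over.OverMorphism.ext (hl'.symm.trans ?_); refine (R.incl_eq_iff l' (l f hf)).2 ?_
    rw [hl, h' f l' hl']

variable {R} in
lemma Rel.map {T T' : AffU.{u}} {m : (homU R.total).obj (op T)} {y : F.obj (op T)}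
    (h : R.Rel m y) (f : T' ⟶ T) : R.Rel ((homU R.total).map f.op m) (F.map f.op y) := by
  intro W T'' g l hl; rw [← map_op_comp]; refine h _ l (hl.trans ?_)
  rw [mor_map, spMap_comp, assoc]

/-- The glued scheme represents `F`. -/
def totalIso : homU R.total ≅ F := NatIso.ofComponents (fun T => Equiv.toIso
    { toFun m := (R.existsUnique_rel_left m).choose
      invFun y := (R.existsUnique_rel_right (T := T.unop) y).choose
      left_inv m := ((R.existsUnique_rel_right _).choose_spec.2 m
        (R.existsUnique_rel_left m).choose_spec.1).symm
      right_inv y := ((R.existsUnique_rel_left _).choose_spec.2 y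
        (R.existsUnique_rel_right (T := T.unop) y).choose_spec.1).symm }) fun f => by
    ext m; exact ((R.existsUnique_rel_left _).choose_spec.2 _
      ((R.existsUnique_rel_left m).choose_spec.1.map f.unop)).symm

lemma rel_totalIso {T : AffU.{u}} (m : (homU R.total).obj (op T)) :
    R.Rel m (R.totalIso.hom.app (op T) m) := (R.existsUnique_rel_left m).choose_spec.1

lemma totalIso_eq {T : AffU.{u}} {m : (homU R.total).obj (op T)} {y : F.obj (op T)}
    (h : R.Rel m y) : R.totalIso.hom.app (op T) m = y :=
  ((R.existsUnique_rel_left m).choose_spec.2 y h).symm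

/-- The functor of points of the glued scheme is the sheafification of `F`. -/
def sheafIso : pointsU.{u}.obj R.total ≅ sheafify baseTopology.{u} (F ⋙ uliftFunctor.{u + 1}) :=
  (show pointsU.{u}.obj R.total ≅ F ⋙ uliftFunctor.{u + 1} from
    Functor.isoWhiskerRight R.totalIso uliftFunctor.{u + 1}) ≪≫
  isoSheafify baseTopology.{u} ((isSheaf_iff_isSheaf_of_type _ _).2
    ((Presieve.isSheaf_comp_uliftFunctor_iff _).2
      (isSheaf_baseTopology fun _ W hW T => R.isSheafFor W hW T)))

variable (τ : F ⟶ F')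

/-- The morphism of representing schemes over `T` induced by a morphism of presheaves. -/
def trunc (T : AffU.{u}) : R.obj T ⟶ R'.obj T := R'.lift (R.proj T) (τ.app _ (R.elt T))

/-- The morphism of gluing data induced by a morphism of presheaves. -/
def truncGluing : R.gluing.functor ⟶ R'.gluing.functor where
  app W := spMap (R.trunc R' τ (.ofOpen W))
  naturality W W' h := by
    refine (spMap_comp _ _).symm.trans (Eq.trans ?_ (spMap_comp _ _))
    refine congrArg spMap (hom_ext (AffU.hom_eq _ _) ?_)
    rw [map_op_comp, map_op_comp, trunc, trunc, map_lift, map, map, map_lift, map_lift,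
      ← NatTrans.naturality_apply, map_lift]

/-- The morphism of glued schemes induced by a morphism of presheaves. -/
def truncTotal : R.total ⟶ R'.total :=
  Over.homMk (colimMap (R.truncGluing R' τ)) (colimit.hom_ext fun W =>
    (ι_colimMap_assoc _ _ _).trans ((congrArg (_ ≫ ·) (R'.incl_hom W)).trans
      ((AffU.w (R.trunc R' τ _)).trans (R.incl_hom W).symm)))

lemma incl_truncTotal (W : AffOp.{u}) :
    R.incl W ≫ (R.truncTotal R' τ).left = spMap (R.trunc R' τ (.ofOpen W)) ≫ R'.incl W :=
  ι_colimMap _ _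

lemma isPullback_trunc (W : AffOp.{u}) :
    IsPullback (spMap (R.trunc R' τ (.ofOpen W))) (R.incl W) (R'.incl W)
      (R.truncTotal R' τ).left := by
  refine .of_right ?_ (R.incl_truncTotal R' τ W).symm (R'.isPullback_incl W)
  rw [← spMap_comp, trunc, lift_proj, Over.w]; exact R.isPullback_incl W

lemma truncTotal_of_trunc {P : MorphismProperty Scheme.{u}} [IsZariskiLocalAtTarget P]
    (h : ∀ T, P (spMap (R.trunc R' τ T))) : P (R.truncTotal R' τ).left :=
  of_isPullback_openCover R'.gluing.cover R.incl
    (fun W => spMap (R.trunc R' τ (.ofOpen W))) (R.isPullback_trunc R' τ) fun W => h (.ofOpen W)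

lemma totalIso_trunc {T : AffU.{u}} (m : (homU R.total).obj (op T)) :
    R'.totalIso.hom.app (op T) (m ≫ R.truncTotal R' τ) =
      τ.app (op T) (R.totalIso.hom.app (op T) m) := by
  refine R'.totalIso_eq fun W T' f l hl => ?_; have hl' : spMap l ≫ R'.incl W =
    (spMap f ≫ mor m) ≫ (R.truncTotal R' τ).left := hl.trans (assoc _ _ _).symm
  let k : T' ⟶ R.obj (.ofOpen W) := homOf ((R.isPullback_trunc R' τ W).lift _ _ hl') (by
    rw [← incl_hom, IsPullback.lift_snd_assoc, assoc, mor_hom, AffU.w])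
  have hk : k ≫ R.trunc R' τ _ = l := AffU.hom_ext (by
    rw [spMap_comp, spMap_homOf, IsPullback.lift_fst])
  rw [← NatTrans.naturality_apply, R.rel_totalIso m f k (by
    rw [spMap_homOf, IsPullback.lift_snd]), ← hk, map_op_comp, trunc, map_lift,
    NatTrans.naturality_apply]

lemma sheafIso_trunc : pointsU.{u}.map (R.truncTotal R' τ) ≫ R'.sheafIso.hom =
    R.sheafIso.hom ≫ sheafifyMap baseTopology.{u} (Functor.whiskerRight τ uliftFunctor.{u + 1}) := by
  have h : pointsU.{u}.map (R.truncTotal R' τ) ≫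
      Functor.whiskerRight R'.totalIso.hom uliftFunctor.{u + 1} =
      Functor.whiskerRight R.totalIso.hom uliftFunctor.{u + 1} ≫
        Functor.whiskerRight τ uliftFunctor.{u + 1} := by
    ext T m; exact congrArg ULift.up (R.totalIso_trunc R' τ m.down)
  refine (assoc _ _ _).symm.trans ((congrArg (· ≫ _) h).trans ?_)
  refine (assoc _ _ _).trans (Eq.trans ?_ (assoc _ _ _).symm)
  exact congrArg (_ ≫ ·) (toSheafify_naturality _ _)

end AffRep

end Sheaves

/-! ### Representability over `U` -/

lemma AffU.good_point (T : AffU.{u}) : Good T.point := by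
  refine .inr ⟨rfl, fun K _ σ h2 ⟨l, h⟩ => ?_⟩; let y : T.sp := PrimeSpectrum.comap σ ⊥
  have hy : (T.hom ≫ PGL2U.{u}.ι) y ∈ PGL2U.{u} := range_comp_ι T.hom ⟨y, rfl⟩
  rw [← Spec.map_preimage (T.hom ≫ PGL2U.{u}.ι)] at hy
  exact hy (SetLike.coe_subset_coe.2 (ker_le_of_scalar h2 h))

/-- The affine `U`-scheme `Spec B` for an algebra `B` over the ring of `T`. -/
abbrev AffU.extend (T : AffU.{u}) {B : Type u} [CommRing B] (i : T.left.unop →+* B) : AffU.{u} :=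
  .mk (Spec.map (CommRingCat.ofHom i) ≫ T.hom)

/-- A morphism to the spectrum of an algebra over the ring of `T`. -/
def AffU.toExtend {T T' : AffU.{u}} (s : T' ⟶ T) {B : Type u} [CommRing B] {i : T.left.unop →+* B}
    (f : B →+* T'.left.unop) (h : f.comp i = s.left.unop.hom) : T' ⟶ T.extend i :=
  CostructuredArrow.homMk (CommRingCat.ofHom f).op (by
    rw [← AffU.w s, AffU.spMap, show s.left.unop = CommRingCat.ofHom i ≫ CommRingCat.ofHom f from
      CommRingCat.hom_ext h.symm, Spec.map_comp, assoc]; rfl)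

/-- The projection from the spectrum of an algebra over the ring of `T`. -/
abbrev AffU.extendProj (T : AffU.{u}) {B : Type u} [CommRing B] (i : T.left.unop →+* B) :
    T.extend i ⟶ T := CostructuredArrow.homMk (CommRingCat.ofHom i).op rfl

lemma AffU.point_extend (T : AffU.{u}) {B : Type u} [CommRing B] (i : T.left.unop →+* B) :
    (RingHom.id B).comp (i.comp T.point) = (T.extend i).point := AffU.point_comp (T.extendProj i)

lemma IsUniversal.existsUnique_hom {N : ℕ∞} {T : AffU.{u}} {B : Type u} [CommRing B]
    {i : T.left.unop →+* B} {u : Moduli N (i.comp T.point)} (hu : IsUniversal i u) {T' : AffU.{u}}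
    (s : T' ⟶ T) (x : (modPresheafU.{u} N).obj (op T')) :
    ∃! l : T' ⟶ T.extend i, l ≫ T.extendProj i = s ∧ (modPresheafU.{u} N).map l.op
      (Moduli.map (RingHom.id B) (T.point_extend i) u) = x := by
  have key {C : Type u} [CommRing C] (σ : T.left.unop →+* C) {ψ' : PGLRing.{u} 2 →+* C}
      (hσ : σ.comp T.point = ψ') (x : Moduli N ψ') :
      ∃! f : B →+* C, ∃ h : f.comp i = σ, Moduli.map f (by rw [← hσ, ← h]; rfl) u = x := by
    subst hσ; exact hu C σ x
  have hmap (l : T' ⟶ T.extend i) (h) : (modPresheafU.{u} N).map l.op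
      (Moduli.map (RingHom.id B) (T.point_extend i) u) = Moduli.map l.left.unop.hom h u :=
    (Moduli.map_comp (RingHom.id B) (T.point_extend i) l.left.unop.hom (AffU.point_comp l) h u).symm
  obtain ⟨f, ⟨h1, h2⟩, h3⟩ := key s.left.unop.hom (AffU.point_comp s) x
  refine ⟨AffU.toExtend s f h1, ⟨?_, (hmap _ _).trans h2⟩, ?_⟩
  · exact CostructuredArrow.hom_ext _ _ (Quiver.Hom.unop_inj (CommRingCat.hom_ext h1))
  · rintro l ⟨rfl, rfl⟩
    exact CostructuredArrow.hom_ext _ _ (Quiver.Hom.unop_inj (CommRingCat.hom_ext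
      (h3 l.left.unop.hom ⟨rfl, (hmap l _).symm⟩)))

lemma exists_affRep : ∃ (R : AffRep (modPresheafU.{u} ⊤)) (R₄ : AffRep (modPresheafU.{u} (4 : ℕ))),
    ∀ T, (R.proj T).left.unop.hom.FiniteType ∧ (R₄.proj T).left.unop.hom.FiniteType ∧
      Function.Surjective (R.trunc R₄ (modTruncU.{u} 4 (by norm_num)) T).left.unop.hom := by
  choose B B₄ _ _ i i₄ u u₄ q hq hi hi₄ hs hu hu₄ e using fun T : AffU.{u} => 
    T.good_point.exists_universal
  let R : AffRep (modPresheafU.{u} ⊤) := ⟨fun T => T.extend (i T), fun T => T.extendProj (i T), _,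
    fun {T _} => (hu T).existsUnique_hom⟩
  let R₄ : AffRep (modPresheafU.{u} (4 : ℕ)) := ⟨fun T => T.extend (i₄ T),
    fun T => T.extendProj (i₄ T), _, fun {T _} => (hu₄ T).existsUnique_hom⟩
  refine ⟨R, R₄, fun T => ⟨hi T, hi₄ T, ?_⟩⟩
  have h : R.trunc R₄ (modTruncU.{u} 4 (by norm_num)) T =
      AffU.toExtend (T.extendProj (i T)) (q T) (hq T) := by
    refine AffRep.hom_ext ?_ ?_
    · rw [AffRep.trunc, AffRep.lift_proj]
      exact CostructuredArrow.hom_ext _ _ (Quiver.Hom.unop_inj (CommRingCat.hom_ext (hq T).symm))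
    · rw [AffRep.trunc, AffRep.map_lift]
      have h1 : (RingHom.id (B T)).comp (((q T).comp (i₄ T)).comp T.point) = (T.extend (i T)).point :=
        (hq T).symm ▸ T.point_extend (i T)
      refine Eq.trans ?_ (Moduli.map_comp (RingHom.id (B₄ T)) (T.point_extend (i₄ T)) (q T)
        (AffU.point_comp (AffU.toExtend (T.extendProj (i T)) (q T) (hq T))) h1 (u₄ T))
      refine Eq.trans ?_ (Moduli.map_comp (q T) (by rw [← hq T]; rfl) (RingHom.id (B T))
        (T.point_extend (i T)) h1 (u₄ T)).symm; rw [e T]; exact Classes.trunc_push _ _ _ _ _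
  rw [h]; exact hs T

instance : IsZariskiLocalAtTarget @IsAffineHom.{u} :=
  @HasAffineProperty.instIsZariskiLocalAtTarget _ _ instHasAffinePropertyIsAffineHomIsAffine.{u}

instance : IsZariskiLocalAtTarget @LocallyOfFiniteType.{u} :=
  @HasRingHomProperty.instIsZariskiLocalAtTarget _ _
    instHasRingHomPropertyLocallyOfFiniteTypeFiniteType.{u}

lemma exists_scheme_modSheafU : ∃ (Z Z₄ : Over BaseU.{u})
    (e : pointsU.{u}.obj Z ≅ modSheafU.{u} ⊤) (e₄ : pointsU.{u}.obj Z₄ ≅ modSheafU.{u} (4 : ℕ)),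
    (IsAffineHom Z.hom ∧ LocallyOfFiniteType Z.hom) ∧
    (IsAffineHom Z₄.hom ∧ LocallyOfFiniteType Z₄.hom) ∧ ∃ q : Z ⟶ Z₄, IsClosedImmersion q.left ∧
      pointsU.{u}.map q ≫ e₄.hom = e.hom ≫ modSheafTruncU.{u} 4 (by norm_num) := by
  obtain ⟨R, R₄, h⟩ := exists_affRep.{u}
  exact ⟨R.total, R₄.total, R.sheafIso, R₄.sheafIso, ⟨R.total_of_proj fun T => inferInstance,
      R.total_of_proj fun T =>
        HasRingHomProperty.Spec_iff.2 (h T).1⟩,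
    ⟨R₄.total_of_proj fun T => inferInstance, R₄.total_of_proj fun T =>
        HasRingHomProperty.Spec_iff.2 (h T).2.1⟩,
    R.truncTotal R₄ _, R.truncTotal_of_trunc R₄ _ fun T =>
      IsClosedImmersion.spec_of_surjective _ (h T).2.2, R.sheafIso_trunc R₄ _⟩

end

end SphPair

theorem theorem1p1 :
    -- `n ≥ 3`: the functors over `PGL_n`
    (∀ n : ℕ, 3 ≤ n →
      ∃ (B B₄ : CommAlgCat.{u} (PGLRing.{u} n))
        (h : (modFunctor.{u} ⊤ n).CorepresentableBy B)
        (h₄ : (modFunctor.{u} (4 : ℕ) n).CorepresentableBy B₄),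
        Algebra.FiniteType (PGLRing.{u} n) B ∧ Algebra.FiniteType (PGLRing.{u} n) B₄ ∧
        ∃ q : B₄ ⟶ B, Function.Surjective q.hom ∧
          ∀ (C : CommAlgCat.{u} (PGLRing.{u} n)) (f : B ⟶ C),
            h₄.homEquiv (q ≫ f) = (modTrunc.{u} 4 (by norm_num) n).app C (h.homEquiv f)) ∧
    -- `n = 2`: the sheafified functors over `U ⊂ PGL_2`
    (∃ (Z Z₄ : Over (PGL2U.{u} : Scheme.{u}))
        (e : pointsU.{u}.obj Z ≅ modSheafU.{u} ⊤) (e₄ : pointsU.{u}.obj Z₄ ≅ modSheafU.{u} (4 : ℕ)),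
        (IsAffineHom Z.hom ∧ LocallyOfFiniteType Z.hom) ∧
        (IsAffineHom Z₄.hom ∧ LocallyOfFiniteType Z₄.hom) ∧
        ∃ q : Z ⟶ Z₄, IsClosedImmersion q.left ∧
          pointsU.{u}.map q ≫ e₄.hom = e.hom ≫ modSheafTruncU.{u} 4 (by norm_num)) ∧
    -- the absolute functors
    (∀ n : ℕ, 3 ≤ n →
      ∃ B : CommRingCat.{u}, Algebra.FiniteType ℤ B ∧
        Nonempty ((sphFunctor.{u} n).CorepresentableBy B)) ∧
    (∃ B : CommRingCat.{u}, Algebra.FiniteType ℤ B ∧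
        Nonempty ((sphTrFunctor.{u} 2).CorepresentableBy B)) := by
  exact ⟨fun n hn => exists_corep_modFunctor hn, exists_scheme_modSheafU,
    fun n hn => exists_corep_sphFunctor hn, exists_corep_sphTrFunctor⟩
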